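/- Let $\sigma>0$, $\kappa>1$, $r_\sigma^2=(1+\sigma^2)/\sigma^2$, let $\varphi$ be the standard Gaussian density and $H_j(x)=(j!)^{-1/2}e^{x^2/2}\frac{d^j}{dx^j}e^{-x^2/2}$. For $M>0$ let $g_\sigma^M(\mu)=\sum_{j\in\mathbb Z}\sigma^{-1}\varphi((\mu+2jM)/\sigma)$ be the Gaussian density wrapped around $[-M,M]$ and $K_M(\mu,x)=\sum_{j\in\mathbb Z}\varphi(x-\mu+2jM)$. For $C>0$ let $A^\sigma_{\kappa,C}$ be the set of functions $\tau$ that are square-integrable with respect to $N(0,\sigma^2)$ and satisfy $\sum_{j\ge1}\kappa^{2j}\langle\tau,H_j(\cdot/\sigma)\rangle^2\le C^2$, where $\langle\tau,h\rangle=\int_{\mathbb R}\tau h\,dN(0,\sigma^2)$. For $\tau\in A^\sigma_{\kappa,C}$ and $n\in\mathbb N$ let the true density on $[-M,M]$ be $g^{(n)}(\mu)=g_\sigma^M(\mu)\exp[\tau(\mu)/\sqrt n-\psi_n]$ (with $\psi_n$ normalizing), and let $X_1,\dots,X_n$ be independent with density $\int_{-M}^M K_M(\mu,x)\,g^{(n)}(\mu)\,d\mu$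 on $[-M,M]$. Let $$p=\max\Big\{2,\Big\lceil\frac{\log(C/\sigma)}{\log(r_\sigma\kappa)}\Big\rceil-1\Big\},\qquad g_\eta(\mu)=g_\sigma^M(\mu)\exp\Big[\sum_{j=1}^p\eta_jH_j(\mu/\sigma)-\psi(\eta)\Big]\ \ (\mu\in[-M,M],\ \eta\in\mathbb R^p),$$ and, for $L>C$, let $\Lambda_L=\{\eta\in\mathbb R^p:\sum_{j=1}^p\kappa^{2j}\eta_j^2<L^2\}$. Let $\hat g^{(n,p)}=g_{\hat\eta}$, where $\hat\eta=\hat\eta(X_1,\dots,X_n)$ is a measurable maximum likelihood estimator with values in $\Lambda_L$: it always lies in $\Lambda_L$, and it maximizes the likelihood $\eta\mapsto\prod_{i=1}^n\int_{-M}^M K_M(\mu,X_i)g_\eta(\mu)\,d\mu$ over all $\eta\in\mathbb R^p$ whenever some such maximizer lies in $\Lambda_L$. Then there is a constant $C_{\sigma,\kappa}>0$, depending only on $\sigma$ and $\kappa$, such that for all $C\ge C_{\sigma,\kappa}$, all $L>C$ and every such estimator, the following limit exists and $$\lim_{M\to\infty}\limsup_{n\to\infty}\ \sup_{\tau\in A^\sigma_{\kappa,C}}\mathbb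 E\big[n\,D_{KL}(g^{(n)},\hat g^{(n,p)})\big]\ \le\ \beta_{\sigma,\kappa}\,C^{\frac{2\log r_\sigma}{\log r_\sigma+\log\kappa}},\qquad \beta_{\sigma,\kappa}=(1+r_\sigma^2)\,\sigma^{\frac{2\log\kappa}{\log r_\sigma+\log\kappa}}.$$ -/

import Mathlib

open MeasureTheory ProbabilityTheory Filter Topology
open scoped ENNReal

namespace LocalDeconv

noncomputable section

/-- The standard Gaussian density `φ`. -/
def phi (x : ℝ) : ℝ := gaussianPDFReal 0 1 x

/-- The domain `Ω_M = [-M, M]`. -/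
def domain (M : ℝ) : Set ℝ := Set.Icc (-M) M

/-- The Gaussian density with standard deviation `σ`, wrapped around `[-M, M]`:
`φ_σ^M(x) = ∑_{j ∈ ℤ} σ⁻¹ φ((x + 2 j M) / σ)`. -/
def wrappedGaussian (σ M x : ℝ) : ℝ :=
  ∑' j : ℤ, σ⁻¹ * phi ((x + 2 * (j : ℝ) * M) / σ)

/-- The cyclic convolution kernel `K_M(μ, x) = ∑_{j ∈ ℤ} φ(x - μ + 2 j M)`. -/
def cyclicKernel (M μ x : ℝ) : ℝ :=
  ∑' j : ℤ, phi (x - μ + 2 * (j : ℝ) * M)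

/-- The carrier: the probability measure on `[-M, M]` with density `g_σ^M = φ_σ^M`. -/
def carrier (σ M : ℝ) : Measure ℝ :=
  (volume.restrict (domain M)).withDensity fun μ => ENNReal.ofReal (wrappedGaussian σ M μ)

/-- The marginal density of an observation with cyclic standard Gaussian noise,
when the latent variable has law `G`. -/
def obsDensity (M : ℝ) (G : Measure ℝ) (x : ℝ) : ℝ :=
  ∫ μ, cyclicKernel M μ x ∂G

/-- The law on `[-M, M]` of one observation `X` when the latent variable has law `G`. -/
def obsLaw (M : ℝ) (G : Measure ℝ) : Measure ℝ :=
  (volume.restrict (domain M)).withDensity fun x => ENNReal.ofReal (obsDensity M G x)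

/-- Normalized Hermite polynomials
`H_j(x) = (j!)^{-1/2} exp(x²/2) (d/dx)^j exp(-x²/2)`. -/
def hermiteFn (j : ℕ) (x : ℝ) : ℝ :=
  (1 / Real.sqrt (j.factorial : ℝ)) * Real.exp (x ^ 2 / 2) *
    deriv^[j] (fun y : ℝ => Real.exp (-(y ^ 2 / 2))) x

/-- Up to sign and normalization these are Mathlib's (probabilists') Hermite polynomials. -/
theorem hermiteFn_eq (j : ℕ) (x : ℝ) :
    hermiteFn j x =
      (-1) ^ j * Polynomial.aeval x (Polynomial.hermite j) / Real.sqrt (j.factorial : ℝ) := by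
  have h : Real.exp (x ^ 2 / 2) * Real.exp (-(x ^ 2 / 2)) = 1 := by
    rw [← Real.exp_add]; simp
  unfold hermiteFn
  rw [Polynomial.deriv_gaussian_eq_hermite_mul_gaussian]
  calc _ = (-1) ^ j * Polynomial.aeval x (Polynomial.hermite j) / Real.sqrt (j.factorial : ℝ) *
        (Real.exp (x ^ 2 / 2) * Real.exp (-(x ^ 2 / 2))) := by ring
    _ = _ := by rw [h, mul_one]

/-- The Hermite coefficient `⟨τ, H_j(·/σ)⟩_{g_σ}`, with `g_σ` the `N(0, σ²)` density on `ℝ`. -/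
def hermiteCoeff (σ : ℝ) (τ : ℝ → ℝ) (j : ℕ) : ℝ :=
  ∫ μ, τ μ * hermiteFn j (μ / σ) ∂(gaussianReal 0 (σ ^ 2).toNNReal)

/-- The ellipsoid `A^σ_{κ,C}` of square-integrable tilting functions with
`∑_{j ≥ 1} κ^{2j} ⟨τ, H_j(·/σ)⟩² ≤ C²`. -/
def ellipsoid (σ κ C : ℝ) : Set (ℝ → ℝ) :=
  {τ | MemLp τ 2 (gaussianReal 0 (σ ^ 2).toNNReal) ∧
    Summable (fun j : ℕ => κ ^ (2 * (j + 1)) * hermiteCoeff σ τ (j + 1) ^ 2) ∧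
    ∑' j : ℕ, κ ^ (2 * (j + 1)) * hermiteCoeff σ τ (j + 1) ^ 2 ≤ C ^ 2}

/-- The true latent law, with density `g_σ^M(μ) exp(τ(μ)/√n - ψ_n)` on `[-M, M]`. -/
def truth (σ M : ℝ) (n : ℕ) (τ : ℝ → ℝ) : Measure ℝ :=
  (carrier σ M).tilted fun μ => τ μ / Real.sqrt n

/-- The `p`-parameter polynomial log-density model around the carrier, with density
`g_σ^M(μ) exp(∑_{j=1}^p η_j H_j(μ/σ) - ψ(η))` on `[-M, M]`
(the coordinate `η_j` is stored at the index `j - 1` of `Fin p`). -/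
def model (σ M : ℝ) {p : ℕ} (η : Fin p → ℝ) : Measure ℝ :=
  (carrier σ M).tilted fun μ => ∑ j : Fin p, η j * hermiteFn (j + 1) (μ / σ)

/-- The likelihood of the noisy sample `X_1, …, X_n` at the parameter `η`. -/
def likelihood (σ M : ℝ) {p n : ℕ} (x : Fin n → ℝ) (η : Fin p → ℝ) : ℝ :=
  ∏ i, obsDensity M (model σ M η) (x i)

/-- Parameters of the model whose log-density ratio to the carrier has Hermite coefficients
with `∑_j κ^{2j} η_j² < L²`. -/
def regular (κ L : ℝ) (p : ℕ) : Set (Fin p → ℝ) :=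
  {η | ∑ j : Fin p, κ ^ (2 * ((j : ℕ) + 1)) * η j ^ 2 < L ^ 2}

/-- `est` is a maximum likelihood estimator of the model parameter from `n` noisy observations,
with values in the regularity class: on every sample it takes its value in the class, and
it is a maximizer of the likelihood over the whole (unrestricted) model whenever the class
contains such a maximizer. -/
structure IsMLE (σ κ L M : ℝ) {p n : ℕ} (est : (Fin n → ℝ) → (Fin p → ℝ)) : Prop where
  measurable : Measurable est
  mem_regular : ∀ x : Fin n → ℝ, (∀ i, x i ∈ domain M) → est x ∈ regular κ L p
  maximal : ∀ x : Fin n → ℝ, (∀ i, x i ∈ domain M) →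
    (∃ η₀ ∈ regular κ L p, ∀ η : Fin p → ℝ, likelihood σ M x η ≤ likelihood σ M x η₀) →
    ∀ η : Fin p → ℝ, likelihood σ M x η ≤ likelihood σ M x (est x)

/-- The rescaled Kullback-Leibler risk `E[n D_KL(g^{(n)}, ĝ)]`, where the expectation is over
`n` independent observations from the model with tilting function `τ`. -/
def risk (σ M : ℝ) {p n : ℕ} (est : (Fin n → ℝ) → (Fin p → ℝ)) (τ : ℝ → ℝ) : ℝ≥0∞ :=
  ∫⁻ x, (n : ℝ≥0∞) * InformationTheory.klDiv (truth σ M n τ) (model σ M (est x))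
    ∂(Measure.pi fun _ : Fin n => obsLaw M (truth σ M n τ))

/-- The worst-case rescaled risk over the ellipsoid. -/
def worstRisk (σ κ C M : ℝ) {p n : ℕ} (est : (Fin n → ℝ) → (Fin p → ℝ)) : ℝ≥0∞ :=
  ⨆ τ ∈ ellipsoid σ κ C, risk σ M est τ

/-- `r_σ = √((1 + σ²) / σ²)`. -/
def rConst (σ : ℝ) : ℝ := Real.sqrt ((1 + σ ^ 2) / σ ^ 2)

/-- `p = max {2, ⌈log(C/σ) / log(r_σ κ)⌉ - 1}` (truncation at `0` is harmless below the `max`). -/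
def polyDegree (σ κ C : ℝ) : ℕ :=
  max 2 (⌈Real.log (C / σ) / Real.log (rConst σ * κ)⌉₊ - 1)

/-- `β_{σ,κ} = (1 + r_σ²) σ^{2 log κ / (log r_σ + log κ)}`. -/
def betaConst (σ κ : ℝ) : ℝ :=
  (1 + rConst σ ^ 2) *
    σ ^ (2 * Real.log κ / (Real.log (rConst σ) + Real.log κ))

end

end LocalDeconv

/-!
# Asymptotic risk of deconvolution by polynomial log-densities

Write `r = √(1 + σ²) / σ`. The proof separates the two limits: the sample size tends to infinity on
a fixed domain, and then the domain grows.

On a fixed domain, the true prior is the tilt of the wrapped Gaussian `carrier` by `τ / √n`, and the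
model is the exponential family generated by the Hermite functions `H_1, …, H_p`. Log-densities of
observations are differences of log-moment generating functions, under the posterior law and under
the carrier (`obsDensity_tilted`), so near the origin the log-likelihood ratio is a quadratic form
given by the score and the information matrix `I`, up to third order. Smoothing by the cyclic kernel
multiplies Fourier coefficients by nonzero numbers, so bounded functions of the observation nearly
determine the prior (`exists_smooth_near`). Hence parameters away from the origin are separated from
it, uniformly, and finitely many empirical means certify that the likelihood is small there
(`exists_consistency_tests`). By Hoeffding's inequality the certificates fail with probability
`o(1 / n)`, while the losses are bounded because the estimator stays in a bounded set. When the
certificates hold, the estimator is a genuine maximizer of the likelihood close to the origin, close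
to `θ = I⁻¹ · score`, and the relative entropy is `Var[∑ θ_j H_j - τ / √n] / 2` to leading order
(`exists_abs_kl_sub_le`). After multiplication by `n` only the first two moments of the score are
needed, not its limit law; along local alternatives they converge uniformly. So the risk converges,
uniformly over the ellipsoid, to the explicit quantity `fixedRisk`
(`eventually_abs_integral_tiltEntropy_sub_le`, `eventually_risk_near`). The uniformity rests on the
fact that elements of the ellipsoid are bounded on compact sets by a common constant, up to additive
constants which do not matter.

As the domain grows, `fixedRisk`, which is a polynomial in covariances and in the entries of `I⁻¹`,
converges to its value in the Gaussian model on the line. The latent variable and the observation on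
the domain are the wrapped versions of `σ U` and `σ U + Z`, with `U`, `Z` independent standard
Gaussian, and wrapping disappears in `L²`, uniformly over the ellipsoid. For Hermite functions this
is dominated convergence; for the tails of the expansions it follows from the domination of the
wrapped Gaussian density by a multiple of the Gaussian density (`exists_wrappedGaussian_le`).
Posterior means are orthogonal projections, hence converge as well
(`l2norm_postMean_wrappedObs_sub_le`). On the line, rotation invariance shows that the conditional
mean of `H_j(U)` is `r^(-j)` times the Hermite function of the standardized observation. So `I`
tends to the diagonal matrix with entries `r^(-2j)`, the estimated coefficients are asymptotically
unbiased, and the risk tends to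
`limitRisk = (∑_{j > p} τ_j² + ∑_{j ≤ p} r^(2j)) / 2`, uniformly over the ellipsoid
(`eventually_abs_fixedRisk_sub_le`). The limit in the theorem therefore exists, and is the supremum
of `limitRisk` over the ellipsoid (`tendsto_limsup_worstRisk`).

It remains to balance. The squared bias is at most `C² κ^(-2(p + 1))` and, as `σ² r² = 1 + σ²`, the
variance is at most `r² σ² r^(2p)`. With `p ≤ log (C / σ) / log (r κ) ≤ p + 1`, which is what the
rounding in the degree provides once `C` is large, these are at most `1` and `r²` times
`σ^(2 log κ / (log r + log κ)) C^(2 log r / (log r + log κ))` (`bias_add_variance_le`). The bound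
thus holds, with a factor `1 / 2` to spare.
-/

namespace LocalDeconv

/-! ### Exponential tilts of a probability measure by small bounded functions -/

section Tilt

variable {α : Type*} {mα : MeasurableSpace α} {ν : Measure α} [IsProbabilityMeasure ν]

lemma integrable_of_abs_le {f : α → ℝ} {b : ℝ} (hf : AEMeasurable f ν)
    (hb : ∀ᵐ x ∂ν, |f x| ≤ b) : Integrable f ν :=
  Integrable.of_bound hf.aestronglyMeasurable b (by simpa using hb)

lemma memLp_of_abs_le {f : α → ℝ} {b : ℝ} (hf : AEMeasurable f ν)
    (hb : ∀ᵐ x ∂ν, |f x| ≤ b) : MemLp f 2 ν :=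
  MemLp.of_bound hf.aestronglyMeasurable b (by simpa using hb)

lemma abs_integral_le_of_abs_le {f : α → ℝ} {b : ℝ} (hb : ∀ᵐ x ∂ν, |f x| ≤ b) :
    |∫ x, f x ∂ν| ≤ b := by
  simpa using norm_integral_le_of_norm_le_const (μ := ν) (f := f) (C := b) (by simpa using hb)

lemma integrable_exp_of_abs_le {f : α → ℝ} {b : ℝ} (hf : AEMeasurable f ν)
    (hb : ∀ᵐ x ∂ν, |f x| ≤ b) : Integrable (fun x => Real.exp (f x)) ν := by
  refine integrable_of_abs_le (b := Real.exp b) hf.exp ?_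
  filter_upwards [hb] with x hx
  rw [abs_of_pos (Real.exp_pos _)]
  exact Real.exp_le_exp.2 ((le_abs_self _).trans hx)

/-- Second-order expansion of the log-moment generating function of a small random variable. -/
lemma abs_log_integral_exp_sub_le {T : α → ℝ} {b : ℝ} (hT : AEMeasurable T ν)
    (hb : ∀ᵐ x ∂ν, |T x| ≤ b) (hb1 : b ≤ 1 / 2) :
    |Real.log (∫ x, Real.exp (T x) ∂ν) - ∫ x, T x ∂ν - Var[T; ν] / 2| ≤ 7 * b ^ 3 := by
  have hb0 : 0 ≤ b := by
    obtain ⟨x, hx⟩ := hb.exists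
    exact (abs_nonneg _).trans hx
  set m := ∫ x, T x ∂ν with hm
  have hmb : |m| ≤ b := abs_integral_le_of_abs_le hb
  have hTi := integrable_of_abs_le hT hb
  -- After centring `T`, the first-order term disappears.
  have hY : ∀ᵐ x ∂ν, |T x - m| ≤ 2 * b := by
    filter_upwards [hb] with x hx
    calc |T x - m| ≤ |T x| + |m| := abs_sub _ _
      _ ≤ _ := by linarith
  have hYm : AEMeasurable (fun x => T x - m) ν := hT.sub_const _
  have hYi := integrable_of_abs_le hYm hY
  have hY2 : ∀ᵐ x ∂ν, |(T x - m) ^ 2| ≤ (2 * b) ^ 2 := by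
    filter_upwards [hY] with x hx
    rw [abs_pow]; gcongr
  have hY2i := integrable_of_abs_le (hYm.pow_const 2) hY2
  have hEi := integrable_exp_of_abs_le hYm hY
  have hvar : Var[T; ν] = ∫ x, (T x - m) ^ 2 ∂ν := variance_eq_integral hT
  have hY0 : ∫ x, (T x - m) ∂ν = 0 := by
    rw [integral_sub hTi (integrable_const _)]; simp [hm]
  set v := ∫ x, (T x - m) ^ 2 ∂ν with hv
  have hv0 : 0 ≤ v := integral_nonneg fun x => sq_nonneg _
  have hvb : v ≤ 4 * b ^ 2 := by
    have := (le_abs_self _).trans (abs_integral_le_of_abs_le hY2); nlinarith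
  set z := ∫ x, Real.exp (T x - m) ∂ν - 1 with hz
  have hR : |z - v / 2| ≤ 2 * b ^ 3 := by
    have : z - v / 2 = ∫ x, (Real.exp (T x - m) - 1 - (T x - m) - (T x - m) ^ 2 / 2) ∂ν := by
      have i1 : Integrable (fun x => Real.exp (T x - m) - 1) ν := hEi.sub (integrable_const _)
      have i2 : Integrable (fun x => Real.exp (T x - m) - 1 - (T x - m)) ν := i1.sub hYi
      rw [integral_sub i2 (hY2i.div_const _), integral_sub i1 hYi,
        integral_sub hEi (integrable_const _), hY0, integral_div]
      simp [hz, hv]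
    rw [this]
    refine abs_integral_le_of_abs_le ?_
    filter_upwards [hY] with x hx
    have h1 := Real.exp_bound (x := T x - m) (by linarith) (n := 3) (by norm_num)
    simp only [Finset.sum_range_succ, Finset.range_zero, Finset.sum_empty] at h1
    norm_num [Nat.factorial] at h1
    have h3 : |T x - m| ^ 3 ≤ (2 * b) ^ 3 := by gcongr
    calc _ = |Real.exp (T x - m) - (1 + (T x - m) + (T x - m) ^ 2 / 2)| := by congr 1; ring
      _ ≤ |T x - m| ^ 3 * (2 / 9) := h1
      _ ≤ (2 * b) ^ 3 * (2 / 9) := by gcongr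
      _ ≤ 2 * b ^ 3 := by nlinarith [pow_nonneg hb0 3]
  have hz0 : 0 ≤ z := by
    have : ∫ x, ((T x - m) + 1) ∂ν ≤ ∫ x, Real.exp (T x - m) ∂ν :=
      integral_mono (hYi.add (integrable_const _)) hEi fun x => Real.add_one_le_exp _
    rw [integral_add hYi (integrable_const _), hY0] at this
    simp at this
    linarith
  have hzb : z ≤ 3 * b ^ 2 := by
    have := (abs_le.1 hR).2
    have : b ^ 3 ≤ b ^ 2 / 2 := by nlinarith [sq_nonneg b]
    linarith
  have hlog : Real.log (∫ x, Real.exp (T x) ∂ν) = m + Real.log (1 + z) := by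
    have : ∫ x, Real.exp (T x) ∂ν = Real.exp m * (1 + z) := by
      rw [hz, add_sub_cancel, ← integral_const_mul]
      congr 1; ext x; rw [← Real.exp_add]; ring_nf
    rw [this, Real.log_mul (Real.exp_pos _).ne' (by linarith), Real.log_exp]
  have hlu : Real.log (1 + z) ≤ z := by
    have := Real.log_le_sub_one_of_pos (x := 1 + z) (by linarith); linarith
  have hll : z - z ^ 2 ≤ Real.log (1 + z) := by
    have h := Real.one_sub_inv_le_log_of_pos (x := 1 + z) (by linarith)
    have : z - z ^ 2 ≤ 1 - (1 + z)⁻¹ := by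
      have h1 : 0 < 1 + z := by linarith
      rw [← sub_nonneg]
      have : 1 - (1 + z)⁻¹ - (z - z ^ 2) = z ^ 3 / (1 + z) := by field_simp; ring
      rw [this]; positivity
    linarith
  have hz2 : z ^ 2 ≤ 5 * b ^ 3 := by
    have h1 : z ^ 2 ≤ (3 * b ^ 2) ^ 2 := by gcongr
    have : b ^ 4 ≤ b ^ 3 / 2 := by nlinarith [pow_nonneg hb0 3]
    nlinarith [pow_nonneg hb0 3]
  rw [hlog, hvar]
  have := abs_le.1 hR
  rw [abs_le]
  constructor <;> linarith [this.1, this.2, pow_nonneg hb0 3]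

/-- Relative entropy between two bounded exponential tilts of the same measure. -/
lemma klDiv_tilted_tilted {a b : α → ℝ} {s t : ℝ} (ha : AEMeasurable a ν)
    (hs : ∀ᵐ x ∂ν, |a x| ≤ s) (hb : AEMeasurable b ν) (ht : ∀ᵐ x ∂ν, |b x| ≤ t) :
    InformationTheory.klDiv (ν.tilted a) (ν.tilted b) =
      ENNReal.ofReal (Real.log (∫ x, Real.exp (b x - a x) ∂(ν.tilted a)) -
        ∫ x, (b x - a x) ∂(ν.tilted a)) := by
  have hae := integrable_exp_of_abs_le ha hs
  have hbe := integrable_exp_of_abs_le hb ht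
  have : IsProbabilityMeasure (ν.tilted a) := isProbabilityMeasure_tilted hae
  have : IsProbabilityMeasure (ν.tilted b) := isProbabilityMeasure_tilted hbe
  have hac : ν.tilted a ≪ ν := tilted_absolutelyContinuous _ _
  set f : α → ℝ := fun x => b x - a x with hf
  have hfm : AEMeasurable f (ν.tilted a) := (hb.sub ha).mono_ac hac
  have hfb : ∀ᵐ x ∂(ν.tilted a), |f x| ≤ t + s := by
    filter_upwards [hac.ae_le hs, hac.ae_le ht] with x h1 h2
    exact (abs_sub _ _).trans (add_le_add h2 h1)
  have hfi := integrable_of_abs_le hfm hfb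
  have hfe := integrable_exp_of_abs_le hfm hfb
  -- The second tilt is a tilt of the first one, by the difference of the exponents.
  have hb' : ν.tilted b = (ν.tilted a).tilted f := by
    rw [tilted_tilted hae]; congr 1; ext x; simp [hf]
  rw [hb']
  have h0 : llr (ν.tilted a) (ν.tilted a) =ᵐ[ν.tilted a] 0 := llr_self _
  have hint : Integrable (llr (ν.tilted a) ((ν.tilted a).tilted f)) (ν.tilted a) :=
    integrable_llr_tilted_right Measure.AbsolutelyContinuous.rfl hfi
      ((integrable_congr h0).2 (integrable_zero _ _ _)) hfe
  have : IsProbabilityMeasure ((ν.tilted a).tilted f) := isProbabilityMeasure_tilted hfe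
  rw [InformationTheory.klDiv_of_ac_of_integrable (absolutelyContinuous_tilted hfe) hint,
    integral_llr_tilted_right Measure.AbsolutelyContinuous.rfl hfi hfe
      ((integrable_congr h0).2 (integrable_zero _ _ _)), integral_congr_ae h0]
  congr 1
  simp
  ring

/-- Second-order expansion of an expectation under a small tilt: the first-order term is
the covariance. -/
lemma abs_integral_tilted_sub_cov_le {a f : α → ℝ} {s F : ℝ} (ha : AEMeasurable a ν)
    (hs : ∀ᵐ x ∂ν, |a x| ≤ s) (hs1 : s ≤ 1) (hf : AEMeasurable f ν)
    (hF : ∀ᵐ x ∂ν, |f x| ≤ F) :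
    |∫ x, f x ∂(ν.tilted a) - ∫ x, f x ∂ν - cov[f, a; ν]| ≤ 18 * F * s ^ 2 := by
  have hs0 : 0 ≤ s := by
    obtain ⟨x, hx⟩ := hs.exists
    exact (abs_nonneg _).trans hx
  have hF0 : 0 ≤ F := by
    obtain ⟨x, hx⟩ := hF.exists
    exact (abs_nonneg _).trans hx
  have hai := integrable_of_abs_le ha hs
  have hae := integrable_exp_of_abs_le ha hs
  have hfi := integrable_of_abs_le hf hF
  set m := ∫ x, f x ∂ν with hm
  have hmF : |m| ≤ F := abs_integral_le_of_abs_le hF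
  have hgm : AEMeasurable (fun x => f x - m) ν := hf.sub_const _
  have hg : ∀ᵐ x ∂ν, |f x - m| ≤ 2 * F := by
    filter_upwards [hF] with x hx
    exact (abs_sub _ _).trans (by linarith)
  have hgi := integrable_of_abs_le hgm hg
  have hg0 : ∫ x, (f x - m) ∂ν = 0 := by
    rw [integral_sub hfi (integrable_const _)]; simp [hm]
  have hgab : ∀ᵐ x ∂ν, |(f x - m) * a x| ≤ 2 * F * s := by
    filter_upwards [hg, hs] with x h1 h2
    rw [abs_mul]; gcongr
  have hgai : Integrable (fun x => (f x - m) * a x) ν := integrable_of_abs_le (hgm.mul ha) hgab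
  set c := ∫ x, (f x - m) * a x ∂ν with hc
  have hcov : cov[f, a; ν] = c := by
    simp only [covariance]
    rw [← hm]
    have : ∀ x, (f x - m) * (a x - ∫ x, a x ∂ν) = (f x - m) * a x - (f x - m) * ∫ x, a x ∂ν :=
      fun x => by ring
    simp_rw [this]
    rw [integral_sub hgai (hgi.mul_const _), integral_mul_const, hg0]
    simp [hc]
  have hcb : |c| ≤ 2 * F * s := abs_integral_le_of_abs_le hgab
  set E := ∫ x, Real.exp (a x) ∂ν with hE
  -- The normalizing constant `E` is close to `1`, and bounded below.
  have hE1 : |E - 1| ≤ 2 * s := by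
    have : E - 1 = ∫ x, (Real.exp (a x) - 1) ∂ν := by
      rw [integral_sub hae (integrable_const _)]; simp [hE]
    rw [this]
    refine abs_integral_le_of_abs_le ?_
    filter_upwards [hs] with x hx
    exact (Real.abs_exp_sub_one_le (hx.trans hs1)).trans (by linarith)
  have hE3 : 1 / 3 ≤ E := by
    have h1 : ∫ x, Real.exp (-1) ∂ν ≤ E := by
      refine integral_mono_ae (integrable_const _) hae ?_
      filter_upwards [hs] with x hx
      exact Real.exp_le_exp.2 (by linarith [neg_abs_le (a x)])
    have h2 : (1 : ℝ) / 3 ≤ Real.exp (-1) := by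
      rw [Real.exp_neg, one_div]
      exact inv_anti₀ (Real.exp_pos _) (by linarith [Real.exp_one_lt_d9])
    simp at h1
    linarith
  have hgeb : ∀ᵐ x ∂ν, |(f x - m) * Real.exp (a x)| ≤ 2 * F * Real.exp 1 := by
    filter_upwards [hg, hs] with x h1 h2
    rw [abs_mul, abs_of_pos (Real.exp_pos _)]
    gcongr
    linarith [le_abs_self (a x)]
  have hgei : Integrable (fun x => (f x - m) * Real.exp (a x)) ν :=
    integrable_of_abs_le (hgm.mul ha.exp) hgeb
  have hfe : ∫ x, (f x - m) * Real.exp (a x) ∂ν = (∫ x, f x ∂(ν.tilted a) - m) * E := by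
    rw [integral_tilted]
    have : ∀ x, (f x - m) * Real.exp (a x) = f x * Real.exp (a x) - m * Real.exp (a x) :=
      fun x => by ring
    have hfei : Integrable (fun x => f x * Real.exp (a x)) ν := by
      refine (hgei.add (hae.const_mul m)).congr (Eventually.of_forall fun x => ?_)
      simp; ring
    simp_rw [this]
    rw [integral_sub hfei (hae.const_mul m), integral_const_mul, sub_mul, ← hE]
    congr 1
    rw [← integral_mul_const]
    congr 1; ext x
    have : E ≠ 0 := by linarith
    simp [smul_eq_mul]; field_simp
  -- As `f` is centred, expanding the exponential leaves the covariance and a remainder of second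
  -- order.
  have hr : |∫ x, (f x - m) * Real.exp (a x) ∂ν - c| ≤ 2 * F * s ^ 2 := by
    have : ∫ x, (f x - m) * Real.exp (a x) ∂ν - c =
        ∫ x, (f x - m) * (Real.exp (a x) - 1 - a x) ∂ν := by
      have h2 : ∀ x, (f x - m) * (Real.exp (a x) - 1 - a x) =
        (f x - m) * Real.exp (a x) - (f x - m) * a x - (f x - m) := fun x => by ring
      simp_rw [h2]
      have i1 : Integrable (fun x => (f x - m) * Real.exp (a x) - (f x - m) * a x) ν :=
        hgei.sub hgai
      rw [integral_sub i1 hgi, integral_sub hgei hgai, hg0, sub_zero]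
    rw [this]
    refine abs_integral_le_of_abs_le ?_
    filter_upwards [hg, hs] with x h1 h2
    rw [abs_mul]
    have h3 := Real.abs_exp_sub_one_sub_id_le (h2.trans hs1)
    have h4 : a x ^ 2 ≤ s ^ 2 := by rw [← sq_abs]; gcongr
    have : |Real.exp (a x) - 1 - a x| ≤ s ^ 2 := h3.trans h4
    gcongr
  rw [hfe] at hr
  rw [hcov]
  set D := ∫ x, f x ∂(ν.tilted a) - m with hD
  have key : |(D - c) * E| ≤ 6 * F * s ^ 2 := by
    have : (D - c) * E = (D * E - c) - (E - 1) * c := by ring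
    rw [this]
    calc _ ≤ |D * E - c| + |(E - 1) * c| := abs_sub _ _
      _ ≤ 2 * F * s ^ 2 + (2 * s) * (2 * F * s) := by rw [abs_mul]; gcongr
      _ = _ := by ring
  rw [abs_mul, abs_of_pos (by linarith : 0 < E)] at key
  nlinarith [abs_nonneg (D - c)]

/-- First-order stability of an expectation under a small tilt. -/
lemma abs_integral_tilted_sub_le {a f : α → ℝ} {s F : ℝ} (ha : AEMeasurable a ν)
    (hs : ∀ᵐ x ∂ν, |a x| ≤ s) (hs1 : s ≤ 1) (hf : AEMeasurable f ν)
    (hF : ∀ᵐ x ∂ν, |f x| ≤ F) :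
    |∫ x, f x ∂(ν.tilted a) - ∫ x, f x ∂ν| ≤ 22 * F * s := by
  have hs0 : 0 ≤ s := by
    obtain ⟨x, hx⟩ := hs.exists
    exact (abs_nonneg _).trans hx
  have hF0 : 0 ≤ F := by
    obtain ⟨x, hx⟩ := hF.exists
    exact (abs_nonneg _).trans hx
  have h := abs_integral_tilted_sub_cov_le ha hs hs1 hf hF
  have hc : |cov[f, a; ν]| ≤ 4 * F * s := by
    simp only [covariance]
    refine abs_integral_le_of_abs_le ?_
    have h1 := abs_integral_le_of_abs_le hF
    have h2 := abs_integral_le_of_abs_le hs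
    filter_upwards [hF, hs] with x h3 h4
    rw [abs_mul]
    calc _ ≤ (F + F) * (s + s) := by
          gcongr
          · exact (abs_sub _ _).trans (add_le_add h3 h1)
          · exact (abs_sub _ _).trans (add_le_add h4 h2)
      _ = _ := by ring
  have h5 : 18 * F * s ^ 2 ≤ 18 * F * s := by
    have : s ^ 2 ≤ s := by nlinarith
    gcongr
  have h6 := abs_le.1 h
  have h7 := abs_le.1 hc
  rw [abs_le]
  constructor <;> linarith [h6.1, h6.2, h7.1, h7.2]

/-- Stability of a variance under a small tilt. -/
lemma abs_variance_tilted_sub_le {a f : α → ℝ} {s F : ℝ} (ha : AEMeasurable a ν)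
    (hs : ∀ᵐ x ∂ν, |a x| ≤ s) (hs1 : s ≤ 1) (hf : AEMeasurable f ν)
    (hF : ∀ᵐ x ∂ν, |f x| ≤ F) :
    |Var[f; ν.tilted a] - Var[f; ν]| ≤ 66 * F ^ 2 * s := by
  have hae := integrable_exp_of_abs_le ha hs
  have : IsProbabilityMeasure (ν.tilted a) := isProbabilityMeasure_tilted hae
  have hac : ν.tilted a ≪ ν := tilted_absolutelyContinuous _ _
  have hF' := hac.ae_le hF
  have hf' := hf.mono_ac hac
  rw [variance_eq_sub (memLp_of_abs_le hf hF), variance_eq_sub (memLp_of_abs_le hf' hF')]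
  have hF2 : ∀ᵐ x ∂ν, |f x ^ 2| ≤ F ^ 2 := by
    filter_upwards [hF] with x hx
    rw [abs_pow]; gcongr
  have h1 := abs_integral_tilted_sub_le ha hs hs1 (hf.pow_const 2) hF2
  have h2 := abs_integral_tilted_sub_le ha hs hs1 hf hF
  have h3 := abs_integral_le_of_abs_le hF
  have h4 : |∫ x, f x ∂(ν.tilted a)| ≤ F := abs_integral_le_of_abs_le hF'
  have hF0 : 0 ≤ F := (abs_nonneg _).trans h3
  simp only [Pi.pow_apply] at *
  set A := ∫ x, f x ∂(ν.tilted a)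
  set B := ∫ x, f x ∂ν
  have h5 : |A ^ 2 - B ^ 2| ≤ 22 * F * s * (2 * F) := by
    have h6 : |A + B| ≤ 2 * F := (abs_add_le _ _).trans (by linarith)
    have h7 : A ^ 2 - B ^ 2 = (A - B) * (A + B) := by ring
    rw [h7, abs_mul]
    exact mul_le_mul h2 h6 (abs_nonneg _) ((abs_nonneg _).trans h2)
  calc _ = |(∫ x, f x ^ 2 ∂(ν.tilted a) - ∫ x, f x ^ 2 ∂ν) - (A ^ 2 - B ^ 2)| := by
        congr 1; ring
    _ ≤ _ := (abs_sub _ _).trans (add_le_add h1 h5)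
    _ = _ := by ring

/-- The relative entropy between two nearby tilts is half the variance of the difference of
the exponents, up to third-order terms. -/
lemma abs_kl_sub_variance_le {a T : α → ℝ} {s t : ℝ} (ha : AEMeasurable a ν)
    (hs : ∀ᵐ x ∂ν, |a x| ≤ s) (hs1 : s ≤ 1) (hT : AEMeasurable T ν)
    (ht : ∀ᵐ x ∂ν, |T x| ≤ t) (ht1 : t ≤ 1 / 2) :
    |Real.log (∫ x, Real.exp (T x) ∂(ν.tilted a)) - ∫ x, T x ∂(ν.tilted a) - Var[T; ν] / 2| ≤
      7 * t ^ 3 + 33 * t ^ 2 * s := by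
  have hae := integrable_exp_of_abs_le ha hs
  have : IsProbabilityMeasure (ν.tilted a) := isProbabilityMeasure_tilted hae
  have hac : ν.tilted a ≪ ν := tilted_absolutelyContinuous _ _
  have h1 := abs_le.1 (abs_log_integral_exp_sub_le (hT.mono_ac hac) (hac.ae_le ht) ht1)
  have h2 := abs_le.1 (abs_variance_tilted_sub_le ha hs hs1 hT ht)
  rw [abs_le]
  constructor <;> linarith [h1.1, h1.2, h2.1, h2.2]

/-- A crude bound on the relative entropy between two bounded tilts. -/
lemma kl_le_of_abs_le {a T : α → ℝ} {s t : ℝ} (ha : AEMeasurable a ν)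
    (hs : ∀ᵐ x ∂ν, |a x| ≤ s) (hT : AEMeasurable T ν) (ht : ∀ᵐ x ∂ν, |T x| ≤ t) :
    0 ≤ Real.log (∫ x, Real.exp (T x) ∂(ν.tilted a)) - ∫ x, T x ∂(ν.tilted a) ∧
    Real.log (∫ x, Real.exp (T x) ∂(ν.tilted a)) - ∫ x, T x ∂(ν.tilted a) ≤ 2 * t := by
  have hae := integrable_exp_of_abs_le ha hs
  have : IsProbabilityMeasure (ν.tilted a) := isProbabilityMeasure_tilted hae
  have hac : ν.tilted a ≪ ν := tilted_absolutelyContinuous _ _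
  have hT' := hT.mono_ac hac
  have ht' := hac.ae_le ht
  have hTi := integrable_of_abs_le hT' ht'
  have hTe := integrable_exp_of_abs_le hT' ht'
  have h3 : |∫ x, T x ∂(ν.tilted a)| ≤ t := abs_integral_le_of_abs_le ht'
  constructor
  · have hJ : Real.exp (∫ x, T x ∂(ν.tilted a)) ≤ ∫ x, Real.exp (T x) ∂(ν.tilted a) :=
      convexOn_exp.map_integral_le Real.continuous_exp.continuousOn isClosed_univ
        (by simp) hTi hTe
    have := Real.log_le_log (Real.exp_pos _) hJ
    rw [Real.log_exp] at this
    linarith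
  · have h4 : ∫ x, Real.exp (T x) ∂(ν.tilted a) ≤ Real.exp t := by
      have h5 : ∫ x, Real.exp (T x) ∂(ν.tilted a) ≤ ∫ x, Real.exp t ∂(ν.tilted a) := by
        refine integral_mono_ae hTe (integrable_const _) ?_
        filter_upwards [ht'] with x hx
        exact Real.exp_le_exp.2 ((le_abs_self _).trans hx)
      simpa using h5
    have := Real.log_le_log (integral_exp_pos hTe) h4
    rw [Real.log_exp] at this
    linarith [(abs_le.1 h3).1]

end Tilt

/-! ### Wrapping the real line around an interval -/

/-- The representative of `x` modulo `2M` in the interval `[-M, M)`. -/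
noncomputable def wrap (M x : ℝ) : ℝ := x - ⌊(x + M) / (2 * M)⌋ * (2 * M)

lemma measurable_wrap (M : ℝ) : Measurable (wrap M) := by
  unfold wrap
  have : Measurable fun x : ℝ => ((⌊(x + M) / (2 * M)⌋ : ℤ) : ℝ) :=
    (measurable_from_top (f := fun n : ℤ => (n : ℝ))).comp
      (Int.measurable_floor.comp (by fun_prop))
  fun_prop

section Wrap

variable {M : ℝ}

lemma wrap_mem (hM : 0 < M) (x : ℝ) : wrap M x ∈ Set.Ico (-M) M := by
  have h1 := Int.floor_le ((x + M) / (2 * M))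
  have h2 := Int.lt_floor_add_one ((x + M) / (2 * M))
  have h3 : (x + M) / (2 * M) * (2 * M) = x + M := by field_simp
  have hM2 : 0 < 2 * M := by linarith
  unfold wrap
  constructor
  · nlinarith
  · nlinarith

lemma wrap_of_mem (hM : 0 < M) {x : ℝ} (hx : x ∈ Set.Ico (-M) M) : wrap M x = x := by
  have : ⌊(x + M) / (2 * M)⌋ = 0 := by
    rw [Int.floor_eq_zero_iff]
    constructor
    · have := hx.1; apply div_nonneg <;> linarith
    · rw [div_lt_one (by linarith)]; linarith [hx.2]
  simp [wrap, this]

lemma wrap_add (hM : 0 < M) (x : ℝ) (n : ℤ) : wrap M (x + 2 * n * M) = wrap M x := by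
  have : (x + 2 * n * M + M) / (2 * M) = (x + M) / (2 * M) + n := by field_simp; ring
  unfold wrap
  rw [this, Int.floor_add_intCast]
  push_cast; ring

lemma exists_wrap_eq (M x : ℝ) : ∃ n : ℤ, wrap M x = x + 2 * n * M :=
  ⟨-⌊(x + M) / (2 * M)⌋, by unfold wrap; push_cast; ring⟩

lemma wrap_mem_domain (hM : 0 < M) (x : ℝ) : wrap M x ∈ domain M :=
  Set.Ico_subset_Icc_self (wrap_mem hM x)

lemma abs_wrap_le (hM : 0 < M) (x : ℝ) : |wrap M x| ≤ |x| := by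
  by_cases hx : x ∈ Set.Ico (-M) M
  · rw [wrap_of_mem hM hx]
  · have h1 : |wrap M x| ≤ M := abs_le.2 (wrap_mem_domain hM x)
    refine h1.trans ?_
    by_contra h
    push Not at h
    exact hx ⟨(abs_lt.1 h).1.le, (abs_lt.1 h).2⟩

/-- Unfolding: an integral over the line is the integral over one period of the periodization. -/
lemma lintegral_eq_lintegral_tsum (hM : 0 < M) {F : ℝ → ℝ≥0∞} (hF : Measurable F) :
    ∫⁻ x, F x = ∫⁻ x in Set.Ico (-M) M, ∑' n : ℤ, F (x + 2 * n * M) := by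
  have hp : 0 < 2 * M := by linarith
  rw [lintegral_tsum (fun n => by fun_prop), ← setLIntegral_univ,
    ← iUnion_Ico_add_zsmul hp (-M), lintegral_iUnion (fun _ => measurableSet_Ico)
      (Set.pairwise_disjoint_Ico_add_zsmul (-M) (2 * M))]
  congr 1; ext n
  rw [← lintegral_indicator measurableSet_Ico, ← lintegral_indicator measurableSet_Ico,
    ← lintegral_add_right_eq_self _ (2 * n * M)]
  congr 1; ext x
  simp only [Set.indicator, Set.mem_Ico]
  have : (-M + n • (2 * M) ≤ x + 2 * n * M ∧ x + 2 * n * M < -M + (n + 1) • (2 * M)) ↔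
      (-M ≤ x ∧ x < M) := by
    simp only [zsmul_eq_mul]; push_cast
    constructor <;> rintro ⟨h1, h2⟩ <;> constructor <;> linarith
  simp only [this]

end Wrap

/-! ### The wrapped Gaussian density and the cyclic kernel -/

section WrappedGaussian

variable {σ M : ℝ}

lemma inv_mul_phi (hσ : 0 < σ) (x : ℝ) :
    σ⁻¹ * phi (x / σ) = gaussianPDFReal 0 (σ ^ 2).toNNReal x := by
  simp only [phi, gaussianPDFReal, Real.coe_toNNReal _ (sq_nonneg σ)]
  rw [Real.sqrt_mul (x := 2 * Real.pi) (by positivity) (σ ^ 2), Real.sqrt_sq hσ.le, mul_inv]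
  simp only [NNReal.coe_one, mul_one, sub_zero]
  have : -(x / σ) ^ 2 / 2 = -x ^ 2 / (2 * σ ^ 2) := by field_simp
  rw [this]; ring

lemma wrappedGaussian_eq (hσ : 0 < σ) (x : ℝ) :
    wrappedGaussian σ M x = ∑' j : ℤ, gaussianPDFReal 0 (σ ^ 2).toNNReal (x + 2 * j * M) := by
  simp only [wrappedGaussian, inv_mul_phi hσ]

lemma cyclicKernel_eq (M μ x : ℝ) : cyclicKernel M μ x = wrappedGaussian 1 M (x - μ) := by
  simp [cyclicKernel, wrappedGaussian]

lemma toNNReal_sq_ne_zero (hσ : 0 < σ) : (σ ^ 2).toNNReal ≠ 0 := by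
  simp [hσ.ne']

/-- The wrapped Gaussian terms are, up to a factor, those of a Jacobi theta series. -/
lemma gaussianPDFReal_add_eq_theta (hσ : 0 < σ) (x : ℝ) (j : ℤ) :
    ((gaussianPDFReal 0 (σ ^ 2).toNNReal (x + 2 * j * M) : ℝ) : ℂ) =
      (gaussianPDFReal 0 (σ ^ 2).toNNReal x : ℝ) *
        jacobiTheta₂_term j (Complex.I * M * x / (Real.pi * σ ^ 2))
          (2 * Complex.I * M ^ 2 / (Real.pi * σ ^ 2)) := by
  have h : gaussianPDFReal 0 (σ ^ 2).toNNReal (x + 2 * j * M) =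
      gaussianPDFReal 0 (σ ^ 2).toNNReal x *
        Real.exp (-(2 * j * M * x) / σ ^ 2 - 2 * j ^ 2 * M ^ 2 / σ ^ 2) := by
    simp only [gaussianPDFReal, Real.coe_toNNReal _ (sq_nonneg σ), sub_zero]
    rw [mul_assoc _ (Real.exp _), ← Real.exp_add]
    congr 2
    field_simp
    ring
  rw [h, jacobiTheta₂_term, Complex.ofReal_mul, Complex.ofReal_exp]
  congr 2
  have hπ : (Real.pi : ℂ) ≠ 0 := by exact_mod_cast Real.pi_ne_zero
  have hσ' : (σ : ℂ) ≠ 0 := by exact_mod_cast hσ.ne'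
  push_cast
  field_simp
  rw [Complex.I_sq]
  ring

lemma im_theta_pos (hσ : 0 < σ) (hM : 0 < M) :
    0 < (2 * Complex.I * M ^ 2 / (Real.pi * σ ^ 2) : ℂ).im := by
  have : (2 * Complex.I * M ^ 2 / (Real.pi * σ ^ 2) : ℂ) =
      ((2 * M ^ 2 / (Real.pi * σ ^ 2) : ℝ) : ℂ) * Complex.I := by push_cast; ring
  rw [this, Complex.im_ofReal_mul, Complex.I_im]
  have := Real.pi_pos
  positivity

lemma summable_gaussianPDFReal_add (hσ : 0 < σ) (hM : 0 < M) (x : ℝ) :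
    Summable fun j : ℤ => gaussianPDFReal 0 (σ ^ 2).toNNReal (x + 2 * j * M) := by
  rw [← Complex.summable_ofReal]
  simp_rw [gaussianPDFReal_add_eq_theta hσ]
  exact ((summable_jacobiTheta₂_term_iff _ _).2 (im_theta_pos hσ hM)).mul_left _

lemma continuous_gaussianPDFReal (m : ℝ) (v : NNReal) : Continuous (gaussianPDFReal m v) := by
  rw [gaussianPDFReal_def]; fun_prop

lemma continuous_wrappedGaussian (hσ : 0 < σ) (hM : 0 < M) :
    Continuous (wrappedGaussian σ M) := by
  have h : ∀ x, wrappedGaussian σ M x = (((gaussianPDFReal 0 (σ ^ 2).toNNReal x : ℝ) : ℂ) *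
      jacobiTheta₂ (Complex.I * M * x / (Real.pi * σ ^ 2))
          (2 * Complex.I * M ^ 2 / (Real.pi * σ ^ 2))).re := by
    intro x
    have := Complex.ofReal_tsum (L := .unconditional ℤ)
      (fun j : ℤ => gaussianPDFReal 0 (σ ^ 2).toNNReal (x + 2 * j * M))
    rw [← wrappedGaussian_eq hσ] at this
    simp_rw [gaussianPDFReal_add_eq_theta hσ] at this
    rw [tsum_mul_left] at this
    rw [← Complex.ofReal_re (wrappedGaussian σ M x), this]; rfl
  rw [funext h]
  have hd : Differentiable ℂ fun z => jacobiTheta₂ z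
      (2 * Complex.I * M ^ 2 / (Real.pi * σ ^ 2)) :=
    fun z => differentiableAt_jacobiTheta₂_fst z (im_theta_pos hσ hM)
  refine Complex.continuous_re.comp (((Complex.continuous_ofReal.comp
    (continuous_gaussianPDFReal _ _))).mul (hd.continuous.comp ?_))
  fun_prop

lemma wrappedGaussian_add (M x : ℝ) (n : ℤ) :
    wrappedGaussian σ M (x + 2 * n * M) = wrappedGaussian σ M x := by
  unfold wrappedGaussian
  rw [← (Equiv.addLeft n).tsum_eq fun j : ℤ => σ⁻¹ * phi ((x + 2 * (j : ℝ) * M) / σ)]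
  congr 1; ext j
  simp only [Equiv.coe_addLeft]
  push_cast
  ring_nf

lemma wrappedGaussian_ge (hσ : 0 < σ) (hM : 0 < M) (x : ℝ) :
    gaussianPDFReal 0 (σ ^ 2).toNNReal x ≤ wrappedGaussian σ M x := by
  rw [wrappedGaussian_eq hσ]
  have := (summable_gaussianPDFReal_add hσ hM x).le_tsum 0
    (fun j _ => gaussianPDFReal_nonneg _ _ _)
  simpa using this

lemma wrappedGaussian_pos (hσ : 0 < σ) (hM : 0 < M) (x : ℝ) : 0 < wrappedGaussian σ M x :=
  (gaussianPDFReal_pos _ _ _ (toNNReal_sq_ne_zero hσ)).trans_le (wrappedGaussian_ge hσ hM x)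

lemma wrappedGaussian_wrap (x : ℝ) :
    wrappedGaussian σ M (wrap M x) = wrappedGaussian σ M x := by
  obtain ⟨n, hn⟩ := exists_wrap_eq M x
  rw [hn, wrappedGaussian_add]

/-- The wrapped Gaussian density is bounded above and below, by compactness and periodicity. -/
lemma exists_wrappedGaussian_bounds (hσ : 0 < σ) (hM : 0 < M) :
    ∃ k₀ k₁ : ℝ, 0 < k₀ ∧ ∀ x, k₀ ≤ wrappedGaussian σ M x ∧ wrappedGaussian σ M x ≤ k₁ := by
  have hne : (domain M).Nonempty := ⟨0, by simp [domain, hM.le]⟩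
  have hc := (continuous_wrappedGaussian hσ hM).continuousOn (s := domain M)
  obtain ⟨a, -, ha⟩ := isCompact_Icc.exists_isMinOn hne hc
  obtain ⟨b, -, hb⟩ := isCompact_Icc.exists_isMaxOn hne hc
  refine ⟨wrappedGaussian σ M a, wrappedGaussian σ M b, wrappedGaussian_pos hσ hM a, fun x => ?_⟩
  rw [← wrappedGaussian_wrap x]
  exact ⟨ha (wrap_mem_domain hM x), hb (wrap_mem_domain hM x)⟩

/-- On one period, the wrapped Gaussian density is at most a constant multiple of the Gaussian
density, uniformly in the period. -/
lemma exists_wrappedGaussian_le (hσ : 0 < σ) :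
    ∃ c : ℝ, 0 < c ∧ ∀ M, 1 ≤ M → ∀ x ∈ domain M,
      wrappedGaussian σ M x ≤ c * gaussianPDFReal 0 (σ ^ 2).toNNReal x := by
  set g := gaussianPDFReal 0 (σ ^ 2).toNNReal with hg
  have hgp : ∀ x, 0 < g x := fun x => gaussianPDFReal_pos _ _ _ (toNNReal_sq_ne_zero hσ)
  -- For `M ≥ 1`, the ratio of the `j`-th term to the central one is at most the same ratio for
  -- period `2` at an endpoint of `[-1, 1]`: the left one for `j ≥ 0`, the right one for `j ≤ 0`.
  have hmono : ∀ x y d e : ℝ, y ^ 2 - e ^ 2 ≤ x ^ 2 - d ^ 2 → g x ≤ g d * (g y / g e) := by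
    intro x y d e h
    rw [mul_div_assoc', le_div_iff₀ (hgp e)]
    simp only [hg, gaussianPDFReal, Real.coe_toNNReal _ (sq_nonneg σ), sub_zero]
    have h1 : Real.exp (-x ^ 2 / (2 * σ ^ 2)) * Real.exp (-e ^ 2 / (2 * σ ^ 2)) ≤
        Real.exp (-d ^ 2 / (2 * σ ^ 2)) * Real.exp (-y ^ 2 / (2 * σ ^ 2)) := by
      rw [← Real.exp_add, ← Real.exp_add, ← add_div, ← add_div]
      exact Real.exp_le_exp.2 (div_le_div_of_nonneg_right (by linarith) (by positivity))
    rw [mul_mul_mul_comm]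
    refine (mul_le_mul_of_nonneg_left h1 (by positivity)).trans_eq ?_
    ring
  refine ⟨(wrappedGaussian σ 1 (-1) + wrappedGaussian σ 1 1) / g 1, ?_, fun M hM x hx => ?_⟩
  · have h1 := wrappedGaussian_pos hσ one_pos (-1)
    have h2 := wrappedGaussian_pos hσ one_pos 1
    have h3 := hgp 1
    positivity
  · have hM0 : 0 < M := by linarith
    have hs1 := summable_gaussianPDFReal_add hσ one_pos (-1)
    have hs2 := summable_gaussianPDFReal_add hσ one_pos 1
    rw [← hg] at hs1 hs2
    rw [wrappedGaussian_eq hσ, wrappedGaussian_eq hσ, wrappedGaussian_eq hσ, ← hg,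
      ← hs1.tsum_add hs2, ← tsum_div_const, ← tsum_mul_right]
    refine (summable_gaussianPDFReal_add hσ hM0 x).tsum_le_tsum (fun j => ?_)
      (((hs1.add hs2).div_const _).mul_right _)
    rw [add_div, add_mul]
    have hM2 : (1 : ℝ) ≤ M ^ 2 := by nlinarith
    rcases le_total 0 j with hj | hj
    · have hj' : (0 : ℝ) ≤ (j : ℝ) ^ 2 - j := by
        rcases eq_or_lt_of_le hj with h | h
        · simp [← h]
        · have : (1 : ℝ) ≤ j := by exact_mod_cast h
          nlinarith
      have hj0 : (0 : ℝ) ≤ j := by exact_mod_cast hj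
      have := hmono (x + 2 * j * M) (-1 + 2 * j * 1) x 1 (by
        have h1 : -M ≤ x := hx.1
        have h2 : 0 ≤ j * M * (x + M) := by
          refine mul_nonneg (mul_nonneg (by linarith) hM0.le) (by linarith)
        nlinarith [mul_nonneg hj' (sub_nonneg.2 hM2)])
      have h3 := hgp x
      have h4 : 0 ≤ g x * (g (1 + 2 * j * 1) / g 1) := by
        have := hgp 1; have := hgp (1 + 2 * j * 1); positivity
      linarith
    · have hj' : (0 : ℝ) ≤ (j : ℝ) ^ 2 + j := by
        rcases eq_or_lt_of_le hj with h | h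
        · simp [h]
        · have : (j : ℝ) ≤ -1 := by exact_mod_cast Int.le_sub_one_of_lt h
          nlinarith
      have hj0 : (j : ℝ) ≤ 0 := by exact_mod_cast hj
      have := hmono (x + 2 * j * M) (1 + 2 * j * 1) x 1 (by
        have h1 : x ≤ M := hx.2
        have h2 : 0 ≤ (-j * M) * (M - x) := by
          refine mul_nonneg (mul_nonneg (by linarith) hM0.le) (by linarith)
        nlinarith [mul_nonneg hj' (sub_nonneg.2 hM2)])
      have h3 := hgp x
      have h4 : 0 ≤ g x * (g (-1 + 2 * j * 1) / g 1) := by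
        have := hgp 1; have := hgp (-1 + 2 * j * 1); positivity
      linarith

/-- Wrapping a Gaussian law gives the law with the wrapped Gaussian density. -/
lemma map_wrap_gaussianReal (hσ : 0 < σ) (hM : 0 < M) (m : ℝ) :
    (gaussianReal m (σ ^ 2).toNNReal).map (wrap M) =
      (volume.restrict (domain M)).withDensity
        fun x => ENNReal.ofReal (wrappedGaussian σ M (x - m)) := by
  ext s hs
  have hms : MeasurableSet (wrap M ⁻¹' s) := measurable_wrap M hs
  rw [Measure.map_apply (measurable_wrap M) hs, gaussianReal_apply _ (toNNReal_sq_ne_zero hσ),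
    withDensity_apply _ hs, ← lintegral_indicator hms,
    lintegral_eq_lintegral_tsum hM ((measurable_gaussianPDF _ _).indicator hms)]
  have hD : volume.restrict (domain M) = volume.restrict (Set.Ico (-M) M) :=
    Measure.restrict_congr_set Ico_ae_eq_Icc.symm
  rw [hD, ← lintegral_indicator hs]
  refine setLIntegral_congr_fun measurableSet_Ico fun x hx => ?_
  have h : ∀ n : ℤ, x + 2 * n * M ∈ wrap M ⁻¹' s ↔ x ∈ s := fun n => by
    rw [Set.mem_preimage, wrap_add hM, wrap_of_mem hM hx]
  by_cases hxs : x ∈ s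
  · rw [Set.indicator_of_mem hxs, wrappedGaussian_eq hσ,
      ENNReal.ofReal_tsum_of_nonneg (fun n => gaussianPDFReal_nonneg _ _ _)
        (summable_gaussianPDFReal_add hσ hM _)]
    congr 1; ext n
    rw [Set.indicator_of_mem ((h n).2 hxs), gaussianPDF, sub_add_eq_add_sub, gaussianPDFReal_sub,
      zero_add]
  · rw [Set.indicator_of_notMem hxs, ENNReal.tsum_eq_zero]
    exact fun n => Set.indicator_of_notMem (fun hn => hxs ((h n).1 hn)) _

lemma carrier_eq_map (hσ : 0 < σ) (hM : 0 < M) :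
    carrier σ M = (gaussianReal 0 (σ ^ 2).toNNReal).map (wrap M) := by
  rw [map_wrap_gaussianReal hσ hM]; simp [carrier]

lemma isProbabilityMeasure_carrier (hσ : 0 < σ) (hM : 0 < M) :
    IsProbabilityMeasure (carrier σ M) := by
  rw [carrier_eq_map hσ hM]
  exact Measure.isProbabilityMeasure_map (measurable_wrap M).aemeasurable

lemma ae_carrier_mem (σ M : ℝ) : ∀ᵐ x ∂(carrier σ M), x ∈ domain M :=
  (withDensity_absolutelyContinuous _ _).ae_le (ae_restrict_mem measurableSet_Icc)

lemma carrier_absolutelyContinuous (hσ : 0 < σ) (M : ℝ) :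
    carrier σ M ≪ gaussianReal 0 (σ ^ 2).toNNReal :=
  (withDensity_absolutelyContinuous _ _).trans
    (Measure.restrict_le_self.absolutelyContinuous.trans
      (gaussianReal_absolutelyContinuous' _ (toNNReal_sq_ne_zero hσ)))

/-- The carrier is dominated by a multiple of the Gaussian law, uniformly in the period. -/
lemma exists_carrier_le (hσ : 0 < σ) :
    ∃ c : ℝ, 0 < c ∧ ∀ M, 1 ≤ M →
      carrier σ M ≤ ENNReal.ofReal c • gaussianReal 0 (σ ^ 2).toNNReal := by
  obtain ⟨c, hc, h⟩ := exists_wrappedGaussian_le hσ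
  refine ⟨c, hc, fun M hM => Measure.le_iff.2 fun s hs => ?_⟩
  rw [carrier, withDensity_apply _ hs, Measure.smul_apply, smul_eq_mul,
    gaussianReal_apply _ (toNNReal_sq_ne_zero hσ), Measure.restrict_restrict hs,
    ← lintegral_const_mul _ (measurable_gaussianPDF _ _)]
  calc _ ≤ ∫⁻ x in s ∩ domain M, ENNReal.ofReal c * gaussianPDF 0 (σ ^ 2).toNNReal x := by
        refine setLIntegral_mono' (hs.inter measurableSet_Icc) fun x hx => ?_
        rw [gaussianPDF, ← ENNReal.ofReal_mul hc.le]
        exact ENNReal.ofReal_le_ofReal (h M hM x hx.2)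
    _ ≤ _ := lintegral_mono_set Set.inter_subset_left

lemma cyclicKernel_wrap (μ x : ℝ) : cyclicKernel M (wrap M μ) x = cyclicKernel M μ x := by
  obtain ⟨n, hn⟩ := exists_wrap_eq M μ
  rw [cyclicKernel_eq, cyclicKernel_eq, hn]
  have := wrappedGaussian_add (σ := 1) M (x - (μ + 2 * n * M)) n
  rw [← this]; congr 1; ring

lemma continuous_cyclicKernel (hM : 0 < M) :
    Continuous fun z : ℝ × ℝ => cyclicKernel M z.1 z.2 := by
  simp_rw [cyclicKernel_eq]
  exact (continuous_wrappedGaussian one_pos hM).comp (by fun_prop)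

lemma continuous_cyclicKernel_left (hM : 0 < M) (x : ℝ) :
    Continuous fun μ => cyclicKernel M μ x := by
  simp_rw [cyclicKernel_eq]
  exact (continuous_wrappedGaussian one_pos hM).comp (by fun_prop)

lemma continuous_cyclicKernel_right (hM : 0 < M) (μ : ℝ) :
    Continuous fun x => cyclicKernel M μ x := by
  simp_rw [cyclicKernel_eq]
  exact (continuous_wrappedGaussian one_pos hM).comp (by fun_prop)

lemma exists_cyclicKernel_bounds (hM : 0 < M) :
    ∃ k₀ k₁ : ℝ, 0 < k₀ ∧ ∀ μ x, k₀ ≤ cyclicKernel M μ x ∧ cyclicKernel M μ x ≤ k₁ := by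
  obtain ⟨k₀, k₁, h0, h⟩ := exists_wrappedGaussian_bounds one_pos hM
  exact ⟨k₀, k₁, h0, fun μ x => by rw [cyclicKernel_eq]; exact h _⟩

/-- The noise kernel is the law of a wrapped Gaussian observation. -/
lemma map_wrap_gaussianReal_one (hM : 0 < M) (μ : ℝ) :
    (gaussianReal μ 1).map (wrap M) =
      (volume.restrict (domain M)).withDensity fun x => ENNReal.ofReal (cyclicKernel M μ x) := by
  have := map_wrap_gaussianReal one_pos hM μ
  simpa [cyclicKernel_eq] using this

lemma integral_cyclicKernel_mul (hM : 0 < M) (μ : ℝ) {f : ℝ → ℝ} (hf : Measurable f) :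
    ∫ x in domain M, cyclicKernel M μ x * f x = ∫ x, f (wrap M x) ∂(gaussianReal μ 1) := by
  obtain ⟨k₀, k₁, h0, h⟩ := exists_cyclicKernel_bounds hM
  have hK : Measurable fun x => ENNReal.ofReal (cyclicKernel M μ x) :=
    (continuous_cyclicKernel_right hM μ).measurable.ennreal_ofReal
  rw [← integral_map (measurable_wrap M).aemeasurable hf.aestronglyMeasurable,
    map_wrap_gaussianReal_one hM,
    integral_withDensity_eq_integral_toReal_smul hK
      (Eventually.of_forall fun x => ENNReal.ofReal_lt_top)]
  refine integral_congr_ae (Eventually.of_forall fun x => ?_)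
  simp only [smul_eq_mul]
  rw [ENNReal.toReal_ofReal (h0.le.trans (h μ x).1)]

lemma integral_cyclicKernel (hM : 0 < M) (μ : ℝ) :
    ∫ x in domain M, cyclicKernel M μ x = 1 := by
  have := integral_cyclicKernel_mul hM μ (f := fun _ => 1) measurable_const
  simpa using this

end WrappedGaussian

/-! ### Posterior means and the smoothing operator of the noise kernel -/

section Kernel

variable {M : ℝ}

/-- The mean of `g` under one noisy observation of the latent value `μ`. -/
noncomputable def smooth (M : ℝ) (g : ℝ → ℝ) (μ : ℝ) : ℝ :=
  ∫ x in domain M, cyclicKernel M μ x * g x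

lemma continuous_hermiteFn (j : ℕ) : Continuous (hermiteFn j) := by
  rw [funext (hermiteFn_eq j)]
  have : Continuous fun x : ℝ => Polynomial.aeval x (Polynomial.hermite j) :=
    Polynomial.continuous_aeval _
  fun_prop

lemma abs_smooth_le (hM : 0 < M) {g : ℝ → ℝ} (hg : Measurable g) {b : ℝ} (hb : ∀ x, |g x| ≤ b)
    (μ : ℝ) : |smooth M g μ| ≤ b := by
  rw [smooth, integral_cyclicKernel_mul hM μ hg]
  exact abs_integral_le_of_abs_le (Eventually.of_forall fun x => hb _)

lemma measurable_smooth (hM : 0 < M) {g : ℝ → ℝ} (hg : Measurable g) :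
    Measurable (smooth M g) := by
  have : StronglyMeasurable fun z : ℝ × ℝ => cyclicKernel M z.1 z.2 * g z.2 :=
    ((continuous_cyclicKernel hM).measurable.mul (hg.comp measurable_snd)).stronglyMeasurable
  exact (this.integral_prod_right (ν := volume.restrict (domain M))).measurable

lemma isFiniteMeasure_domain (M : ℝ) : IsFiniteMeasure (volume.restrict (domain M)) :=
  ⟨by simp [domain]⟩

/-- The law of the latent variable given the observation `x`, when its prior law is `G`. Bayes' rule
makes it the exponential tilt of `G` by the logarithm of the kernel, so that the lemmas on tilts
apply to it. -/
noncomputable def posterior (M : ℝ) (G : Measure ℝ) (x : ℝ) : Measure ℝ :=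
  G.tilted fun μ => Real.log (cyclicKernel M μ x)

lemma exp_log_cyclicKernel (hM : 0 < M) (μ x : ℝ) :
    Real.exp (Real.log (cyclicKernel M μ x)) = cyclicKernel M μ x := by
  obtain ⟨k₀, k₁, h0, h⟩ := exists_cyclicKernel_bounds hM
  exact Real.exp_log (h0.trans_le (h μ x).1)

lemma posterior_absolutelyContinuous (M : ℝ) (G : Measure ℝ) (x : ℝ) : posterior M G x ≪ G :=
  tilted_absolutelyContinuous _ _

lemma integral_posterior (hM : 0 < M) (G : Measure ℝ) (f : ℝ → ℝ) (x : ℝ) :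
    ∫ μ, f μ ∂(posterior M G x) = (∫ μ, f μ * cyclicKernel M μ x ∂G) / obsDensity M G x := by
  rw [posterior, integral_tilted]
  simp_rw [exp_log_cyclicKernel hM, smul_eq_mul, div_eq_mul_inv]
  rw [← integral_mul_const]
  congr 1; ext μ
  simp only [obsDensity]; ring

lemma continuous_integral_mul_cyclicKernel (hM : 0 < M) {G : Measure ℝ} {f : ℝ → ℝ}
    (hf : Integrable f G) :
    Continuous fun x => ∫ μ, f μ * cyclicKernel M μ x ∂G := by
  obtain ⟨k₀, k₁, h0, h⟩ := exists_cyclicKernel_bounds hM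
  have h1 : ∀ x, AEStronglyMeasurable (fun μ => f μ * cyclicKernel M μ x) G := fun x =>
    hf.aestronglyMeasurable.mul (continuous_cyclicKernel_left hM x).aestronglyMeasurable
  have h2 : ∀ x, ∀ᵐ μ ∂G, ‖f μ * cyclicKernel M μ x‖ ≤ |f μ| * k₁ := fun x =>
    Eventually.of_forall fun μ => by
      rw [norm_mul, Real.norm_eq_abs, Real.norm_eq_abs, abs_of_nonneg (h0.le.trans (h μ x).1)]
      exact mul_le_mul_of_nonneg_left (h μ x).2 (abs_nonneg _)
  have h3 : ∀ᵐ μ ∂G, Continuous fun x => f μ * cyclicKernel M μ x :=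
    Eventually.of_forall fun μ => (continuous_cyclicKernel_right hM μ).const_mul (f μ)
  exact continuous_of_dominated h1 h2 (hf.abs.mul_const k₁) h3

variable {G : Measure ℝ} [IsProbabilityMeasure G]

lemma integrable_cyclicKernel (hM : 0 < M) (x : ℝ) :
    Integrable (fun μ => cyclicKernel M μ x) G := by
  obtain ⟨k₀, k₁, h0, h⟩ := exists_cyclicKernel_bounds hM
  refine integrable_of_abs_le (b := k₁)
    (continuous_cyclicKernel_left hM x).aemeasurable
    (Eventually.of_forall fun μ => ?_)
  exact abs_le.2 ⟨by linarith [(h μ x).1, (h μ x).2], (h μ x).2⟩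

lemma obsDensity_bounds (hM : 0 < M) {k₀ k₁ : ℝ}
    (h : ∀ μ x, k₀ ≤ cyclicKernel M μ x ∧ cyclicKernel M μ x ≤ k₁) (x : ℝ) :
    k₀ ≤ obsDensity M G x ∧ obsDensity M G x ≤ k₁ := by
  constructor
  · have := integral_mono (μ := G) (integrable_const k₀) (integrable_cyclicKernel hM x)
      (fun μ => (h μ x).1)
    simpa [obsDensity] using this
  · have := integral_mono (μ := G) (integrable_cyclicKernel hM x) (integrable_const k₁)
      (fun μ => (h μ x).2)
    simpa [obsDensity] using this

lemma obsDensity_pos (hM : 0 < M) (x : ℝ) : 0 < obsDensity M G x := by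
  obtain ⟨k₀, k₁, h0, h⟩ := exists_cyclicKernel_bounds hM
  exact h0.trans_le (obsDensity_bounds hM h x).1

lemma continuous_obsDensity (hM : 0 < M) : Continuous (obsDensity M G) := by
  have := continuous_integral_mul_cyclicKernel (G := G) hM (integrable_const 1)
  have e : obsDensity M G = fun x => ∫ μ, cyclicKernel M μ x ∂G := rfl
  rw [e]
  simpa using this

/-- Fubini for the noise channel. -/
lemma integral_domain_integral_mul (hM : 0 < M) {f g : ℝ → ℝ} (hf : Integrable f G)
    (hg : Measurable g) {b : ℝ} (hb : ∀ x, |g x| ≤ b) :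
    ∫ x in domain M, (∫ μ, f μ * cyclicKernel M μ x ∂G) * g x = ∫ μ, f μ * smooth M g μ ∂G := by
  obtain ⟨k₀, k₁, h0, h⟩ := exists_cyclicKernel_bounds hM
  have := isFiniteMeasure_domain M
  simp_rw [smooth, ← integral_mul_const, ← integral_const_mul]
  rw [integral_integral_swap]
  · simp_rw [mul_assoc]
  · have h1 : Integrable (fun z : ℝ × ℝ => (1 : ℝ) * f z.2)
        ((volume.restrict (domain M)).prod G) := (integrable_const (1 : ℝ)).mul_prod hf
    have h2 : Measurable fun z : ℝ × ℝ => cyclicKernel M z.2 z.1 * g z.1 :=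
      ((continuous_cyclicKernel hM).comp continuous_swap).measurable.mul (hg.comp measurable_fst)
    have := h1.bdd_mul (c := k₁ * b) h2.aestronglyMeasurable (Eventually.of_forall fun z => by
      rw [norm_mul, Real.norm_eq_abs, Real.norm_eq_abs,
        abs_of_nonneg (h0.le.trans (h z.2 z.1).1)]
      exact mul_le_mul (h _ _).2 (hb _) (abs_nonneg _)
        (h0.le.trans ((h z.2 z.1).1.trans (h _ _).2)))
    refine this.congr (Eventually.of_forall fun z => ?_)
    simp only [Function.uncurry]
    ring

lemma integral_obsLaw (hM : 0 < M) (g : ℝ → ℝ) :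
    ∫ x, g x ∂(obsLaw M G) = ∫ x in domain M, obsDensity M G x * g x := by
  rw [obsLaw, integral_withDensity_eq_integral_toReal_smul
    (continuous_obsDensity hM).measurable.ennreal_ofReal
    (Eventually.of_forall fun x => ENNReal.ofReal_lt_top)]
  refine integral_congr_ae (Eventually.of_forall fun x => ?_)
  simp only [smul_eq_mul]
  rw [ENNReal.toReal_ofReal (obsDensity_pos hM x).le]

/-- The mean of a bounded statistic of one observation is the latent mean of its smoothing. -/
lemma integral_obsLaw_eq_smooth (hM : 0 < M) {g : ℝ → ℝ} (hg : Measurable g) {b : ℝ}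
    (hb : ∀ x, |g x| ≤ b) : ∫ x, g x ∂(obsLaw M G) = ∫ μ, smooth M g μ ∂G := by
  rw [integral_obsLaw hM]
  have := integral_domain_integral_mul (G := G) hM (integrable_const 1) hg hb
  simpa [obsDensity] using this

lemma isProbabilityMeasure_obsLaw (hM : 0 < M) : IsProbabilityMeasure (obsLaw M G) := by
  obtain ⟨k₀, k₁, h0, h⟩ := exists_cyclicKernel_bounds hM
  have := isFiniteMeasure_domain M
  have hi : Integrable (obsDensity M G) (volume.restrict (domain M)) :=
    Integrable.of_bound (continuous_obsDensity hM).aestronglyMeasurable k₁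
      (Eventually.of_forall fun x => by
        rw [Real.norm_eq_abs, abs_of_pos (obsDensity_pos hM x)]
        exact (obsDensity_bounds hM h x).2)
  have h1 := integral_domain_integral_mul (G := G) hM (integrable_const 1)
    (g := fun _ => 1) measurable_const (b := 1) (by simp)
  simp [smooth, integral_cyclicKernel hM] at h1
  constructor
  rw [obsLaw, withDensity_apply _ MeasurableSet.univ, Measure.restrict_univ,
    ← ofReal_integral_eq_lintegral_ofReal hi
      (Eventually.of_forall fun x => (obsDensity_pos hM x).le)]
  simp only [obsDensity]
  rw [h1]; simp

lemma ae_obsLaw_mem (M : ℝ) (G : Measure ℝ) : ∀ᵐ x ∂(obsLaw M G), x ∈ domain M :=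
  (withDensity_absolutelyContinuous _ _).ae_le (ae_restrict_mem measurableSet_Icc)

lemma isProbabilityMeasure_posterior (hM : 0 < M) (x : ℝ) :
    IsProbabilityMeasure (posterior M G x) := by
  refine isProbabilityMeasure_tilted ?_
  simp_rw [exp_log_cyclicKernel hM]
  exact integrable_cyclicKernel hM x

lemma continuous_integral_posterior (hM : 0 < M) {f : ℝ → ℝ} (hf : Integrable f G) :
    Continuous fun x => ∫ μ, f μ ∂(posterior M G x) := by
  simp_rw [integral_posterior hM G]
  exact (continuous_integral_mul_cyclicKernel hM hf).div (continuous_obsDensity hM)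
    fun x => (obsDensity_pos hM x).ne'

/-- Projection property of the posterior mean. -/
lemma integral_obsLaw_posterior_mul (hM : 0 < M) {f g : ℝ → ℝ} (hf : Integrable f G)
    (hg : Measurable g) {b : ℝ} (hb : ∀ x, |g x| ≤ b) :
    ∫ x, (∫ μ, f μ ∂(posterior M G x)) * g x ∂(obsLaw M G) = ∫ μ, f μ * smooth M g μ ∂G := by
  rw [integral_obsLaw hM, ← integral_domain_integral_mul hM hf hg hb]
  refine integral_congr_ae (Eventually.of_forall fun x => ?_)
  have := (obsDensity_pos (G := G) hM x).ne'
  simp only [integral_posterior hM G]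
  field_simp

lemma integral_obsLaw_posterior (hM : 0 < M) {f : ℝ → ℝ} (hf : Integrable f G) :
    ∫ x, (∫ μ, f μ ∂(posterior M G x)) ∂(obsLaw M G) = ∫ μ, f μ ∂G := by
  have := integral_obsLaw_posterior_mul hM hf (g := fun _ => 1) measurable_const (b := 1)
    (by simp)
  simpa [smooth, integral_cyclicKernel hM] using this

/-- The observation density of a tilted prior, through the posterior of the untilted one. -/
lemma obsDensity_tilted (hM : 0 < M) {T : ℝ → ℝ} {b : ℝ} (hT : AEMeasurable T G)
    (hb : ∀ᵐ μ ∂G, |T μ| ≤ b) (x : ℝ) :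
    Real.log (obsDensity M (G.tilted T) x) = Real.log (obsDensity M G x) +
      Real.log (∫ μ, Real.exp (T μ) ∂(posterior M G x)) -
      Real.log (∫ μ, Real.exp (T μ) ∂G) := by
  have hTe := integrable_exp_of_abs_le hT hb
  have := isProbabilityMeasure_posterior (G := G) hM x
  have hac := posterior_absolutelyContinuous M G x
  have hTe' := integrable_exp_of_abs_le (hT.mono_ac hac) (hac.ae_le hb)
  have h1 := integral_exp_pos hTe
  have h2 := integral_exp_pos hTe'
  have h3 := obsDensity_pos (G := G) hM x
  have h : obsDensity M (G.tilted T) x = obsDensity M G x *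
      (∫ μ, Real.exp (T μ) ∂(posterior M G x)) / ∫ μ, Real.exp (T μ) ∂G := by
    rw [integral_posterior hM, mul_div_cancel₀ _ h3.ne']
    rw [obsDensity, integral_tilted]
    simp_rw [div_eq_mul_inv]
    rw [← integral_mul_const]
    congr 1; ext μ
    simp only [smul_eq_mul]; ring
  rw [h, Real.log_div (by positivity) h1.ne', Real.log_mul h3.ne' h2.ne']

end Kernel

/-! ### Local quadratic expansion of the log-likelihood -/

section Local

open Matrix

variable {p : ℕ}

/-- The linear combination of the features `φ` with coefficients `η`. -/
noncomputable def lin (φ : Fin p → ℝ → ℝ) (η : Fin p → ℝ) (μ : ℝ) : ℝ := ∑ j, η j * φ j μ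

lemma abs_lin_le {φ : Fin p → ℝ → ℝ} {B : ℝ} {μ : ℝ} (h : ∀ j, |φ j μ| ≤ B) (η : Fin p → ℝ) :
    |lin φ η μ| ≤ p * B * ‖η‖ := by
  calc |lin φ η μ| ≤ ∑ j, |η j * φ j μ| := Finset.abs_sum_le_sum_abs _ _
    _ ≤ ∑ j : Fin p, ‖η‖ * B := by
        refine Finset.sum_le_sum fun j _ => ?_
        rw [abs_mul]
        exact mul_le_mul (norm_le_pi_norm η j) (h j) (abs_nonneg _) (norm_nonneg _)
    _ = _ := by simp; ring

lemma lin_sub (φ : Fin p → ℝ → ℝ) (η θ : Fin p → ℝ) (μ : ℝ) :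
    lin φ η μ - lin φ θ μ = lin φ (η - θ) μ := by
  simp [lin, ← Finset.sum_sub_distrib, sub_mul]

section Measure

variable {ν : Measure ℝ} {φ : Fin p → ℝ → ℝ} {B : ℝ}

lemma aemeasurable_lin (hφ : ∀ j, AEMeasurable (φ j) ν) (η : Fin p → ℝ) :
    AEMeasurable (lin φ η) ν :=
  Finset.aemeasurable_fun_sum _ fun j _ => (hφ j).const_mul _

lemma ae_abs_lin_le (hB : ∀ j, ∀ᵐ μ ∂ν, |φ j μ| ≤ B) (η : Fin p → ℝ) :
    ∀ᵐ μ ∂ν, |lin φ η μ| ≤ p * B * ‖η‖ := by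
  filter_upwards [ae_all_iff.2 hB] with μ h
  exact abs_lin_le h η

variable [IsProbabilityMeasure ν]

lemma integral_lin (hφ : ∀ j, AEMeasurable (φ j) ν) (hB : ∀ j, ∀ᵐ μ ∂ν, |φ j μ| ≤ B)
    (η : Fin p → ℝ) : ∫ μ, lin φ η μ ∂ν = ∑ j, η j * ∫ μ, φ j μ ∂ν := by
  simp only [lin]
  rw [integral_finsetSum _ fun j _ => (integrable_of_abs_le (hφ j) (hB j)).const_mul _]
  simp_rw [integral_const_mul]

lemma variance_lin (hφ : ∀ j, AEMeasurable (φ j) ν) (hB : ∀ j, ∀ᵐ μ ∂ν, |φ j μ| ≤ B)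
    (η : Fin p → ℝ) :
    Var[lin φ η; ν] = η ⬝ᵥ (Matrix.of fun j k => cov[φ j, φ k; ν]) *ᵥ η := by
  have hL : ∀ j, MemLp (fun μ => η j * φ j μ) 2 ν := fun j =>
    (memLp_of_abs_le (hφ j) (hB j)).const_mul _
  rw [← covariance_self (aemeasurable_lin hφ η)]
  have e : lin φ η = fun μ => ∑ j, η j * φ j μ := rfl
  rw [e, covariance_fun_sum_fun_sum hL hL]
  simp only [dotProduct, mulVec, of_apply, Finset.mul_sum]
  refine Finset.sum_congr rfl fun j _ => Finset.sum_congr rfl fun k _ => ?_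
  rw [covariance_const_mul_left, covariance_const_mul_right]
  ring

/-- The variances of two close bounded functions are close. -/
lemma abs_variance_sub_le {X Y : ℝ → ℝ} {d t : ℝ} (hX : AEMeasurable X ν)
    (hY : AEMeasurable Y ν) (hd : ∀ᵐ μ ∂ν, |X μ - Y μ| ≤ d) (hXt : ∀ᵐ μ ∂ν, |X μ| ≤ t)
    (hYt : ∀ᵐ μ ∂ν, |Y μ| ≤ t) : |Var[X; ν] - Var[Y; ν]| ≤ 4 * d * t := by
  have hX2 := memLp_of_abs_le hX hXt
  have hY2 := memLp_of_abs_le hY hYt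
  have hd0 : 0 ≤ d := by
    obtain ⟨x, hx⟩ := hd.exists
    exact (abs_nonneg _).trans hx
  rw [variance_eq_sub hX2, variance_eq_sub hY2]
  have h1 : |∫ μ, X μ ∂ν - ∫ μ, Y μ ∂ν| ≤ d := by
    rw [← integral_sub (integrable_of_abs_le hX hXt) (integrable_of_abs_le hY hYt)]
    exact abs_integral_le_of_abs_le hd
  have h2 := abs_integral_le_of_abs_le hXt
  have h3 := abs_integral_le_of_abs_le hYt
  have h4 : |∫ μ, X μ ^ 2 ∂ν - ∫ μ, Y μ ^ 2 ∂ν| ≤ d * (2 * t) := by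
    rw [← integral_sub hX2.integrable_sq hY2.integrable_sq]
    refine abs_integral_le_of_abs_le ?_
    filter_upwards [hd, hXt, hYt] with μ h5 h6 h7
    have h8 : X μ ^ 2 - Y μ ^ 2 = (X μ - Y μ) * (X μ + Y μ) := by ring
    rw [h8, abs_mul]
    exact mul_le_mul h5 ((abs_add_le _ _).trans (by linarith)) (abs_nonneg _) hd0
  have h5 : |(∫ μ, X μ ∂ν) ^ 2 - (∫ μ, Y μ ∂ν) ^ 2| ≤ d * (2 * t) := by
    have h8 : (∫ μ, X μ ∂ν) ^ 2 - (∫ μ, Y μ ∂ν) ^ 2 =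
      (∫ μ, X μ ∂ν - ∫ μ, Y μ ∂ν) * (∫ μ, X μ ∂ν + ∫ μ, Y μ ∂ν) := by ring
    rw [h8, abs_mul]
    exact mul_le_mul h1 ((abs_add_le _ _).trans (by linarith)) (abs_nonneg _) hd0
  simp only [Pi.pow_apply]
  have h6 := abs_le.1 h4
  have h7 := abs_le.1 h5
  rw [abs_le]
  constructor <;> linarith [h6.1, h6.2, h7.1, h7.2]

end Measure

section Quadratic

variable {A : Matrix (Fin p) (Fin p) ℝ}

lemma abs_dotProduct_mulVec_le {b : ℝ} (h : ∀ j k, |A j k| ≤ b) (v : Fin p → ℝ) :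
    |v ⬝ᵥ A *ᵥ v| ≤ (p : ℝ) ^ 2 * b * ‖v‖ ^ 2 := by
  simp only [dotProduct, mulVec, Finset.mul_sum]
  calc _ ≤ ∑ j, ∑ k, |v j * (A j k * v k)| :=
        (Finset.abs_sum_le_sum_abs _ _).trans
          (Finset.sum_le_sum fun j _ => Finset.abs_sum_le_sum_abs _ _)
    _ ≤ ∑ j : Fin p, ∑ k : Fin p, ‖v‖ * (b * ‖v‖) := by
        refine Finset.sum_le_sum fun j _ => Finset.sum_le_sum fun k _ => ?_
        rw [abs_mul, abs_mul]
        have := h j k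
        have h0 := (abs_nonneg _).trans this
        have h1 : |v j| ≤ ‖v‖ := norm_le_pi_norm v j
        have h2 : |v k| ≤ ‖v‖ := norm_le_pi_norm v k
        gcongr
    _ = _ := by simp; ring

/-- An approximate maximizer comparison: if `L` is close to the concave quadratic with
maximizer `θ`, any point where `L` is at least `L θ` is close to `θ`. -/
lemma norm_sub_sq_le_of_near_quadratic (hA : A.IsSymm) {l r : ℝ} (hl : 0 < l)
    (hpos : ∀ v, l * ‖v‖ ^ 2 ≤ v ⬝ᵥ A *ᵥ v) {η θ : Fin p → ℝ} {L : (Fin p → ℝ) → ℝ}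
    (hη : |L η - (η ⬝ᵥ A *ᵥ θ - η ⬝ᵥ A *ᵥ η / 2)| ≤ r * ‖η‖ ^ 2)
    (hθ : |L θ - (θ ⬝ᵥ A *ᵥ θ - θ ⬝ᵥ A *ᵥ θ / 2)| ≤ r * ‖θ‖ ^ 2)
    (hL : L θ ≤ L η) (hr0 : 0 ≤ r) (hr : r ≤ l / 8) :
    ‖η - θ‖ ^ 2 ≤ 12 * r / l * ‖θ‖ ^ 2 := by
  have hsym : θ ⬝ᵥ A *ᵥ η = η ⬝ᵥ A *ᵥ θ := by
    rw [dotProduct_mulVec, ← mulVec_transpose, hA.eq, dotProduct_comm]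
  have h1 : (η - θ) ⬝ᵥ A *ᵥ (η - θ) =
      η ⬝ᵥ A *ᵥ η - 2 * (η ⬝ᵥ A *ᵥ θ) + θ ⬝ᵥ A *ᵥ θ := by
    rw [mulVec_sub, dotProduct_sub, sub_dotProduct, sub_dotProduct, hsym]; ring
  have h2 := hpos (η - θ)
  have h3 := abs_le.1 hη
  have h4 := abs_le.1 hθ
  have h5 : ‖η‖ ^ 2 ≤ 2 * ‖η - θ‖ ^ 2 + 2 * ‖θ‖ ^ 2 := by
    have : ‖η‖ ≤ ‖η - θ‖ + ‖θ‖ := by simpa using norm_add_le (η - θ) θ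
    nlinarith [sq_nonneg (‖η - θ‖ - ‖θ‖), norm_nonneg η, norm_nonneg (η - θ), norm_nonneg θ]
  have h6 : l / 2 * ‖η - θ‖ ^ 2 ≤ r * (2 * ‖η - θ‖ ^ 2 + 3 * ‖θ‖ ^ 2) := by
    nlinarith [mul_le_mul_of_nonneg_left h5 hr0]
  have h7 : l * ‖η - θ‖ ^ 2 ≤ 12 * r * ‖θ‖ ^ 2 := by
    nlinarith [mul_le_mul_of_nonneg_right hr (sq_nonneg ‖η - θ‖)]
  rw [div_mul_eq_mul_div, le_div_iff₀ hl]
  linarith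

end Quadratic

variable {M : ℝ} {G : Measure ℝ} {φ : Fin p → ℝ → ℝ}

/-- The posterior mean of the `j`-th feature. -/
noncomputable def postMean (M : ℝ) (G : Measure ℝ) (φ : Fin p → ℝ → ℝ) (j : Fin p) (x : ℝ) : ℝ :=
  ∫ μ, φ j μ ∂(posterior M G x)

/-- The Hessian at the origin of the log-density of one observation, as a function of the
natural parameter. -/
noncomputable def curvature (M : ℝ) (G : Measure ℝ) (φ : Fin p → ℝ → ℝ) (j k : Fin p)
    (x : ℝ) : ℝ :=
  cov[φ j, φ k; posterior M G x] - cov[φ j, φ k; G]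

/-- The Fisher information matrix of one observation at the origin. -/
noncomputable def info (M : ℝ) (G : Measure ℝ) (φ : Fin p → ℝ → ℝ) : Matrix (Fin p) (Fin p) ℝ :=
  Matrix.of fun j k => cov[postMean M G φ j, postMean M G φ k; obsLaw M G]

lemma info_isSymm : (info M G φ).IsSymm := by
  ext j k; simp [info, covariance_comm]

/-- Log-likelihood ratio of one observation, relative to the origin of the parameter space. -/
noncomputable def logRatio (M : ℝ) (G : Measure ℝ) (φ : Fin p → ℝ → ℝ) (η : Fin p → ℝ)
    (x : ℝ) : ℝ :=
  Real.log (obsDensity M (G.tilted (lin φ η)) x) - Real.log (obsDensity M G x)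

/-- The average of `f` over the sample `x`. -/
noncomputable def avg {n : ℕ} (x : Fin n → ℝ) (f : ℝ → ℝ) : ℝ := (∑ i, f (x i)) / n

section Avg

variable {n : ℕ}

lemma abs_avg_le {x : Fin n → ℝ} {f : ℝ → ℝ} {b : ℝ} (hb0 : 0 ≤ b) (hb : ∀ i, |f (x i)| ≤ b) :
    |avg x f| ≤ b := by
  rcases Nat.eq_zero_or_pos n with rfl | hn
  · simpa [avg] using hb0
  have hn' : (0 : ℝ) < n := by exact_mod_cast hn
  rw [avg, abs_div, abs_of_pos hn', div_le_iff₀ hn']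
  calc _ ≤ ∑ i, |f (x i)| := Finset.abs_sum_le_sum_abs _ _
    _ ≤ ∑ _i : Fin n, b := Finset.sum_le_sum fun i _ => hb i
    _ = _ := by simp; ring

lemma avg_sub (x : Fin n → ℝ) (f g : ℝ → ℝ) :
    avg x (fun y => f y - g y) = avg x f - avg x g := by
  simp [avg, Finset.sum_sub_distrib, sub_div]

lemma avg_add (x : Fin n → ℝ) (f g : ℝ → ℝ) :
    avg x (fun y => f y + g y) = avg x f + avg x g := by
  simp [avg, Finset.sum_add_distrib, add_div]

lemma avg_const_mul (x : Fin n → ℝ) (c : ℝ) (f : ℝ → ℝ) :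
    avg x (fun y => c * f y) = c * avg x f := by
  simp [avg, ← Finset.mul_sum, mul_div_assoc]

lemma avg_const (hn : 0 < n) (x : Fin n → ℝ) (c : ℝ) : avg x (fun _ => c) = c := by
  have : (n : ℝ) ≠ 0 := by exact_mod_cast hn.ne'
  simp [avg]; field_simp

lemma avg_sum {ι : Type*} (s : Finset ι) (x : Fin n → ℝ) (f : ι → ℝ → ℝ) :
    avg x (fun y => ∑ k ∈ s, f k y) = ∑ k ∈ s, avg x (f k) := by
  simp only [avg, ← Finset.sum_div]
  rw [Finset.sum_comm]

end Avg

variable [IsProbabilityMeasure G] {B : ℝ}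

/-- The log-likelihood ratio of a single observation is quadratic in a small parameter: by
`obsDensity_tilted` it is a difference of two log-moment generating functions, under the posterior
law and under the carrier. -/
lemma abs_logRatio_sub_le (hM : 0 < M) (hφ : ∀ j, AEMeasurable (φ j) G)
    (hB : ∀ j, ∀ᵐ μ ∂G, |φ j μ| ≤ B) {η : Fin p → ℝ} (hη : p * B * ‖η‖ ≤ 1 / 2) (x : ℝ) :
    |logRatio M G φ η x - (η ⬝ᵥ (fun j => postMean M G φ j x - ∫ μ, φ j μ ∂G) +
      η ⬝ᵥ (Matrix.of fun j k => curvature M G φ j k x) *ᵥ η / 2)| ≤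
      14 * (p * B * ‖η‖) ^ 3 := by
  have hac := posterior_absolutelyContinuous M G x
  have := isProbabilityMeasure_posterior (G := G) hM x
  have hφ' : ∀ j, AEMeasurable (φ j) (posterior M G x) := fun j => (hφ j).mono_ac hac
  have hB' : ∀ j, ∀ᵐ μ ∂(posterior M G x), |φ j μ| ≤ B := fun j => hac.ae_le (hB j)
  have h1 := abs_log_integral_exp_sub_le (aemeasurable_lin hφ η) (ae_abs_lin_le hB η) hη
  have h2 := abs_log_integral_exp_sub_le (aemeasurable_lin hφ' η) (ae_abs_lin_le hB' η) hη
  rw [integral_lin hφ hB, variance_lin hφ hB] at h1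
  rw [integral_lin hφ' hB', variance_lin hφ' hB'] at h2
  have h3 : η ⬝ᵥ (Matrix.of fun j k => curvature M G φ j k x) *ᵥ η =
      η ⬝ᵥ (Matrix.of fun j k => cov[φ j, φ k; posterior M G x]) *ᵥ η -
      η ⬝ᵥ (Matrix.of fun j k => cov[φ j, φ k; G]) *ᵥ η := by
    rw [← dotProduct_sub, ← sub_mulVec]; rfl
  have h4 : η ⬝ᵥ (fun j => postMean M G φ j x - ∫ μ, φ j μ ∂G) =
      ∑ j, η j * ∫ μ, φ j μ ∂(posterior M G x) - ∑ j, η j * ∫ μ, φ j μ ∂G := by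
    simp [dotProduct, postMean, mul_sub, Finset.sum_sub_distrib]
  rw [logRatio, obsDensity_tilted hM (aemeasurable_lin hφ η) (ae_abs_lin_le hB η), h3, h4]
  have h5 := abs_le.1 h1
  have h6 := abs_le.1 h2
  rw [abs_le]
  constructor <;> linarith [h5.1, h5.2, h6.1, h6.2]

/-- The normalized score of the sample at the origin. -/
noncomputable def meanScore (M : ℝ) (G : Measure ℝ) (φ : Fin p → ℝ → ℝ) {n : ℕ}
    (x : Fin n → ℝ) : Fin p → ℝ :=
  fun j => avg x (postMean M G φ j) - ∫ μ, φ j μ ∂G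

/-- The one-step approximation `I⁻¹ · score` of the maximum likelihood estimator. -/
noncomputable def oneStep (M : ℝ) (G : Measure ℝ) (φ : Fin p → ℝ → ℝ) {n : ℕ}
    (x : Fin n → ℝ) : Fin p → ℝ :=
  (info M G φ)⁻¹ *ᵥ meanScore M G φ x

/-- The average log-likelihood ratio is close to the quadratic form given by the score and the
information, as soon as the empirical curvature is close to minus the information. -/
lemma abs_avg_logRatio_sub_le (hM : 0 < M) (hφ : ∀ j, AEMeasurable (φ j) G)
    (hB0 : 0 ≤ B) (hB : ∀ j, ∀ᵐ μ ∂G, |φ j μ| ≤ B) {η : Fin p → ℝ}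
    (hη : p * B * ‖η‖ ≤ 1 / 2) {n : ℕ} (hn : 0 < n) (x : Fin n → ℝ) {δ : ℝ}
    (hδ : ∀ j k, |avg x (curvature M G φ j k) + info M G φ j k| ≤ δ) (hηδ : ‖η‖ ≤ δ) :
    |avg x (logRatio M G φ η) - (η ⬝ᵥ meanScore M G φ x - η ⬝ᵥ info M G φ *ᵥ η / 2)| ≤
      ((p : ℝ) ^ 2 * δ + 14 * (p * B) ^ 3 * δ) * ‖η‖ ^ 2 := by
  have hδ0 : 0 ≤ δ := (norm_nonneg _).trans hηδ
  set D : Matrix (Fin p) (Fin p) ℝ :=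
    Matrix.of fun j k => avg x (curvature M G φ j k) + info M G φ j k with hD
  have h1 := abs_dotProduct_mulVec_le (A := D) (b := δ) hδ η
  have h2 : |avg x (logRatio M G φ η) - (η ⬝ᵥ meanScore M G φ x +
      (η ⬝ᵥ D *ᵥ η - η ⬝ᵥ info M G φ *ᵥ η) / 2)| ≤ 14 * (p * B * ‖η‖) ^ 3 := by
    have h3 : η ⬝ᵥ D *ᵥ η - η ⬝ᵥ info M G φ *ᵥ η =
        η ⬝ᵥ (Matrix.of fun j k => avg x (curvature M G φ j k)) *ᵥ η := by
      rw [← dotProduct_sub, ← sub_mulVec]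
      congr 2; ext j k; simp [hD]
    have h4 : η ⬝ᵥ meanScore M G φ x +
        η ⬝ᵥ (Matrix.of fun j k => avg x (curvature M G φ j k)) *ᵥ η / 2 =
        avg x (fun y => η ⬝ᵥ (fun j => postMean M G φ j y - ∫ μ, φ j μ ∂G) +
          η ⬝ᵥ (Matrix.of fun j k => curvature M G φ j k y) *ᵥ η / 2) := by
      have e1 : ∀ y, η ⬝ᵥ (Matrix.of fun j k => curvature M G φ j k y) *ᵥ η / 2 =
          2⁻¹ * (η ⬝ᵥ (Matrix.of fun j k => curvature M G φ j k y) *ᵥ η) := fun y => by ring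
      simp_rw [e1]
      rw [avg_add, avg_const_mul]
      simp only [dotProduct, mulVec, of_apply, Finset.mul_sum, meanScore]
      rw [avg_sum, avg_sum]
      congr 1
      · refine Finset.sum_congr rfl fun j _ => ?_
        rw [avg_const_mul, avg_sub, avg_const hn]
      · rw [div_eq_inv_mul]
        congr 1
        refine Finset.sum_congr rfl fun j _ => ?_
        rw [avg_sum]
        refine Finset.sum_congr rfl fun k _ => ?_
        have e2 : (fun y => η j * (curvature M G φ j k y * η k)) =
          fun y => (η j * η k) * curvature M G φ j k y := by ext y; ring
        rw [e2, avg_const_mul]; ring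
    rw [h3, h4, ← avg_sub]
    refine abs_avg_le (by positivity) fun i => ?_
    exact abs_logRatio_sub_le hM hφ hB hη (x i)
  have h5 : 14 * (p * B * ‖η‖) ^ 3 ≤ 14 * (p * B) ^ 3 * δ * ‖η‖ ^ 2 := by
    have : 14 * (p * B * ‖η‖) ^ 3 = 14 * (p * B) ^ 3 * ‖η‖ ^ 2 * ‖η‖ := by ring
    rw [this]
    calc _ ≤ 14 * (p * B) ^ 3 * ‖η‖ ^ 2 * δ := by gcongr
      _ = _ := by ring
  have h6 := abs_le.1 h1
  have h7 := abs_le.1 (h2.trans h5)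
  have h8 : 0 ≤ (p : ℝ) ^ 2 * δ * ‖η‖ ^ 2 := by positivity
  rw [abs_le]
  constructor <;> nlinarith [h6.1, h6.2, h7.1, h7.2]

set_option maxHeartbeats 1000000 in
/-- On samples for which the estimator is close to the origin and the empirical curvature is close
to minus the information, the relative entropy loss of any parameter beating the one-step
approximation is, to leading order, the quadratic loss of the one-step approximation. -/
theorem exists_abs_kl_sub_le (hM : 0 < M) (hφ : ∀ j, AEMeasurable (φ j) G)
    (hB0 : 0 ≤ B) (hB : ∀ j, ∀ᵐ μ ∂G, |φ j μ| ≤ B) {l : ℝ} (hl : 0 < l)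
    (hpos : ∀ v, l * ‖v‖ ^ 2 ≤ v ⬝ᵥ info M G φ *ᵥ v) :
    ∃ c ε₀ : ℝ, 0 ≤ c ∧ 0 < ε₀ ∧ ∀ ε, 0 < ε → ε ≤ ε₀ → ∀ (n : ℕ), 0 < n →
      ∀ (x : Fin n → ℝ) (a : ℝ → ℝ) (s : ℝ) (η : Fin p → ℝ), AEMeasurable a G →
      (∀ᵐ μ ∂G, |a μ| ≤ s) → s ≤ ε ^ 2 → ‖η‖ ≤ ε ^ 2 → ‖oneStep M G φ x‖ ≤ ε ^ 2 →
      (∀ j k, |avg x (curvature M G φ j k) + info M G φ j k| ≤ ε ^ 2) →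
      avg x (logRatio M G φ (oneStep M G φ x)) ≤ avg x (logRatio M G φ η) →
      |Real.log (∫ μ, Real.exp (lin φ η μ - a μ) ∂(G.tilted a)) -
          ∫ μ, (lin φ η μ - a μ) ∂(G.tilted a) -
          Var[fun μ => lin φ (oneStep M G φ x) μ - a μ; G] / 2| ≤
        c * ε * (s ^ 2 + ‖oneStep M G φ x‖ ^ 2) := by
  -- A coercive information matrix is invertible.
  have hdet : IsUnit (info M G φ).det := by
    rw [← Matrix.isUnit_iff_isUnit_det, ← Matrix.mulVec_injective_iff_isUnit]
    intro v w hvw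
    have h0 : info M G φ *ᵥ (v - w) = 0 := by
      rw [mulVec_sub]; exact sub_eq_zero.2 hvw
    have h1 := hpos (v - w)
    rw [h0, dotProduct_zero] at h1
    have h2 : ‖v - w‖ ^ 2 ≤ 0 := by nlinarith
    have h3 : ‖v - w‖ = 0 := by nlinarith [norm_nonneg (v - w), sq_nonneg ‖v - w‖]
    exact sub_eq_zero.1 (norm_eq_zero.1 h3)
  set K : ℝ := p * B with hK
  have hK0 : 0 ≤ K := by positivity
  set R : ℝ := (p : ℝ) ^ 2 + 14 * K ^ 3 with hR
  have hR0 : 0 ≤ R := by positivity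
  set c₁ : ℝ := Real.sqrt (12 * R / l) with hc₁
  have hc₁0 : 0 ≤ c₁ := Real.sqrt_nonneg _
  have hc₁2 : c₁ ^ 2 = 12 * R / l := Real.sq_sqrt (by positivity)
  set c₂ : ℝ := 1 + 2 * K with hc₂
  have hc₂0 : 0 ≤ c₂ := by positivity
  -- `ε₀` makes all third-order expansions valid and the quadratic comparison coercive.
  obtain ⟨ε₀, hε₀, hε1, hεK, hεR, hεc⟩ : ∃ ε₀ : ℝ, 0 < ε₀ ∧ ε₀ ≤ 1 ∧ ε₀ * (1 + K) ≤ 1 / 2 ∧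
      ε₀ * R ≤ l / 8 ∧ ε₀ * c₁ ≤ 1 := by
    refine ⟨min (min 1 (1 / (2 * (1 + K)))) (min (l / (8 * (R + 1))) (1 / (c₁ + 1))), ?_, ?_,
      ?_, ?_, ?_⟩
    · positivity
    · exact (min_le_left _ _).trans (min_le_left _ _)
    · calc _ ≤ 1 / (2 * (1 + K)) * (1 + K) := by
            gcongr
            exact (min_le_left _ _).trans (min_le_right _ _)
        _ = _ := by field_simp
    · calc _ ≤ l / (8 * (R + 1)) * (R + 1) := by
            gcongr
            · exact (min_le_right _ _).trans (min_le_left _ _)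
            · linarith
        _ = _ := by field_simp
    · calc _ ≤ 1 / (c₁ + 1) * (c₁ + 1) := by
            gcongr
            · exact (min_le_right _ _).trans (min_le_right _ _)
            · linarith
        _ = _ := by field_simp
  refine ⟨2 * (c₂ ^ 2 * (7 * (1 + K) + 33) + 2 * (K * c₁) * c₂), ε₀, by positivity, hε₀, ?_⟩
  intro ε hε hεε n hn x a s η ha hs hsε hηε hθε hcurv hmax
  set θ := oneStep M G φ x with hθ
  have hs0 : 0 ≤ s := by
    obtain ⟨y, hy⟩ := hs.exists
    exact (abs_nonneg _).trans hy
  have hε2 : ε ^ 2 ≤ ε := by nlinarith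
  have hIθ : info M G φ *ᵥ θ = meanScore M G φ x := by
    rw [hθ, oneStep, mulVec_mulVec, Matrix.mul_nonsing_inv _ hdet, one_mulVec]
  have hKε : (1 + K) * ε ≤ 1 / 2 :=
    (mul_le_mul_of_nonneg_left hεε (by positivity)).trans (by linarith)
  have hKη' : K * ‖η‖ ≤ K * ε := mul_le_mul_of_nonneg_left (hηε.trans hε2) hK0
  have hKθ' : K * ‖θ‖ ≤ K * ε := mul_le_mul_of_nonneg_left (hθε.trans hε2) hK0
  have hKη : K * ‖η‖ ≤ 1 / 2 := by linarith
  have hKθ : K * ‖θ‖ ≤ 1 / 2 := by linarith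
  have hRε : R * ε ^ 2 ≤ l / 8 :=
    (mul_le_mul_of_nonneg_left (hε2.trans hεε) hR0).trans (by linarith)
  have h1 := abs_avg_logRatio_sub_le hM hφ hB0 hB hKη hn x hcurv hηε
  have h2 := abs_avg_logRatio_sub_le hM hφ hB0 hB hKθ hn x hcurv hθε
  rw [← hIθ] at h1 h2
  have hr : (p : ℝ) ^ 2 * ε ^ 2 + 14 * (p * B) ^ 3 * ε ^ 2 = R * ε ^ 2 := by rw [hR]; ring
  rw [hr] at h1 h2
  -- A point at which the perturbed quadratic form exceeds its value at the vertex `θ` is close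
  -- to `θ`.
  have h3 := norm_sub_sq_le_of_near_quadratic info_isSymm hl hpos (L := fun η =>
    avg x (logRatio M G φ η)) h1 h2 hmax (by positivity) hRε
  have hd : ‖η - θ‖ ≤ c₁ * ε * ‖θ‖ := by
    have e : 12 * (R * ε ^ 2) / l * ‖θ‖ ^ 2 = (c₁ * ε * ‖θ‖) ^ 2 := by
      rw [mul_pow, mul_pow, hc₁2]; ring
    rw [e] at h3
    exact (pow_le_pow_iff_left₀ (norm_nonneg _) (by positivity) two_ne_zero).1 h3
  have hηθ : ‖η‖ ≤ 2 * ‖θ‖ := by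
    have h4 : ‖η‖ ≤ ‖η - θ‖ + ‖θ‖ := by simpa using norm_add_le (η - θ) θ
    have h5 : c₁ * ε ≤ 1 := (mul_le_mul_of_nonneg_left hεε hc₁0).trans (by linarith)
    have h6 : c₁ * ε * ‖θ‖ ≤ 1 * ‖θ‖ := mul_le_mul_of_nonneg_right h5 (norm_nonneg θ)
    linarith
  set u := s + ‖θ‖ with hu
  have hu0 : 0 ≤ u := by positivity
  have hXm : AEMeasurable (fun μ => lin φ η μ - a μ) G := (aemeasurable_lin hφ η).sub ha
  have hYm : AEMeasurable (fun μ => lin φ θ μ - a μ) G := (aemeasurable_lin hφ θ).sub ha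
  set t := s + K * ‖η‖ with ht
  have ht0 : 0 ≤ t := by positivity
  have htu : t ≤ c₂ * u := by
    have e1 : K * ‖η‖ ≤ K * (2 * ‖θ‖) := mul_le_mul_of_nonneg_left hηθ hK0
    have e2 : c₂ * u = s + 2 * (K * s) + ‖θ‖ + K * (2 * ‖θ‖) := by rw [hc₂, hu]; ring
    have e3 := mul_nonneg hK0 hs0
    have e4 := norm_nonneg θ
    linarith
  have htε : t ≤ (1 + K) * ε := by rw [ht]; linarith
  have hX : ∀ᵐ μ ∂G, |lin φ η μ - a μ| ≤ t := by
    filter_upwards [ae_abs_lin_le hB η, hs] with μ h4 h5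
    exact (abs_sub _ _).trans (by linarith)
  have hX' : ∀ᵐ μ ∂G, |lin φ η μ - a μ| ≤ c₂ * u := hX.mono fun μ h => h.trans htu
  have hY' : ∀ᵐ μ ∂G, |lin φ θ μ - a μ| ≤ c₂ * u := by
    filter_upwards [ae_abs_lin_le hB θ, hs] with μ h4 h5
    refine (abs_sub _ _).trans ?_
    have e2 : c₂ * u = s + 2 * (K * s) + ‖θ‖ + K * ‖θ‖ + K * ‖θ‖ := by rw [hc₂, hu]; ring
    have e3 := mul_nonneg hK0 hs0
    have e4 := mul_nonneg hK0 (norm_nonneg θ)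
    have e5 := norm_nonneg θ
    linarith
  have hXY : ∀ᵐ μ ∂G, |(lin φ η μ - a μ) - (lin φ θ μ - a μ)| ≤ K * c₁ * ε * u := by
    filter_upwards [ae_abs_lin_le hB (η - θ)] with μ h4
    rw [sub_sub_sub_cancel_right, lin_sub]
    refine h4.trans ?_
    calc K * ‖η - θ‖ ≤ K * (c₁ * ε * ‖θ‖) := by gcongr
      _ ≤ K * (c₁ * ε * u) := by
          gcongr
          linarith
      _ = _ := by ring
  have h4 := abs_kl_sub_variance_le ha hs (by linarith) hXm hX (by linarith)
  have h5 := abs_variance_sub_le hXm hYm hXY hX' hY'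
  have h6 : 7 * t ^ 3 + 33 * t ^ 2 * s ≤ c₂ ^ 2 * (7 * (1 + K) + 33) * ε * u ^ 2 := by
    have e1 : 7 * t ^ 3 + 33 * t ^ 2 * s = t ^ 2 * (7 * t + 33 * s) := by ring
    rw [e1]
    calc _ ≤ (c₂ * u) ^ 2 * (7 * ((1 + K) * ε) + 33 * ε) := by
          gcongr
          linarith
      _ = _ := by ring
  have h7 : u ^ 2 ≤ 2 * (s ^ 2 + ‖θ‖ ^ 2) := by
    rw [hu]; nlinarith [sq_nonneg (s - ‖θ‖)]
  have h8 : 2 * (c₂ ^ 2 * (7 * (1 + K) + 33) + 2 * (K * c₁) * c₂) * ε * (s ^ 2 + ‖θ‖ ^ 2) ≥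
      (c₂ ^ 2 * (7 * (1 + K) + 33) + 2 * (K * c₁) * c₂) * ε * u ^ 2 := by
    have : 0 ≤ (c₂ ^ 2 * (7 * (1 + K) + 33) + 2 * (K * c₁) * c₂) * ε := by positivity
    have := mul_le_mul_of_nonneg_left h7 this
    linarith
  have h9 := abs_le.1 (h4.trans h6)
  have h10 := abs_le.1 h5
  have e9 : 4 * (K * c₁ * ε * u) * (c₂ * u) / 2 = 2 * (K * c₁) * c₂ * ε * u ^ 2 := by ring
  have e10 : (c₂ ^ 2 * (7 * (1 + K) + 33) + 2 * (K * c₁) * c₂) * ε * u ^ 2 =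
      c₂ ^ 2 * (7 * (1 + K) + 33) * ε * u ^ 2 + 2 * (K * c₁) * c₂ * ε * u ^ 2 := by ring
  rw [abs_le]
  constructor <;> linarith [h9.1, h9.2, h10.1, h10.2]

end Local

/-! ### Deconvolution: smoothing has dense range -/

section Deconvolution

variable {M : ℝ}

lemma integral_cyclicKernel_smul (hM : 0 < M) (μ : ℝ) {f : ℝ → ℂ} (hf : Measurable f) :
    ∫ x in domain M, cyclicKernel M μ x • f x = ∫ x, f (wrap M x) ∂(gaussianReal μ 1) := by
  obtain ⟨k₀, k₁, h0, h⟩ := exists_cyclicKernel_bounds hM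
  have hK : Measurable fun x => ENNReal.ofReal (cyclicKernel M μ x) :=
    (continuous_cyclicKernel_right hM μ).measurable.ennreal_ofReal
  rw [← integral_map (measurable_wrap M).aemeasurable hf.aestronglyMeasurable,
    map_wrap_gaussianReal_one hM,
    integral_withDensity_eq_integral_toReal_smul hK (Eventually.of_forall fun x =>
      ENNReal.ofReal_lt_top)]
  refine integral_congr_ae (Eventually.of_forall fun x => ?_)
  simp only
  rw [ENNReal.toReal_ofReal (h0.le.trans (h μ x).1)]

/-- Trigonometric monomials are eigenfunctions of the smoothing operator. -/
lemma integral_cyclicKernel_smul_fourier (hM : 0 < M) (μ : ℝ) (n : ℤ) :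
    ∫ x in domain M, cyclicKernel M μ x • (fourier n (x : AddCircle (2 * M)) : ℂ) =
      Complex.exp (-((Real.pi * n / M : ℝ) : ℂ) ^ 2 / 2) * fourier n (μ : AddCircle (2 * M)) := by
  have hc : Continuous fun x : ℝ => (fourier n (x : AddCircle (2 * M)) : ℂ) :=
    (fourier n).continuous.comp (AddCircle.continuous_mk' _)
  have hM' : (M : ℂ) ≠ 0 := by exact_mod_cast hM.ne'
  rw [integral_cyclicKernel_smul hM μ hc.measurable]
  have h1 : ∀ x : ℝ, ((wrap M x : ℝ) : AddCircle (2 * M)) = (x : AddCircle (2 * M)) := by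
    intro x
    obtain ⟨k, hk⟩ := exists_wrap_eq M x
    rw [hk, AddCircle.coe_add]
    have : ((2 * k * M : ℝ) : AddCircle (2 * M)) = 0 := by
      rw [AddCircle.coe_eq_zero_iff]
      exact ⟨k, by simp; ring⟩
    rw [this, add_zero]
  simp_rw [h1, fourier_coe_apply]
  have h2 := charFun_gaussianReal (μ := μ) (v := 1) (Real.pi * n / M)
  rw [charFun_apply_real] at h2
  have h3 : ∀ x : ℝ, Complex.exp (2 * Real.pi * Complex.I * n * x / ((2 * M : ℝ) : ℂ)) =
      Complex.exp (((Real.pi * n / M : ℝ) : ℂ) * x * Complex.I) := by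
    intro x; congr 1; push_cast; field_simp
  simp_rw [h3]
  rw [h2, ← Complex.exp_add]
  congr 1
  push_cast
  ring

/-- Every continuous function on the circle is uniformly close to the smoothing of a bounded
function. -/
lemma exists_smooth_near_complex (hM : 0 < M) [Fact (0 < 2 * M)] (F : C(AddCircle (2 * M), ℂ))
    {ε : ℝ} (hε : 0 < ε) :
    ∃ ψ : ℝ → ℂ, Measurable ψ ∧ (∃ b, ∀ x, ‖ψ x‖ ≤ b) ∧
      ∀ μ : ℝ, ‖(∫ x in domain M, cyclicKernel M μ x • ψ x) - F μ‖ < ε := by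
  have hF : F ∈ (Submodule.span ℂ (Set.range (@fourier (2 * M)))).topologicalClosure := by
    rw [span_fourier_closure_eq_top]; trivial
  rw [← SetLike.mem_coe, Submodule.topologicalClosure_coe, Metric.mem_closure_iff] at hF
  obtain ⟨P, hP, hd⟩ := hF ε hε
  have key : ∃ ψ : ℝ → ℂ, Measurable ψ ∧ (∃ b, ∀ x, ‖ψ x‖ ≤ b) ∧
      ∀ μ : ℝ, ∫ x in domain M, cyclicKernel M μ x • ψ x = P μ := by
    -- The exponentials are eigenvectors of the smoothing operator with nonzero eigenvalues, so
    -- trigonometric polynomials lie exactly in its range.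
    clear hd
    induction hP using Submodule.span_induction with
    | mem P hP =>
      obtain ⟨n, rfl⟩ := hP
      set e : ℂ := Complex.exp (-((Real.pi * n / M : ℝ) : ℂ) ^ 2 / 2) with he
      have hc : Continuous fun x : ℝ => (fourier n (x : AddCircle (2 * M)) : ℂ) :=
        (fourier n).continuous.comp (AddCircle.continuous_mk' _)
      refine ⟨fun x => e⁻¹ * fourier n (x : AddCircle (2 * M)), hc.measurable.const_mul _,
        ⟨‖e⁻¹‖, fun x => ?_⟩, fun μ => ?_⟩
      · rw [norm_mul, fourier_apply, Circle.norm_coe, mul_one]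
      · have h1 : ∀ x : ℝ, cyclicKernel M μ x • (e⁻¹ * fourier n (x : AddCircle (2 * M))) =
          e⁻¹ * (cyclicKernel M μ x • (fourier n (x : AddCircle (2 * M)) : ℂ)) :=
          fun x => (mul_smul_comm _ _ _).symm
        simp_rw [h1]
        rw [integral_const_mul, integral_cyclicKernel_smul_fourier hM, ← he, ← mul_assoc,
          inv_mul_cancel₀ (Complex.exp_ne_zero _), one_mul]
    | zero => exact ⟨0, measurable_const, ⟨0, by simp⟩, by simp⟩
    | add P Q _ _ hP hQ =>
      obtain ⟨ψ, h1, ⟨b, h2⟩, h3⟩ := hP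
      obtain ⟨ψ', h1', ⟨b', h2'⟩, h3'⟩ := hQ
      refine ⟨fun x => ψ x + ψ' x, h1.add h1',
        ⟨b + b', fun x => (norm_add_le _ _).trans (add_le_add (h2 x) (h2' x))⟩, fun μ => ?_⟩
      rw [integral_cyclicKernel_smul hM μ (f := fun x => ψ x + ψ' x) (h1.add h1'),
        integral_add, ← integral_cyclicKernel_smul hM μ h1,
        ← integral_cyclicKernel_smul hM μ h1', h3, h3', ContinuousMap.add_apply]
      · exact Integrable.of_bound (h1.comp (measurable_wrap M)).aestronglyMeasurable b
          (Eventually.of_forall fun x => h2 _)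
      · exact Integrable.of_bound (h1'.comp (measurable_wrap M)).aestronglyMeasurable b'
          (Eventually.of_forall fun x => h2' _)
    | smul a P _ hP =>
      obtain ⟨ψ, h1, ⟨b, h2⟩, h3⟩ := hP
      refine ⟨fun x => a * ψ x, h1.const_mul a, ⟨‖a‖ * b, fun x => ?_⟩, fun μ => ?_⟩
      · rw [norm_mul]; exact mul_le_mul_of_nonneg_left (h2 x) (norm_nonneg _)
      · have h4 : ∀ x : ℝ, cyclicKernel M μ x • (a * ψ x) = a * (cyclicKernel M μ x • ψ x) :=
          fun x => (mul_smul_comm _ _ _).symm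
        simp_rw [h4]
        rw [integral_const_mul, h3]; rfl
  obtain ⟨ψ, h1, h2, h3⟩ := key
  refine ⟨ψ, h1, h2, fun μ => ?_⟩
  rw [h3, ← dist_eq_norm, dist_comm]
  exact (ContinuousMap.dist_apply_le_dist _).trans_lt hd

lemma exists_smooth_near (hM : 0 < M) {f : ℝ → ℝ} (hf : Continuous f) (hper : f (-M) = f M)
    {ε : ℝ} (hε : 0 < ε) :
    ∃ ψ : ℝ → ℝ, Measurable ψ ∧ (∃ b, ∀ x, |ψ x| ≤ b) ∧
      ∀ μ ∈ domain M, |smooth M ψ μ - f μ| < ε := by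
  have : Fact (0 < 2 * M) := ⟨by linarith⟩
  have e : -M + 2 * M = M := by ring
  set fc : ℝ → ℂ := fun x => (f x : ℂ) with hfc
  let F : C(AddCircle (2 * M), ℂ) := ⟨AddCircle.liftIco (2 * M) (-M) fc,
    AddCircle.liftIco_continuous (by rw [e]; simp [hfc, hper])
      (Complex.continuous_ofReal.comp hf).continuousOn⟩
  have hF : ∀ μ ∈ domain M, F (μ : AddCircle (2 * M)) = f μ := by
    intro μ hμ
    rcases eq_or_lt_of_le hμ.2 with h | h
    · have h1 : ((M : ℝ) : AddCircle (2 * M)) = ((-M : ℝ) : AddCircle (2 * M)) := by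
        have h2 := AddCircle.coe_add_period (2 * M) (-M)
        rwa [e] at h2
      rw [h, h1]
      change AddCircle.liftIco (2 * M) (-M) fc ((-M : ℝ) : AddCircle (2 * M)) = f M
      rw [AddCircle.liftIco_coe_apply ⟨le_rfl, by linarith⟩, ← hper]
    · exact AddCircle.liftIco_coe_apply (f := fc) ⟨hμ.1, by rw [e]; exact h⟩
  obtain ⟨ψ, h1, ⟨b, h2⟩, h3⟩ := exists_smooth_near_complex hM F hε
  have h1' : Measurable fun x => (ψ x).re := Complex.measurable_re.comp h1
  refine ⟨fun x => (ψ x).re, h1', ⟨b, fun x => (Complex.abs_re_le_norm _).trans (h2 x)⟩,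
    fun μ hμ => ?_⟩
  have h4 := (Complex.abs_re_le_norm _).trans_lt (h3 μ)
  rw [hF μ hμ, Complex.sub_re, Complex.ofReal_re, integral_cyclicKernel_smul hM μ h1] at h4
  rw [smooth, integral_cyclicKernel_mul hM μ h1']
  have hi : Integrable (fun x => ψ (wrap M x)) (gaussianReal μ 1) :=
    Integrable.of_bound (h1.comp (measurable_wrap M)).aestronglyMeasurable b
      (Eventually.of_forall fun x => h2 _)
  have h5 := integral_re hi
  simp only [RCLike.re_eq_complex_re] at h5
  rwa [h5]

end Deconvolution

/-! ### Separation of the model away from the carrier -/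

section Separation

open Matrix

variable {p : ℕ}

/-- A positive definite quadratic form is bounded below by a multiple of the squared norm. -/
lemma exists_quadratic_lower_bound (A : Matrix (Fin p) (Fin p) ℝ)
    (h : ∀ v : Fin p → ℝ, v ≠ 0 → 0 < v ⬝ᵥ A *ᵥ v) :
    ∃ l : ℝ, 0 < l ∧ ∀ v : Fin p → ℝ, l * ‖v‖ ^ 2 ≤ v ⬝ᵥ A *ᵥ v := by
  have hc : Continuous fun v : Fin p → ℝ => v ⬝ᵥ A *ᵥ v := by
    simp only [dotProduct, mulVec]; fun_prop
  have key : ∃ l : ℝ, 0 < l ∧ ∀ u : Fin p → ℝ, ‖u‖ = 1 → l ≤ u ⬝ᵥ A *ᵥ u := by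
    rcases (Metric.sphere (0 : Fin p → ℝ) 1).eq_empty_or_nonempty with he | hne
    · refine ⟨1, one_pos, fun u hu => ?_⟩
      have : u ∈ Metric.sphere (0 : Fin p → ℝ) 1 := by simpa using hu
      simp [he] at this
    · obtain ⟨u₀, hu₀, hmin⟩ := (isCompact_sphere _ _).exists_isMinOn hne hc.continuousOn
      refine ⟨u₀ ⬝ᵥ A *ᵥ u₀, h u₀ ?_, fun u hu => hmin (by simpa using hu)⟩
      rintro rfl
      simp at hu₀
  obtain ⟨l, hl, hu⟩ := key
  refine ⟨l, hl, fun v => ?_⟩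
  rcases eq_or_ne v 0 with rfl | hv
  · simp
  · have hn : 0 < ‖v‖ := norm_pos_iff.2 hv
    have h1 := hu (‖v‖⁻¹ • v) (by rw [norm_smul, norm_inv, norm_norm, inv_mul_cancel₀ hn.ne'])
    rw [mulVec_smul, smul_dotProduct, dotProduct_smul, smul_eq_mul, smul_eq_mul] at h1
    have h2 := mul_le_mul_of_nonneg_right h1 (sq_nonneg ‖v‖)
    calc l * ‖v‖ ^ 2 ≤ _ := h2
      _ = _ := by field_simp

variable {ν : Measure ℝ} [IsProbabilityMeasure ν] {φ : Fin p → ℝ → ℝ} {B : ℝ}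

/-- Jensen's inequality for concave powers of an exponential moment. -/
lemma log_integral_exp_mul_le {Y : ℝ → ℝ} {b s : ℝ} (hY : AEMeasurable Y ν)
    (hb : ∀ᵐ μ ∂ν, |Y μ| ≤ b) (hs0 : 0 ≤ s) (hs1 : s ≤ 1) :
    Real.log (∫ μ, Real.exp (s * Y μ) ∂ν) ≤ s * Real.log (∫ μ, Real.exp (Y μ) ∂ν) := by
  have hYe := integrable_exp_of_abs_le hY hb
  have hb' : ∀ᵐ μ ∂ν, |s * Y μ| ≤ s * b := by
    filter_upwards [hb] with μ h
    rw [abs_mul, abs_of_nonneg hs0]; gcongr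
  have hsYe := integrable_exp_of_abs_le (hY.const_mul s) hb'
  have h1 : ∀ μ, Real.exp (s * Y μ) = Real.exp (Y μ) ^ s := fun μ => by
    rw [← Real.exp_mul, mul_comm]
  have h2 : ∫ μ, Real.exp (s * Y μ) ∂ν ≤ (∫ μ, Real.exp (Y μ) ∂ν) ^ s := by
    simp_rw [h1] at hsYe ⊢
    exact (Real.concaveOn_rpow hs0 hs1).le_map_integral
      (Real.continuous_rpow_const hs0).continuousOn isClosed_Ici
      (Eventually.of_forall fun μ => (Real.exp_pos _).le) hYe hsYe
  rw [← Real.log_rpow (integral_exp_pos hYe)]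
  exact Real.log_le_log (integral_exp_pos hsYe) h2

/-- In an exponential family with linearly independent features, the mean parameters stay away
from those of the origin when the natural parameter does. -/
lemma exists_mean_separation (hφ : ∀ j, AEMeasurable (φ j) ν) (hB0 : 0 ≤ B)
    (hB : ∀ j, ∀ᵐ μ ∂ν, |φ j μ| ≤ B) (hvar : ∀ v : Fin p → ℝ, v ≠ 0 → 0 < Var[lin φ v; ν])
    {δ : ℝ} (hδ : 0 < δ) :
    ∃ c : ℝ, 0 < c ∧ ∀ η : Fin p → ℝ, δ ≤ ‖η‖ →
      ∃ j, c ≤ |∫ μ, φ j μ ∂(ν.tilted (lin φ η)) - ∫ μ, φ j μ ∂ν| := by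
  obtain ⟨l, hl, hlv⟩ := exists_quadratic_lower_bound
    (Matrix.of fun j k => cov[φ j, φ k; ν]) (fun v hv => by
      rw [← variance_lin hφ hB]; exact hvar v hv)
  set K : ℝ := p * B with hK
  have hK0 : 0 ≤ K := by positivity
  -- it suffices to move the threshold to a small value `d`, where the Taylor expansion applies
  obtain ⟨d, hd, hdδ, hdK, hdl⟩ : ∃ d : ℝ, 0 < d ∧ d ≤ δ ∧ K * d ≤ 1 / 2 ∧
      7 * K ^ 3 * d ≤ l / 4 := by
    refine ⟨min δ (min (1 / (2 * (K + 1))) (l / (4 * (7 * K ^ 3 + 1)))), by positivity,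
      min_le_left _ _, ?_, ?_⟩
    · calc _ ≤ (K + 1) * (1 / (2 * (K + 1))) := by
            gcongr
            · linarith
            · exact (min_le_right _ _).trans (min_le_left _ _)
        _ = _ := by field_simp
    · calc _ ≤ (7 * K ^ 3 + 1) * (l / (4 * (7 * K ^ 3 + 1))) := by
            gcongr
            · linarith
            · exact (min_le_right _ _).trans (min_le_right _ _)
        _ = _ := by field_simp
  refine ⟨d * l / (4 * (p + 1)), by positivity, fun η hη => ?_⟩
  by_contra! hcon
  have ht : 0 < ‖η‖ := hδ.trans_le hη
  set t := ‖η‖ with htdef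
  set Q := lin φ η with hQ
  have hQm : AEMeasurable Q ν := aemeasurable_lin hφ η
  have hQb : ∀ᵐ μ ∂ν, |Q μ| ≤ K * t := ae_abs_lin_le hB η
  have hQe := integrable_exp_of_abs_le hQm hQb
  have hac : ν.tilted Q ≪ ν := tilted_absolutelyContinuous _ _
  have : IsProbabilityMeasure (ν.tilted Q) := isProbabilityMeasure_tilted hQe
  set m := ∫ μ, Q μ ∂ν with hm
  -- Gibbs' inequality for the tilted law
  have h1 : Real.log (∫ μ, Real.exp (Q μ) ∂ν) ≤ ∫ μ, Q μ ∂(ν.tilted Q) := by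
    have h2 := (kl_le_of_abs_le hQm hQb (T := fun μ => -Q μ) hQm.neg
      (hQb.mono fun μ h => by rwa [abs_neg])).1
    rw [integral_neg, integral_exp_tilted Q (fun μ => -Q μ)] at h2
    have h3 : (∫ μ, Real.exp ((Q + fun μ => -Q μ) μ) ∂ν) = 1 := by simp
    rw [h3, one_div, Real.log_inv] at h2
    linarith
  -- expansion at the small parameter `(d / t) η`
  set s := d / t with hs
  have hs0 : 0 < s := by positivity
  have hs1 : s ≤ 1 := (div_le_one ht).2 (hdδ.trans hη)
  have hst : s * t = d := by rw [hs]; field_simp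
  have h4 := log_integral_exp_mul_le hQm hQb hs0.le hs1
  have hsη : ‖s • η‖ = d := by rw [norm_smul, Real.norm_of_nonneg hs0.le, ← htdef, hst]
  have h5 := abs_log_integral_exp_sub_le (aemeasurable_lin hφ (s • η))
    (ae_abs_lin_le hB (s • η)) (by rw [hsη]; exact hdK)
  have hlin : ∀ μ, lin φ (s • η) μ = s * Q μ := fun μ => by
    simp [hQ, lin, Finset.mul_sum, mul_assoc]
  have h6 := hlv (s • η)
  rw [← variance_lin hφ hB, hsη] at h6
  rw [hsη] at h5
  simp_rw [hlin] at h5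
  rw [integral_const_mul, ← hm] at h5
  have h7 : d ^ 2 * l / 4 ≤ s * (∫ μ, Q μ ∂(ν.tilted Q) - m) := by
    have h8 := (abs_le.1 h5).1
    have h9 : 7 * (K * d) ^ 3 ≤ d ^ 2 * (l / 4) := by
      have : 7 * (K * d) ^ 3 = d ^ 2 * (7 * K ^ 3 * d) := by ring
      rw [this]; gcongr
    have h10 := mul_le_mul_of_nonneg_left h1 hs0.le
    have h11 : (p : ℝ) * B * d = K * d := rfl
    rw [h11] at h8
    nlinarith
  have h12 : ∫ μ, Q μ ∂(ν.tilted Q) - m ≤ t * (p * (d * l / (4 * (p + 1)))) := by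
    rw [hm, hQ, integral_lin hφ hB,
      integral_lin (fun j => (hφ j).mono_ac hac) (fun j => hac.ae_le (hB j)),
      ← Finset.sum_sub_distrib]
    calc _ ≤ ∑ j : Fin p, t * (d * l / (4 * (p + 1))) := by
          refine Finset.sum_le_sum fun j _ => ?_
          rw [← mul_sub]
          refine (le_abs_self _).trans ?_
          rw [abs_mul]
          exact mul_le_mul (norm_le_pi_norm η j) (hcon j).le (abs_nonneg _) ht.le
      _ = _ := by simp; ring
  have h13 : s * (∫ μ, Q μ ∂(ν.tilted Q) - m) ≤ s * (t * (p * (d * l / (4 * (p + 1))))) := by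
    gcongr
  rw [← mul_assoc, hst] at h13
  have h14 : d * (p * (d * l / (4 * (p + 1)))) < d ^ 2 * l / 4 := by
    have : d * (p * (d * l / (4 * (p + 1)))) = d ^ 2 * l / 4 * (p / (p + 1)) := by field_simp
    rw [this]
    have h15 : (p : ℝ) / (p + 1) < 1 := by rw [div_lt_one (by positivity)]; linarith
    have h16 : 0 < d ^ 2 * l / 4 := by positivity
    nlinarith
  linarith

variable {G : Measure ℝ} [IsProbabilityMeasure G] {M : ℝ}

/-- The parameters away from the origin are separated from the carrier by test functions that
vanish at the endpoints of the domain, hence extend continuously to the circle. -/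
lemma exists_test_separation (hφ : ∀ j, AEMeasurable (φ j) G) (hB0 : 0 ≤ B)
    (hB : ∀ j, ∀ᵐ μ ∂G, |φ j μ| ≤ B) {χ : ℝ → ℝ} {b : ℝ} (hχ : Measurable χ)
    (hχ0 : ∀ᵐ μ ∂G, 0 < χ μ) (hχb : ∀ᵐ μ ∂G, χ μ ≤ b)
    (hsep : ∀ v : Fin p → ℝ, v ≠ 0 → ∀ c : ℝ, ¬ lin φ v =ᵐ[G] fun _ => c)
    {δ : ℝ} (hδ : 0 < δ) :
    ∃ c : ℝ, 0 < c ∧ ∀ η : Fin p → ℝ, δ ≤ ‖η‖ →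
      c ≤ |∫ μ, χ μ ∂(G.tilted (lin φ η)) - ∫ μ, χ μ ∂G| ∨
      ∃ j, c ≤ |∫ μ, χ μ * φ j μ ∂(G.tilted (lin φ η)) - ∫ μ, χ μ * φ j μ ∂G| := by
  have hχb' : ∀ᵐ μ ∂G, |χ μ| ≤ b := by
    filter_upwards [hχ0, hχb] with μ h1 h2
    rwa [abs_of_pos h1]
  have hχi : Integrable χ G := integrable_of_abs_le hχ.aemeasurable hχb'
  have hee : (fun μ => Real.exp (Real.log (χ μ))) =ᵐ[G] χ := by
    filter_upwards [hχ0] with μ h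
    rw [Real.exp_log h]
  have hei : Integrable (fun μ => Real.exp (Real.log (χ μ))) G := (integrable_congr hee).2 hχi
  -- In the exponential family with carrier proportional to `χ · G`, the mean parameters separate.
  set ν := G.tilted fun μ => Real.log (χ μ) with hν
  have : IsProbabilityMeasure ν := isProbabilityMeasure_tilted hei
  have hac : ν ≪ G := tilted_absolutelyContinuous _ _
  have hac' : G ≪ ν := absolutelyContinuous_tilted hei
  have hφν : ∀ j, AEMeasurable (φ j) ν := fun j => (hφ j).mono_ac hac
  have hBν : ∀ j, ∀ᵐ μ ∂ν, |φ j μ| ≤ B := fun j => hac.ae_le (hB j)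
  obtain ⟨c, hc, hcη⟩ := exists_mean_separation hφν hB0 hBν (fun v hv => by
    refine (variance_nonneg _ _).lt_of_ne fun h0 => ?_
    have hL := memLp_of_abs_le ((aemeasurable_lin hφν v).sub_const (∫ μ, lin φ v μ ∂ν))
      ((ae_abs_lin_le hBν v).mono fun μ h => (abs_sub _ _).trans (add_le_add_left h _))
    rw [variance_eq_integral (aemeasurable_lin hφν v), eq_comm,
      integral_eq_zero_iff_of_nonneg (fun μ => sq_nonneg _) hL.integrable_sq] at h0
    refine hsep v hv (∫ μ, lin φ v μ ∂ν) (hac'.ae_eq ?_)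
    filter_upwards [h0] with μ h
    exact sub_eq_zero.1 (pow_eq_zero_iff two_ne_zero |>.1 h)) hδ
  set W := ∫ μ, χ μ ∂G with hW
  have hWe : ∫ μ, Real.exp (Real.log (χ μ)) ∂G = W := integral_congr_ae hee
  have hW0 : 0 < W := by rw [← hWe]; exact integral_exp_pos hei
  -- means under the weighted law are ratios of means of test functions
  have hmean : ∀ η j, ∫ μ, φ j μ ∂(ν.tilted (lin φ η)) =
      (∫ μ, χ μ * φ j μ ∂(G.tilted (lin φ η))) / ∫ μ, χ μ ∂(G.tilted (lin φ η)) := by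
    intro η j
    rw [hν, tilted_tilted hei, add_comm,
      ← tilted_tilted (integrable_exp_of_abs_le (aemeasurable_lin hφ η) (ae_abs_lin_le hB η)),
      integral_tilted]
    have hacη : G.tilted (lin φ η) ≪ G := tilted_absolutelyContinuous _ _
    rw [integral_congr_ae (hacη.ae_eq hee), ← integral_div]
    refine integral_congr_ae ?_
    filter_upwards [hacη.ae_eq hee] with μ hμ
    rw [hμ, smul_eq_mul]; ring
  have hmean0 : ∀ j, ∫ μ, φ j μ ∂ν = (∫ μ, χ μ * φ j μ ∂G) / W := by
    intro j
    rw [hν, integral_tilted, hWe, ← integral_div]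
    refine integral_congr_ae ?_
    filter_upwards [hee] with μ hμ
    rw [hμ, smul_eq_mul]; ring
  refine ⟨min (W / 2) (W * c / (4 * (1 + B))), by positivity, fun η hη => ?_⟩
  by_contra! hcon
  obtain ⟨h1, h2⟩ := hcon
  obtain ⟨j, hj⟩ := hcη η hη
  have h2j := h2 j
  rw [hmean, hmean0] at hj
  set a' := ∫ μ, χ μ * φ j μ ∂(G.tilted (lin φ η))
  set b' := ∫ μ, χ μ ∂(G.tilted (lin φ η))
  set a := ∫ μ, χ μ * φ j μ ∂G with ha
  have haB : |a| ≤ B * W := by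
    rw [ha, hW, ← integral_const_mul]
    refine (abs_integral_le_integral_abs).trans ?_
    refine integral_mono_ae ?_ (hχi.const_mul _) ?_
    · refine Integrable.abs (integrable_of_abs_le (b := b * B) (hχ.aemeasurable.mul (hφ j)) ?_)
      filter_upwards [hχb', hB j] with μ h3 h4
      rw [abs_mul]; exact mul_le_mul h3 h4 (abs_nonneg _) ((abs_nonneg _).trans h3)
    · filter_upwards [hχ0, hB j] with μ h3 h4
      rw [abs_mul, abs_of_pos h3, mul_comm]
      exact mul_le_mul_of_nonneg_right h4 h3.le
  have hb' : W / 2 < b' := by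
    have := (abs_lt.1 (h1.trans_le (min_le_left _ _))).1
    linarith
  have hb0 : 0 < b' := by linarith
  have e : a' / b' - a / W = ((a' - a) - (a / W) * (b' - W)) / b' := by field_simp; ring
  set e₀ := W * c / (4 * (1 + B)) with he₀
  have he₀0 : 0 < e₀ := by positivity
  have h5 : |(a' - a) - (a / W) * (b' - W)| < e₀ * (1 + B) := by
    have h6 : |a / W| ≤ B := by rw [abs_div, abs_of_pos hW0, div_le_iff₀ hW0]; exact haB
    calc _ ≤ |a' - a| + |a / W| * |b' - W| := by rw [← abs_mul]; exact abs_sub _ _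
      _ ≤ |a' - a| + B * e₀ := by
          gcongr
          exact (h1.trans_le (min_le_right _ _)).le
      _ < e₀ + B * e₀ := by
          have := h2j.trans_le (min_le_right _ _)
          linarith
      _ = _ := by ring
  rw [e, abs_div, abs_of_pos hb0, le_div_iff₀ hb0] at hj
  have h7 : e₀ * (1 + B) = W * c / 4 := by rw [he₀]; field_simp
  nlinarith

end Separation

/-! ### Consistency: uniform control of the likelihood far from the carrier -/

section Consistency

variable {M : ℝ} {G G' : Measure ℝ} [IsProbabilityMeasure G] [IsProbabilityMeasure G']

/-- The smoothed test functions see the `L¹` distance of the observation densities. -/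
lemma abs_integral_sub_le_of_smooth_near (hM : 0 < M) (hG : ∀ᵐ μ ∂G, μ ∈ domain M)
    (hG' : ∀ᵐ μ ∂G', μ ∈ domain M) {f ψ : ℝ → ℝ} (hf : Continuous f) (hψ : Measurable ψ) {b ε : ℝ}
    (hb : ∀ x, |ψ x| ≤ b) (h : ∀ μ ∈ domain M, |smooth M ψ μ - f μ| < ε) :
    |∫ μ, f μ ∂G' - ∫ μ, f μ ∂G| ≤
      2 * ε + b * ∫ x in domain M, |obsDensity M G' x - obsDensity M G x| := by
  obtain ⟨F, hF⟩ := (isCompact_Icc (a := -M) (b := M)).exists_bound_of_continuousOn hf.continuousOn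
  have := isFiniteMeasure_domain M
  have key : ∀ (Q : Measure ℝ) [IsProbabilityMeasure Q], (∀ᵐ μ ∂Q, μ ∈ domain M) →
      |∫ μ, smooth M ψ μ ∂Q - ∫ μ, f μ ∂Q| ≤ ε := by
    intro Q _ hQ
    have h1 : Integrable (smooth M ψ) Q := integrable_of_abs_le
      (measurable_smooth hM hψ).aemeasurable (Eventually.of_forall (abs_smooth_le hM hψ hb))
    have h2 : Integrable f Q := integrable_of_abs_le hf.aemeasurable (hQ.mono fun μ hμ => hF μ hμ)
    rw [← integral_sub h1 h2]
    exact abs_integral_le_of_abs_le (hQ.mono fun μ hμ => (h μ hμ).le)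
  have h1 := abs_le.1 (key G hG)
  have h2 := abs_le.1 (key G' hG')
  have hc : Continuous fun x => obsDensity M G' x - obsDensity M G x :=
    (continuous_obsDensity hM).sub (continuous_obsDensity hM)
  have hci : ∀ (Q : Measure ℝ) [IsProbabilityMeasure Q],
      Integrable (fun x => obsDensity M Q x * ψ x) (volume.restrict (domain M)) := by
    intro Q _
    refine Integrable.mul_bdd (c := b) ?_ hψ.aestronglyMeasurable (Eventually.of_forall hb)
    exact (continuous_obsDensity hM).continuousOn.integrableOn_compact isCompact_Icc
  have h3 : |∫ μ, smooth M ψ μ ∂G' - ∫ μ, smooth M ψ μ ∂G| ≤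
      b * ∫ x in domain M, |obsDensity M G' x - obsDensity M G x| := by
    rw [← integral_obsLaw_eq_smooth hM hψ hb, ← integral_obsLaw_eq_smooth hM hψ hb,
      integral_obsLaw hM, integral_obsLaw hM, ← integral_sub (hci G') (hci G),
      ← integral_const_mul]
    refine abs_integral_le_integral_abs.trans ?_
    refine integral_mono_of_nonneg (Eventually.of_forall fun x => abs_nonneg _) ?_
      (Eventually.of_forall fun x => ?_)
    · exact (hc.abs.const_mul b).continuousOn.integrableOn_compact isCompact_Icc
    · simp only
      rw [← sub_mul, abs_mul, mul_comm]
      exact mul_le_mul_of_nonneg_right (hb x) (abs_nonneg _)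
  have h4 := abs_le.1 h3
  rw [abs_le]
  constructor <;> linarith [h1.1, h1.2, h2.1, h2.2, h4.1, h4.2]

/-- A pointwise form of the lower bound of the relative entropy by the Hellinger distance: apply
`log t ≤ t - 1` to `√(a / b)`. -/
lemma mul_log_div_le {a b k : ℝ} (ha : 0 < a) (hb : 0 < b) (hak : a ≤ k) (hbk : b ≤ k) :
    b * (Real.log a - Real.log b) ≤ a - b - (a - b) ^ 2 / (4 * k) := by
  obtain ⟨u, hu, rfl⟩ : ∃ u : ℝ, 0 < u ∧ a = u ^ 2 :=
    ⟨√a, Real.sqrt_pos.2 ha, (Real.sq_sqrt ha.le).symm⟩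
  obtain ⟨v, hv, rfl⟩ : ∃ v : ℝ, 0 < v ∧ b = v ^ 2 :=
    ⟨√b, Real.sqrt_pos.2 hb, (Real.sq_sqrt hb.le).symm⟩
  have h1 : Real.log (u ^ 2) - Real.log (v ^ 2) = 2 * Real.log (u / v) := by
    rw [Real.log_div hu.ne' hv.ne', Real.log_pow, Real.log_pow]; push_cast; ring
  have h2 : Real.log (u / v) ≤ u / v - 1 := Real.log_le_sub_one_of_pos (by positivity)
  have h3 : v ^ 2 * (2 * (u / v - 1)) = u ^ 2 - v ^ 2 - (u - v) ^ 2 := by field_simp; ring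
  have h4 : (u ^ 2 - v ^ 2) ^ 2 / (4 * k) ≤ (u - v) ^ 2 := by
    have hk : 0 < k := ha.trans_le hak
    rw [div_le_iff₀ (by linarith)]
    have h5 : (u + v) ^ 2 ≤ 4 * k := by nlinarith [sq_nonneg (u - v)]
    calc (u ^ 2 - v ^ 2) ^ 2 = (u - v) ^ 2 * (u + v) ^ 2 := by ring
      _ ≤ _ := mul_le_mul_of_nonneg_left h5 (sq_nonneg _)
  rw [h1]
  have h5 := mul_le_mul_of_nonneg_left (mul_le_mul_of_nonneg_left h2 zero_le_two) (sq_nonneg v)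
  linarith

lemma integral_obsDensity (hM : 0 < M) : ∫ x in domain M, obsDensity M G x = 1 := by
  have := isProbabilityMeasure_obsLaw (G := G) hM
  have h := integral_obsLaw (G := G) hM (fun _ => 1)
  simpa using h.symm

/-- Expected log-likelihood ratios are negative, quantitatively in the `L¹` distance. -/
lemma integral_log_sub_log_le (hM : 0 < M) {k₁ : ℝ} (hk₁ : 0 < k₁)
    (hk : ∀ μ x, 0 ≤ cyclicKernel M μ x ∧ cyclicKernel M μ x ≤ k₁) {c : ℝ} (hc : 0 < c)
    (h : c ≤ ∫ x in domain M, |obsDensity M G' x - obsDensity M G x|) :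
    ∫ x, (Real.log (obsDensity M G' x) - Real.log (obsDensity M G x)) ∂(obsLaw M G) ≤
      -(c ^ 2 / (8 * M * k₁)) := by
  have := isFiniteMeasure_domain M
  have hp := fun x => obsDensity_pos (G := G) hM x
  have hp' := fun x => obsDensity_pos (G := G') hM x
  have c1 := continuous_obsDensity (G := G) hM
  have c2 := continuous_obsDensity (G := G') hM
  have hio : ∀ f : ℝ → ℝ, Continuous f → Integrable f (volume.restrict (domain M)) :=
    fun f hf => hf.continuousOn.integrableOn_compact isCompact_Icc
  set θ := c / (2 * M) with hθ
  have hθ0 : 0 < θ := by positivity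
  rw [integral_obsLaw hM]
  -- The linear minorant `2θ|y| - θ²` of `y²`, with `θ` the lower bound `c / (2M)` of the mean of
  -- `|y|`, replaces the Cauchy–Schwarz inequality.
  have h1 : ∀ x, obsDensity M G x * (Real.log (obsDensity M G' x) - Real.log (obsDensity M G x)) ≤
      obsDensity M G' x - obsDensity M G x -
        (2 * θ * |obsDensity M G' x - obsDensity M G x| - θ ^ 2) * (1 / (4 * k₁)) := by
    intro x
    have h2 := mul_log_div_le (hp' x) (hp x) (obsDensity_bounds hM hk x).2
      (obsDensity_bounds hM hk x).2
    refine h2.trans ?_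
    have h3 : 2 * θ * |obsDensity M G' x - obsDensity M G x| - θ ^ 2 ≤
        (obsDensity M G' x - obsDensity M G x) ^ 2 := by
      rw [← sq_abs (obsDensity M G' x - obsDensity M G x)]
      nlinarith [sq_nonneg (|obsDensity M G' x - obsDensity M G x| - θ)]
    have h4 := mul_le_mul_of_nonneg_right h3 (by positivity : 0 ≤ 1 / (4 * k₁))
    rw [div_eq_mul_one_div]
    linarith
  have c3 : Continuous fun x => obsDensity M G x *
      (Real.log (obsDensity M G' x) - Real.log (obsDensity M G x)) :=
    c1.mul ((c2.log fun x => (hp' x).ne').sub (c1.log fun x => (hp x).ne'))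
  have c4 : Continuous fun x => obsDensity M G' x - obsDensity M G x := c2.sub c1
  have c5 : Continuous fun x => 2 * θ * |obsDensity M G' x - obsDensity M G x| :=
    c4.abs.const_mul _
  have c6 : Continuous fun x => (2 * θ * |obsDensity M G' x - obsDensity M G x| - θ ^ 2) *
      (1 / (4 * k₁)) := (c5.sub continuous_const).mul_const _
  have c7 : Continuous fun x => obsDensity M G' x - obsDensity M G x -
      (2 * θ * |obsDensity M G' x - obsDensity M G x| - θ ^ 2) * (1 / (4 * k₁)) := c4.sub c6
  have h5 := integral_mono (hio _ c3) (hio _ c7) h1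
  refine h5.trans ?_
  rw [integral_sub (hio _ c4) (hio _ c6), integral_sub (hio _ c2) (hio _ c1),
    integral_obsDensity hM, integral_obsDensity hM, integral_mul_const,
    integral_sub (hio _ c5) (integrable_const _), integral_const_mul]
  have hvol : ∫ _x in domain M, θ ^ 2 = 2 * M * θ ^ 2 := by
    rw [integral_const]
    simp [domain, Measure.real, ENNReal.toReal_ofReal (by linarith : 0 ≤ M + M)]
    left; ring
  rw [hvol]
  have h6 : c ^ 2 / (2 * M) ≤
      2 * θ * (∫ x in domain M, |obsDensity M G' x - obsDensity M G x|) - 2 * M * θ ^ 2 := by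
    have h7 : 2 * θ * c ≤ 2 * θ * ∫ x in domain M, |obsDensity M G' x - obsDensity M G x| := by
      gcongr
    have h8 : c ^ 2 / (2 * M) = 2 * θ * c - 2 * M * θ ^ 2 := by rw [hθ]; field_simp; ring
    linarith
  have h9 := mul_le_mul_of_nonneg_right h6 (by positivity : 0 ≤ 1 / (4 * k₁))
  have h10 : c ^ 2 / (2 * M) * (1 / (4 * k₁)) = c ^ 2 / (8 * M * k₁) := by field_simp; norm_num
  linarith

/-- The observation densities are equicontinuous, uniformly in the latent law. -/
lemma exists_obsDensity_equicontinuous (hM : 0 < M) {ε : ℝ} (hε : 0 < ε) :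
    ∃ ρ : ℝ, 0 < ρ ∧ ∀ (Q : Measure ℝ) [IsProbabilityMeasure Q], ∀ x ∈ domain M, ∀ y ∈ domain M,
      |x - y| < ρ → |obsDensity M Q x - obsDensity M Q y| ≤ ε := by
  have huc := (isCompact_Icc (a := -(2 * M)) (b := 2 * M)).uniformContinuousOn_of_continuous
    (continuous_wrappedGaussian one_pos hM).continuousOn
  rw [Metric.uniformContinuousOn_iff] at huc
  obtain ⟨ρ, hρ, h⟩ := huc ε hε
  refine ⟨ρ, hρ, fun Q _ x hx y hy hxy => ?_⟩
  rw [obsDensity, obsDensity,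
    ← integral_sub (integrable_cyclicKernel hM x) (integrable_cyclicKernel hM y)]
  refine abs_integral_le_of_abs_le (Eventually.of_forall fun μ => ?_)
  rw [← cyclicKernel_wrap μ x, ← cyclicKernel_wrap μ y, cyclicKernel_eq, cyclicKernel_eq]
  have hw := wrap_mem_domain hM μ
  refine (h _ ?_ _ ?_ ?_).le
  · exact ⟨by linarith [hx.1, hw.2], by linarith [hx.2, hw.1]⟩
  · exact ⟨by linarith [hy.1, hw.2], by linarith [hy.2, hw.1]⟩
  · rw [Real.dist_eq, sub_sub_sub_cancel_right]; exact hxy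

lemma abs_log_sub_log_le {a b k : ℝ} (hk : 0 < k) (ha : k ≤ a) (hb : k ≤ b) :
    |Real.log a - Real.log b| ≤ |a - b| / k := by
  have ha0 := hk.trans_le ha
  have hb0 := hk.trans_le hb
  have key : ∀ x y : ℝ, k ≤ x → k ≤ y → Real.log x - Real.log y ≤ |x - y| / k := by
    intro x y hx hy
    have hx0 := hk.trans_le hx
    have hy0 := hk.trans_le hy
    rw [← Real.log_div hx0.ne' hy0.ne']
    have h1 := Real.log_le_sub_one_of_pos (by positivity : 0 < x / y)
    have h2 : x / y - 1 = (x - y) / y := by field_simp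
    calc _ ≤ (x - y) / y := by rw [← h2]; exact h1
      _ ≤ |x - y| / y := by gcongr; exact le_abs_self _
      _ ≤ _ := by gcongr
  rw [abs_le]
  constructor
  · have := key b a hb ha
    rw [abs_sub_comm] at this
    linarith
  · exact key a b ha hb

/-- Cell decomposition of the domain: averages of slowly varying functions are controlled by
cell frequencies. -/
lemma exists_cells (hM : 0 < M) {ρ : ℝ} (hρ : 0 < ρ) :
    ∃ (N : ℕ) (t : Fin N → ℝ) (S : Fin N → Set ℝ), (∀ k, MeasurableSet (S k)) ∧
      (∀ k, t k ∈ domain M) ∧ (∀ x ∈ domain M, ∃! k, x ∈ S k) ∧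
      ∀ k, ∀ x ∈ S k, |x - t k| < ρ := by
  obtain ⟨m, hm⟩ := exists_nat_gt (2 * M / ρ)
  have hm0 : (0 : ℝ) < m := lt_of_le_of_lt (by positivity) hm
  have hmM : 2 * M / m < ρ := by
    rw [div_lt_iff₀ hρ] at hm
    rw [div_lt_iff₀ hm0]; linarith
  refine ⟨m + 1, fun k => -M + k * (2 * M / m),
    fun k => Set.Ico (-M + k * (2 * M / m)) (-M + (k + 1) * (2 * M / m)),
    fun k => measurableSet_Ico, fun k => ?_, fun x hx => ?_, fun k x hx => ?_⟩
  · have h1 : (k : ℝ) ≤ m := by exact_mod_cast Nat.lt_succ_iff.1 k.2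
    have h2 : (k : ℝ) * (2 * M / m) ≤ m * (2 * M / m) := by gcongr
    have h3 : (m : ℝ) * (2 * M / m) = 2 * M := by field_simp
    exact ⟨by have : 0 ≤ (k : ℝ) * (2 * M / m) := by positivity
              linarith, by linarith⟩
  · have hd : 0 < 2 * M / m := by positivity
    set q := (x + M) / (2 * M / m) with hq
    have hq0 : 0 ≤ q := div_nonneg (by linarith [hx.1]) hd.le
    have hqm : q ≤ m := by
      rw [hq, div_le_iff₀ hd]
      have h3 : (m : ℝ) * (2 * M / m) = 2 * M := by field_simp
      linarith [hx.2]
    have hxq : x = -M + q * (2 * M / m) := by rw [hq]; field_simp; ring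
    have hiff : ∀ k : Fin (m + 1), x ∈ Set.Ico (-M + k * (2 * M / m))
        (-M + ((k : ℝ) + 1) * (2 * M / m)) ↔ ⌊q⌋₊ = k := by
      intro k
      rw [Nat.floor_eq_iff hq0, hxq, Set.mem_Ico]
      constructor
      · rintro ⟨h1, h2⟩
        exact ⟨le_of_mul_le_mul_right (by linarith) hd, lt_of_mul_lt_mul_right (by linarith) hd.le⟩
      · rintro ⟨h1, h2⟩
        have h3 := mul_le_mul_of_nonneg_right h1 hd.le
        have h4 := mul_lt_mul_of_pos_right h2 hd
        constructor <;> linarith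
    refine ⟨⟨⌊q⌋₊, Nat.lt_succ_of_le (Nat.floor_le_of_le hqm)⟩, (hiff _).2 rfl, fun k hk => ?_⟩
    exact Fin.ext ((hiff k).1 hk).symm
  · rw [abs_of_nonneg (by linarith [hx.1])]
    have := hx.2
    have h1 : -M + ((k : ℝ) + 1) * (2 * M / m) - (-M + k * (2 * M / m)) = 2 * M / m := by ring
    linarith

end Consistency

section CellAverages

variable {M : ℝ} {P : Measure ℝ} [IsProbabilityMeasure P]

/-- An empirical mean is controlled by the population mean and the cell frequencies. -/
lemma avg_le_of_cells {N : ℕ} {t : Fin N → ℝ} {S : Fin N → Set ℝ}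
    (hS : ∀ k, MeasurableSet (S k)) (ht : ∀ k, t k ∈ domain M)
    (hu : ∀ x ∈ domain M, ∃! k, x ∈ S k) {ρ : ℝ} (hρ : ∀ k, ∀ x ∈ S k, |x - t k| < ρ)
    (hP : ∀ᵐ x ∂P, x ∈ domain M) {f : ℝ → ℝ} (hf : Measurable f) {F d ε : ℝ}
    (hF : ∀ x ∈ domain M, |f x| ≤ F)
    (hd : ∀ x ∈ domain M, ∀ y ∈ domain M, |x - y| < ρ → |f x - f y| ≤ d) {n : ℕ} (hn : 0 < n)
    (x : Fin n → ℝ) (hx : ∀ i, x i ∈ domain M)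
    (hε : ∀ k, |avg x ((S k).indicator 1) - ∫ y, (S k).indicator 1 y ∂P| ≤ ε) :
    avg x f ≤ ∫ y, f y ∂P + 2 * d + N * F * ε := by
  set g : ℝ → ℝ := fun y => ∑ k, f (t k) * (S k).indicator 1 y with hg
  have hgx : ∀ y ∈ domain M, |f y - g y| ≤ d := by
    intro y hy
    obtain ⟨k, hk, huk⟩ := hu y hy
    have : g y = f (t k) := by
      simp only [hg]
      rw [Finset.sum_eq_single k]
      · simp [hk]
      · intro l _ hl
        have : y ∉ S l := fun h => hl (huk l h)
        simp [this]
      · simp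
    rw [this]
    exact hd y hy _ (ht k) (hρ k y hk)
  have hn' : (0 : ℝ) < n := by exact_mod_cast hn
  have h1 : avg x f - avg x g ≤ d := by
    rw [← avg_sub, avg, div_le_iff₀ hn']
    calc ∑ i, (f (x i) - g (x i)) ≤ ∑ _i : Fin n, d :=
          Finset.sum_le_sum fun i _ => (le_abs_self _).trans (hgx _ (hx i))
      _ = d * n := by simp [mul_comm]
  have hi : ∀ k, Integrable ((S k).indicator (1 : ℝ → ℝ)) P := fun k =>
    (integrable_const (1 : ℝ)).indicator (hS k)
  have hgi : Integrable g P := integrable_finsetSum _ fun k _ => (hi k).const_mul _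
  have hfi : Integrable f P := integrable_of_abs_le hf.aemeasurable (hP.mono hF)
  have h2 : ∫ y, g y ∂P - ∫ y, f y ∂P ≤ d := by
    rw [← integral_sub hgi hfi]
    refine (le_abs_self _).trans (abs_integral_le_of_abs_le (hP.mono fun y hy => ?_))
    rw [abs_sub_comm]; exact hgx y hy
  have h3 : avg x g - ∫ y, g y ∂P ≤ N * F * ε := by
    simp only [hg]
    rw [avg_sum, integral_finsetSum _ fun k _ => (hi k).const_mul _, ← Finset.sum_sub_distrib]
    calc _ ≤ ∑ _k : Fin N, F * ε := by
          refine Finset.sum_le_sum fun k _ => ?_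
          rw [avg_const_mul, integral_const_mul, ← mul_sub]
          refine (le_abs_self _).trans ?_
          rw [abs_mul]
          exact mul_le_mul (hF _ (ht k)) (hε k) (abs_nonneg _) ((abs_nonneg _).trans (hF _ (ht k)))
      _ = _ := by simp; ring
  linarith

end CellAverages

section Consistency

variable {p : ℕ} {M B : ℝ} {G : Measure ℝ} [IsProbabilityMeasure G] {φ : Fin p → ℝ → ℝ}

lemma isProbabilityMeasure_tilted_lin (hφ : ∀ j, AEMeasurable (φ j) G)
    (hB : ∀ j, ∀ᵐ μ ∂G, |φ j μ| ≤ B) (η : Fin p → ℝ) :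
    IsProbabilityMeasure (G.tilted (lin φ η)) :=
  isProbabilityMeasure_tilted
    (integrable_exp_of_abs_le (aemeasurable_lin hφ η) (ae_abs_lin_le hB η))

/-- The observation densities of parameters away from the origin stay away from that of the
carrier in `L¹`. -/
lemma exists_integral_abs_obsDensity_sub_ge (hM : 0 < M) (hφ : ∀ j, Continuous (φ j))
    (hB0 : 0 ≤ B) (hB : ∀ j, ∀ᵐ μ ∂G, |φ j μ| ≤ B) (hG : ∀ᵐ μ ∂G, μ ∈ Set.Ioo (-M) M)
    (hsep : ∀ v : Fin p → ℝ, v ≠ 0 → ∀ c : ℝ, ¬ lin φ v =ᵐ[G] fun _ => c)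
    {δ : ℝ} (hδ : 0 < δ) :
    ∃ c : ℝ, 0 < c ∧ ∀ η : Fin p → ℝ, δ ≤ ‖η‖ →
      c ≤ ∫ x in domain M, |obsDensity M (G.tilted (lin φ η)) x - obsDensity M G x| := by
  -- The weight `χ` vanishes at `±M`, so the test functions `χ` and `χ φ_j` extend continuously to
  -- the circle, and are uniformly close to smoothings of bounded functions of the observation.
  set χ : ℝ → ℝ := fun μ => M ^ 2 - μ ^ 2 with hχ
  have hχc : Continuous χ := by fun_prop
  have hφm := fun j => (hφ j).aemeasurable (μ := G)
  obtain ⟨c, hc, hsep'⟩ := exists_test_separation (φ := φ) hφm hB0 hB (χ := χ) (b := M ^ 2)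
    hχc.measurable (hG.mono fun μ hμ => by simp only [hχ]; nlinarith [hμ.1, hμ.2])
    (Eventually.of_forall fun μ => by simp only [hχ]; nlinarith [sq_nonneg μ]) hsep hδ
  have hG' : ∀ᵐ μ ∂G, μ ∈ domain M := hG.mono fun μ hμ => Set.Ioo_subset_Icc_self hμ
  have hχ1 : χ (-M) = 0 := by simp [hχ]
  have hχ2 : χ M = 0 := by simp [hχ]
  obtain ⟨ψ, hψm, ⟨b, hb⟩, hψ⟩ := exists_smooth_near hM hχc (by rw [hχ1, hχ2])
    (by positivity : 0 < c / 4)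
  have := fun j => exists_smooth_near hM (hχc.mul (hφ j)) (by simp [hχ1, hχ2])
    (by positivity : 0 < c / 4)
  choose ψ' hψm' hb' hψ' using this
  choose b' hb' using hb'
  have hb0 : 0 ≤ b := (abs_nonneg _).trans (hb 0)
  have hb0' : ∀ j, 0 ≤ b' j := fun j => (abs_nonneg _).trans (hb' j 0)
  set β := b + ∑ j, b' j + 1 with hβ
  have hS : 0 ≤ ∑ j, b' j := Finset.sum_nonneg fun j _ => hb0' j
  have hβ0 : 0 < β := by positivity
  refine ⟨c / (2 * β), by positivity, fun η hη => ?_⟩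
  have := isProbabilityMeasure_tilted_lin hφm hB η
  have hGt : ∀ᵐ μ ∂(G.tilted (lin φ η)), μ ∈ domain M :=
    (tilted_absolutelyContinuous _ _).ae_le hG'
  set I := ∫ x in domain M, |obsDensity M (G.tilted (lin φ η)) x - obsDensity M G x| with hI
  have hI0 : 0 ≤ I := integral_nonneg fun x => abs_nonneg _
  have key : ∀ b₀, b₀ ≤ β → c ≤ 2 * (c / 4) + b₀ * I → c / (2 * β) ≤ I := by
    intro b₀ h1 h2
    rw [div_le_iff₀ (by positivity)]
    have := mul_le_mul_of_nonneg_right h1 hI0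
    linarith
  rcases hsep' η hη with h | ⟨j, h⟩
  · refine key b (by linarith) (h.trans ?_)
    exact abs_integral_sub_le_of_smooth_near hM hG' hGt hχc hψm hb hψ
  · refine key (b' j) ?_ (h.trans ?_)
    · have := Finset.single_le_sum (fun j _ => hb0' j) (Finset.mem_univ j)
      linarith
    · exact abs_integral_sub_le_of_smooth_near hM hG' hGt (hχc.mul (hφ j)) (hψm' j) (hb' j)
        (hψ' j)

/-- Finitely many bounded statistics decide that the log-likelihood ratio is negative at every
parameter away from the origin. -/
theorem exists_consistency_tests (hM : 0 < M) (hφ : ∀ j, Continuous (φ j))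
    (hB0 : 0 ≤ B) (hB : ∀ j, ∀ᵐ μ ∂G, |φ j μ| ≤ B) (hG : ∀ᵐ μ ∂G, μ ∈ Set.Ioo (-M) M)
    (hsep : ∀ v : Fin p → ℝ, v ≠ 0 → ∀ c : ℝ, ¬ lin φ v =ᵐ[G] fun _ => c)
    {δ : ℝ} (hδ : 0 < δ) :
    ∃ (N : ℕ) (ρ : Fin N → ℝ → ℝ) (ε : ℝ), 0 < ε ∧ (∀ k, Measurable (ρ k)) ∧
      (∀ k x, |ρ k x| ≤ 1) ∧ ∀ (n : ℕ), 0 < n → ∀ x : Fin n → ℝ, (∀ i, x i ∈ domain M) →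
      (∀ k, |avg x (ρ k) - ∫ y, ρ k y ∂(obsLaw M G)| ≤ ε) →
      ∀ η : Fin p → ℝ, δ ≤ ‖η‖ → avg x (logRatio M G φ η) < 0 := by
  obtain ⟨k₀, k₁, hk₀, hk⟩ := exists_cyclicKernel_bounds hM
  have hk₁ : 0 < k₁ := hk₀.trans_le ((hk 0 0).1.trans (hk 0 0).2)
  obtain ⟨c, hc, hL⟩ := exists_integral_abs_obsDensity_sub_ge hM hφ hB0 hB hG hsep hδ
  set c' := c ^ 2 / (8 * M * k₁) with hc'
  have hc0 : 0 < c' := by positivity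
  -- Observation densities are equicontinuous, whatever the prior, so the same cells and the same
  -- `ε` serve all parameters `η` at once, although these range over an unbounded set.
  obtain ⟨r, hr, hequi⟩ := exists_obsDensity_equicontinuous hM
    (by positivity : 0 < c' * k₀ / 16)
  obtain ⟨N, t, S, hSm, ht, hu, hSr⟩ := exists_cells hM hr
  set F := k₁ / k₀ with hF
  have hF0 : 0 < F := by positivity
  refine ⟨N, fun k => (S k).indicator 1, c' / (4 * (N * F + 1)), by positivity,
    fun k => measurable_one.indicator (hSm k), fun k x => ?_, fun n hn x hx hε η hη => ?_⟩
  · by_cases h : x ∈ S k <;> simp [h]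
  have := isProbabilityMeasure_tilted_lin (fun j => (hφ j).aemeasurable) hB η
  have := isProbabilityMeasure_obsLaw (G := G) hM
  have hcont : Continuous (logRatio M G φ η) :=
    ((continuous_obsDensity hM).log fun x => (obsDensity_pos hM x).ne').sub
      ((continuous_obsDensity hM).log fun x => (obsDensity_pos hM x).ne')
  have b1 := fun x => obsDensity_bounds (G := G.tilted (lin φ η)) hM hk x
  have b2 := fun x => obsDensity_bounds (G := G) hM hk x
  have hmain := avg_le_of_cells (d := c' / 8) (F := F) hSm ht hu hSr (ae_obsLaw_mem M G)
    hcont.measurable (fun x _ => ?_) (fun x hx y hy hxy => ?_) hn x hx hε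
  · have h1 : ∫ y, logRatio M G φ η y ∂(obsLaw M G) ≤ -c' :=
      integral_log_sub_log_le hM hk₁ (fun μ x => ⟨hk₀.le.trans (hk μ x).1, (hk μ x).2⟩) hc
        (hL η hη)
    have h2 : N * F * (c' / (4 * (N * F + 1))) ≤ c' / 4 := by
      have : N * F * (c' / (4 * (N * F + 1))) = c' / 4 * (N * F / (N * F + 1)) := by field_simp
      rw [this]
      have h3 : (N * F) / (N * F + 1) ≤ 1 := by
        rw [div_le_one (by positivity)]; linarith
      have := mul_le_mul_of_nonneg_left h3 (by positivity : 0 ≤ c' / 4)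
      linarith
    linarith
  · refine (abs_log_sub_log_le hk₀ (b1 x).1 (b2 x).1).trans ?_
    rw [hF]
    gcongr
    rw [abs_le]
    constructor <;> linarith [(b1 x).1, (b1 x).2, (b2 x).1, (b2 x).2]
  · have h1 := (abs_log_sub_log_le hk₀ (b1 x).1 (b1 y).1).trans
      (div_le_div_of_nonneg_right (hequi (G.tilted (lin φ η)) x hx y hy hxy) hk₀.le)
    have h2 := (abs_log_sub_log_le hk₀ (b2 x).1 (b2 y).1).trans
      (div_le_div_of_nonneg_right (hequi G x hx y hy hxy) hk₀.le)
    have h3 : c' * k₀ / 16 / k₀ = c' / 16 := by field_simp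
    rw [h3] at h1 h2
    rw [abs_le] at h1 h2 ⊢
    simp only [logRatio]
    constructor <;> linarith [h1.1, h1.2, h2.1, h2.2]

end Consistency

/-! ### Empirical means: concentration and moments along local alternatives -/

section SampleMean

variable {P : Measure ℝ} {n : ℕ} {f g : ℝ → ℝ} {F : ℝ}

lemma measurable_avg (hf : Measurable f) : Measurable fun x : Fin n → ℝ => avg x f := by
  unfold avg
  exact (Finset.measurable_fun_sum _ fun i _ => hf.comp (measurable_pi_apply i)).div_const _

variable [IsProbabilityMeasure P]

lemma integral_avg (hn : 0 < n) (hf : Measurable f) (hF : ∀ x, |f x| ≤ F) :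
    ∫ x : Fin n → ℝ, avg x f ∂(Measure.pi fun _ => P) = ∫ x, f x ∂P := by
  have hn' : (n : ℝ) ≠ 0 := by exact_mod_cast hn.ne'
  simp only [avg]
  rw [integral_div, integral_finsetSum]
  · have : ∀ i : Fin n, ∫ x : Fin n → ℝ, f (x i) ∂(Measure.pi fun _ => P) = ∫ x, f x ∂P :=
      fun i => integral_comp_eval (μ := fun _ : Fin n => P) hf.aestronglyMeasurable
    simp [this]; field_simp
  · exact fun i _ => integrable_of_abs_le (hf.comp (measurable_pi_apply i)).aemeasurable
      (Eventually.of_forall fun x => hF _)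

lemma covariance_avg (hn : 0 < n) (hf : Measurable f) (hF : ∀ x, |f x| ≤ F)
    (hg : Measurable g) (hG : ∀ x, |g x| ≤ F) :
    cov[fun x : Fin n → ℝ => avg x f, fun x => avg x g; Measure.pi fun _ => P] =
      cov[f, g; P] / n := by
  have hn' : (n : ℝ) ≠ 0 := by exact_mod_cast hn.ne'
  have hm : ∀ {h : ℝ → ℝ}, Measurable h → (∀ x, |h x| ≤ F) → ∀ i : Fin n,
      MemLp (fun x : Fin n → ℝ => h (x i)) 2 (Measure.pi fun _ => P) := fun hh hb i =>
    memLp_of_abs_le (hh.comp (measurable_pi_apply i)).aemeasurable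
      (Eventually.of_forall fun x => hb _)
  simp only [avg, div_eq_inv_mul]
  rw [covariance_const_mul_left, covariance_const_mul_right,
    covariance_fun_sum_fun_sum (hm hf hF) (hm hg hG)]
  have key : ∀ i k : Fin n, cov[fun x : Fin n → ℝ => f (x i), fun x => g (x k);
      Measure.pi fun _ => P] = if i = k then cov[f, g; P] else 0 := by
    intro i k
    split_ifs with h
    · subst h
      have h1 := (measurePreserving_eval (fun _ : Fin n => P) i)
      conv_rhs => rw [← h1.map_eq]
      exact (covariance_map_fun hf.aestronglyMeasurable hg.aestronglyMeasurable
        (measurable_pi_apply i).aemeasurable).symm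
    · have h1 := (iIndepFun_pi (μ := fun _ : Fin n => P) (X := fun _ => id)
        fun _ => aemeasurable_id).indepFun h
      exact (h1.comp hf hg).covariance_eq_zero (hm hf hF i) (hm hg hG k)
  simp_rw [key]
  simp only [Finset.sum_ite_eq, Finset.mem_univ, if_true, Finset.sum_const, Finset.card_univ,
    Fintype.card_fin, nsmul_eq_mul]
  field_simp

/-- Hoeffding's inequality for the sample mean of a bounded function. -/
lemma measureReal_le_abs_avg_sub (hn : 0 < n) (hf : Measurable f) (hF : ∀ x, |f x| ≤ F)
    {e : ℝ} (he : 0 ≤ e) :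
    (Measure.pi fun _ : Fin n => P).real {x | e ≤ |avg x f - ∫ y, f y ∂P|} ≤
      2 * Real.exp (-(n * (e ^ 2 / (2 * F ^ 2)))) := by
  have hn' : (0 : ℝ) < n := by exact_mod_cast hn
  have hF0 : 0 ≤ F := (abs_nonneg _).trans (hF 0)
  have key : ∀ {h : ℝ → ℝ}, Measurable h → (∀ x, |h x| ≤ F) →
      (Measure.pi fun _ : Fin n => P).real {x | e ≤ avg x h - ∫ y, h y ∂P} ≤
      Real.exp (-(n * (e ^ 2 / (2 * F ^ 2)))) := by
    intro h hh hb
    have hsub : HasSubgaussianMGF (fun y => h y - ∫ z, h z ∂P) ((‖F - -F‖₊ / 2) ^ 2) P :=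
      hasSubgaussianMGF_of_mem_Icc hh.aemeasurable (Eventually.of_forall fun y =>
        ⟨(abs_le.1 (hb y)).1, (abs_le.1 (hb y)).2⟩)
    have hmeas : Measurable fun y => h y - ∫ z, h z ∂P := hh.sub_const _
    have hind := iIndepFun_pi (μ := fun _ : Fin n => P) (X := fun _ y => h y - ∫ z, h z ∂P)
      fun _ => hmeas.aemeasurable
    have hsub' : ∀ i ∈ (Finset.univ : Finset (Fin n)),
        HasSubgaussianMGF (fun x : Fin n → ℝ => h (x i) - ∫ z, h z ∂P)
          ((‖F - -F‖₊ / 2) ^ 2) (Measure.pi fun _ => P) := by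
      intro i _
      refine HasSubgaussianMGF.of_map (measurable_pi_apply i).aemeasurable
        (X := fun y => h y - ∫ z, h z ∂P) ?_
      rw [(measurePreserving_eval (fun _ : Fin n => P) i).map_eq]
      exact hsub
    have h1 := HasSubgaussianMGF.measure_sum_ge_le_of_iIndepFun hind hsub'
      (ε := n * e) (by positivity)
    have h2 : {x : Fin n → ℝ | e ≤ avg x h - ∫ y, h y ∂P} =
        {x | n * e ≤ ∑ i, (h (x i) - ∫ z, h z ∂P)} := by
      ext x
      simp only [Set.mem_ofPred_eq, Finset.sum_sub_distrib, avg]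
      rw [Finset.sum_const, Finset.card_univ, Fintype.card_fin, nsmul_eq_mul, le_sub_iff_add_le,
        le_sub_iff_add_le, le_div_iff₀ hn', ← mul_add, mul_comm]
    rw [h2]
    refine h1.trans (le_of_eq ?_)
    congr 1
    simp only [sub_neg_eq_add, Finset.sum_const, Finset.card_univ, Fintype.card_fin,
      nsmul_eq_mul]
    push_cast
    rw [Real.norm_eq_abs, abs_of_nonneg (by linarith)]
    rcases hF0.eq_or_lt with h0 | h0
    · simp [← h0]
    field_simp
    ring
  have h1 := key hf hF
  have h2 := key (h := fun x => -f x) hf.neg (by simpa using hF)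
  have h3 : {x : Fin n → ℝ | e ≤ |avg x f - ∫ y, f y ∂P|} ⊆
      {x | e ≤ avg x f - ∫ y, f y ∂P} ∪
      {x | e ≤ avg x (fun y => -f y) - ∫ y, -f y ∂P} := by
    intro x hx
    have e1 : avg x (fun y => -f y) - ∫ y, -f y ∂P = -(avg x f - ∫ y, f y ∂P) := by
      rw [integral_neg]; simp [avg, neg_div]; ring
    simp only [Set.mem_union, Set.mem_ofPred_eq, e1] at hx ⊢
    exact le_abs.1 hx
  have h4 := (measureReal_mono h3).trans
    (measureReal_union_le (μ := Measure.pi fun _ : Fin n => P) _ _)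
  linarith

end SampleMean

section LocalAlternatives

lemma ae_abs_div_sqrt_le {G : Measure ℝ} {T : ℝ → ℝ} {B₀ : ℝ} (hb : ∀ᵐ μ ∂G, |T μ| ≤ B₀) (n : ℕ) :
    ∀ᵐ μ ∂G, |T μ / √(n : ℝ)| ≤ B₀ / √(n : ℝ) := by
  filter_upwards [hb] with μ h
  rw [abs_div, abs_of_nonneg (Real.sqrt_nonneg _)]
  gcongr

variable {M : ℝ} {G : Measure ℝ} [IsProbabilityMeasure G] {f g : ℝ → ℝ} {F : ℝ}

lemma integral_obsLaw_tilted_near (hM : 0 < M) {a : ℝ → ℝ} {s : ℝ} (ha : AEMeasurable a G)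
    (hs : ∀ᵐ μ ∂G, |a μ| ≤ s) (hs1 : s ≤ 1) (hf : Measurable f) (hF : ∀ x, |f x| ≤ F) :
    |∫ x, f x ∂(obsLaw M (G.tilted a)) - ∫ x, f x ∂(obsLaw M G)| ≤ 22 * F * s ∧
    |∫ x, f x ∂(obsLaw M (G.tilted a)) - ∫ x, f x ∂(obsLaw M G) - cov[smooth M f, a; G]| ≤
      18 * F * s ^ 2 := by
  have : IsProbabilityMeasure (G.tilted a) :=
    isProbabilityMeasure_tilted (integrable_exp_of_abs_le ha hs)
  rw [integral_obsLaw_eq_smooth hM hf hF, integral_obsLaw_eq_smooth hM hf hF]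
  have h1 := (measurable_smooth hM hf).aemeasurable (μ := G)
  have h2 : ∀ᵐ μ ∂G, |smooth M f μ| ≤ F := Eventually.of_forall (abs_smooth_le hM hf hF)
  exact ⟨abs_integral_tilted_sub_le ha hs hs1 h1 h2,
    abs_integral_tilted_sub_cov_le ha hs hs1 h1 h2⟩

lemma tendsto_nat_mul_exp_neg {c : ℝ} (hc : 0 < c) :
    Tendsto (fun n : ℕ => (n : ℝ) * (2 * Real.exp (-(n * c)))) atTop (𝓝 0) := by
  have h1 := (Real.tendsto_pow_mul_exp_neg_atTop_nhds_zero 1).comp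
    ((tendsto_natCast_atTop_atTop (R := ℝ)).atTop_mul_const hc)
  have h2 := h1.const_mul (2 / c)
  rw [mul_zero] at h2
  refine h2.congr fun n => ?_
  simp only [Function.comp, pow_one]
  field_simp

lemma tendsto_div_sqrt_nat (b : ℝ) : Tendsto (fun n : ℕ => b / √(n : ℝ)) atTop (𝓝 0) :=
  (Real.tendsto_sqrt_atTop.comp tendsto_natCast_atTop_atTop).const_div_atTop b

/-- Under local alternatives, finitely many empirical means are close to their expectations under
the carrier, except on an event of probability `o(1/n)`. -/
lemma eventually_nat_mul_measureReal_le (hM : 0 < M) {ι : Type*} [Fintype ι] {f : ι → ℝ → ℝ}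
    (hf : ∀ k, Measurable (f k)) (hF : ∀ k x, |f k x| ≤ F) (B₀ : ℝ) {e ε : ℝ} (he : 0 < e)
    (hε : 0 < ε) :
    ∀ᶠ n : ℕ in atTop, ∀ T : ℝ → ℝ, AEMeasurable T G → (∀ᵐ μ ∂G, |T μ| ≤ B₀) →
      n * (Measure.pi fun _ : Fin n => obsLaw M (G.tilted fun μ => T μ / √n)).real
        {x | ∃ k, e < |avg x (f k) - ∫ y, f k y ∂(obsLaw M G)|} ≤ ε := by
  set F' := |F| + 1 with hF'
  have hF'0 : 0 < F' := by positivity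
  have hFF : ∀ k x, |f k x| ≤ F' := fun k x =>
    (hF k x).trans ((le_abs_self F).trans (by linarith))
  set c := (e / 2) ^ 2 / (2 * F' ^ 2) with hc
  have hc0 : 0 < c := by positivity
  have l1 : ∀ᶠ n : ℕ in atTop, 22 * F' * (B₀ / √(n : ℝ)) < e / 2 := by
    have := (tendsto_div_sqrt_nat B₀).const_mul (22 * F')
    rw [mul_zero] at this
    exact this.eventually (gt_mem_nhds (by positivity))
  have l2 : ∀ᶠ n : ℕ in atTop, B₀ / √(n : ℝ) < 1 :=
    (tendsto_div_sqrt_nat B₀).eventually (gt_mem_nhds one_pos)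
  have l3 : ∀ᶠ n : ℕ in atTop, (Fintype.card ι : ℝ) * (n * (2 * Real.exp (-(n * c)))) < ε := by
    have := (tendsto_nat_mul_exp_neg hc0).const_mul (Fintype.card ι : ℝ)
    rw [mul_zero] at this
    exact this.eventually (gt_mem_nhds hε)
  filter_upwards [l1, l2, l3, eventually_gt_atTop 0] with n h1 h2 h3 hn T hT hb
  have hs := ae_abs_div_sqrt_le hb n
  have hTn : AEMeasurable (fun μ => T μ / √n) G := hT.div_const _
  have : IsProbabilityMeasure (G.tilted fun μ => T μ / √n) :=
    isProbabilityMeasure_tilted (integrable_exp_of_abs_le hTn hs)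
  have := isProbabilityMeasure_obsLaw (G := G.tilted fun μ => T μ / √n) hM
  set P := obsLaw M (G.tilted fun μ => T μ / √n) with hP
  have hsub : {x : Fin n → ℝ | ∃ k, e < |avg x (f k) - ∫ y, f k y ∂(obsLaw M G)|} ⊆
      ⋃ k ∈ (Finset.univ : Finset ι), {x | e / 2 ≤ |avg x (f k) - ∫ y, f k y ∂P|} := by
    rintro x ⟨k, hk⟩
    simp only [Finset.mem_univ, Set.iUnion_true, Set.mem_iUnion, Set.mem_ofPred_eq]
    refine ⟨k, ?_⟩
    have h4 := (integral_obsLaw_tilted_near hM hTn hs h2.le (hf k) (hFF k)).1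
    have h5 := abs_sub_le (avg x (f k)) (∫ y, f k y ∂P) (∫ y, f k y ∂(obsLaw M G))
    linarith
  have h4 : (Measure.pi fun _ : Fin n => P).real
      {x | ∃ k, e < |avg x (f k) - ∫ y, f k y ∂(obsLaw M G)|} ≤
      Fintype.card ι * (2 * Real.exp (-(n * c))) := by
    refine (measureReal_mono hsub (measure_ne_top _ _)).trans
      ((measureReal_biUnion_finset_le _ _).trans ?_)
    calc _ ≤ ∑ _k : ι, 2 * Real.exp (-(n * c)) :=
          Finset.sum_le_sum fun k _ =>
            measureReal_le_abs_avg_sub hn (hf k) (hFF k) (by positivity)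
      _ = _ := by simp
  have h5 := mul_le_mul_of_nonneg_left h4 (Nat.cast_nonneg (α := ℝ) n)
  linarith

/-- Under local alternatives, the centred and rescaled empirical means have, asymptotically, the
first two moments of a shifted Gaussian vector. -/
lemma abs_integral_scaled_avg_le (hM : 0 < M) {B₀ : ℝ} {T : ℝ → ℝ} {n : ℕ} (hn : 0 < n)
    (hT : AEMeasurable T G) (hb : ∀ᵐ μ ∂G, |T μ| ≤ B₀) (hs1 : B₀ / √n ≤ 1)
    (hf : Measurable f) (hF : ∀ x, |f x| ≤ F) (hg : Measurable g) (hG : ∀ x, |g x| ≤ F) :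
    |∫ x : Fin n → ℝ, √n * (avg x f - ∫ y, f y ∂(obsLaw M G))
        ∂(Measure.pi fun _ => obsLaw M (G.tilted fun μ => T μ / √n)) -
        cov[smooth M f, T; G]| ≤ 18 * F * B₀ ^ 2 / √n ∧
    |∫ x : Fin n → ℝ, √n * (avg x f - ∫ y, f y ∂(obsLaw M G)) *
        (√n * (avg x g - ∫ y, g y ∂(obsLaw M G)))
        ∂(Measure.pi fun _ => obsLaw M (G.tilted fun μ => T μ / √n)) -
        (cov[f, g; obsLaw M G] + cov[smooth M f, T; G] * cov[smooth M g, T; G])| ≤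
      (66 * F ^ 2 * B₀ + 18 * F * B₀ ^ 2 * (44 * F * B₀ + 18 * F * B₀ ^ 2)) / √n := by
  have hn' : (0 : ℝ) < n := by exact_mod_cast hn
  have hr : 0 < √(n : ℝ) := Real.sqrt_pos.2 hn'
  have hrn : √(n : ℝ) * √(n : ℝ) = n := Real.mul_self_sqrt hn'.le
  have hs := ae_abs_div_sqrt_le hb n
  have hTn : AEMeasurable (fun μ => T μ / √n) G := hT.div_const _
  have hB₀ : 0 ≤ B₀ := by
    obtain ⟨x, hx⟩ := hb.exists
    exact (abs_nonneg _).trans hx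
  have hF0 : 0 ≤ F := (abs_nonneg _).trans (hF 0)
  have : IsProbabilityMeasure (G.tilted fun μ => T μ / √n) :=
    isProbabilityMeasure_tilted (integrable_exp_of_abs_le hTn hs)
  have i1 := isProbabilityMeasure_obsLaw (G := G.tilted fun μ => T μ / √n) hM
  have i0 := isProbabilityMeasure_obsLaw (G := G) hM
  set P := obsLaw M (G.tilted fun μ => T μ / √n) with hP
  set s := B₀ / √(n : ℝ) with hsdef
  have hs0 : 0 ≤ s := by positivity
  have hrs : √(n : ℝ) * s = B₀ := by rw [hsdef]; field_simp
  set E₀ : (ℝ → ℝ) → ℝ := fun h => ∫ y, h y ∂(obsLaw M G) with hE₀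
  set E₁ : (ℝ → ℝ) → ℝ := fun h => ∫ y, h y ∂P with hE₁
  have havi : ∀ {h : ℝ → ℝ}, Measurable h → (∀ x, |h x| ≤ F) →
      MemLp (fun x : Fin n → ℝ => avg x h) 2 (Measure.pi fun _ => P) := fun hh hhF =>
    memLp_of_abs_le (measurable_avg hh).aemeasurable
      (Eventually.of_forall fun x => abs_avg_le hF0 fun i => hhF _)
  have one : ∀ {h : ℝ → ℝ}, Measurable h → (∀ x, |h x| ≤ F) →
      ∫ x : Fin n → ℝ, √n * (avg x h - E₀ h) ∂(Measure.pi fun _ => P) = √n * (E₁ h - E₀ h) ∧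
      |√n * (E₁ h - E₀ h) - cov[smooth M h, T; G]| ≤ 18 * F * B₀ ^ 2 / √n ∧
      |√n * (E₁ h - E₀ h)| ≤ 22 * F * B₀ := by
    intro h hh hhF
    refine ⟨?_, ?_, ?_⟩
    · rw [integral_const_mul, integral_sub ((havi hh hhF).integrable one_le_two)
        (integrable_const _), integral_avg hn hh hhF]
      simp [hE₁]
    · have h1 := (integral_obsLaw_tilted_near hM hTn hs hs1 hh hhF).2
      have h2 : cov[smooth M h, fun μ => T μ / √n; G] = cov[smooth M h, T; G] / √n := by
        simp_rw [div_eq_inv_mul]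
        rw [covariance_const_mul_right]
      rw [h2] at h1
      have h3 : √n * (E₁ h - E₀ h) - cov[smooth M h, T; G] =
          √n * (E₁ h - E₀ h - cov[smooth M h, T; G] / √n) := by field_simp
      rw [h3, abs_mul, abs_of_pos hr]
      refine (mul_le_mul_of_nonneg_left h1 hr.le).trans (le_of_eq ?_)
      rw [hsdef, div_pow]
      field_simp
    · have h1 := (integral_obsLaw_tilted_near hM hTn hs hs1 hh hhF).1
      rw [abs_mul, abs_of_pos hr]
      refine (mul_le_mul_of_nonneg_left h1 hr.le).trans (le_of_eq ?_)
      rw [← hrs]; ring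
  obtain ⟨f1, f2, f3⟩ := one hf hF
  obtain ⟨g1, g2, g3⟩ := one hg hG
  refine ⟨by rw [f1]; exact f2, ?_⟩
  have hprod : ∫ x : Fin n → ℝ, √n * (avg x f - E₀ f) * (√n * (avg x g - E₀ g))
      ∂(Measure.pi fun _ => P) =
      cov[f, g; P] + √n * (E₁ f - E₀ f) * (√n * (E₁ g - E₀ g)) := by
    have mf : MemLp (fun x : Fin n → ℝ => √n * (avg x f - E₀ f)) 2 (Measure.pi fun _ => P) :=
      ((havi hf hF).sub (memLp_const _)).const_mul _
    have mg : MemLp (fun x : Fin n → ℝ => √n * (avg x g - E₀ g)) 2 (Measure.pi fun _ => P) :=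
      ((havi hg hG).sub (memLp_const _)).const_mul _
    have h1 := covariance_eq_sub mf mg
    rw [f1, g1, covariance_const_mul_left, covariance_const_mul_right,
      covariance_sub_const_left ((havi hf hF).integrable one_le_two),
      covariance_sub_const_right ((havi hg hG).integrable one_le_two),
      covariance_avg hn hf hF hg hG] at h1
    have h2 : √n * (√n * (cov[f, g; P] / n)) = cov[f, g; P] := by
      rw [← mul_assoc, hrn]; field_simp
    rw [h2] at h1
    simp only [Pi.mul_apply] at h1
    linarith
  rw [hprod]
  have hcov : |cov[f, g; P] - cov[f, g; obsLaw M G]| ≤ 66 * F ^ 2 * s := by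
    have mem : ∀ (Q : Measure ℝ) [IsProbabilityMeasure Q] {h : ℝ → ℝ}, Measurable h →
        (∀ x, |h x| ≤ F) → MemLp h 2 Q := fun Q _ h hh hhF =>
      memLp_of_abs_le hh.aemeasurable (Eventually.of_forall hhF)
    rw [covariance_eq_sub (mem P hf hF) (mem P hg hG),
      covariance_eq_sub (mem _ hf hF) (mem _ hg hG)]
    have h1 := (integral_obsLaw_tilted_near hM hTn hs hs1 (f := f * g) (F := F ^ 2)
      (hf.mul hg) fun x => by
        rw [Pi.mul_apply, abs_mul, sq]
        exact mul_le_mul (hF x) (hG x) (abs_nonneg _) hF0).1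
    have h2 := (integral_obsLaw_tilted_near hM hTn hs hs1 hf hF).1
    have h3 := (integral_obsLaw_tilted_near hM hTn hs hs1 hg hG).1
    have h4 : |E₁ f| ≤ F := abs_integral_le_of_abs_le (Eventually.of_forall hF)
    have h5 : |E₀ g| ≤ F := abs_integral_le_of_abs_le (Eventually.of_forall hG)
    have h6 : |E₁ f * E₁ g - E₀ f * E₀ g| ≤ 44 * F ^ 2 * s := by
      have e1 : E₁ f * E₁ g - E₀ f * E₀ g = E₁ f * (E₁ g - E₀ g) + (E₁ f - E₀ f) * E₀ g := by ring
      rw [e1]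
      refine (abs_add_le _ _).trans ?_
      rw [abs_mul, abs_mul]
      have := mul_le_mul h4 h3 (abs_nonneg _) hF0
      have := mul_le_mul h2 h5 (abs_nonneg _) (by positivity)
      linarith
    have h1' := abs_le.1 h1
    have h6' := abs_le.1 h6
    simp only [hE₁, hE₀] at h6'
    rw [abs_le]
    constructor <;> linarith [h1'.1, h1'.2, h6'.1, h6'.2]
  set x := √n * (E₁ f - E₀ f)
  set y := √n * (E₁ g - E₀ g)
  set bf := cov[smooth M f, T; G]
  set bg := cov[smooth M g, T; G]
  have hd1 : 18 * F * B₀ ^ 2 / √(n : ℝ) = 18 * F * B₀ * s := by rw [hsdef]; ring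
  have hbf : |bf| ≤ 22 * F * B₀ + 18 * F * B₀ ^ 2 := by
    have h1 := abs_sub_abs_le_abs_sub bf x
    rw [abs_sub_comm] at h1
    have h2 : 18 * F * B₀ * s ≤ 18 * F * B₀ ^ 2 := by
      have h3 : 0 ≤ B₀ * (√(n : ℝ) - 1) := by
        refine mul_nonneg hB₀ ?_
        have : (1 : ℝ) ≤ √n := Real.one_le_sqrt.2 (by exact_mod_cast hn)
        linarith
      have h4 : s ≤ B₀ := by
        rw [hsdef, div_le_iff₀ hr]; linarith
      rw [sq, ← mul_assoc]
      exact mul_le_mul_of_nonneg_left h4 (by positivity)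
    rw [hd1] at f2
    linarith
  have hxy : |x * y - bf * bg| ≤ 18 * F * B₀ * s * (44 * F * B₀ + 18 * F * B₀ ^ 2) := by
    rw [hd1] at f2 g2
    have e1 : x * y - bf * bg = (x - bf) * y + bf * (y - bg) := by ring
    rw [e1]
    refine (abs_add_le _ _).trans ?_
    rw [abs_mul (x - bf) y, abs_mul bf]
    have h1 := mul_le_mul f2 g3 (abs_nonneg _) (by positivity)
    have h2 := mul_le_mul hbf g2 (abs_nonneg _) (by positivity)
    linarith
  have hfin : (66 * F ^ 2 * B₀ + 18 * F * B₀ ^ 2 * (44 * F * B₀ + 18 * F * B₀ ^ 2)) / √(n : ℝ) =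
      66 * F ^ 2 * s + 18 * F * B₀ * s * (44 * F * B₀ + 18 * F * B₀ ^ 2) := by
    rw [hsdef]; ring
  rw [hfin]
  have h1 := abs_le.1 hcov
  have h2 := abs_le.1 hxy
  rw [abs_le]
  constructor <;> linarith [h1.1, h1.2, h2.1, h2.2]

end LocalAlternatives

/-! ### Posterior statistics, relative entropy and the limiting loss -/

section

open Matrix

section Statistics

variable {p : ℕ} {M B : ℝ} {G : Measure ℝ} [IsProbabilityMeasure G] {φ : Fin p → ℝ → ℝ}

lemma abs_covariance_le {f g : ℝ → ℝ} {b c : ℝ} (hf : AEMeasurable f G) (hg : AEMeasurable g G)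
    (hb : ∀ᵐ μ ∂G, |f μ| ≤ b) (hc : ∀ᵐ μ ∂G, |g μ| ≤ c) : |cov[f, g; G]| ≤ 2 * b * c := by
  have hb0 : 0 ≤ b := by
    obtain ⟨x, hx⟩ := hb.exists
    exact (abs_nonneg _).trans hx
  rw [covariance_eq_sub (memLp_of_abs_le hf hb) (memLp_of_abs_le hg hc)]
  have h1 : |∫ μ, (f * g) μ ∂G| ≤ b * c := abs_integral_le_of_abs_le (by
    filter_upwards [hb, hc] with μ h1 h2
    rw [Pi.mul_apply, abs_mul]
    exact mul_le_mul h1 h2 (abs_nonneg _) hb0)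
  have h2 : |(∫ μ, f μ ∂G) * ∫ μ, g μ ∂G| ≤ b * c := by
    rw [abs_mul]
    exact mul_le_mul (abs_integral_le_of_abs_le hb) (abs_integral_le_of_abs_le hc)
      (abs_nonneg _) hb0
  refine (abs_sub _ _).trans ?_
  linarith

lemma continuous_postMean (hM : 0 < M) (hφ : ∀ j, AEMeasurable (φ j) G)
    (hB : ∀ j, ∀ᵐ μ ∂G, |φ j μ| ≤ B) (j : Fin p) : Continuous (postMean M G φ j) :=
  continuous_integral_posterior hM (integrable_of_abs_le (hφ j) (hB j))

lemma abs_postMean_le (hM : 0 < M) (hB : ∀ j, ∀ᵐ μ ∂G, |φ j μ| ≤ B) (j : Fin p) (x : ℝ) :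
    |postMean M G φ j x| ≤ B := by
  have := isProbabilityMeasure_posterior (G := G) hM x
  exact abs_integral_le_of_abs_le ((posterior_absolutelyContinuous M G x).ae_le (hB j))

lemma integral_postMean (hM : 0 < M) (hφ : ∀ j, AEMeasurable (φ j) G)
    (hB : ∀ j, ∀ᵐ μ ∂G, |φ j μ| ≤ B) (j : Fin p) :
    ∫ x, postMean M G φ j x ∂(obsLaw M G) = ∫ μ, φ j μ ∂G :=
  integral_obsLaw_posterior hM (integrable_of_abs_le (hφ j) (hB j))

lemma curvature_eq (hM : 0 < M) (hφ : ∀ j, AEMeasurable (φ j) G)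
    (hB : ∀ j, ∀ᵐ μ ∂G, |φ j μ| ≤ B) (j k : Fin p) (x : ℝ) :
    curvature M G φ j k x = ∫ μ, φ j μ * φ k μ ∂(posterior M G x) -
      postMean M G φ j x * postMean M G φ k x - cov[φ j, φ k; G] := by
  have := isProbabilityMeasure_posterior (G := G) hM x
  have hac := posterior_absolutelyContinuous M G x
  rw [curvature, covariance_eq_sub
    (memLp_of_abs_le ((hφ j).mono_ac hac) (hac.ae_le (hB j)))
    (memLp_of_abs_le ((hφ k).mono_ac hac) (hac.ae_le (hB k)))]
  rfl

lemma integrable_features_mul (hφ : ∀ j, AEMeasurable (φ j) G) (hB : ∀ j, ∀ᵐ μ ∂G, |φ j μ| ≤ B)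
    (j k : Fin p) : Integrable (fun μ => φ j μ * φ k μ) G :=
  (memLp_of_abs_le (hφ j) (hB j)).integrable_mul (memLp_of_abs_le (hφ k) (hB k))

lemma continuous_curvature (hM : 0 < M) (hφ : ∀ j, AEMeasurable (φ j) G)
    (hB : ∀ j, ∀ᵐ μ ∂G, |φ j μ| ≤ B) (j k : Fin p) : Continuous (curvature M G φ j k) := by
  rw [funext (curvature_eq hM hφ hB j k)]
  exact ((continuous_integral_posterior hM (integrable_features_mul hφ hB j k)).sub
    ((continuous_postMean hM hφ hB j).mul (continuous_postMean hM hφ hB k))).sub continuous_const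

lemma abs_curvature_le (hM : 0 < M) (hφ : ∀ j, AEMeasurable (φ j) G)
    (hB : ∀ j, ∀ᵐ μ ∂G, |φ j μ| ≤ B) (j k : Fin p) (x : ℝ) :
    |curvature M G φ j k x| ≤ 4 * B ^ 2 := by
  have := isProbabilityMeasure_posterior (G := G) hM x
  have hac := posterior_absolutelyContinuous M G x
  have h1 := abs_covariance_le ((hφ j).mono_ac hac) ((hφ k).mono_ac hac) (hac.ae_le (hB j))
    (hac.ae_le (hB k))
  have h2 := abs_covariance_le (hφ j) (hφ k) (hB j) (hB k)
  refine (abs_sub _ _).trans ?_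
  linarith

lemma integral_curvature (hM : 0 < M) (hφ : ∀ j, AEMeasurable (φ j) G)
    (hB : ∀ j, ∀ᵐ μ ∂G, |φ j μ| ≤ B) (j k : Fin p) :
    ∫ x, curvature M G φ j k x ∂(obsLaw M G) = -info M G φ j k := by
  have := isProbabilityMeasure_obsLaw (G := G) hM
  have hS : ∀ j, MemLp (postMean M G φ j) 2 (obsLaw M G) := fun j => memLp_of_abs_le
    (continuous_postMean hM hφ hB j).aemeasurable
    (Eventually.of_forall (abs_postMean_le hM hB j))
  have hSS : Integrable (fun x => postMean M G φ j x * postMean M G φ k x) (obsLaw M G) :=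
    (hS j).integrable_mul (hS k)
  have hP : Integrable (fun x => ∫ μ, φ j μ * φ k μ ∂(posterior M G x)) (obsLaw M G) := by
    refine integrable_of_abs_le (b := B ^ 2)
      (continuous_integral_posterior hM (integrable_features_mul hφ hB j k)).aemeasurable
      (Eventually.of_forall fun x => ?_)
    have := isProbabilityMeasure_posterior (G := G) hM x
    refine abs_integral_le_of_abs_le ((posterior_absolutelyContinuous M G x).ae_le ?_)
    filter_upwards [hB j, hB k] with μ h1 h2
    rw [abs_mul, sq]
    exact mul_le_mul h1 h2 (abs_nonneg _) ((abs_nonneg _).trans h1)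
  simp_rw [curvature_eq hM hφ hB j k]
  have hPS : Integrable (fun x => ∫ μ, φ j μ * φ k μ ∂(posterior M G x) -
      postMean M G φ j x * postMean M G φ k x) (obsLaw M G) := hP.sub hSS
  rw [integral_sub hPS (integrable_const _), integral_sub hP hSS,
    integral_obsLaw_posterior hM (integrable_features_mul hφ hB j k), integral_const,
    covariance_eq_sub (memLp_of_abs_le (hφ j) (hB j)) (memLp_of_abs_le (hφ k) (hB k)), info,
    Matrix.of_apply, covariance_eq_sub (hS j) (hS k), integral_postMean hM hφ hB,
    integral_postMean hM hφ hB]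
  simp only [Pi.mul_apply, probReal_univ, one_smul]
  ring

end Statistics

section RelativeEntropy

variable {p : ℕ} {B : ℝ} {G : Measure ℝ} [IsProbabilityMeasure G] {φ : Fin p → ℝ → ℝ}

/-- The relative entropy of the tilt by `a` with respect to the tilt by `b`, as a real number. -/
noncomputable def tiltEntropy (G : Measure ℝ) (a b : ℝ → ℝ) : ℝ :=
  Real.log (∫ μ, Real.exp (b μ - a μ) ∂(G.tilted a)) - ∫ μ, (b μ - a μ) ∂(G.tilted a)

lemma continuous_lin (μ : ℝ) : Continuous fun η : Fin p → ℝ => lin φ η μ := by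
  unfold lin; fun_prop

lemma continuous_integral_exp_lin (hφ : ∀ j, AEMeasurable (φ j) G)
    (hB : ∀ j, ∀ᵐ μ ∂G, |φ j μ| ≤ B) (hB0 : 0 ≤ B) {w : ℝ → ℝ} {b : ℝ} (hw : AEMeasurable w G)
    (hb : ∀ᵐ μ ∂G, |w μ| ≤ b) :
    Continuous fun η : Fin p → ℝ => ∫ μ, Real.exp (lin φ η μ - w μ) ∂G := by
  rw [continuous_iff_continuousAt]
  intro η₀
  refine continuousAt_of_dominated (bound := fun _ => Real.exp (p * B * (‖η₀‖ + 1) + b))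
    (Eventually.of_forall fun η => ((aemeasurable_lin hφ η).sub hw).exp.aestronglyMeasurable)
    ?_ (integrable_const _) (Eventually.of_forall fun μ => ?_)
  · filter_upwards [Metric.ball_mem_nhds η₀ one_pos] with η hη
    filter_upwards [ae_abs_lin_le hB η, hb] with μ h1 h2
    rw [Real.norm_eq_abs, abs_of_pos (Real.exp_pos _)]
    have h3 : ‖η‖ ≤ ‖η₀‖ + 1 := by
      have := norm_sub_norm_le η η₀
      rw [Metric.mem_ball, dist_eq_norm] at hη
      linarith
    have h4 : p * B * ‖η‖ ≤ p * B * (‖η₀‖ + 1) := by gcongr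
    exact Real.exp_le_exp.2 (by linarith [(abs_le.1 h1).2, (abs_le.1 h2).1])
  · exact (Real.continuous_exp.comp ((continuous_lin μ).sub continuous_const)).continuousAt

lemma continuous_tiltEntropy (hφ : ∀ j, AEMeasurable (φ j) G)
    (hB : ∀ j, ∀ᵐ μ ∂G, |φ j μ| ≤ B) (hB0 : 0 ≤ B) {a : ℝ → ℝ} {s : ℝ} (ha : AEMeasurable a G)
    (hs : ∀ᵐ μ ∂G, |a μ| ≤ s) :
    Continuous fun η : Fin p → ℝ => tiltEntropy G a (lin φ η) := by
  have hac : G.tilted a ≪ G := tilted_absolutelyContinuous _ _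
  have : IsProbabilityMeasure (G.tilted a) :=
    isProbabilityMeasure_tilted (integrable_exp_of_abs_le ha hs)
  have hφ' := fun j => (hφ j).mono_ac hac
  have hB' := fun j => hac.ae_le (hB j)
  have h1 := continuous_integral_exp_lin hφ' hB' hB0 (ha.mono_ac hac) (hac.ae_le hs)
  refine (h1.log fun η => ?_).sub ?_
  · have hi : Integrable (fun μ => Real.exp (lin φ η μ - a μ)) (G.tilted a) := by
      refine integrable_exp_of_abs_le (b := p * B * ‖η‖ + s)
        ((aemeasurable_lin hφ' η).sub (ha.mono_ac hac)) ?_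
      filter_upwards [ae_abs_lin_le hB' η, hac.ae_le hs] with μ h1 h2
      exact (abs_sub _ _).trans (by linarith)
    exact (integral_exp_pos hi).ne'
  · have e : ∀ η, ∫ μ, (lin φ η μ - a μ) ∂(G.tilted a) =
        ∑ j, η j * ∫ μ, φ j μ ∂(G.tilted a) - ∫ μ, a μ ∂(G.tilted a) := fun η => by
      rw [integral_sub (integrable_of_abs_le (aemeasurable_lin hφ' η) (ae_abs_lin_le hB' η))
        (integrable_of_abs_le (ha.mono_ac hac) (hac.ae_le hs)), integral_lin hφ' hB']
    simp_rw [e]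
    fun_prop

lemma tiltEntropy_bounds {a b : ℝ → ℝ} {s t : ℝ} (ha : AEMeasurable a G)
    (hs : ∀ᵐ μ ∂G, |a μ| ≤ s) (hb : AEMeasurable b G) (ht : ∀ᵐ μ ∂G, |b μ| ≤ t) :
    0 ≤ tiltEntropy G a b ∧ tiltEntropy G a b ≤ 2 * (s + t) := by
  refine kl_le_of_abs_le ha hs (hb.sub ha) ?_
  filter_upwards [hs, ht] with μ h1 h2
  exact (abs_sub _ _).trans (by linarith)

end RelativeEntropy

section QuadraticLoss

variable {p : ℕ} {B : ℝ} {G : Measure ℝ} [IsProbabilityMeasure G] {φ : Fin p → ℝ → ℝ}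

/-- The quadratic limit of the rescaled risk, in terms of the variance `v` of the direction, its
covariances `c` with the features and `b` with the smoothed scores, a matrix `A` (the inverse
information), the covariance `V` of the features, and the covariance `I` of the scores. -/
noncomputable def limitLoss (v : ℝ) (c b : Fin p → ℝ) (A V I : Matrix (Fin p) (Fin p) ℝ) : ℝ :=
  (v - 2 * ∑ j, (Aᵀ *ᵥ c) j * b j + ∑ j, ∑ k, (Aᵀ * V * A) j k * (I j k + b j * b k)) / 2

lemma variance_lin_mulVec_sub (hφ : ∀ j, AEMeasurable (φ j) G)
    (hB : ∀ j, ∀ᵐ μ ∂G, |φ j μ| ≤ B) {T : ℝ → ℝ} (hT : MemLp T 2 G)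
    (A : Matrix (Fin p) (Fin p) ℝ) (z : Fin p → ℝ) :
    Var[fun μ => lin φ (A *ᵥ z) μ - T μ; G] / 2 =
      limitLoss Var[T; G] (fun j => cov[φ j, T; G]) z A (Matrix.of fun j k => cov[φ j, φ k; G])
        0 := by
  have hL : ∀ η, MemLp (lin φ η) 2 G := fun η =>
    memLp_of_abs_le (aemeasurable_lin hφ η) (ae_abs_lin_le hB η)
  have hL' : ∀ (η : Fin p → ℝ) j, MemLp (fun μ => η j * φ j μ) 2 G := fun η j =>
    (memLp_of_abs_le (hφ j) (hB j)).const_mul _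
  have h1 : Var[fun μ => lin φ (A *ᵥ z) μ - T μ; G] =
      Var[lin φ (A *ᵥ z); G] - 2 * cov[lin φ (A *ᵥ z), T; G] + Var[T; G] :=
    variance_sub (hL _) hT
  have h2 : cov[lin φ (A *ᵥ z), T; G] = (A *ᵥ z) ⬝ᵥ fun j => cov[φ j, T; G] := by
    have e : lin φ (A *ᵥ z) = fun μ => ∑ j, (A *ᵥ z) j * φ j μ := rfl
    rw [e, covariance_fun_sum_left (hL' _) hT]
    simp_rw [covariance_const_mul_left]
    rfl
  rw [h1, h2, variance_lin hφ hB, limitLoss]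
  set V : Matrix (Fin p) (Fin p) ℝ := Matrix.of fun j k => cov[φ j, φ k; G]
  set c : Fin p → ℝ := fun j => cov[φ j, T; G]
  have h3 : (A *ᵥ z) ⬝ᵥ c = ∑ j, (Aᵀ *ᵥ c) j * z j := by
    rw [mulVec_transpose]
    change _ = (c ᵥ* A) ⬝ᵥ z
    rw [← dotProduct_mulVec, dotProduct_comm]
  have h4 : (A *ᵥ z) ⬝ᵥ V *ᵥ (A *ᵥ z) =
      ∑ j, ∑ k, (Aᵀ * V * A) j k * ((0 : Matrix (Fin p) (Fin p) ℝ) j k + z j * z k) := by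
    have : (A *ᵥ z) ⬝ᵥ V *ᵥ (A *ᵥ z) = z ⬝ᵥ (Aᵀ * V * A) *ᵥ z := by
      rw [← mulVec_mulVec, ← mulVec_mulVec, dotProduct_mulVec z, ← mulVec_transpose,
        transpose_transpose]
    rw [this]
    simp only [dotProduct, mulVec, Finset.mul_sum, Matrix.zero_apply, zero_add]
    exact Finset.sum_congr rfl fun j _ => Finset.sum_congr rfl fun k _ => by ring
  rw [h3, h4]
  ring

/-- The loss at a random argument with approximately the moments of a shifted Gaussian. -/
lemma abs_integral_limitLoss_sub_le {Ω : Type*} {mΩ : MeasurableSpace Ω} {P : Measure Ω}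
    [IsProbabilityMeasure P] {Z : Ω → Fin p → ℝ} (hZ : ∀ j, MemLp (fun ω => Z ω j) 2 P)
    (v : ℝ) {c b : Fin p → ℝ} {A V I : Matrix (Fin p) (Fin p) ℝ} {e γ : ℝ}
    (hc : ∀ j, |(Aᵀ *ᵥ c) j| ≤ γ) (he0 : 0 ≤ e)
    (h1 : ∀ j, |∫ ω, Z ω j ∂P - b j| ≤ e)
    (h2 : ∀ j k, |∫ ω, Z ω j * Z ω k ∂P - (I j k + b j * b k)| ≤ e) :
    |∫ ω, limitLoss v c (Z ω) A V 0 ∂P - limitLoss v c b A V I| ≤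
      (p * γ + ∑ j, ∑ k, |(Aᵀ * V * A) j k|) * e := by
  set W := Aᵀ * V * A
  have i1 : ∀ j, Integrable (fun ω => Z ω j) P := fun j => (hZ j).integrable one_le_two
  have i2 : ∀ j k, Integrable (fun ω => Z ω j * Z ω k) P := fun j k => (hZ j).integrable_mul (hZ k)
  have i3 : Integrable (fun ω => ∑ j, (Aᵀ *ᵥ c) j * Z ω j) P :=
    integrable_finsetSum _ fun j _ => (i1 j).const_mul _
  have i4 : Integrable (fun ω => ∑ j, ∑ k, W j k * (Z ω j * Z ω k)) P :=
    integrable_finsetSum _ fun j _ => integrable_finsetSum _ fun k _ => (i2 j k).const_mul _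
  have i5 : Integrable (fun ω => v - 2 * ∑ j, (Aᵀ *ᵥ c) j * Z ω j) P :=
    (integrable_const _).sub (i3.const_mul _)
  have i6 : ∀ w : Fin p → Fin p → ℝ, ∫ ω, ∑ j, ∑ k, w j k * (Z ω j * Z ω k) ∂P =
      ∑ j, ∑ k, w j k * ∫ ω, Z ω j * Z ω k ∂P := by
    intro w
    rw [integral_finsetSum _ fun j _ => integrable_finsetSum _ fun k _ => (i2 j k).const_mul _]
    refine Finset.sum_congr rfl fun j _ => ?_
    rw [integral_finsetSum _ fun k _ => (i2 j k).const_mul _]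
    simp_rw [integral_const_mul]
  have i7 : ∫ ω, ∑ j, ∑ k, W j k * (Z ω j * Z ω k) ∂P =
      ∑ j, ∑ k, W j k * ∫ ω, Z ω j * Z ω k ∂P := i6 fun j k => W j k
  have e1 : ∫ ω, limitLoss v c (Z ω) A V 0 ∂P =
      (v - 2 * ∑ j, (Aᵀ *ᵥ c) j * (∫ ω, Z ω j ∂P) +
        ∑ j, ∑ k, W j k * ∫ ω, Z ω j * Z ω k ∂P) / 2 := by
    simp only [limitLoss, Matrix.zero_apply, zero_add]
    rw [integral_div, integral_add i5 i4, integral_sub (integrable_const _) (i3.const_mul _),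
      integral_const_mul, integral_finsetSum _ fun j _ => (i1 j).const_mul _, i7]
    simp_rw [integral_const_mul]
    simp
  have e2 : ∫ ω, limitLoss v c (Z ω) A V 0 ∂P - limitLoss v c b A V I =
      -(∑ j, (Aᵀ *ᵥ c) j * (∫ ω, Z ω j ∂P - b j)) +
        (∑ j, ∑ k, W j k * (∫ ω, Z ω j * Z ω k ∂P - (I j k + b j * b k))) / 2 := by
    rw [e1, limitLoss]
    simp_rw [mul_sub, Finset.sum_sub_distrib]
    ring
  rw [e2]
  have b1 : |∑ j, (Aᵀ *ᵥ c) j * (∫ ω, Z ω j ∂P - b j)| ≤ p * γ * e := by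
    refine (Finset.abs_sum_le_sum_abs _ _).trans ?_
    calc _ ≤ ∑ _j : Fin p, γ * e := Finset.sum_le_sum fun j _ => by
          rw [abs_mul]
          exact mul_le_mul (hc j) (h1 j) (abs_nonneg _) ((abs_nonneg _).trans (hc j))
      _ = _ := by simp; ring
  have b2 : |∑ j, ∑ k, W j k * (∫ ω, Z ω j * Z ω k ∂P - (I j k + b j * b k))| ≤
      (∑ j, ∑ k, |W j k|) * e := by
    rw [Finset.sum_mul]
    refine (Finset.abs_sum_le_sum_abs _ _).trans (Finset.sum_le_sum fun j _ => ?_)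
    rw [Finset.sum_mul]
    refine (Finset.abs_sum_le_sum_abs _ _).trans (Finset.sum_le_sum fun k _ => ?_)
    rw [abs_mul]
    exact mul_le_mul_of_nonneg_left (h2 j k) (abs_nonneg _)
  have b3 : 0 ≤ (∑ j, ∑ k, |W j k|) * e :=
    mul_nonneg (Finset.sum_nonneg fun j _ => Finset.sum_nonneg fun k _ => abs_nonneg _) he0
  have b1' := abs_le.1 b1
  have b2' := abs_le.1 b2
  rw [abs_le]
  constructor <;> linarith [b1'.1, b1'.2, b2'.1, b2'.2]

end QuadraticLoss

end

/-! ### The limiting risk on a fixed domain -/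

section

open Matrix

lemma norm_mulVec_le_sum {p : ℕ} (A : Matrix (Fin p) (Fin p) ℝ) (z : Fin p → ℝ) :
    ‖A *ᵥ z‖ ≤ (∑ j, ∑ k, |A j k|) * ‖z‖ := by
  have h0 : ∀ j, 0 ≤ ∑ k, |A j k| := fun j => Finset.sum_nonneg fun k _ => abs_nonneg _
  refine (pi_norm_le_iff_of_nonneg (mul_nonneg (Finset.sum_nonneg fun j _ => h0 j)
    (norm_nonneg _))).2 fun j => ?_
  calc ‖(A *ᵥ z) j‖ ≤ ∑ k, |A j k * z k| := by
        simp only [Real.norm_eq_abs, mulVec, dotProduct]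
        exact Finset.abs_sum_le_sum_abs _ _
    _ ≤ ∑ k, |A j k| * ‖z‖ := Finset.sum_le_sum fun k _ => by
        rw [abs_mul]
        exact mul_le_mul_of_nonneg_left (norm_le_pi_norm z k) (abs_nonneg _)
    _ = (∑ k, |A j k|) * ‖z‖ := by rw [Finset.sum_mul]
    _ ≤ _ := mul_le_mul_of_nonneg_right
        (Finset.single_le_sum (fun j _ => h0 j) (Finset.mem_univ j)) (norm_nonneg _)

lemma sq_norm_le_sum_sq {p : ℕ} (z : Fin p → ℝ) : ‖z‖ ^ 2 ≤ ∑ j, z j ^ 2 := by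
  have h0 : 0 ≤ ∑ j, z j ^ 2 := Finset.sum_nonneg fun j _ => sq_nonneg _
  have h1 : ‖z‖ ≤ √(∑ j, z j ^ 2) :=
    (pi_norm_le_iff_of_nonneg (Real.sqrt_nonneg _)).2 fun j => by
      refine Real.abs_le_sqrt ?_
      exact Finset.single_le_sum (f := fun j => z j ^ 2) (fun j _ => sq_nonneg _)
        (Finset.mem_univ j)
  calc ‖z‖ ^ 2 ≤ √(∑ j, z j ^ 2) ^ 2 := by gcongr
    _ = _ := Real.sq_sqrt h0

section FixedDomain

variable {p : ℕ} {M B : ℝ} {G : Measure ℝ} {φ : Fin p → ℝ → ℝ}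

/-- The limit, at a fixed size of the domain, of the rescaled risk of the maximum likelihood
estimator along the local alternatives in direction `T`. -/
noncomputable def fixedRisk (M : ℝ) (G : Measure ℝ) (φ : Fin p → ℝ → ℝ) (T : ℝ → ℝ) : ℝ :=
  limitLoss Var[T; G] (fun j => cov[φ j, T; G])
    (fun j => cov[smooth M (postMean M G φ j), T; G]) (info M G φ)⁻¹
    (Matrix.of fun j k => cov[φ j, φ k; G]) (info M G φ)

lemma ae_pi_forall_mem {P : Measure ℝ} [IsProbabilityMeasure P] {S : Set ℝ}
    (h : ∀ᵐ x ∂P, x ∈ S) (n : ℕ) :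
    ∀ᵐ x : Fin n → ℝ ∂(Measure.pi fun _ => P), ∀ i, x i ∈ S :=
  ae_all_iff.2 fun i =>
    (measurePreserving_eval (fun _ : Fin n => P) i).quasiMeasurePreserving.ae h

variable [IsProbabilityMeasure G]

lemma norm_meanScore_le (hM : 0 < M) (hB0 : 0 ≤ B) (hB : ∀ j, ∀ᵐ μ ∂G, |φ j μ| ≤ B) {n : ℕ}
    (x : Fin n → ℝ) : ‖meanScore M G φ x‖ ≤ 2 * B := by
  refine (pi_norm_le_iff_of_nonneg (by positivity)).2 fun j => ?_
  refine (abs_sub _ _).trans ?_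
  have h1 := abs_avg_le (x := x) hB0 fun i => abs_postMean_le (M := M) hM hB j (x i)
  have h2 := abs_integral_le_of_abs_le (hB j)
  linarith

lemma measurable_meanScore (hM : 0 < M) (hφ : ∀ j, AEMeasurable (φ j) G)
    (hB : ∀ j, ∀ᵐ μ ∂G, |φ j μ| ≤ B) {n : ℕ} (j : Fin p) :
    Measurable fun x : Fin n → ℝ => meanScore M G φ x j :=
  (measurable_avg (continuous_postMean hM hφ hB j).measurable).sub_const _

set_option maxHeartbeats 1600000 in
/-- Along local alternatives, the rescaled relative entropy risk of the maximum likelihood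
estimator converges, uniformly over uniformly bounded directions. -/
theorem eventually_abs_integral_tiltEntropy_sub_le (hM : 0 < M) (hφ : ∀ j, Continuous (φ j))
    (hB0 : 0 ≤ B) (hB : ∀ j, ∀ᵐ μ ∂G, |φ j μ| ≤ B) (hG : ∀ᵐ μ ∂G, μ ∈ Set.Ioo (-M) M)
    (hsep : ∀ v : Fin p → ℝ, v ≠ 0 → ∀ c : ℝ, ¬ lin φ v =ᵐ[G] fun _ => c)
    {l : ℝ} (hl : 0 < l) (hpos : ∀ v, l * ‖v‖ ^ 2 ≤ v ⬝ᵥ info M G φ *ᵥ v)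
    {δ₀ : ℝ} (hδ₀ : 0 < δ₀) (L B₀ : ℝ) {ε : ℝ} (hε : 0 < ε) :
    ∀ᶠ n : ℕ in atTop, ∀ T : ℝ → ℝ, AEMeasurable T G → (∀ᵐ μ ∂G, |T μ| ≤ B₀) →
      ∀ est : (Fin n → ℝ) → (Fin p → ℝ), Measurable est →
      (∀ x, (∀ i, x i ∈ domain M) → ‖est x‖ ≤ L) →
      (∀ δ, 0 < δ → δ ≤ δ₀ → ∀ x, (∀ i, x i ∈ domain M) →
        (∀ η : Fin p → ℝ, δ ≤ ‖η‖ → avg x (logRatio M G φ η) < 0) →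
        ‖est x‖ ≤ δ ∧
          ∀ η, avg x (logRatio M G φ η) ≤ avg x (logRatio M G φ (est x))) →
      |∫ x, n * tiltEntropy G (fun μ => T μ / √n) (lin φ (est x))
        ∂(Measure.pi fun _ : Fin n => obsLaw M (G.tilted fun μ => T μ / √n)) -
        fixedRisk M G φ T| ≤ ε := by
  have hφm := fun j => (hφ j).aemeasurable (μ := G)
  obtain ⟨c, ε₀, hc, hε₀, hloc⟩ := exists_abs_kl_sub_le hM hφm hB0 hB hl hpos
  set A := (info M G φ)⁻¹ with hA
  set α := ∑ j, ∑ k, |A j k| with hα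
  have hα0 : 0 ≤ α := Finset.sum_nonneg fun j _ => Finset.sum_nonneg fun k _ => abs_nonneg _
  -- a bound for the second moments of the coordinates of the score
  set m₂ := 2 * B ^ 2 + (2 * B * B₀) ^ 2 + 1 with hm₂
  have hm₂0 : 0 < m₂ := by positivity
  set Q := B₀ ^ 2 + α ^ 2 * (p * m₂) with hQ
  have hQ0 : 0 ≤ Q := by positivity
  set ε' := min (min ε₀ 1) (min δ₀ (ε / (3 * (c * Q + 1)))) with hε'
  have hε'0 : 0 < ε' := by
    refine lt_min (lt_min hε₀ one_pos) (lt_min hδ₀ ?_)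
    positivity
  have hε'1 : ε' ≤ 1 := (min_le_left _ _).trans (min_le_right _ _)
  have hε'2 : ε' ≤ ε₀ := (min_le_left _ _).trans (min_le_left _ _)
  have hε'3 : ε' ^ 2 ≤ δ₀ := by
    have h1 : ε' ≤ δ₀ := (min_le_right _ _).trans (min_le_left _ _)
    nlinarith
  have hε'4 : c * ε' * Q ≤ ε / 3 := by
    have h1 : ε' ≤ ε / (3 * (c * Q + 1)) := (min_le_right _ _).trans (min_le_right _ _)
    rw [le_div_iff₀ (by positivity)] at h1
    linarith
  -- an a priori bound for the losses, used on the exceptional event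
  set K := 2 * (1 + p * B * L) + (p * B * (α * (2 * B)) + 1) ^ 2 with hK
  obtain ⟨N, ρ, εc, hεc, hρm, hρ1, hcons⟩ := exists_consistency_tests hM hφ hB0 hB hG hsep
    (by positivity : 0 < ε' ^ 2)
  set e := min εc (ε' ^ 2 / (α + 1)) with he
  have he0 : 0 < e := lt_min hεc (by positivity)
  have heα : α * e ≤ ε' ^ 2 := by
    have h1 : e ≤ ε' ^ 2 / (α + 1) := min_le_right _ _
    rw [le_div_iff₀ (by positivity)] at h1
    linarith
  have he1 : e ≤ ε' ^ 2 :=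
    (min_le_right _ _).trans (div_le_self (by positivity) (by linarith))
  -- The statistics whose empirical means have to be close to their means: the consistency tests,
  -- the posterior means of the features and the entries of the curvature.
  set f : Fin N ⊕ Fin p ⊕ (Fin p × Fin p) → ℝ → ℝ :=
    Sum.elim ρ (Sum.elim (postMean M G φ) fun jk => curvature M G φ jk.1 jk.2) with hf
  have hfm : ∀ k, Measurable (f k) := by
    rintro (k | j | ⟨j, k⟩)
    · exact hρm k
    · exact (continuous_postMean hM hφm hB j).measurable
    · exact (continuous_curvature hM hφm hB j k).measurable
  have hfF : ∀ k x, |f k x| ≤ 1 + B + 4 * B ^ 2 := by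
    have hB2 : 0 ≤ B ^ 2 := sq_nonneg B
    rintro (k | j | ⟨j, k⟩) x
    · exact (hρ1 k x).trans (by linarith)
    · exact (abs_postMean_le hM hB j x).trans (by linarith)
    · exact (abs_curvature_le hM hφm hB j k x).trans (by linarith)
  have hbad := eventually_nat_mul_measureReal_le (G := G) hM hfm hfF B₀ he0
    (by positivity : 0 < ε / (3 * (|K| + 1)))
  set w : ℝ := 18 * B * B₀ ^ 2 +
    (66 * B ^ 2 * B₀ + 18 * B * B₀ ^ 2 * (44 * B * B₀ + 18 * B * B₀ ^ 2)) with hw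
  set V : Matrix (Fin p) (Fin p) ℝ := Matrix.of fun j k => cov[φ j, φ k; G] with hV
  set β := p * (α * (2 * B * B₀)) + ∑ j, ∑ k, |(Aᵀ * V * A) j k| with hβ
  have l1 : ∀ᶠ n : ℕ in atTop, B₀ / √(n : ℝ) < ε' ^ 2 :=
    (tendsto_div_sqrt_nat B₀).eventually (gt_mem_nhds (by positivity))
  have l2 : ∀ᶠ n : ℕ in atTop, w / √(n : ℝ) < 1 :=
    (tendsto_div_sqrt_nat w).eventually (gt_mem_nhds one_pos)
  have l3 : ∀ᶠ n : ℕ in atTop, β * (w / √(n : ℝ)) < ε / 3 := by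
    have := (tendsto_div_sqrt_nat w).const_mul β
    rw [mul_zero] at this
    exact this.eventually (gt_mem_nhds (by positivity))
  filter_upwards [hbad, l1, l2, l3, eventually_gt_atTop 0] with n hbad h1 h2 h3 hn
    T hT hb est hest hestL hmle
  have hn' : (0 : ℝ) < n := by exact_mod_cast hn
  have hr : 0 < √(n : ℝ) := Real.sqrt_pos.2 hn'
  have hrn : √(n : ℝ) ^ 2 = n := Real.sq_sqrt hn'.le
  have hB₀ : 0 ≤ B₀ := by
    obtain ⟨x, hx⟩ := hb.exists
    exact (abs_nonneg _).trans hx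
  have hs := ae_abs_div_sqrt_le hb n
  have hbad := hbad T hT hb
  set s := B₀ / √(n : ℝ) with hsdef
  have hs0 : 0 ≤ s := by positivity
  have hs1 : s ≤ 1 := h1.le.trans (pow_le_one₀ hε'0.le hε'1)
  set a : ℝ → ℝ := fun μ => T μ / √(n : ℝ) with ha
  have ham : AEMeasurable a G := hT.div_const _
  have hp1 : IsProbabilityMeasure (G.tilted a) :=
    isProbabilityMeasure_tilted (integrable_exp_of_abs_le ham hs)
  have hp2 := isProbabilityMeasure_obsLaw (G := G.tilted a) hM
  have hp3 := isProbabilityMeasure_obsLaw (G := G) hM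
  set P := Measure.pi fun _ : Fin n => obsLaw M (G.tilted a) with hP
  have hdom : ∀ᵐ x ∂P, ∀ i, x i ∈ domain M := ae_pi_forall_mem (ae_obsLaw_mem M _) n
  -- The exceptional event, of probability `o(1 / n)`.
  set bad : Set (Fin n → ℝ) :=
    {x | ∃ k, e < |avg x (f k) - ∫ y, f k y ∂(obsLaw M G)|} with hbaddef
  have hbadm : MeasurableSet bad := by
    have : bad = ⋃ k, {x | e < |avg x (f k) - ∫ y, f k y ∂(obsLaw M G)|} := by
      ext x; simp [hbaddef]
    rw [this]
    exact MeasurableSet.iUnion fun k => measurableSet_lt measurable_const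
      (_root_.measurable_abs.comp ((measurable_avg (hfm k)).sub_const _))
  set Z : (Fin n → ℝ) → Fin p → ℝ := fun x j => √(n : ℝ) * meanScore M G φ x j with hZ
  have hZm : ∀ j, MemLp (fun x => Z x j) 2 P := fun j => by
    refine memLp_of_abs_le (b := √(n : ℝ) * (2 * B))
      ((measurable_meanScore hM hφm hB j).const_mul _).aemeasurable
      (Eventually.of_forall fun x => ?_)
    simp only [hZ]
    rw [abs_mul, abs_of_pos hr]
    exact mul_le_mul_of_nonneg_left
      ((norm_le_pi_norm (meanScore M G φ x) j).trans (norm_meanScore_le hM hB0 hB x)) hr.le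
  have hAZ : ∀ x, A *ᵥ Z x = √(n : ℝ) • oneStep M G φ x := fun x => by
    have : Z x = √(n : ℝ) • meanScore M G φ x := rfl
    rw [this, mulVec_smul, oneStep]
  have hone : ∀ x : Fin n → ℝ, ‖oneStep M G φ x‖ ≤ α * (2 * B) := fun x =>
    (norm_mulVec_le_sum _ _).trans
      (mul_le_mul_of_nonneg_left (norm_meanScore_le hM hB0 hB x) hα0)
  -- moments of the score
  have hmom : ∀ j k, |∫ x, Z x j ∂P - cov[smooth M (postMean M G φ j), T; G]| ≤ w / √(n : ℝ) ∧
      |∫ x, Z x j * Z x k ∂P - (info M G φ j k + cov[smooth M (postMean M G φ j), T; G] *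
        cov[smooth M (postMean M G φ k), T; G])| ≤ w / √(n : ℝ) := by
    intro j k
    have h4 := abs_integral_scaled_avg_le hM hn hT hb hs1
      (continuous_postMean hM hφm hB j).measurable (abs_postMean_le hM hB j)
      (continuous_postMean hM hφm hB k).measurable (abs_postMean_le hM hB k)
    rw [integral_postMean hM hφm hB, integral_postMean hM hφm hB] at h4
    refine ⟨h4.1.trans ?_, h4.2.trans ?_⟩
    · refine div_le_div_of_nonneg_right ?_ hr.le
      rw [hw]; exact le_add_of_nonneg_right (by positivity)
    · refine div_le_div_of_nonneg_right ?_ hr.le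
      rw [hw]; exact le_add_of_nonneg_left (by positivity)
  have hsm : ∀ j, |cov[smooth M (postMean M G φ j), T; G]| ≤ 2 * B * B₀ := fun j =>
    abs_covariance_le
      (measurable_smooth hM (continuous_postMean hM hφm hB j).measurable).aemeasurable hT
      (Eventually.of_forall (abs_smooth_le hM (continuous_postMean hM hφm hB j).measurable
        (abs_postMean_le hM hB j))) hb
  have hinfo : ∀ j, |info M G φ j j| ≤ 2 * B ^ 2 := fun j => by
    have := abs_covariance_le (G := obsLaw M G) (continuous_postMean hM hφm hB j).aemeasurable
      (continuous_postMean hM hφm hB j).aemeasurable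
      (Eventually.of_forall (abs_postMean_le hM hB j))
      (Eventually.of_forall (abs_postMean_le hM hB j))
    rw [info, Matrix.of_apply]
    linarith
  have hZ2 : ∀ j, ∫ x, Z x j * Z x j ∂P ≤ m₂ := fun j => by
    have h4 := (abs_le.1 (hmom j j).2).2
    have h5 := (abs_le.1 (hinfo j)).2
    have h6 : cov[smooth M (postMean M G φ j), T; G] * cov[smooth M (postMean M G φ j), T; G] ≤
        (2 * B * B₀) ^ 2 := by
      rw [← sq, ← sq_abs]
      exact pow_le_pow_left₀ (abs_nonneg _) (hsm j) 2
    linarith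
  have hZi : ∀ j, Integrable (fun x => Z x j * Z x j) P := fun j => (hZm j).integrable_mul (hZm j)
  have hZsum : ∫ x, ∑ j, Z x j * Z x j ∂P ≤ p * m₂ := by
    rw [integral_finsetSum _ fun j _ => hZi j]
    calc _ ≤ ∑ _j : Fin p, m₂ := Finset.sum_le_sum fun j _ => hZ2 j
      _ = _ := by simp
  -- the quadratic loss of the one-step approximation
  set qf : (Fin n → ℝ) → ℝ := fun x =>
    limitLoss Var[T; G] (fun j => cov[φ j, T; G]) (Z x) A V 0 with hqf
  have hq : ∀ x, qf x = n * (Var[fun μ => lin φ (oneStep M G φ x) μ - a μ; G] / 2) := by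
    intro x
    have h4 := variance_lin_mulVec_sub hφm hB (memLp_of_abs_le hT hb) A (Z x)
    simp only [hqf]
    rw [← h4, hAZ]
    have h5 : (fun μ => lin φ (√(n : ℝ) • oneStep M G φ x) μ - T μ) =
        fun μ => √(n : ℝ) * (lin φ (oneStep M G φ x) μ - a μ) := by
      funext μ
      simp only [ha, lin, mul_sub, Finset.mul_sum, Pi.smul_apply, smul_eq_mul]
      congr 1
      · exact Finset.sum_congr rfl fun j _ => by ring
      · field_simp
    rw [h5, variance_const_mul, hrn]
    ring
  have hqi : Integrable qf P := by
    simp only [hqf, limitLoss, Matrix.zero_apply, zero_add]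
    refine Integrable.div_const (((integrable_const _).sub
      ((integrable_finsetSum _ fun j _ => ((hZm j).integrable one_le_two).const_mul _).const_mul
        _)).add ?_) _
    exact integrable_finsetSum _ fun j _ => integrable_finsetSum _ fun k _ =>
      ((hZm j).integrable_mul (hZm k)).const_mul _
  have hqE : |∫ x, qf x ∂P - fixedRisk M G φ T| ≤ β * (w / √(n : ℝ)) := by
    have hw0 : 0 ≤ w := by positivity
    refine abs_integral_limitLoss_sub_le hZm _ (fun j => ?_) (by positivity)
      (fun j => (hmom j j).1) fun j k => (hmom j k).2
    have h4 : |(Aᵀ *ᵥ fun j => cov[φ j, T; G]) j| ≤ ‖Aᵀ *ᵥ fun j => cov[φ j, T; G]‖ :=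
      norm_le_pi_norm (Aᵀ *ᵥ fun j => cov[φ j, T; G]) j
    refine h4.trans ((norm_mulVec_le_sum _ _).trans ?_)
    have h5 : ∑ j, ∑ k, |Aᵀ j k| = α := by
      rw [Finset.sum_comm]; rfl
    rw [h5]
    refine mul_le_mul_of_nonneg_left ?_ hα0
    exact (pi_norm_le_iff_of_nonneg (by positivity)).2 fun k =>
      abs_covariance_le (hφm k) hT (hB k) hb
  -- the loss itself
  set kf : (Fin n → ℝ) → ℝ := fun x => n * tiltEntropy G a (lin φ (est x)) with hkf
  have hkm : Measurable kf :=
    ((continuous_tiltEntropy hφm hB hB0 ham hs).measurable.comp hest).const_mul _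
  have hkb : ∀ x, (∀ i, x i ∈ domain M) → |kf x| ≤ n * (2 * (1 + p * B * L)) := by
    intro x hx
    have h4 := tiltEntropy_bounds ham hs (aemeasurable_lin hφm (est x))
      (ae_abs_lin_le hB (est x))
    have h5 : p * B * ‖est x‖ ≤ p * B * L :=
      mul_le_mul_of_nonneg_left (hestL x hx) (by positivity)
    simp only [hkf]
    rw [abs_of_nonneg (mul_nonneg hn'.le h4.1)]
    exact mul_le_mul_of_nonneg_left (by linarith [h4.2]) hn'.le
  have hki : Integrable kf P := integrable_of_abs_le hkm.aemeasurable (hdom.mono hkb)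
  have hqb : ∀ x, |qf x| ≤ n * (p * B * (α * (2 * B)) + 1) ^ 2 := by
    intro x
    have h4 : ∀ᵐ μ ∂G, |lin φ (oneStep M G φ x) μ - a μ| ≤ p * B * (α * (2 * B)) + 1 := by
      filter_upwards [hs, ae_abs_lin_le hB (oneStep M G φ x)] with μ h4 h5
      have h6 : p * B * ‖oneStep M G φ x‖ ≤ p * B * (α * (2 * B)) :=
        mul_le_mul_of_nonneg_left (hone x) (by positivity)
      exact (abs_sub _ _).trans (by linarith)
    have h5 := abs_covariance_le ((aemeasurable_lin hφm _).sub ham)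
      ((aemeasurable_lin hφm _).sub ham) h4 h4
    rw [hq, abs_mul, abs_of_pos hn']
    refine mul_le_mul_of_nonneg_left ?_ hn'.le
    have h6 : Var[fun μ => lin φ (oneStep M G φ x) μ - a μ; G] =
      cov[lin φ (oneStep M G φ x) - a, lin φ (oneStep M G φ x) - a; G] :=
      (covariance_self ((aemeasurable_lin hφm _).sub ham)).symm
    rw [h6, abs_div, abs_two, div_le_iff₀ two_pos]
    linarith
  -- Off the exceptional event, the estimator is a maximizer close to the origin, and the loss is
  -- its quadratic approximation up to a small multiple of `B₀²` plus the squared score; on that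
  -- event, the a priori bound `n * K` is good enough.
  have hD : ∀ x, (∀ i, x i ∈ domain M) →
      |kf x - qf x| ≤ c * ε' * (B₀ ^ 2 + α ^ 2 * ∑ j, Z x j * Z x j) +
        bad.indicator (fun _ => n * |K|) x := by
    intro x hx
    have hsum0 : 0 ≤ ∑ j, Z x j * Z x j := Finset.sum_nonneg fun j _ => mul_self_nonneg _
    by_cases hxb : x ∈ bad
    · rw [Set.indicator_of_mem hxb]
      have h4 : |kf x - qf x| ≤ n * K := by
        refine (abs_sub _ _).trans ?_
        rw [hK, mul_add]
        exact add_le_add (hkb x hx) (hqb x)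
      have h5 : n * K ≤ n * |K| := mul_le_mul_of_nonneg_left (le_abs_self _) hn'.le
      have h6 : 0 ≤ c * ε' * (B₀ ^ 2 + α ^ 2 * ∑ j, Z x j * Z x j) := by positivity
      linarith
    · rw [Set.indicator_of_notMem hxb, add_zero]
      have hgood : ∀ k, |avg x (f k) - ∫ y, f k y ∂(obsLaw M G)| ≤ e := by
        intro k
        by_contra! h
        exact hxb ⟨k, h⟩
      have hneg := hcons n hn x hx fun k => (hgood (Sum.inl k)).trans (min_le_left _ _)
      obtain ⟨hsmall, hmax⟩ := hmle (ε' ^ 2) (by positivity) hε'3 x hx hneg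
      have hms : ‖meanScore M G φ x‖ ≤ e := by
        refine (pi_norm_le_iff_of_nonneg he0.le).2 fun j => ?_
        have h4 := hgood (Sum.inr (Sum.inl j))
        simp only [hf, Sum.elim_inr, Sum.elim_inl] at h4
        rw [integral_postMean hM hφm hB] at h4
        exact h4
      have hos : ‖oneStep M G φ x‖ ≤ ε' ^ 2 :=
        (norm_mulVec_le_sum _ _).trans ((mul_le_mul_of_nonneg_left hms hα0).trans heα)
      have h4 := hloc ε' hε'0 hε'2 n hn x a s (est x) ham hs h1.le hsmall hos
        (fun j k => by
          have h4 := hgood (Sum.inr (Sum.inr (j, k)))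
          simp only [hf, Sum.elim_inr] at h4
          rw [integral_curvature hM hφm hB, sub_neg_eq_add] at h4
          exact h4.trans he1) (hmax _)
      have h5 : kf x - qf x = n * (tiltEntropy G a (lin φ (est x)) -
          Var[fun μ => lin φ (oneStep M G φ x) μ - a μ; G] / 2) := by
        rw [hq]; simp only [hkf]; ring
      rw [h5, abs_mul, abs_of_pos hn']
      refine (mul_le_mul_of_nonneg_left h4 hn'.le).trans ?_
      have h6 : n * s ^ 2 = B₀ ^ 2 := by rw [hsdef, div_pow, hrn]; field_simp
      have h7 : n * ‖oneStep M G φ x‖ ^ 2 ≤ α ^ 2 * ∑ j, Z x j * Z x j := by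
        have h8 : n * ‖oneStep M G φ x‖ ^ 2 = ‖A *ᵥ Z x‖ ^ 2 := by
          rw [hAZ, norm_smul, mul_pow, Real.norm_eq_abs, sq_abs, hrn]
        rw [h8]
        calc ‖A *ᵥ Z x‖ ^ 2 ≤ (α * ‖Z x‖) ^ 2 :=
              pow_le_pow_left₀ (norm_nonneg _) (norm_mulVec_le_sum _ _) 2
          _ = α ^ 2 * ‖Z x‖ ^ 2 := by ring
          _ ≤ α ^ 2 * ∑ j, Z x j ^ 2 :=
              mul_le_mul_of_nonneg_left (sq_norm_le_sum_sq _) (sq_nonneg _)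
          _ = _ := by simp_rw [sq]
      have h8 : n * (c * ε' * (s ^ 2 + ‖oneStep M G φ x‖ ^ 2)) =
          c * ε' * (n * s ^ 2 + n * ‖oneStep M G φ x‖ ^ 2) := by ring
      rw [h8, h6]
      exact mul_le_mul_of_nonneg_left (by linarith) (by positivity)
  have hDE : |∫ x, kf x ∂P - ∫ x, qf x ∂P| ≤ c * ε' * Q + |K| * (n * P.real bad) := by
    rw [← integral_sub hki hqi]
    have i1 : Integrable (fun x => c * ε' * (B₀ ^ 2 + α ^ 2 * ∑ j, Z x j * Z x j)) P :=
      ((integrable_const _).add ((integrable_finsetSum _ fun j _ => hZi j).const_mul _)).const_mul _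
    have i2 : Integrable (bad.indicator fun _ => n * |K|) P := (integrable_const _).indicator hbadm
    refine (abs_integral_le_integral_abs).trans ((integral_mono_ae (hki.sub hqi).abs (i1.add i2)
      (hdom.mono hD)).trans ?_)
    have h4 := integral_add i1 i2
    simp only [Pi.add_apply]
    rw [h4, integral_indicator_const _ hbadm, integral_const_mul,
      integral_add (integrable_const _) ((integrable_finsetSum _ fun j _ => hZi j).const_mul _),
      integral_const_mul, integral_const, probReal_univ, one_smul, smul_eq_mul]
    have h5 : c * ε' * (B₀ ^ 2 + α ^ 2 * ∫ x, ∑ j, Z x j * Z x j ∂P) ≤ c * ε' * Q := by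
      refine mul_le_mul_of_nonneg_left ?_ (by positivity)
      rw [hQ]
      have := mul_le_mul_of_nonneg_left hZsum (sq_nonneg α)
      linarith
    linarith
  have hbad' : |K| * (n * P.real bad) ≤ ε / 3 := by
    refine (mul_le_mul_of_nonneg_left hbad (abs_nonneg _)).trans ?_
    have h4 : |K| * (ε / (3 * (|K| + 1))) = ε / 3 * (|K| / (|K| + 1)) := by field_simp
    rw [h4]
    have h5 : |K| / (|K| + 1) ≤ 1 := by
      rw [div_le_one (by positivity)]; linarith
    have := mul_le_mul_of_nonneg_left h5 (by positivity : 0 ≤ ε / 3)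
    linarith
  have h4 := abs_sub_le (∫ x, kf x ∂P) (∫ x, qf x ∂P) (fixedRisk M G φ T)
  linarith

end FixedDomain

end

/-! ### Hermite functions and the Gaussian measure -/

section Hermite

open Polynomial

lemma hermiteFn_zero (x : ℝ) : hermiteFn 0 x = 1 := by simp [hermiteFn_eq]

/-- The normalized Hermite functions as real polynomials. -/
noncomputable def hermitePoly (j : ℕ) : ℝ[X] :=
  C ((-1) ^ j / √(j.factorial : ℝ)) * (hermite j).map (Int.castRingHom ℝ)

lemma eval_map_hermite (j : ℕ) (x : ℝ) :
    ((hermite j).map (Int.castRingHom ℝ)).eval x = aeval x (hermite j) := by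
  rw [eval_map, aeval_def]; rfl

lemma eval_hermitePoly (j : ℕ) (x : ℝ) : (hermitePoly j).eval x = hermiteFn j x := by
  rw [hermiteFn_eq, hermitePoly, eval_mul, eval_C, eval_map_hermite]
  ring

lemma integrable_pow_gaussian (k : ℕ) : Integrable (fun x : ℝ => x ^ k) (gaussianReal 0 1) := by
  have h := (memLp_id_gaussianReal (μ := 0) (v := 1) k).integrable_norm_pow' (p := k)
  refine (integrable_norm_iff (by fun_prop)).1 ?_
  simpa using h

lemma integrable_eval_gaussian (P : ℝ[X]) : Integrable (fun x => P.eval x) (gaussianReal 0 1) := by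
  simp_rw [eval_eq_sum_range]
  exact integrable_finsetSum _ fun k _ => (integrable_pow_gaussian k).const_mul _

lemma memLp_eval_gaussian (P : ℝ[X]) : MemLp (fun x => P.eval x) 2 (gaussianReal 0 1) := by
  refine (memLp_two_iff_integrable_sq (by fun_prop)).2 ?_
  have := integrable_eval_gaussian (P ^ 2)
  simpa using this

lemma memLp_hermiteFn (j : ℕ) : MemLp (hermiteFn j) 2 (gaussianReal 0 1) := by
  have := memLp_eval_gaussian (hermitePoly j)
  simpa only [eval_hermitePoly] using this

/-- Gaussian integration by parts. -/
lemma integral_mul_eval_gaussian (P : ℝ[X]) :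
    ∫ x, x * P.eval x ∂(gaussianReal 0 1) = ∫ x, (derivative P).eval x ∂(gaussianReal 0 1) := by
  have hd : ∀ x, HasDerivAt (fun x => gaussianPDFReal 0 1 x * P.eval x)
      (gaussianPDFReal 0 1 x * ((derivative P).eval x - x * P.eval x)) x := by
    intro x
    have h1 : HasDerivAt (fun x : ℝ => gaussianPDFReal 0 1 x) (gaussianPDFReal 0 1 x * (-x)) x := by
      have hpdf : ∀ x, gaussianPDFReal 0 1 x = (√(2 * Real.pi))⁻¹ * Real.exp (-x ^ 2 / 2) := by
        intro x; simp [gaussianPDFReal]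
      simp only [hpdf]
      have h2 : HasDerivAt (fun x : ℝ => -x ^ 2 / 2) (-x) x :=
        ((hasDerivAt_pow 2 x).fun_neg.div_const 2).congr_deriv (by simp; ring)
      exact (h2.exp.const_mul _).congr_deriv (by ring)
    exact (h1.mul (P.hasDerivAt x)).congr_deriv (by ring)
  have hi : ∀ Q : ℝ[X], Integrable (fun x => gaussianPDFReal 0 1 x * Q.eval x) := by
    intro Q
    have h1 := integrable_eval_gaussian Q
    rw [gaussianReal_of_var_ne_zero _ one_ne_zero, integrable_withDensity_iff_integrable_smul'
      (measurable_gaussianPDF _ _) (Eventually.of_forall fun x => gaussianPDF_lt_top)] at h1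
    refine h1.congr (Eventually.of_forall fun x => ?_)
    simp [toReal_gaussianPDF]
  have hQ : ∀ x, (derivative P - X * P).eval x = (derivative P).eval x - x * P.eval x := by simp
  have h1 := integral_eq_zero_of_hasDerivAt_of_integrable hd
    (by simp_rw [← hQ]; exact hi (derivative P - X * P)) (hi P)
  have h2 := integral_gaussianReal_eq_integral_smul (μ := 0) (v := 1) one_ne_zero
    (f := fun x => (derivative P).eval x - x * P.eval x)
  simp only [smul_eq_mul] at h2
  rw [h1] at h2
  have h3 := integrable_eval_gaussian (X * P)
  simp only [eval_mul, eval_X] at h3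
  rw [integral_sub (integrable_eval_gaussian _) h3] at h2
  linarith

lemma derivative_hermite_succ (n : ℕ) :
    derivative (hermite (n + 1)) = (n + 1 : ℤ[X]) * hermite n := by
  induction n with
  | zero => simp
  | succ n ih =>
    rw [hermite_succ (n + 1), derivative_sub, derivative_mul, ih, derivative_X, derivative_mul]
    have : derivative ((n : ℤ[X]) + 1) = 0 := by
      have : ((n : ℤ[X]) + 1) = ((n + 1 : ℕ) : ℤ[X]) := by push_cast; ring
      rw [this, derivative_natCast]
    rw [this, hermite_succ n]
    push_cast
    ring

/-- Real-coefficient version of the probabilists' Hermite polynomials. -/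
noncomputable def realHermite (n : ℕ) : ℝ[X] := (hermite n).map (Int.castRingHom ℝ)

lemma realHermite_succ (n : ℕ) :
    realHermite (n + 1) = X * realHermite n - derivative (realHermite n) := by
  rw [realHermite, hermite_succ, Polynomial.map_sub, Polynomial.map_mul, map_X, ← derivative_map]
  rfl

lemma derivative_realHermite_succ (n : ℕ) :
    derivative (realHermite (n + 1)) = (n + 1 : ℝ[X]) * realHermite n := by
  rw [realHermite, derivative_map, derivative_hermite_succ, Polynomial.map_mul]
  simp [realHermite]

lemma integral_realHermite_succ_mul (n : ℕ) (P : ℝ[X]) :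
    ∫ x, (realHermite (n + 1)).eval x * P.eval x ∂(gaussianReal 0 1) =
      ∫ x, (realHermite n).eval x * (derivative P).eval x ∂(gaussianReal 0 1) := by
  have h1 := integral_mul_eval_gaussian (realHermite n * P)
  have i1 := integrable_eval_gaussian (derivative (realHermite n) * P)
  have i2 := integrable_eval_gaussian (realHermite n * derivative P)
  have i3 := integrable_eval_gaussian (X * (realHermite n * P))
  simp only [derivative_mul, eval_add, eval_mul, eval_X] at h1 i1 i2 i3
  rw [integral_add i1 i2] at h1
  have h2 : ∀ x, (realHermite (n + 1)).eval x * P.eval x =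
      x * ((realHermite n).eval x * P.eval x) -
        (derivative (realHermite n)).eval x * P.eval x := by
    intro x
    rw [realHermite_succ]; simp; ring
  simp_rw [h2]
  rw [integral_sub i3 i1, h1]
  ring

lemma integral_realHermite_mul (n m : ℕ) :
    ∫ x, (realHermite n).eval x * (realHermite m).eval x ∂(gaussianReal 0 1) =
      if n = m then (n.factorial : ℝ) else 0 := by
  have h0 : realHermite 0 = 1 := by simp [realHermite]
  induction n generalizing m with
  | zero =>
    cases m with
    | zero => simp [h0]
    | succ m =>
      have := integral_realHermite_succ_mul m 1
      simp only [derivative_one, eval_zero, mul_zero, integral_zero] at this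
      simp_rw [mul_comm ((realHermite 0).eval _), h0]
      simpa using this
  | succ n ih =>
    cases m with
    | zero =>
      have := integral_realHermite_succ_mul n 1
      simp only [derivative_one, eval_zero, mul_zero, integral_zero] at this
      rw [h0]
      simpa using this
    | succ m =>
      rw [integral_realHermite_succ_mul, derivative_realHermite_succ]
      have h2 : ∀ x, (realHermite n).eval x * ((m + 1 : ℝ[X]) * realHermite m).eval x =
          (m + 1 : ℝ) * ((realHermite n).eval x * (realHermite m).eval x) := by
        intro x; simp; ring
      simp_rw [h2]
      rw [integral_const_mul, ih]
      by_cases h : n = m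
      · subst h; simp [Nat.factorial_succ]
      · simp [h]

lemma hermiteFn_eq_realHermite (j : ℕ) (x : ℝ) :
    hermiteFn j x = (-1) ^ j / √(j.factorial : ℝ) * (realHermite j).eval x := by
  rw [hermiteFn_eq, realHermite, eval_map_hermite]; ring

/-- The normalized Hermite functions are orthonormal in `L²(N(0, 1))`. -/
lemma integral_hermiteFn_mul (i j : ℕ) :
    ∫ x, hermiteFn i x * hermiteFn j x ∂(gaussianReal 0 1) = if i = j then 1 else 0 := by
  have h1 : ∀ x, hermiteFn i x * hermiteFn j x =
      ((-1) ^ i / √(i.factorial : ℝ) * ((-1) ^ j / √(j.factorial : ℝ))) *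
        ((realHermite i).eval x * (realHermite j).eval x) := by
    intro x; rw [hermiteFn_eq_realHermite, hermiteFn_eq_realHermite]; ring
  simp_rw [h1]
  rw [integral_const_mul, integral_realHermite_mul]
  by_cases h : i = j
  · subst h
    have h2 : (0 : ℝ) < i.factorial := by exact_mod_cast i.factorial_pos
    have h3 : √(i.factorial : ℝ) * √(i.factorial : ℝ) = i.factorial := Real.mul_self_sqrt h2.le
    have h4 : ((-1 : ℝ) ^ i) * (-1) ^ i = 1 := by rw [← mul_pow]; simp
    have h5 : √(i.factorial : ℝ) ≠ 0 := (Real.sqrt_pos.2 h2).ne'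
    simp only [if_true]
    rw [div_mul_div_comm, h4, h3]
    field_simp
  · simp [h]

/-- The Ornstein–Uhlenbeck averages of a Hermite polynomial. -/
lemma integral_realHermite_rotate {ρ s : ℝ} (h : ρ ^ 2 + s ^ 2 = 1) (n : ℕ) (y : ℝ) :
    ∫ z, (realHermite n).eval (ρ * y + s * z) ∂(gaussianReal 0 1) =
      ρ ^ n * (realHermite n).eval y := by
  have h0 : realHermite 0 = 1 := by simp [realHermite]
  have hcomp : ∀ (P : ℝ[X]) (z : ℝ), P.eval (ρ * y + s * z) =
      (P.comp (C (ρ * y) + C s * X)).eval z := by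
    intro P z; simp
  have step : ∀ n, ∫ z, (realHermite (n + 1)).eval (ρ * y + s * z) ∂(gaussianReal 0 1) =
      ρ * y * ∫ z, (realHermite n).eval (ρ * y + s * z) ∂(gaussianReal 0 1) -
        ρ ^ 2 * ∫ z, (derivative (realHermite n)).eval (ρ * y + s * z) ∂(gaussianReal 0 1) := by
    intro n
    have h1 := integral_mul_eval_gaussian ((realHermite n).comp (C (ρ * y) + C s * X))
    have i1 := integrable_eval_gaussian ((realHermite n).comp (C (ρ * y) + C s * X))
    have i2 := integrable_eval_gaussian (X * (realHermite n).comp (C (ρ * y) + C s * X))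
    have i3 := integrable_eval_gaussian ((derivative (realHermite n)).comp (C (ρ * y) + C s * X))
    have e1 : ∀ z, (derivative ((realHermite n).comp (C (ρ * y) + C s * X))).eval z =
        s * (derivative (realHermite n)).eval (ρ * y + s * z) := by
      intro z
      rw [derivative_comp]
      simp
    simp_rw [e1] at h1
    simp only [eval_mul, eval_X] at i2
    simp_rw [← hcomp] at h1 i1 i2 i3
    rw [integral_const_mul] at h1
    have e2 : ∀ z, (realHermite (n + 1)).eval (ρ * y + s * z) =
        ρ * y * (realHermite n).eval (ρ * y + s * z) +
          s * (z * (realHermite n).eval (ρ * y + s * z)) -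
          (derivative (realHermite n)).eval (ρ * y + s * z) := by
      intro z; rw [realHermite_succ]; simp; ring
    simp_rw [e2]
    have i4 : Integrable (fun z => ρ * y * (realHermite n).eval (ρ * y + s * z) +
        s * (z * (realHermite n).eval (ρ * y + s * z))) (gaussianReal 0 1) :=
      (i1.const_mul _).add (i2.const_mul _)
    rw [integral_sub i4 i3, integral_add (i1.const_mul _) (i2.const_mul _), integral_const_mul,
      integral_const_mul, h1]
    have : ρ ^ 2 = 1 - s ^ 2 := by linarith
    rw [this]; ring
  induction n using Nat.strong_induction_on with
  | _ n ih =>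
    match n with
    | 0 => simp [h0]
    | 1 =>
      rw [step 0, ih 0 (by omega), h0]
      simp [realHermite]
    | n + 2 =>
      rw [step (n + 1), ih (n + 1) (by omega), derivative_realHermite_succ]
      have e1 : ∀ z, ((n + 1 : ℝ[X]) * realHermite n).eval (ρ * y + s * z) =
          (n + 1) * (realHermite n).eval (ρ * y + s * z) := by intro z; simp
      simp_rw [e1]
      rw [integral_const_mul, ih n (by omega), realHermite_succ (n + 1),
        derivative_realHermite_succ]
      simp
      ring

/-- Mehler's rule: conditionally on one coordinate of a correlated Gaussian pair, the Hermite
functions of the other are multiplied by the powers of the correlation. -/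
lemma integral_hermiteFn_rotate {ρ s : ℝ} (h : ρ ^ 2 + s ^ 2 = 1) (n : ℕ) (y : ℝ) :
    ∫ z, hermiteFn n (ρ * y + s * z) ∂(gaussianReal 0 1) = ρ ^ n * hermiteFn n y := by
  simp_rw [hermiteFn_eq_realHermite]
  rw [integral_const_mul, integral_realHermite_rotate h]
  ring

/-- The three-term recurrence. The sign of the middle term is that of the convention
`H_j ∝ exp (x² / 2) (d / dx)^j exp (-x² / 2)`, in which `H_j` has leading sign `(-1)^j`. -/
lemma hermiteFn_recursion (n : ℕ) (x : ℝ) :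
    √((n : ℝ) + 2) * hermiteFn (n + 2) x =
      -(x * hermiteFn (n + 1) x) - √((n : ℝ) + 1) * hermiteFn n x := by
  have h1 : (realHermite (n + 2)).eval x =
      x * (realHermite (n + 1)).eval x - (n + 1) * (realHermite n).eval x := by
    rw [realHermite_succ, derivative_realHermite_succ]; simp
  simp_rw [hermiteFn_eq_realHermite]
  rw [h1]
  have hf : (0 : ℝ) < n.factorial := by exact_mod_cast n.factorial_pos
  have e1 : ((n + 1).factorial : ℝ) = (n + 1) * n.factorial := by
    rw [Nat.factorial_succ]; push_cast; ring
  have e2 : ((n + 2).factorial : ℝ) = (n + 2) * ((n + 1) * n.factorial) := by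
    rw [Nat.factorial_succ, Nat.cast_mul, e1]; push_cast; ring
  rw [e1, e2, Real.sqrt_mul (by positivity), Real.sqrt_mul (by positivity)]
  have p1 : 0 < √((n : ℝ) + 1) := Real.sqrt_pos.2 (by positivity)
  have p2 : 0 < √((n : ℝ) + 2) := Real.sqrt_pos.2 (by positivity)
  have p3 : 0 < √(n.factorial : ℝ) := Real.sqrt_pos.2 hf
  have q1 : √((n : ℝ) + 1) ^ 2 = n + 1 := Real.sq_sqrt (by positivity)
  field_simp
  rw [q1]
  ring

/-- On compact sets the normalized Hermite functions grow slower than any exponential. -/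
lemma exists_hermiteFn_le (R : ℝ) {c : ℝ} (hc : 1 < c) :
    ∃ A : ℝ, 0 < A ∧ ∀ n x, |x| ≤ R → |hermiteFn n x| ≤ A * c ^ n := by
  -- From index `n₀` on, `|R| ≤ (c - 1) √(n + 2)`, and the recurrence propagates the bound; before,
  -- compactness gives it.
  obtain ⟨n₀, hn₀⟩ := exists_nat_gt ((|R| / (c - 1)) ^ 2)
  have hb : ∀ n, ∃ b, ∀ x ∈ Set.Icc (-R) R, ‖hermiteFn n x‖ ≤ b := fun n =>
    isCompact_Icc.exists_bound_of_continuousOn (continuous_hermiteFn n).continuousOn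
  choose b hb using hb
  set A := 1 + ∑ n ∈ Finset.range (n₀ + 2), |b n| with hA
  have hA0 : 0 < A := by positivity
  have hsmall : ∀ n < n₀ + 2, ∀ x, |x| ≤ R → |hermiteFn n x| ≤ A * c ^ n := by
    intro n hn x hx
    have h1 : |hermiteFn n x| ≤ b n := hb n x ⟨(abs_le.1 hx).1, (abs_le.1 hx).2⟩
    have h2 : |b n| ≤ ∑ n ∈ Finset.range (n₀ + 2), |b n| :=
      Finset.single_le_sum (f := fun n => |b n|) (fun n _ => abs_nonneg _)
        (Finset.mem_range.2 hn)
    have h3 : A * 1 ≤ A * c ^ n := mul_le_mul_of_nonneg_left (one_le_pow₀ hc.le) hA0.le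
    linarith [le_abs_self (b n)]
  refine ⟨A, hA0, fun n => ?_⟩
  induction n using Nat.strong_induction_on with
  | _ n ih =>
    intro x hx
    by_cases hn : n < n₀ + 2
    · exact hsmall n hn x hx
    obtain ⟨m, rfl⟩ : ∃ m, n = m + 2 := ⟨n - 2, by omega⟩
    have h1 := ih m (by omega) x hx
    have h2 := ih (m + 1) (by omega) x hx
    have h3 := hermiteFn_recursion m x
    have p2 : 0 < √((m : ℝ) + 2) := Real.sqrt_pos.2 (by positivity)
    have hle : √((m : ℝ) + 1) ≤ √((m : ℝ) + 2) := Real.sqrt_le_sqrt (by linarith)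
    have hR : |R| ≤ (c - 1) * √((m : ℝ) + 2) := by
      have h4 : |R| / (c - 1) ≤ √((m : ℝ) + 2) := by
        refine Real.le_sqrt_of_sq_le (hn₀.le.trans ?_)
        have : (n₀ : ℝ) ≤ m := by exact_mod_cast (by omega : n₀ ≤ m)
        linarith
      rw [div_le_iff₀ (by linarith)] at h4
      linarith
    have h4 : √((m : ℝ) + 2) * |hermiteFn (m + 2) x| ≤
        |R| * (A * c ^ (m + 1)) + √((m : ℝ) + 2) * (A * c ^ m) := by
      rw [← abs_of_pos p2, ← abs_mul, h3, abs_of_pos p2]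
      refine (abs_sub _ _).trans (add_le_add ?_ ?_)
      · rw [abs_neg, abs_mul]
        exact mul_le_mul (hx.trans (le_abs_self _)) h2 (abs_nonneg _) (abs_nonneg _)
      · rw [abs_mul, abs_of_nonneg (Real.sqrt_nonneg _)]
        exact mul_le_mul hle h1 (abs_nonneg _) p2.le
    have h5 : |R| * (A * c ^ (m + 1)) ≤ (c - 1) * √((m : ℝ) + 2) * (A * c ^ (m + 1)) :=
      mul_le_mul_of_nonneg_right hR (by positivity)
    have h6 : √((m : ℝ) + 2) * |hermiteFn (m + 2) x| ≤
        √((m : ℝ) + 2) * ((c - 1) * (A * c ^ (m + 1)) + A * c ^ m) := by linarith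
    have h7 := le_of_mul_le_mul_left h6 p2
    have h8 : (c - 1) * (A * c ^ (m + 1)) + A * c ^ m ≤ A * c ^ (m + 2) := by
      have : A * c ^ (m + 2) - ((c - 1) * (A * c ^ (m + 1)) + A * c ^ m) =
        A * c ^ m * (c - 1) := by ring
      have h9 : 0 ≤ A * c ^ m * (c - 1) := by
        have : 0 ≤ c - 1 := by linarith
        positivity
      linarith
    exact h7.trans h8

end Hermite

/-! ### Completeness of the Hermite functions and the Parseval identity -/

section Completeness

open Polynomial

variable {f : ℝ → ℝ}

lemma memLp_exp_abs_mul_gaussian (t : ℝ) :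
    MemLp (fun x : ℝ => Real.exp |t * x|) 2 (gaussianReal 0 1) := by
  refine (memLp_two_iff_integrable_sq (by fun_prop)).2 ?_
  have h1 := integrable_exp_mul_gaussianReal (μ := 0) (v := 1) (2 * t)
  have h2 := integrable_exp_mul_gaussianReal (μ := 0) (v := 1) (-(2 * t))
  refine (h1.add h2).mono' (by fun_prop) (Eventually.of_forall fun x => ?_)
  rw [Real.norm_eq_abs, abs_of_nonneg (by positivity), Pi.add_apply, ← Real.exp_nat_mul]
  push_cast
  rcases abs_cases (t * x) with ⟨h, _⟩ | ⟨h, _⟩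
  · rw [h, show 2 * (t * x) = 2 * t * x by ring]
    linarith [Real.exp_pos (-(2 * t) * x)]
  · rw [h, show 2 * -(t * x) = -(2 * t) * x by ring]
    linarith [Real.exp_pos (2 * t * x)]

/-- A function orthogonal to the Hermite functions is orthogonal to all monomials, since the Hermite
polynomials are monic up to a constant. -/
lemma integral_mul_pow_eq_zero (hf : MemLp f 2 (gaussianReal 0 1))
    (h : ∀ n, ∫ x, f x * hermiteFn n x ∂(gaussianReal 0 1) = 0) (k : ℕ) :
    ∫ x, f x * x ^ k ∂(gaussianReal 0 1) = 0 := by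
  have hH : ∀ n, ∫ x, f x * (realHermite n).eval x ∂(gaussianReal 0 1) = 0 := by
    intro n
    have h1 := h n
    simp_rw [hermiteFn_eq_realHermite] at h1
    have h2 : ∀ x, f x * ((-1) ^ n / √(n.factorial : ℝ) * (realHermite n).eval x) =
        (-1) ^ n / √(n.factorial : ℝ) * (f x * (realHermite n).eval x) := fun x => by ring
    simp_rw [h2] at h1
    rw [integral_const_mul] at h1
    have h3 : (0 : ℝ) < n.factorial := by exact_mod_cast n.factorial_pos
    refine (mul_eq_zero.1 h1).resolve_left (div_ne_zero (by simp) (Real.sqrt_pos.2 h3).ne')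
  have hi : ∀ k, Integrable (fun x => f x * x ^ k) (gaussianReal 0 1) := by
    intro k
    have := memLp_eval_gaussian (X ^ k)
    simp only [eval_pow, eval_X] at this
    exact hf.integrable_mul this
  induction k using Nat.strong_induction_on with
  | _ k ih =>
    have h1 := hH k
    have hdeg : (realHermite k).natDegree = k := by
      rw [realHermite, (hermite_monic k).natDegree_map, natDegree_hermite]
    have hlead : (realHermite k).coeff k = 1 := by
      rw [realHermite, coeff_map, coeff_hermite_self]; simp
    simp_rw [eval_eq_sum_range, hdeg, Finset.sum_range_succ, hlead, one_mul, mul_add,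
      Finset.mul_sum] at h1
    have e : ∀ x i, f x * ((realHermite k).coeff i * x ^ i) =
        (realHermite k).coeff i * (f x * x ^ i) := fun x i => by ring
    simp_rw [e] at h1
    rw [integral_add (integrable_finsetSum _ fun i _ => (hi i).const_mul _) (hi k),
      integral_finsetSum _ fun i _ => (hi i).const_mul _] at h1
    rw [Finset.sum_eq_zero fun i hi' => by
      rw [integral_const_mul, ih i (Finset.mem_range.1 hi'), mul_zero], zero_add] at h1
    exact h1

/-- Summing the exponential series, such a function is orthogonal to all characters; the exchange of
sum and integral uses that `exp |t x|` is square-integrable. -/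
lemma integral_mul_cexp_eq_zero (hf : MemLp f 2 (gaussianReal 0 1))
    (h : ∀ n, ∫ x, f x * hermiteFn n x ∂(gaussianReal 0 1) = 0) (t : ℝ) :
    ∫ x, (f x : ℂ) * Complex.exp (t * x * Complex.I) ∂(gaussianReal 0 1) = 0 := by
  have hk := integral_mul_pow_eq_zero hf h
  have hexp := memLp_exp_abs_mul_gaussian t
  have hsum : ∀ x : ℝ, HasSum (fun k : ℕ => |f x| * (|t * x| ^ k / k.factorial))
      (|f x| * Real.exp |t * x|) := fun x => by
    rw [Real.exp_eq_exp_ℝ]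
    exact (NormedSpace.expSeries_div_hasSum_exp |t * x|).mul_left _
  have hs := hasSum_integral_of_dominated_convergence (μ := gaussianReal 0 1)
    (F := fun (k : ℕ) (x : ℝ) => (f x : ℂ) * ((t * x * Complex.I) ^ k / k.factorial))
    (f := fun x => (f x : ℂ) * Complex.exp (t * x * Complex.I))
    (fun k x => |f x| * (|t * x| ^ k / k.factorial))
    (fun k => (Complex.continuous_ofReal.comp_aestronglyMeasurable hf.1).mul
      (by fun_prop))
    (fun k => Eventually.of_forall fun x => by
      rw [norm_mul, norm_div, norm_pow, norm_mul, Complex.norm_I, mul_one, ← Complex.ofReal_mul,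
        Complex.norm_real, Complex.norm_real, Complex.norm_natCast, Real.norm_eq_abs,
        Real.norm_eq_abs])
    (Eventually.of_forall fun x => (hsum x).summable)
    (by
      simp_rw [fun x => (hsum x).tsum_eq]
      exact hf.abs.integrable_mul hexp)
    (Eventually.of_forall fun x => by
      rw [Complex.exp_eq_exp_ℂ]
      exact (NormedSpace.expSeries_div_hasSum_exp ((t : ℂ) * x * Complex.I)).mul_left _)
  have hz : ∀ k : ℕ, ∫ x, (f x : ℂ) * ((t * x * Complex.I) ^ k / k.factorial)
      ∂(gaussianReal 0 1) = 0 := by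
    intro k
    have e : ∀ x : ℝ, (f x : ℂ) * ((t * x * Complex.I) ^ k / k.factorial) =
        ((t : ℂ) * Complex.I) ^ k / k.factorial * ((f x * x ^ k : ℝ) : ℂ) := by
      intro x; push_cast; ring
    simp_rw [e]
    rw [integral_const_mul, integral_complex_ofReal, hk]
    simp
  simp_rw [hz] at hs
  exact hs.unique hasSum_zero

/-- The Hermite functions are complete in `L²(N(0, 1))`. -/
lemma ae_eq_zero_of_hermite_coeff_eq_zero (hf : MemLp f 2 (gaussianReal 0 1))
    (h : ∀ n, ∫ x, f x * hermiteFn n x ∂(gaussianReal 0 1) = 0) : f =ᵐ[gaussianReal 0 1] 0 := by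
  have hfi := hf.integrable one_le_two
  set γ := gaussianReal 0 1 with hγ
  -- The positive and the negative part of `f` are densities of finite measures with the same
  -- characteristic function.
  set μp := γ.withDensity fun x => ENNReal.ofReal (f x) with hμp
  set μm := γ.withDensity fun x => ENNReal.ofReal (-f x) with hμm
  have fp : IsFiniteMeasure μp := isFiniteMeasure_withDensity_ofReal hfi.2
  have fm : IsFiniteMeasure μm := isFiniteMeasure_withDensity_ofReal hfi.neg.2
  have hch : ∀ (g : ℝ → ℝ), AEMeasurable g γ → ∀ t : ℝ,
      charFun (γ.withDensity fun x => ENNReal.ofReal (g x)) t =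
      ∫ x, ((max (g x) 0 : ℝ) : ℂ) * Complex.exp (t * x * Complex.I) ∂γ := by
    intro g hg t
    rw [charFun_apply_real, integral_withDensity_eq_integral_toReal_smul₀ hg.ennreal_ofReal
      (Eventually.of_forall fun x => ENNReal.ofReal_lt_top)]
    refine integral_congr_ae (Eventually.of_forall fun x => ?_)
    simp only [ENNReal.toReal_ofReal']
    rw [Complex.real_smul]
  have hbd : ∀ (g : ℝ → ℝ), Integrable g γ → ∀ t : ℝ,
      Integrable (fun x => (g x : ℂ) * Complex.exp (t * x * Complex.I)) γ := by
    intro g hg t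
    refine (hg.ofReal (𝕜 := ℂ)).mul_bdd (c := 1) (by fun_prop) (Eventually.of_forall fun x => ?_)
    rw [← Complex.ofReal_mul, Complex.norm_exp_ofReal_mul_I]
  have heq : μp = μm := by
    refine Measure.ext_of_charFun ?_
    funext t
    rw [hch f hf.1.aemeasurable, hch (fun x => -f x) hf.1.aemeasurable.neg, ← sub_eq_zero,
      ← integral_sub (hbd (fun x => max (f x) 0) hfi.pos_part t)
        (hbd (fun x => max (-f x) 0) hfi.neg_part t),
      ← integral_mul_cexp_eq_zero hf h t]
    refine integral_congr_ae (Eventually.of_forall fun x => ?_)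
    simp only
    rw [← sub_mul, ← Complex.ofReal_sub]
    congr 2
    rcases le_total (f x) 0 with h | h
    · rw [max_eq_right h, max_eq_left (by linarith)]; ring
    · rw [max_eq_left h, max_eq_right (by linarith)]; ring
  have h1 : (fun x => ENNReal.ofReal (f x)) =ᵐ[γ] fun x => ENNReal.ofReal (-f x) := by
    refine (withDensity_eq_iff hf.1.aemeasurable.ennreal_ofReal
      hf.1.aemeasurable.neg.ennreal_ofReal ?_).1 heq
    exact hfi.lintegral_lt_top.ne
  filter_upwards [h1] with x hx
  rw [Pi.zero_apply]
  rcases le_total (f x) 0 with h | h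
  · rw [ENNReal.ofReal_of_nonpos h] at hx
    have := ENNReal.ofReal_eq_zero.1 hx.symm
    linarith
  · rw [ENNReal.ofReal_of_nonpos (by linarith : -f x ≤ 0)] at hx
    have := ENNReal.ofReal_eq_zero.1 hx
    linarith

/-- Parseval's identity for the Hermite expansion. -/
theorem hasSum_hermite_coeff_sq (hf : MemLp f 2 (gaussianReal 0 1)) :
    HasSum (fun n => (∫ x, f x * hermiteFn n x ∂(gaussianReal 0 1)) ^ 2)
      (∫ x, f x ^ 2 ∂(gaussianReal 0 1)) := by
  set γ := gaussianReal 0 1 with hγ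
  have hin : ∀ {g k : ℝ → ℝ} (hg : MemLp g 2 γ) (hk : MemLp k 2 γ),
      inner ℝ (hg.toLp g) (hk.toLp k) = ∫ x, g x * k x ∂γ := by
    intro g k hg hk
    rw [L2.inner_def]
    refine integral_congr_ae ?_
    filter_upwards [hg.coeFn_toLp, hk.coeFn_toLp] with x h1 h2
    rw [h1, h2]
    simp [mul_comm]
  set v : ℕ → Lp ℝ 2 γ := fun n => (memLp_hermiteFn n).toLp (hermiteFn n) with hv
  have hon : Orthonormal ℝ v := by
    rw [orthonormal_iff_ite]
    intro i j
    simp only [hv]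
    rw [hin, integral_hermiteFn_mul]
  have hbot : (Submodule.span ℝ (Set.range v))ᗮ = ⊥ := by
    rw [Submodule.eq_bot_iff]
    intro g hg
    have h1 : ∀ n, ∫ x, g x * hermiteFn n x ∂γ = 0 := by
      intro n
      have h2 := (Submodule.mem_orthogonal' _ _).1 hg (v n)
        (Submodule.subset_span (Set.mem_range_self n))
      have h3 := hin (Lp.memLp g) (memLp_hermiteFn n)
      rw [Lp.toLp_coeFn] at h3
      rw [← h3]; exact h2
    have h2 := ae_eq_zero_of_hermite_coeff_eq_zero (Lp.memLp g) h1
    exact (Lp.eq_zero_iff_ae_eq_zero).2 h2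
  have hs := (HilbertBasis.mkOfOrthogonalEqBot hon hbot).hasSum_inner_mul_inner
    (hf.toLp f) (hf.toLp f)
  rw [HilbertBasis.coe_mkOfOrthogonalEqBot, hin] at hs
  simp only [hv, hin] at hs
  have e1 : ∫ x, f x * f x ∂γ = ∫ x, f x ^ 2 ∂γ := by simp_rw [sq]
  rw [e1] at hs
  refine hs.congr_fun fun n => ?_
  rw [sq]
  congr 1
  simp_rw [mul_comm]

end Completeness

/-! ### Hermite expansions of the elements of the ellipsoid -/

section Expansion

/-- The Hermite coefficients of a function with respect to the standard Gaussian measure. -/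
noncomputable def gaussCoeff (f : ℝ → ℝ) (j : ℕ) : ℝ :=
  ∫ x, f x * hermiteFn j x ∂(gaussianReal 0 1)

/-- The partial sums of the Hermite expansion. -/
noncomputable def hermiteSum (a : ℕ → ℝ) (N : ℕ) (x : ℝ) : ℝ :=
  ∑ j ∈ Finset.range N, a j * hermiteFn j x

variable {f : ℝ → ℝ}

lemma memLp_hermiteSum (a : ℕ → ℝ) (N : ℕ) : MemLp (hermiteSum a N) 2 (gaussianReal 0 1) :=
  memLp_finsetSum _ fun j _ => (memLp_hermiteFn j).const_mul _

lemma gaussCoeff_sub {g : ℝ → ℝ} (hf : MemLp f 2 (gaussianReal 0 1))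
    (hg : MemLp g 2 (gaussianReal 0 1)) (j : ℕ) :
    gaussCoeff (fun x => f x - g x) j = gaussCoeff f j - gaussCoeff g j := by
  simp only [gaussCoeff, sub_mul]
  exact integral_sub (hf.integrable_mul (memLp_hermiteFn j))
    (hg.integrable_mul (memLp_hermiteFn j))

lemma gaussCoeff_hermiteSum (a : ℕ → ℝ) (N j : ℕ) :
    gaussCoeff (hermiteSum a N) j = if j < N then a j else 0 := by
  simp only [gaussCoeff, hermiteSum, Finset.sum_mul]
  have hi : ∀ i, Integrable (fun x => a i * hermiteFn i x * hermiteFn j x) (gaussianReal 0 1) :=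
    fun i => ((memLp_hermiteFn i).const_mul (a i)).integrable_mul (memLp_hermiteFn j)
  rw [integral_finsetSum _ fun i _ => hi i]
  simp_rw [mul_assoc, integral_const_mul, integral_hermiteFn_mul]
  simp

/-- The squared `L²` distance to a partial sum is the tail of the squared coefficients. -/
lemma hasSum_tail_sq (hf : MemLp f 2 (gaussianReal 0 1)) (N : ℕ) :
    HasSum (fun j => gaussCoeff f (j + N) ^ 2)
      (∫ x, (f x - hermiteSum (gaussCoeff f) N x) ^ 2 ∂(gaussianReal 0 1)) := by
  have h1 := hasSum_hermite_coeff_sq (hf.sub (memLp_hermiteSum (gaussCoeff f) N))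
  have h2 : ∀ j, ∫ x, (f - hermiteSum (gaussCoeff f) N) x * hermiteFn j x ∂(gaussianReal 0 1) =
      if j < N then 0 else gaussCoeff f j := by
    intro j
    have := gaussCoeff_sub hf (memLp_hermiteSum (gaussCoeff f) N) j
    rw [gaussCoeff_hermiteSum] at this
    refine Eq.trans this ?_
    split_ifs <;> ring
  simp_rw [h2] at h1
  have h3 := (hasSum_nat_add_iff' N).2 h1
  rw [Finset.sum_eq_zero fun j hj => by simp [Finset.mem_range.1 hj], sub_zero] at h3
  simpa using h3

lemma tendsto_integral_sq_sub_hermiteSum (hf : MemLp f 2 (gaussianReal 0 1)) :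
    Tendsto (fun N => ∫ x, (f x - hermiteSum (gaussCoeff f) N x) ^ 2 ∂(gaussianReal 0 1))
      atTop (𝓝 0) := by
  have h := tendsto_sum_nat_add fun j => gaussCoeff f j ^ 2
  exact h.congr fun N => (hasSum_tail_sq hf N).tsum_eq

variable {κ C : ℝ}

/-- The Hermite expansion of a function in an ellipsoid is uniformly bounded on compact sets. -/
lemma exists_abs_sub_gaussCoeff_le (hκ : 1 < κ) (C R : ℝ) :
    ∃ B₀ : ℝ, ∀ f : ℝ → ℝ, MemLp f 2 (gaussianReal 0 1) →
      (∀ j, κ ^ (2 * (j + 1)) * gaussCoeff f (j + 1) ^ 2 ≤ C ^ 2) →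
      ∀ᵐ x ∂(gaussianReal 0 1), |x| ≤ R → |f x - gaussCoeff f 0| ≤ B₀ := by
  have hκ0 : 0 < κ := by linarith
  obtain ⟨A, hA, hAb⟩ := exists_hermiteFn_le R (c := (1 + κ) / 2) (by linarith)
  -- The coefficients decay like `κ^(-j)` and the Hermite functions grow slower than
  -- `((1 + κ) / 2)^j`, so the expansion is dominated by a geometric series of ratio `q < 1`.
  set q := (1 + κ) / 2 / κ with hq
  have hq0 : 0 ≤ q := by positivity
  have hq1 : q < 1 := by rw [hq, div_lt_one hκ0]; linarith
  refine ⟨|C| * A / (1 - q), fun f hf hC => ?_⟩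
  have hcoef : ∀ j, |gaussCoeff f (j + 1)| * κ ^ (j + 1) ≤ |C| := by
    intro j
    rw [← abs_of_pos (pow_pos hκ0 (j + 1)), ← abs_mul]
    refine sq_le_sq.1 ?_
    refine le_trans (le_of_eq ?_) (hC j)
    ring
  -- The partial sums satisfy the bound; it passes to `f` along a subsequence converging almost
  -- everywhere.
  have hpart : ∀ N x, |x| ≤ R →
      |hermiteSum (gaussCoeff f) (N + 1) x - gaussCoeff f 0| ≤ |C| * A / (1 - q) := by
    intro N x hx
    rw [hermiteSum, Finset.sum_range_succ', hermiteFn_zero, mul_one, add_sub_cancel_right]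
    calc _ ≤ ∑ j ∈ Finset.range N, |gaussCoeff f (j + 1) * hermiteFn (j + 1) x| :=
          Finset.abs_sum_le_sum_abs _ _
      _ ≤ ∑ j ∈ Finset.range N, |C| * A * q ^ j := by
          refine Finset.sum_le_sum fun j _ => ?_
          rw [abs_mul]
          have h1 := hAb (j + 1) x hx
          have h2 : A * ((1 + κ) / 2) ^ (j + 1) = A * q ^ (j + 1) * κ ^ (j + 1) := by
            rw [mul_assoc, ← mul_pow, hq]; field_simp
          have h3 : q ^ (j + 1) ≤ q ^ j := pow_le_pow_of_le_one hq0 hq1.le (Nat.le_succ j)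
          calc _ ≤ |gaussCoeff f (j + 1)| * (A * q ^ (j + 1) * κ ^ (j + 1)) := by
                rw [← h2]; exact mul_le_mul_of_nonneg_left h1 (abs_nonneg _)
            _ = |gaussCoeff f (j + 1)| * κ ^ (j + 1) * (A * q ^ (j + 1)) := by ring
            _ ≤ |C| * (A * q ^ j) := by
                refine mul_le_mul (hcoef j) ?_ (by positivity) (abs_nonneg _)
                exact mul_le_mul_of_nonneg_left h3 hA.le
            _ = _ := by ring
      _ ≤ |C| * A * (1 - q)⁻¹ := by
          rw [← Finset.mul_sum]
          refine mul_le_mul_of_nonneg_left ?_ (by positivity)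
          rw [← tsum_geometric_of_lt_one hq0 hq1]
          exact (summable_geometric_of_lt_one hq0 hq1).sum_le_tsum _ fun j _ => by positivity
      _ = _ := by rw [div_eq_mul_inv]
  have hL2 : ∀ N, MemLp (hermiteSum (gaussCoeff f) N - f) 2 (gaussianReal 0 1) :=
    fun N => (memLp_hermiteSum _ N).sub hf
  have hlim : Tendsto (fun N => eLpNorm (hermiteSum (gaussCoeff f) N - f) 2 (gaussianReal 0 1))
      atTop (𝓝 0) := by
    have h1 : ∀ N, eLpNorm (hermiteSum (gaussCoeff f) N - f) 2 (gaussianReal 0 1) =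
        ENNReal.ofReal ((∫ x, (f x - hermiteSum (gaussCoeff f) N x) ^ 2
          ∂(gaussianReal 0 1)) ^ (1 / 2 : ℝ)) := by
      intro N
      rw [(hL2 N).eLpNorm_eq_integral_rpow_norm two_ne_zero ENNReal.ofNat_ne_top]
      congr 2
      · refine integral_congr_ae (Eventually.of_forall fun x => ?_)
        simp only [ENNReal.toReal_ofNat, Real.norm_eq_abs, Real.rpow_two, sq_abs, Pi.sub_apply]
        ring
      · simp
    simp_rw [h1]
    have h2 := (tendsto_integral_sq_sub_hermiteSum hf).rpow_const (p := 1 / 2)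
      (Or.inr (by norm_num))
    rw [Real.zero_rpow (by norm_num)] at h2
    have h3 := (ENNReal.continuous_ofReal.tendsto 0).comp h2
    rwa [ENNReal.ofReal_zero] at h3
  obtain ⟨ns, hns, hae⟩ := (tendstoInMeasure_of_tendsto_eLpNorm two_ne_zero
    (fun N => (memLp_hermiteSum (gaussCoeff f) N).1) hf.1 hlim).exists_seq_tendsto_ae
  filter_upwards [hae] with x hx hxR
  have h1 : Tendsto (fun i => |hermiteSum (gaussCoeff f) (ns i) x - gaussCoeff f 0|) atTop
      (𝓝 |f x - gaussCoeff f 0|) := (hx.sub_const _).abs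
  refine le_of_tendsto h1 ?_
  filter_upwards [hns.tendsto_atTop.eventually_ge_atTop 1] with i hi
  obtain ⟨m, hm⟩ : ∃ m, ns i = m + 1 := ⟨ns i - 1, by omega⟩
  rw [hm]
  exact hpart m x hxR

end Expansion

section Ellipsoid

variable {σ κ C : ℝ} {τ : ℝ → ℝ}

lemma map_mul_gaussian (σ : ℝ) :
    (gaussianReal 0 1).map (fun u => σ * u) = gaussianReal 0 (σ ^ 2).toNNReal := by
  rw [gaussianReal_map_const_mul]
  congr 1
  · simp
  · ext; simp [Real.coe_toNNReal _ (sq_nonneg σ)]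

lemma memLp_comp_mul (hτ : MemLp τ 2 (gaussianReal 0 (σ ^ 2).toNNReal)) :
    MemLp (fun u => τ (σ * u)) 2 (gaussianReal 0 1) := by
  rw [← map_mul_gaussian] at hτ
  exact hτ.comp_of_map (by fun_prop)

lemma hermiteCoeff_eq_gaussCoeff (hσ : 0 < σ) (hτ : MemLp τ 2 (gaussianReal 0 (σ ^ 2).toNNReal))
    (j : ℕ) : hermiteCoeff σ τ j = gaussCoeff (fun u => τ (σ * u)) j := by
  rw [hermiteCoeff, gaussCoeff, ← map_mul_gaussian, integral_map (by fun_prop)]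
  · refine integral_congr_ae (Eventually.of_forall fun u => ?_)
    simp only
    rw [mul_div_cancel_left₀ _ hσ.ne']
  · rw [map_mul_gaussian]
    exact hτ.1.mul ((continuous_hermiteFn j).comp (by fun_prop)).aestronglyMeasurable

lemma ellipsoid_coeff_le (hσ : 0 < σ) (hτ : τ ∈ ellipsoid σ κ C) (j : ℕ) :
    κ ^ (2 * (j + 1)) * gaussCoeff (fun u => τ (σ * u)) (j + 1) ^ 2 ≤ C ^ 2 := by
  obtain ⟨h1, h2, h3⟩ := hτ
  rw [← hermiteCoeff_eq_gaussCoeff hσ h1]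
  refine le_trans ?_ h3
  exact h2.le_tsum j fun i _ => by
    rw [pow_mul]
    positivity

/-- The part of the expansion of a function in an ellipsoid beyond degree `N` is uniformly
small. -/
lemma integral_sq_sub_hermiteSum_le (hσ : 0 < σ) (hκ : 1 < κ) (hτ : τ ∈ ellipsoid σ κ C) (N : ℕ) :
    ∫ u, (τ (σ * u) - hermiteSum (gaussCoeff fun u => τ (σ * u)) (N + 1) u) ^ 2
      ∂(gaussianReal 0 1) ≤ C ^ 2 / κ ^ (2 * (N + 1)) := by
  obtain ⟨h1, h2, h3⟩ := hτ
  have hκ0 : 0 < κ := by linarith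
  have hs := hasSum_tail_sq (memLp_comp_mul h1) (N + 1)
  set a := gaussCoeff fun u => τ (σ * u) with ha
  simp_rw [hermiteCoeff_eq_gaussCoeff hσ h1] at h2 h3
  rw [← ha] at h2 h3
  rw [le_div_iff₀ (by positivity)]
  have h4 := (summable_nat_add_iff N).2 h2
  have h5 : ∑' j, κ ^ (2 * (j + N + 1)) * a (j + N + 1) ^ 2 ≤ C ^ 2 := by
    refine le_trans ?_ h3
    have h6 := h2.sum_add_tsum_nat_add N
    have h7 : 0 ≤ ∑ j ∈ Finset.range N, κ ^ (2 * (j + 1)) * a (j + 1) ^ 2 :=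
      Finset.sum_nonneg fun j _ => by positivity
    linarith
  refine le_trans ?_ h5
  have h6 := hs.mul_right (κ ^ (2 * (N + 1)))
  refine hasSum_le (fun j => ?_) h6 h4.hasSum
  rw [mul_comm]
  refine mul_le_mul_of_nonneg_right ?_ (sq_nonneg _)
  exact pow_le_pow_right₀ hκ.le (by omega)

lemma abs_gaussCoeff_le (hσ : 0 < σ) (hκ : 1 < κ) (hC : 0 ≤ C) (hτ : τ ∈ ellipsoid σ κ C) (j : ℕ) :
    |gaussCoeff (fun u => τ (σ * u)) (j + 1)| ≤ C := by
  have h1 := ellipsoid_coeff_le hσ hτ j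
  have h2 : 1 ≤ κ ^ (2 * (j + 1)) := one_le_pow₀ hκ.le
  refine abs_le_of_sq_le_sq ?_ hC
  nlinarith [sq_nonneg (gaussCoeff (fun u => τ (σ * u)) (j + 1))]

end Ellipsoid

/-! ### Wrapping in `L²`, on a growing domain -/

section L2

variable {Ω : Type*} {mΩ : MeasurableSpace Ω} {P : Measure Ω} {f g f' g' : Ω → ℝ}

/-- The `L²` norm of a real function. -/
noncomputable def l2norm (P : Measure Ω) (f : Ω → ℝ) : ℝ := √(∫ ω, f ω ^ 2 ∂P)

lemma l2norm_nonneg (P : Measure Ω) (f : Ω → ℝ) : 0 ≤ l2norm P f := Real.sqrt_nonneg _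

lemma sq_l2norm (P : Measure Ω) (f : Ω → ℝ) : l2norm P f ^ 2 = ∫ ω, f ω ^ 2 ∂P :=
  Real.sq_sqrt (integral_nonneg fun _ => sq_nonneg _)

/-- The Cauchy–Schwarz inequality. -/
lemma abs_integral_mul_le_l2norm (hf : MemLp f 2 P) (hg : MemLp g 2 P) :
    |∫ ω, f ω * g ω ∂P| ≤ l2norm P f * l2norm P g := by
  have hfg : Integrable (fun ω => f ω * g ω) P := hf.integrable_mul hg
  have h : ∀ t : ℝ, 0 ≤ (∫ ω, f ω ^ 2 ∂P) * (t * t) + (2 * ∫ ω, f ω * g ω ∂P) * t +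
      ∫ ω, g ω ^ 2 ∂P := by
    intro t
    have h1 : 0 ≤ ∫ ω, (t * t * f ω ^ 2 + (2 * t * (f ω * g ω) + g ω ^ 2)) ∂P := by
      refine integral_nonneg fun ω => ?_
      simp only [Pi.zero_apply]
      nlinarith [sq_nonneg (t * f ω + g ω)]
    have i2 : Integrable (fun ω => 2 * t * (f ω * g ω) + g ω ^ 2) P :=
      (hfg.const_mul _).add hg.integrable_sq
    rw [integral_add (hf.integrable_sq.const_mul _) i2,
      integral_add (hfg.const_mul _) hg.integrable_sq, integral_const_mul,
      integral_const_mul] at h1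
    linarith
  have h1 := discrim_le_zero h
  rw [discrim] at h1
  rw [l2norm, l2norm, ← Real.sqrt_mul (integral_nonneg fun _ => sq_nonneg _)]
  refine Real.abs_le_sqrt ?_
  nlinarith

lemma l2norm_add_le (hf : MemLp f 2 P) (hg : MemLp g 2 P) :
    l2norm P (fun ω => f ω + g ω) ≤ l2norm P f + l2norm P g := by
  have hfg : Integrable (fun ω => f ω * g ω) P := hf.integrable_mul hg
  refine abs_le_of_sq_le_sq' ?_ (add_nonneg (l2norm_nonneg _ _) (l2norm_nonneg _ _)) |>.2
  have e : ∀ ω, (f ω + g ω) ^ 2 = f ω ^ 2 + (2 * (f ω * g ω) + g ω ^ 2) := fun ω => by ring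
  have i2 : Integrable (fun ω => 2 * (f ω * g ω) + g ω ^ 2) P :=
    (hfg.const_mul _).add hg.integrable_sq
  rw [sq_l2norm]
  simp_rw [e]
  rw [integral_add hf.integrable_sq i2, integral_add (hfg.const_mul _) hg.integrable_sq,
    integral_const_mul, ← sq_l2norm, ← sq_l2norm]
  nlinarith [(abs_le.1 (abs_integral_mul_le_l2norm hf hg)).2]

lemma l2norm_const_mul (c : ℝ) (f : Ω → ℝ) :
    l2norm P (fun ω => c * f ω) = |c| * l2norm P f := by
  simp_rw [l2norm, mul_pow]
  rw [integral_const_mul, Real.sqrt_mul (sq_nonneg c), Real.sqrt_sq_eq_abs]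

lemma l2norm_sum_le {ι : Type*} (s : Finset ι) {f : ι → Ω → ℝ} (hf : ∀ i, MemLp (f i) 2 P) :
    l2norm P (fun ω => ∑ i ∈ s, f i ω) ≤ ∑ i ∈ s, l2norm P (f i) := by
  classical
  induction s using Finset.induction_on with
  | empty => simp [l2norm]
  | insert a s ha ih =>
    simp_rw [Finset.sum_insert ha]
    exact (l2norm_add_le (hf a) (memLp_finsetSum _ fun i _ => hf i)).trans (by linarith)

variable [IsProbabilityMeasure P]

lemma abs_covariance_le_l2norm (hf : MemLp f 2 P) (hg : MemLp g 2 P) :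
    |cov[f, g; P]| ≤ l2norm P f * l2norm P g := by
  have key : ∀ {h : Ω → ℝ}, MemLp h 2 P → l2norm P (fun ω => h ω - ∫ ω, h ω ∂P) ≤ l2norm P h := by
    intro h hh
    refine Real.sqrt_le_sqrt ?_
    rw [← variance_eq_integral hh.1.aemeasurable]
    exact variance_le_expectation_sq hh.1
  refine (abs_integral_mul_le_l2norm (hf.sub (memLp_const _)) (hg.sub (memLp_const _))).trans ?_
  exact mul_le_mul (key hf) (key hg) (l2norm_nonneg _ _) (l2norm_nonneg _ _)

/-- Covariances depend continuously on their arguments, in `L²`. -/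
lemma abs_covariance_sub_le (hf : MemLp f 2 P) (hg : MemLp g 2 P) (hf' : MemLp f' 2 P)
    (hg' : MemLp g' 2 P) {ε K : ℝ} (h1 : l2norm P (fun ω => f ω - f' ω) ≤ ε)
    (h2 : l2norm P (fun ω => g ω - g' ω) ≤ ε) (h3 : l2norm P f' ≤ K) (h4 : l2norm P g' ≤ K) :
    |cov[f, g; P] - cov[f', g'; P]| ≤ ε * (2 * K + ε) := by
  have hε : 0 ≤ ε := (l2norm_nonneg _ _).trans h1
  have hg2 : l2norm P g ≤ K + ε := by
    have := l2norm_add_le hg' (hg.sub hg')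
    have e : (fun ω => g' ω + (g - g') ω) = g := by ext ω; simp
    rw [e] at this
    exact this.trans (add_le_add h4 h2)
  have e : cov[f, g; P] - cov[f', g'; P] =
      cov[fun ω => f ω - f' ω, g; P] + cov[f', fun ω => g ω - g' ω; P] := by
    rw [covariance_fun_sub_left hf hf' hg, covariance_fun_sub_right hf' hg hg']
    ring
  rw [e]
  refine (abs_add_le _ _).trans ?_
  have i1 := (abs_covariance_le_l2norm (hf.sub hf') hg).trans
    (mul_le_mul h1 hg2 (l2norm_nonneg _ _) hε)
  have i2 := (abs_covariance_le_l2norm hf' (hg.sub hg')).trans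
    (mul_le_mul h3 h2 (l2norm_nonneg _ _) ((l2norm_nonneg _ _).trans h3))
  have i3 : |cov[fun ω => f ω - f' ω, g; P]| ≤ ε * (K + ε) := i1
  have i4 : |cov[f', fun ω => g ω - g' ω; P]| ≤ K * ε := i2
  linarith

end L2

section WrappingDisappears

/-- As the domain grows, wrapping disappears in the Hermite functions. -/
lemma tendsto_l2norm_hermiteFn_wrap {c : ℝ} (hc : 0 < c) (j : ℕ) :
    Tendsto (fun M => l2norm (gaussianReal 0 1)
      fun y => hermiteFn j (wrap M (c * y) / c) - hermiteFn j y) atTop (𝓝 0) := by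
  -- `D` is increasing in `|y|` and dominates the Hermite function, and wrapping decreases absolute
  -- values, so `2 D` dominates the difference; the latter vanishes as soon as `M > |c y|`.
  set D : ℝ → ℝ := fun y =>
    ∑ i ∈ Finset.range ((hermitePoly j).natDegree + 1), |(hermitePoly j).coeff i| * |y ^ i| with hD
  have hDm : MemLp D 2 (gaussianReal 0 1) := by
    refine memLp_finsetSum _ fun i _ => MemLp.const_mul ?_ _
    have := (memLp_eval_gaussian (Polynomial.X ^ i)).abs
    simp only [Polynomial.eval_pow, Polynomial.eval_X] at this
    exact this
  have hle : ∀ v y : ℝ, |v| ≤ |y| → |hermiteFn j v| ≤ D y := by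
    intro v y h
    rw [← eval_hermitePoly, Polynomial.eval_eq_sum_range]
    refine (Finset.abs_sum_le_sum_abs _ _).trans (Finset.sum_le_sum fun i _ => ?_)
    rw [abs_mul, abs_pow, abs_pow]
    gcongr
  have hwle : ∀ M, 0 < M → ∀ y, |wrap M (c * y) / c| ≤ |y| := by
    intro M hM y
    rw [abs_div, abs_of_pos hc, div_le_iff₀ hc]
    refine (abs_wrap_le hM _).trans (le_of_eq ?_)
    rw [abs_mul, abs_of_pos hc, mul_comm]
  have hmain : Tendsto (fun M => ∫ y, (hermiteFn j (wrap M (c * y) / c) - hermiteFn j y) ^ 2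
      ∂(gaussianReal 0 1)) atTop (𝓝 (∫ _y, (0 : ℝ) ∂(gaussianReal 0 1))) := by
    refine tendsto_integral_filter_of_dominated_convergence (fun y => (2 * D y) ^ 2) ?_ ?_
      (hDm.const_mul 2).integrable_sq (Eventually.of_forall fun y => ?_)
    · refine Eventually.of_forall fun M => Measurable.aestronglyMeasurable ?_
      have h1 : Measurable fun y => hermiteFn j (wrap M (c * y) / c) :=
        (continuous_hermiteFn j).measurable.comp
          (((measurable_wrap M).comp (measurable_const_mul c)).div_const c)
      exact (h1.sub (continuous_hermiteFn j).measurable).pow_const 2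
    · filter_upwards [eventually_gt_atTop 0] with M hM
      refine Eventually.of_forall fun y => ?_
      rw [Real.norm_eq_abs, abs_of_nonneg (sq_nonneg _), ← sq_abs]
      refine pow_le_pow_left₀ (abs_nonneg _) ?_ 2
      refine (abs_sub _ _).trans ?_
      linarith [hle _ _ (hwle M hM y), hle y y le_rfl]
    · refine tendsto_const_nhds.congr' ?_
      filter_upwards [eventually_gt_atTop |c * y|] with M hM
      have h2 := abs_lt.1 hM
      rw [wrap_of_mem ((abs_nonneg _).trans_lt hM) ⟨h2.1.le, h2.2⟩,
        mul_div_cancel_left₀ _ hc.ne']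
      simp
  rw [integral_zero] at hmain
  have := (Real.continuous_sqrt.tendsto 0).comp hmain
  rw [Real.sqrt_zero] at this
  exact this

lemma memLp_hermiteFn_wrap {c M : ℝ} (hM : 0 < M) (j : ℕ) :
    MemLp (fun y => hermiteFn j (wrap M (c * y) / c)) 2 (gaussianReal 0 1) := by
  obtain ⟨b, hb⟩ := (isCompact_Icc (a := -M) (b := M)).exists_bound_of_continuousOn
    (f := fun x => hermiteFn j (x / c)) ((continuous_hermiteFn j).comp
      (continuous_id.div_const c)).continuousOn
  refine memLp_of_abs_le (b := b) ?_ (Eventually.of_forall fun y => hb _ (wrap_mem_domain hM _))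
  exact ((continuous_hermiteFn j).measurable.comp
    (((measurable_wrap M).comp (measurable_const_mul c)).div_const c)).aemeasurable

variable {σ κ C : ℝ} {τ : ℝ → ℝ}

lemma map_wrap_mul_gaussian (hσ : 0 < σ) {M : ℝ} (hM : 0 < M) :
    (gaussianReal 0 1).map (fun u => wrap M (σ * u)) = carrier σ M := by
  rw [carrier_eq_map hσ hM, ← map_mul_gaussian σ,
    Measure.map_map (measurable_wrap M) (measurable_const_mul σ)]
  rfl

/-- Wrapping is bounded in `L²`, uniformly in the size of the domain. -/
lemma exists_l2norm_wrap_le (hσ : 0 < σ) :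
    ∃ c : ℝ, 0 < c ∧ ∀ M, 1 ≤ M → ∀ f : ℝ → ℝ, MemLp f 2 (gaussianReal 0 (σ ^ 2).toNNReal) →
      MemLp (fun u => f (wrap M (σ * u))) 2 (gaussianReal 0 1) ∧
      l2norm (gaussianReal 0 1) (fun u => f (wrap M (σ * u))) ≤
        c * l2norm (gaussianReal 0 1) fun u => f (σ * u) := by
  obtain ⟨c, hc, hle⟩ := exists_carrier_le hσ
  refine ⟨√c, Real.sqrt_pos.2 hc, fun M hM f hf => ?_⟩
  have hM0 : 0 < M := by linarith
  have hm : Measurable fun u => wrap M (σ * u) := (measurable_wrap M).comp (measurable_const_mul σ)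
  have hf1 : MemLp f 2 (carrier σ M) :=
    (hf.smul_measure ENNReal.ofReal_ne_top).mono_measure (hle M hM)
  rw [← map_wrap_mul_gaussian hσ hM0] at hf1
  refine ⟨hf1.comp_of_map hm.aemeasurable, ?_⟩
  rw [l2norm, l2norm, ← Real.sqrt_mul hc.le]
  refine Real.sqrt_le_sqrt ?_
  have e1 : ∫ u, f (wrap M (σ * u)) ^ 2 ∂(gaussianReal 0 1) = ∫ μ, f μ ^ 2 ∂(carrier σ M) := by
    rw [← map_wrap_mul_gaussian hσ hM0]
    exact (integral_map hm.aemeasurable (hf1.1.pow 2)).symm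
  have e2 : ∫ u, f (σ * u) ^ 2 ∂(gaussianReal 0 1) =
      ∫ μ, f μ ^ 2 ∂(gaussianReal 0 (σ ^ 2).toNNReal) := by
    have h1 := hf.1.pow 2
    rw [← map_mul_gaussian] at h1 ⊢
    exact (integral_map (by fun_prop) h1).symm
  rw [e1, e2]
  have h1 := integral_mono_measure (hle M hM) (Eventually.of_forall fun μ => sq_nonneg (f μ))
    (hf.integrable_sq.smul_measure ENNReal.ofReal_ne_top)
  rw [integral_smul_measure, ENNReal.toReal_ofReal hc.le, smul_eq_mul] at h1
  exact h1

/-- As the domain grows, wrapping disappears uniformly over an ellipsoid. -/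
lemma eventually_l2norm_wrap_sub_le (hσ : 0 < σ) (hκ : 1 < κ) (hC : 0 ≤ C) {ε : ℝ} (hε : 0 < ε) :
    ∀ᶠ M in atTop, ∀ τ ∈ ellipsoid σ κ C,
      l2norm (gaussianReal 0 1) (fun u => τ (wrap M (σ * u)) - τ (σ * u)) ≤ ε := by
  obtain ⟨c, hc, hwrap⟩ := exists_l2norm_wrap_le hσ
  -- The tail of the expansion beyond degree `N` is small, uniformly over the ellipsoid, and stays
  -- so after wrapping; only finitely many Hermite functions remain.
  obtain ⟨N, hN⟩ : ∃ N : ℕ, (c + 1) * (C / κ ^ (N + 1)) ≤ ε / 2 := by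
    have h1 : Tendsto (fun N : ℕ => (c + 1) * (C * (κ⁻¹) ^ (N + 1))) atTop
        (𝓝 ((c + 1) * (C * 0))) :=
      (((tendsto_pow_atTop_nhds_zero_of_lt_one (by positivity)
        (inv_lt_one_of_one_lt₀ hκ)).comp (tendsto_add_atTop_nat 1)).const_mul C).const_mul _
    rw [mul_zero, mul_zero] at h1
    obtain ⟨N, hN⟩ := (h1.eventually (gt_mem_nhds (half_pos hε))).exists
    refine ⟨N, ?_⟩
    rw [div_eq_mul_inv C, ← inv_pow]
    exact hN.le
  have hsum : Tendsto (fun M => ∑ j ∈ Finset.range N, C * l2norm (gaussianReal 0 1)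
      fun y => hermiteFn (j + 1) (wrap M (σ * y) / σ) - hermiteFn (j + 1) y) atTop (𝓝 0) := by
    have := tendsto_finsetSum (Finset.range N) fun j (_ : j ∈ Finset.range N) =>
      (tendsto_l2norm_hermiteFn_wrap hσ (j + 1)).const_mul C
    simpa using this
  filter_upwards [hsum.eventually (gt_mem_nhds (half_pos hε)), eventually_ge_atTop 1]
    with M hM1 hM τ hτ
  have hM0 : 0 < M := by linarith
  have hκ0 : 0 < κ := by linarith
  set γ := gaussianReal 0 1 with hγ
  set a := gaussCoeff fun u => τ (σ * u) with ha
  -- the remainder of the expansion, as a function of the latent variable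
  set R : ℝ → ℝ := fun μ => τ μ - hermiteSum a (N + 1) (μ / σ) with hR
  have hcan : ∀ u, σ * u / σ = u := fun u => mul_div_cancel_left₀ u hσ.ne'
  have hRm : MemLp R 2 (gaussianReal 0 (σ ^ 2).toNNReal) := by
    refine hτ.1.sub ?_
    have h1 := memLp_hermiteSum a (N + 1)
    rw [← map_mul_gaussian]
    refine (memLp_map_measure_iff ?_ (by fun_prop)).2 ?_
    · refine Measurable.aestronglyMeasurable ?_
      unfold hermiteSum
      exact Finset.measurable_fun_sum _ fun j _ =>
        ((continuous_hermiteFn j).measurable.comp (measurable_id.div_const σ)).const_mul _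
    · have h2 : (fun μ => hermiteSum a (N + 1) (μ / σ)) ∘ (fun u => σ * u) =
          hermiteSum a (N + 1) := by ext u; simp only [Function.comp, hcan]
      rw [h2]; exact h1
  obtain ⟨w1, w2⟩ := hwrap M hM R hRm
  have hR0 : l2norm γ (fun u => R (σ * u)) ≤ C / κ ^ (N + 1) := by
    have h1 := integral_sq_sub_hermiteSum_le hσ hκ hτ N
    have h2 : C ^ 2 / κ ^ (2 * (N + 1)) = (C / κ ^ (N + 1)) ^ 2 := by
      rw [div_pow, ← pow_mul, mul_comm 2]
    rw [h2] at h1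
    simp only [hR, hcan, l2norm]
    exact Real.sqrt_le_iff.2 ⟨by positivity, h1⟩
  have hRm' : MemLp (fun u => R (σ * u)) 2 γ := memLp_comp_mul hRm
  set S : ℕ → ℝ → ℝ := fun j u =>
    a (j + 1) * (hermiteFn (j + 1) (wrap M (σ * u) / σ) - hermiteFn (j + 1) u) with hS
  have hSm : ∀ j, MemLp (S j) 2 γ := fun j =>
    ((memLp_hermiteFn_wrap hM0 _).sub (memLp_hermiteFn _)).const_mul _
  have e : ∀ u, τ (wrap M (σ * u)) - τ (σ * u) =
      (R (wrap M (σ * u)) + -1 * R (σ * u)) + ∑ j ∈ Finset.range N, S j u := by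
    intro u
    simp only [hR, hS, hcan, hermiteSum, Finset.sum_range_succ', hermiteFn_zero, mul_sub,
      Finset.sum_sub_distrib]
    ring
  simp_rw [e]
  have h1 := l2norm_add_le (w1.add (hRm'.const_mul (-1)))
    (memLp_finsetSum (Finset.range N) fun j _ => hSm j)
  have h2 := l2norm_add_le w1 (hRm'.const_mul (-1))
  have h3 := l2norm_sum_le (Finset.range N) hSm
  rw [l2norm_const_mul] at h2
  have h4 : ∑ j ∈ Finset.range N, l2norm γ (S j) ≤ ∑ j ∈ Finset.range N, C * l2norm γ
      fun y => hermiteFn (j + 1) (wrap M (σ * y) / σ) - hermiteFn (j + 1) y := by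
    refine Finset.sum_le_sum fun j _ => ?_
    simp only [hS]
    rw [l2norm_const_mul]
    exact mul_le_mul_of_nonneg_right (abs_gaussCoeff_le hσ hκ hC hτ j) (l2norm_nonneg _ _)
  have h5 : c * l2norm γ (fun u => R (σ * u)) ≤ c * (C / κ ^ (N + 1)) :=
    mul_le_mul_of_nonneg_left hR0 hc.le
  simp only [abs_neg, abs_one, one_mul] at h2
  refine (h1.trans ?_ : _ ≤ ε)
  have h6 : l2norm γ (fun u => R (wrap M (σ * u)) + -1 * R (σ * u)) ≤ ε / 2 := by linarith
  have h7 : l2norm γ (fun u => ∑ j ∈ Finset.range N, S j u) ≤ ε / 2 := by linarith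
  exact (add_le_add h6 h7).trans (by linarith)

end WrappingDisappears

/-! ### The jointly Gaussian model on the line -/

section Joint

variable {σ M : ℝ}

/-- The law of a pair of independent standard Gaussian variables. -/
noncomputable def gaussPair : Measure (ℝ × ℝ) := (gaussianReal 0 1).prod (gaussianReal 0 1)

instance : IsProbabilityMeasure gaussPair := by unfold gaussPair; infer_instance

lemma measurePreserving_fst_gaussPair :
    MeasurePreserving (Prod.fst : ℝ × ℝ → ℝ) gaussPair (gaussianReal 0 1) :=
  measurePreserving_fst

lemma smooth_wrap (g : ℝ → ℝ) (μ : ℝ) : smooth M g (wrap M μ) = smooth M g μ := by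
  simp only [smooth, cyclicKernel_wrap]

lemma smooth_eq_integral (hM : 0 < M) {g : ℝ → ℝ} (hg : Measurable g) (μ : ℝ) :
    smooth M g μ = ∫ z, g (wrap M (μ + z)) ∂(gaussianReal 0 1) := by
  rw [smooth, integral_cyclicKernel_mul hM μ hg]
  have h : gaussianReal μ 1 = (gaussianReal 0 1).map fun z => μ + z := by
    rw [gaussianReal_map_const_add]; simp
  rw [h, integral_map (by fun_prop)]
  exact (hg.comp (measurable_wrap M)).aestronglyMeasurable

/-- The latent value and its noisy observation are the wrapped versions of jointly Gaussian
variables. -/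
lemma integral_mul_smooth_carrier (hσ : 0 < σ) (hM : 0 < M) {f g : ℝ → ℝ}
    (hf : Integrable f (carrier σ M)) (hg : Measurable g) {b : ℝ} (hb : ∀ x, |g x| ≤ b) :
    ∫ μ, f μ * smooth M g μ ∂(carrier σ M) =
      ∫ ω, f (wrap M (σ * ω.1)) * g (wrap M (σ * ω.1 + ω.2)) ∂gaussPair := by
  have hm : Measurable fun u => wrap M (σ * u) := (measurable_wrap M).comp (measurable_const_mul σ)
  rw [← map_wrap_mul_gaussian hσ hM] at hf ⊢
  have hf' : Integrable (fun u => f (wrap M (σ * u))) (gaussianReal 0 1) :=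
    hf.comp_measurable hm
  have hms : AEStronglyMeasurable (fun μ => f μ * smooth M g μ)
      ((gaussianReal 0 1).map fun u => wrap M (σ * u)) :=
    hf.1.mul (measurable_smooth hM hg).aestronglyMeasurable
  rw [integral_map hm.aemeasurable hms, gaussPair, integral_prod]
  · refine integral_congr_ae (Eventually.of_forall fun u => ?_)
    simp only
    rw [integral_const_mul, smooth_wrap, smooth_eq_integral hM hg]
  · refine Integrable.mul_bdd (c := b) (hf'.comp_fst _) ?_ (Eventually.of_forall fun ω => hb _)
    exact (hg.comp ((measurable_wrap M).comp (by fun_prop))).aestronglyMeasurable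

lemma integral_obsLaw_carrier (hσ : 0 < σ) (hM : 0 < M) {g : ℝ → ℝ} (hg : Measurable g) {b : ℝ}
    (hb : ∀ x, |g x| ≤ b) :
    ∫ x, g x ∂(obsLaw M (carrier σ M)) =
      ∫ ω, g (wrap M (σ * ω.1 + ω.2)) ∂gaussPair := by
  have := isProbabilityMeasure_carrier hσ hM
  have h := integral_mul_smooth_carrier hσ hM (f := fun _ => 1) (integrable_const _) hg hb
  rw [integral_obsLaw_eq_smooth hM hg hb]
  simpa using h

lemma map_wrap_gaussPair (hσ : 0 < σ) (hM : 0 < M) :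
    gaussPair.map (fun ω => wrap M (σ * ω.1 + ω.2)) = obsLaw M (carrier σ M) := by
  have := isProbabilityMeasure_carrier hσ hM
  have := isProbabilityMeasure_obsLaw (G := carrier σ M) hM
  have hm : Measurable fun ω : ℝ × ℝ => wrap M (σ * ω.1 + ω.2) :=
    (measurable_wrap M).comp (by fun_prop)
  have := Measure.isProbabilityMeasure_map (μ := gaussPair) hm.aemeasurable
  refine Measure.ext fun s hs =>
    (ENNReal.toReal_eq_toReal_iff' (measure_ne_top _ _) (measure_ne_top _ _)).1 ?_
  change Measure.real _ s = Measure.real _ s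
  have h := integral_obsLaw_carrier hσ hM (g := s.indicator 1) (measurable_one.indicator hs)
    (b := 1) fun x => by by_cases h : x ∈ s <;> simp [h]
  rw [integral_indicator_one hs] at h
  rw [h, map_measureReal_apply hm hs, ← integral_indicator_one (hm hs)]
  rfl

/-! The rotation that diagonalizes the pair (latent value, observation). -/

lemma measurePreserving_rotation (θ : ℝ) :
    MeasurePreserving (fun ω : ℝ × ℝ => (Real.cos θ * ω.1 + Real.sin θ * ω.2,
      -Real.sin θ * ω.1 + Real.cos θ * ω.2)) gaussPair gaussPair := by
  refine ⟨by fun_prop, ?_⟩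
  have h := IsGaussian.map_rotation_eq_self (μ := gaussianReal 0 1) (by simp) θ
  have e : (fun ω : ℝ × ℝ => (Real.cos θ * ω.1 + Real.sin θ * ω.2,
      -Real.sin θ * ω.1 + Real.cos θ * ω.2)) = ContinuousLinearMap.rotation θ := by
    ext ω <;> simp [ContinuousLinearMap.rotation_apply]
  rw [e]
  exact h

/-- The standard deviation of an observation. -/
noncomputable def obsScale (σ : ℝ) : ℝ := √(1 + σ ^ 2)

lemma obsScale_pos (σ : ℝ) : 0 < obsScale σ := Real.sqrt_pos.2 (by positivity)

lemma sq_obsScale (σ : ℝ) : obsScale σ ^ 2 = 1 + σ ^ 2 := Real.sq_sqrt (by positivity)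

lemma sq_div_obsScale_add (σ : ℝ) : (σ / obsScale σ) ^ 2 + (1 / obsScale σ) ^ 2 = 1 := by
  rw [div_pow, div_pow, sq_obsScale]
  field_simp
  ring

/-- Independent standard Gaussian coordinates of which the first is the normalized observation. -/
lemma measurePreserving_unrotate (σ : ℝ) :
    MeasurePreserving (fun ω : ℝ × ℝ => (σ / obsScale σ * ω.1 - 1 / obsScale σ * ω.2,
      1 / obsScale σ * ω.1 + σ / obsScale σ * ω.2)) gaussPair gaussPair := by
  have h := measurePreserving_rotation (-(Real.pi / 2 - Real.arctan σ))
  have e : √(1 + σ ^ 2) = obsScale σ := rfl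
  rw [Real.cos_neg, Real.sin_neg, Real.cos_pi_div_two_sub, Real.sin_pi_div_two_sub,
    Real.sin_arctan, Real.cos_arctan, e] at h
  convert h using 3
  · ring
  · ring

lemma measurePreserving_obs (σ : ℝ) :
    MeasurePreserving (fun ω : ℝ × ℝ => (σ * ω.1 + ω.2) / obsScale σ) gaussPair
      (gaussianReal 0 1) := by
  refine ⟨by fun_prop, ?_⟩
  have h := measurePreserving_unrotate σ
  rw [← h.map_eq, Measure.map_map (by fun_prop) h.measurable]
  rw [← measurePreserving_fst_gaussPair.map_eq]
  congr 1
  ext ω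
  have h1 := sq_div_obsScale_add σ
  have h2 := (obsScale_pos σ).ne'
  simp only [Function.comp]
  have : (σ * (σ / obsScale σ * ω.1 - 1 / obsScale σ * ω.2) +
      (1 / obsScale σ * ω.1 + σ / obsScale σ * ω.2)) / obsScale σ =
      ((σ / obsScale σ) ^ 2 + (1 / obsScale σ) ^ 2) * ω.1 := by
    field_simp; ring
  rw [this, h1, one_mul]

/-- The conditional mean of `H_j` of the standardized latent variable, given the observation. -/
noncomputable def condHermite (σ : ℝ) (j : ℕ) (x : ℝ) : ℝ :=
  (σ / obsScale σ) ^ j * hermiteFn j (x / obsScale σ)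

lemma memLp_condHermite (σ : ℝ) (j : ℕ) :
    MemLp (fun ω : ℝ × ℝ => condHermite σ j (σ * ω.1 + ω.2)) 2 gaussPair :=
  ((memLp_hermiteFn j).comp_measurePreserving (measurePreserving_obs σ)).const_mul _

lemma memLp_hermiteFn_fst (j : ℕ) :
    MemLp (fun ω : ℝ × ℝ => hermiteFn j ω.1) 2 gaussPair :=
  (memLp_hermiteFn j).comp_measurePreserving measurePreserving_fst_gaussPair

/-- `condHermite` is the conditional mean of the Hermite function of the latent variable. In the
rotated coordinates, the observation is a multiple of the first one. -/
lemma integral_hermiteFn_fst_mul (σ : ℝ) (j : ℕ) {g : ℝ → ℝ} (hg : Measurable g) {b : ℝ}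
    (hb : ∀ x, |g x| ≤ b) :
    ∫ ω, hermiteFn j ω.1 * g (σ * ω.1 + ω.2) ∂gaussPair =
      ∫ ω, condHermite σ j (σ * ω.1 + ω.2) * g (σ * ω.1 + ω.2) ∂gaussPair := by
  have hc := (obsScale_pos σ).ne'
  have h := measurePreserving_unrotate σ
  have hX : ∀ ω : ℝ × ℝ, σ * (σ / obsScale σ * ω.1 - 1 / obsScale σ * ω.2) +
      (1 / obsScale σ * ω.1 + σ / obsScale σ * ω.2) = obsScale σ * ω.1 := by
    intro ω
    have h1 := sq_obsScale σ
    field_simp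
    rw [h1]; ring
  have hgm : AEStronglyMeasurable (fun ω : ℝ × ℝ => g (σ * ω.1 + ω.2)) gaussPair :=
    (hg.comp (by fun_prop)).aestronglyMeasurable
  have i1 : Integrable (fun ω : ℝ × ℝ => hermiteFn j ω.1 * g (σ * ω.1 + ω.2)) gaussPair :=
    ((memLp_hermiteFn_fst j).integrable one_le_two).mul_bdd (c := b) hgm
      (Eventually.of_forall fun ω => hb _)
  have i2 : Integrable (fun ω : ℝ × ℝ => condHermite σ j (σ * ω.1 + ω.2) *
      g (σ * ω.1 + ω.2)) gaussPair :=
    ((memLp_condHermite σ j).integrable one_le_two).mul_bdd (c := b) hgm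
      (Eventually.of_forall fun ω => hb _)
  have j1 := h.integrable_comp_of_integrable i1
  have j2 := h.integrable_comp_of_integrable i2
  have e1 := integral_map h.aemeasurable (h.map_eq.symm ▸ i1.1)
  have e2 := integral_map h.aemeasurable (h.map_eq.symm ▸ i2.1)
  rw [h.map_eq] at e1 e2
  rw [e1, e2]
  simp only [Function.comp_def, hX] at j1 j2 ⊢
  rw [gaussPair] at j1 j2 ⊢
  rw [integral_prod _ j1, integral_prod _ j2]
  refine integral_congr_ae (Eventually.of_forall fun y => ?_)
  simp only
  rw [integral_mul_const, integral_const, probReal_univ, one_smul]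
  congr 1
  have h3 := integral_hermiteFn_rotate (ρ := σ / obsScale σ) (s := -(1 / obsScale σ))
    (by rw [neg_sq]; exact sq_div_obsScale_add σ) j y
  simp only [neg_mul, ← sub_eq_add_neg] at h3
  rw [h3, condHermite, mul_div_cancel_left₀ _ hc]

/-- The conditional means are diagonal for the pairing with functions of the latent variable: both
the conditional mean and its adjoint act on `H_j` by the factor `(σ / √(1 + σ²))^j`. -/
lemma integral_condHermite_mul (σ : ℝ) (j : ℕ) {f : ℝ → ℝ} (hf : MemLp f 2 (gaussianReal 0 1)) :
    ∫ ω, condHermite σ j (σ * ω.1 + ω.2) * f ω.1 ∂gaussPair =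
      (σ / obsScale σ) ^ (2 * j) * gaussCoeff f j := by
  have hf' : MemLp (fun ω : ℝ × ℝ => f ω.1) 2 gaussPair :=
    hf.comp_measurePreserving measurePreserving_fst_gaussPair
  have hi : Integrable (fun ω : ℝ × ℝ => condHermite σ j (σ * ω.1 + ω.2) * f ω.1) gaussPair :=
    (memLp_condHermite σ j).integrable_mul hf'
  rw [gaussPair] at hi ⊢
  rw [integral_prod _ hi, gaussCoeff, ← integral_const_mul]
  refine integral_congr_ae (Eventually.of_forall fun u => ?_)
  simp only [condHermite]
  have h1 := integral_hermiteFn_rotate (sq_div_obsScale_add σ) j u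
  have h2 : ∀ z, (σ * u + z) / obsScale σ = σ / obsScale σ * u + 1 / obsScale σ * z := by
    intro z; ring
  simp_rw [h2]
  rw [integral_mul_const, integral_const_mul, h1]
  ring

end Joint

/-! ### The features and their posterior means, compared with the model on the line -/

section Limits

variable {σ κ C M : ℝ} {p : ℕ}

/-- The sufficient statistics of the polynomial log-density model. -/
noncomputable def feature (σ : ℝ) (p : ℕ) (j : Fin p) (μ : ℝ) : ℝ := hermiteFn (j + 1) (μ / σ)

lemma continuous_feature (j : Fin p) : Continuous (feature σ p j) :=
  (continuous_hermiteFn _).comp (continuous_id.div_const σ)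

lemma exists_abs_feature_le (σ : ℝ) (p : ℕ) (M : ℝ) :
    ∃ B : ℝ, 0 ≤ B ∧ ∀ j, ∀ μ ∈ domain M, |feature σ p j μ| ≤ B := by
  have : ∀ j : Fin p, ∃ b, ∀ μ ∈ Set.Icc (-M) M, ‖feature σ p j μ‖ ≤ b := fun j =>
    isCompact_Icc.exists_bound_of_continuousOn (continuous_feature j).continuousOn
  choose b hb using this
  refine ⟨∑ j, |b j|, Finset.sum_nonneg fun j _ => abs_nonneg _, fun j μ hμ => ?_⟩
  exact (hb j μ hμ).trans ((le_abs_self _).trans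
    (Finset.single_le_sum (f := fun j => |b j|) (fun j _ => abs_nonneg _) (Finset.mem_univ j)))

lemma ae_abs_feature_le {B : ℝ} (hB : ∀ j, ∀ μ ∈ domain M, |feature σ p j μ| ≤ B) (j : Fin p) :
    ∀ᵐ μ ∂(carrier σ M), |feature σ p j μ| ≤ B :=
  (ae_carrier_mem σ M).mono fun μ hμ => hB j μ hμ

lemma l2norm_comp {Ω Ω' : Type*} {mΩ : MeasurableSpace Ω} {mΩ' : MeasurableSpace Ω'}
    {P : Measure Ω} {P' : Measure Ω'} {Y : Ω → Ω'} (hY : MeasurePreserving Y P P') {f : Ω' → ℝ}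
    (hf : AEStronglyMeasurable f P') : l2norm P (fun ω => f (Y ω)) = l2norm P' f := by
  have h := integral_map hY.aemeasurable (hY.map_eq.symm ▸ hf.pow 2)
  rw [hY.map_eq] at h
  rw [l2norm, l2norm]
  congr 1
  exact h.symm

/-- The wrapped observation. -/
noncomputable def wrappedObs (σ M : ℝ) (ω : ℝ × ℝ) : ℝ := wrap M (σ * ω.1 + ω.2)

/-- The wrapped latent variable. -/
noncomputable def wrappedLatent (σ M : ℝ) (ω : ℝ × ℝ) : ℝ := wrap M (σ * ω.1)

lemma measurable_wrappedObs : Measurable (wrappedObs σ M) :=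
  (measurable_wrap M).comp (by fun_prop)

lemma measurable_wrappedLatent : Measurable (wrappedLatent σ M) :=
  (measurable_wrap M).comp (by fun_prop)

lemma measurePreserving_wrappedLatent (hσ : 0 < σ) (hM : 0 < M) :
    MeasurePreserving (wrappedLatent σ M) gaussPair (carrier σ M) := by
  refine ⟨measurable_wrappedLatent, ?_⟩
  have hm : Measurable fun u => wrap M (σ * u) := (measurable_wrap M).comp (measurable_const_mul σ)
  rw [← map_wrap_mul_gaussian hσ hM, ← measurePreserving_fst_gaussPair.map_eq,
    Measure.map_map hm measurable_fst]
  rfl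

lemma measurePreserving_wrappedObs (hσ : 0 < σ) (hM : 0 < M) :
    MeasurePreserving (wrappedObs σ M) gaussPair (obsLaw M (carrier σ M)) :=
  ⟨measurable_wrappedObs, map_wrap_gaussPair hσ hM⟩

lemma covariance_comp {Ω Ω' : Type*} {mΩ : MeasurableSpace Ω} {mΩ' : MeasurableSpace Ω'}
    {P : Measure Ω} {P' : Measure Ω'} {Y : Ω → Ω'} (hY : MeasurePreserving Y P P') {f g : Ω' → ℝ}
    (hf : AEStronglyMeasurable f P') (hg : AEStronglyMeasurable g P') :
    cov[f, g; P'] = cov[fun ω => f (Y ω), fun ω => g (Y ω); P] := by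
  rw [← hY.map_eq] at hf hg ⊢
  exact covariance_map_fun hf hg hY.aemeasurable

/-- How far wrapping moves the `j`-th Hermite function at scale `c`, in `L²`. -/
noncomputable def wrapError (c M : ℝ) (j : ℕ) : ℝ :=
  l2norm (gaussianReal 0 1) fun y => hermiteFn j (wrap M (c * y) / c) - hermiteFn j y

lemma memLp_feature_wrappedLatent (hM : 0 < M) (j : Fin p) :
    MemLp (fun ω => feature σ p j (wrappedLatent σ M ω)) 2 gaussPair :=
  (memLp_hermiteFn_wrap (c := σ) hM (j + 1)).comp_measurePreserving measurePreserving_fst_gaussPair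

lemma l2norm_feature_wrappedLatent_sub (hM : 0 < M) (j : Fin p) :
    l2norm gaussPair (fun ω => feature σ p j (wrappedLatent σ M ω) - hermiteFn (j + 1) ω.1) =
      wrapError σ M (j + 1) :=
  l2norm_comp measurePreserving_fst_gaussPair
    ((memLp_hermiteFn_wrap (c := σ) hM (j + 1)).sub (memLp_hermiteFn (j + 1))).1

lemma memLp_condHermite_wrappedObs (hM : 0 < M) (j : ℕ) :
    MemLp (fun ω => condHermite σ j (wrappedObs σ M ω)) 2 gaussPair := by
  have h := ((memLp_hermiteFn_wrap (c := obsScale σ) hM j).const_mul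
    ((σ / obsScale σ) ^ j)).comp_measurePreserving (measurePreserving_obs σ)
  have e : (fun ω => condHermite σ j (wrappedObs σ M ω)) =
      (fun y => (σ / obsScale σ) ^ j * hermiteFn j (wrap M (obsScale σ * y) / obsScale σ)) ∘
        fun ω : ℝ × ℝ => (σ * ω.1 + ω.2) / obsScale σ := by
    ext ω
    simp only [Function.comp, condHermite, wrappedObs, mul_div_cancel₀ _ (obsScale_pos σ).ne']
  rw [e]; exact h

lemma l2norm_condHermite_wrappedObs_sub (hσ : 0 < σ) (hM : 0 < M) (j : ℕ) :
    l2norm gaussPair (fun ω => condHermite σ j (wrappedObs σ M ω) -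
      condHermite σ j (σ * ω.1 + ω.2)) ≤ wrapError (obsScale σ) M j := by
  have h0 := obsScale_pos σ
  have e : (fun ω : ℝ × ℝ => condHermite σ j (wrappedObs σ M ω) -
      condHermite σ j (σ * ω.1 + ω.2)) = fun ω => (σ / obsScale σ) ^ j *
        (fun y => hermiteFn j (wrap M (obsScale σ * y) / obsScale σ) - hermiteFn j y)
          ((σ * ω.1 + ω.2) / obsScale σ) := by
    ext ω
    simp only [condHermite, wrappedObs, mul_div_cancel₀ _ h0.ne']
    ring
  have hm : AEStronglyMeasurable
      (fun y => hermiteFn j (wrap M (obsScale σ * y) / obsScale σ) - hermiteFn j y)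
      (gaussianReal 0 1) :=
    ((memLp_hermiteFn_wrap (c := obsScale σ) hM j).sub (memLp_hermiteFn j)).1
  rw [e, l2norm_const_mul, l2norm_comp (measurePreserving_obs σ) hm]
  have h1 : |(σ / obsScale σ) ^ j| ≤ 1 := by
    rw [abs_of_nonneg (by positivity)]
    refine pow_le_one₀ (by positivity) ?_
    rw [div_le_one h0]
    exact Real.le_sqrt_of_sq_le (by linarith)
  calc _ ≤ 1 * wrapError (obsScale σ) M j :=
        mul_le_mul_of_nonneg_right h1 (l2norm_nonneg _ _)
    _ = _ := one_mul _

lemma memLp_postMean_wrappedObs (hσ : 0 < σ) (hM : 0 < M) (j : Fin p) :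
    MemLp (fun ω => postMean M (carrier σ M) (feature σ p) j (wrappedObs σ M ω)) 2 gaussPair := by
  have := isProbabilityMeasure_carrier hσ hM
  obtain ⟨B, hB0, hB⟩ := exists_abs_feature_le σ p M
  have hφ := fun j => (continuous_feature (σ := σ) (p := p) j).aemeasurable (μ := carrier σ M)
  exact memLp_of_abs_le ((continuous_postMean hM hφ (ae_abs_feature_le hB) j).measurable.comp
    measurable_wrappedObs).aemeasurable
    (Eventually.of_forall fun ω => abs_postMean_le hM (ae_abs_feature_le hB) j _)

/-- The posterior means of the features on the domain are close to the conditional means in the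
unwrapped Gaussian model: both are orthogonal projections, of nearby random variables. -/
lemma l2norm_postMean_wrappedObs_sub_le (hσ : 0 < σ) (hM : 0 < M) (j : Fin p) :
    l2norm gaussPair (fun ω => postMean M (carrier σ M) (feature σ p) j (wrappedObs σ M ω) -
      condHermite σ (j + 1) (σ * ω.1 + ω.2)) ≤
      wrapError σ M (j + 1) + 2 * wrapError (obsScale σ) M (j + 1) := by
  have := isProbabilityMeasure_carrier hσ hM
  obtain ⟨B, hB0, hB⟩ := exists_abs_feature_le σ p M
  have hBae := fun j => ae_abs_feature_le (σ := σ) hB j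
  have hφ := fun j => (continuous_feature (σ := σ) (p := p) j).aemeasurable (μ := carrier σ M)
  set S := postMean M (carrier σ M) (feature σ p) j with hS
  have hSc : Continuous S := continuous_postMean hM hφ hBae j
  have hSb : ∀ x, |S x| ≤ B := abs_postMean_le hM hBae j
  have hmc : Continuous (condHermite σ (j + 1)) :=
    ((continuous_hermiteFn _).comp (continuous_id.div_const _)).const_mul _
  obtain ⟨b, hb⟩ := (isCompact_Icc (a := -M) (b := M)).exists_bound_of_continuousOn
    hmc.continuousOn
  -- The difference `D` is a bounded function of the observation, so that both projection properties
  -- apply to it.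
  set D : ℝ → ℝ := fun x => S (wrap M x) - condHermite σ (j + 1) (wrap M x) with hD
  have hDm : Measurable D := (hSc.sub hmc).measurable.comp (measurable_wrap M)
  have hDb : ∀ x, |D x| ≤ B + b := fun x =>
    (abs_sub _ _).trans (add_le_add (hSb _) (hb _ (wrap_mem_domain hM x)))
  have hww : ∀ x, D (wrap M x) = D x := fun x => by
    simp only [hD, wrap_of_mem hM (wrap_mem hM x)]
  set X : ℝ × ℝ → ℝ := fun ω => σ * ω.1 + ω.2 with hX
  have hXm : Measurable X := by fun_prop
  have hDX : MemLp (fun ω => D (X ω)) 2 gaussPair :=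
    memLp_of_abs_le (hDm.comp hXm).aemeasurable (Eventually.of_forall fun ω => hDb _)
  have mS := memLp_postMean_wrappedObs (p := p) hσ hM j
  have mc := memLp_condHermite_wrappedObs (σ := σ) hM (j + 1)
  have mc' := memLp_condHermite σ (j + 1)
  have mf := memLp_feature_wrappedLatent (σ := σ) (p := p) hM j
  have mH := memLp_hermiteFn_fst (j + 1)
  -- the projection property on the domain
  have e1 : ∫ ω, S (wrappedObs σ M ω) * D (X ω) ∂gaussPair =
      ∫ ω, feature σ p j (wrappedLatent σ M ω) * D (X ω) ∂gaussPair := by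
    have h1 := integral_obsLaw_posterior_mul (G := carrier σ M) hM
      (integrable_of_abs_le (hφ j) (hBae j)) hDm hDb
    rw [integral_mul_smooth_carrier hσ hM (integrable_of_abs_le (hφ j) (hBae j)) hDm hDb] at h1
    have h2 := integral_obsLaw_carrier hσ hM (g := fun x => S x * D x) (b := B * (B + b))
      (hSc.measurable.mul hDm) fun x => by
        rw [abs_mul]; exact mul_le_mul (hSb x) (hDb x) (abs_nonneg _) hB0
    simp only [hww] at h1 h2
    exact h2.symm.trans h1
  -- the projection property in the unwrapped model
  have e2 := integral_hermiteFn_fst_mul σ (j + 1) hDm hDb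
  -- Subtracting the two identities expresses the norm of `D` through the wrapping errors alone.
  have e3 : ∫ ω, D (X ω) ^ 2 ∂gaussPair =
      ∫ ω, (feature σ p j (wrappedLatent σ M ω) - hermiteFn (j + 1) ω.1) * D (X ω) ∂gaussPair -
      ∫ ω, (condHermite σ (j + 1) (wrappedObs σ M ω) - condHermite σ (j + 1) (X ω)) * D (X ω)
        ∂gaussPair := by
    have i1 : Integrable (fun ω => S (wrappedObs σ M ω) * D (X ω)) gaussPair :=
      mS.integrable_mul hDX
    have i2 : Integrable (fun ω => condHermite σ (j + 1) (wrappedObs σ M ω) * D (X ω)) gaussPair :=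
      mc.integrable_mul hDX
    have i3 : Integrable (fun ω => condHermite σ (j + 1) (X ω) * D (X ω)) gaussPair :=
      mc'.integrable_mul hDX
    have i4 : Integrable (fun ω => feature σ p j (wrappedLatent σ M ω) * D (X ω)) gaussPair :=
      mf.integrable_mul hDX
    have i5 : Integrable (fun ω : ℝ × ℝ => hermiteFn (j + 1) ω.1 * D (X ω)) gaussPair :=
      mH.integrable_mul hDX
    have h1 : ∀ ω, D (X ω) ^ 2 = S (wrappedObs σ M ω) * D (X ω) -
        condHermite σ (j + 1) (wrappedObs σ M ω) * D (X ω) := by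
      intro ω
      have : D (X ω) = S (wrappedObs σ M ω) - condHermite σ (j + 1) (wrappedObs σ M ω) := rfl
      rw [sq]
      nth_rw 1 [this]
      ring
    simp_rw [h1, sub_mul]
    rw [integral_sub i1 i2, integral_sub i4 i5, integral_sub i2 i3, e1, e2]
    ring
  have hd : l2norm gaussPair (fun ω => D (X ω)) ≤
      wrapError σ M (j + 1) + wrapError (obsScale σ) M (j + 1) := by
    set d := l2norm gaussPair fun ω => D (X ω) with hddef
    have hd0 : 0 ≤ d := l2norm_nonneg _ _
    have h1 := abs_integral_mul_le_l2norm (mf.sub mH) hDX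
    have h2 := abs_integral_mul_le_l2norm (mc.sub mc') hDX
    have h3 : d ^ 2 ≤ (wrapError σ M (j + 1) + wrapError (obsScale σ) M (j + 1)) * d := by
      rw [hddef, sq_l2norm, e3, add_mul]
      have h4 := l2norm_feature_wrappedLatent_sub (σ := σ) hM j
      have h5 := l2norm_condHermite_wrappedObs_sub hσ hM (j + 1)
      have h6 := mul_le_mul_of_nonneg_right h5 hd0
      rw [← h4]
      have h7 := (abs_le.1 h1).2
      have h8 := (abs_le.1 h2).1
      simp only [Pi.sub_apply] at h7 h8
      have h9 : l2norm gaussPair ((fun ω => condHermite σ (j + 1) (wrappedObs σ M ω)) -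
          fun ω => condHermite σ (j + 1) (σ * ω.1 + ω.2)) * d ≤
          wrapError (obsScale σ) M (j + 1) * d := h6
      refine (sub_le_sub h7 h8).trans ?_
      rw [sub_neg_eq_add]
      exact add_le_add (le_of_eq rfl) h9
    rcases hd0.eq_or_lt with h | h
    · rw [← h]; exact add_nonneg (l2norm_nonneg _ _) (l2norm_nonneg _ _)
    · rw [sq] at h3; exact le_of_mul_le_mul_right h3 h
  have e4 : ∀ ω : ℝ × ℝ, S (wrappedObs σ M ω) - condHermite σ (j + 1) (σ * ω.1 + ω.2) =
      D (X ω) + (condHermite σ (j + 1) (wrappedObs σ M ω) -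
        condHermite σ (j + 1) (σ * ω.1 + ω.2)) := by
    intro ω
    have : D (X ω) = S (wrappedObs σ M ω) - condHermite σ (j + 1) (wrappedObs σ M ω) := rfl
    rw [this]; ring
  simp_rw [e4]
  have h1 := l2norm_add_le hDX (mc.sub mc')
  have h2 := l2norm_condHermite_wrappedObs_sub hσ hM (j + 1)
  refine (h1.trans (add_le_add hd h2)).trans (le_of_eq ?_)
  ring

end Limits

/-! ### Asymptotic calculus, and the limits of covariances on a growing domain -/

section

open Matrix

section Asymptotics

/-- Two families of reals are asymptotically equal along `l` when the second is eventually bounded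
and their difference vanishes. Unlike mere vanishing of the difference, this is compatible with
products. -/
structure AsympEq {ι : Type*} (l : Filter ι) (f f' : ι → ℝ) : Prop where
  tendsto_sub : Tendsto (fun i => f i - f' i) l (𝓝 0)
  bounded : ∃ K, ∀ᶠ i in l, |f' i| ≤ K

variable {ι : Type*} {l : Filter ι} {f g f' g' : ι → ℝ}

lemma AsympEq.of_tendsto {c : ℝ} (h : Tendsto f l (𝓝 c)) : AsympEq l f fun _ => c :=
  ⟨by simpa using h.sub_const c, |c|, Eventually.of_forall fun _ => le_rfl⟩

lemma AsympEq.const (l : Filter ι) (c : ℝ) : AsympEq l (fun _ => c) fun _ => c :=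
  .of_tendsto tendsto_const_nhds

lemma AsympEq.congr (h : AsympEq l f f') (hf : f =ᶠ[l] g) (hf' : f' =ᶠ[l] g') :
    AsympEq l g g' := by
  obtain ⟨h1, K, hK⟩ := h
  refine ⟨h1.congr' (hf.sub hf'), K, ?_⟩
  filter_upwards [hK, hf'] with i h1 h2
  rwa [← h2]

lemma AsympEq.add (h : AsympEq l f f') (h' : AsympEq l g g') :
    AsympEq l (fun i => f i + g i) fun i => f' i + g' i := by
  obtain ⟨h1, K, hK⟩ := h
  obtain ⟨h2, K', hK'⟩ := h'
  refine ⟨?_, K + K', ?_⟩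
  · have := h1.add h2
    rw [add_zero] at this
    exact this.congr fun i => by ring
  · filter_upwards [hK, hK'] with i h1 h2
    exact (abs_add_le _ _).trans (add_le_add h1 h2)

lemma AsympEq.mul (h : AsympEq l f f') (h' : AsympEq l g g') :
    AsympEq l (fun i => f i * g i) fun i => f' i * g' i := by
  obtain ⟨h1, K, hK⟩ := h
  obtain ⟨h2, K', hK'⟩ := h'
  have bdd : ∀ {u v : ι → ℝ} {B : ℝ}, Tendsto u l (𝓝 0) → (∀ᶠ i in l, |v i| ≤ B) →
      Tendsto (fun i => u i * v i) l (𝓝 0) := by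
    intro u v B hu hv
    refine squeeze_zero_norm' (a := fun i => |u i| * B) ?_ ?_
    · filter_upwards [hv] with i hi
      rw [norm_mul]
      exact mul_le_mul_of_nonneg_left hi (abs_nonneg _)
    · simpa using hu.abs.mul_const B
  refine ⟨?_, K * K', ?_⟩
  · have := ((bdd h1 hK').add (bdd h2 hK)).add (h1.mul h2)
    simp only [mul_zero, add_zero] at this
    exact this.congr fun i => by ring
  · filter_upwards [hK, hK'] with i h1 h2
    rw [abs_mul]
    exact mul_le_mul h1 h2 (abs_nonneg _) ((abs_nonneg _).trans h1)

lemma AsympEq.sum {α : Type*} (s : Finset α) {f f' : α → ι → ℝ}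
    (h : ∀ a, AsympEq l (f a) (f' a)) :
    AsympEq l (fun i => ∑ a ∈ s, f a i) fun i => ∑ a ∈ s, f' a i := by
  classical
  induction s using Finset.induction_on with
  | empty => simpa using AsympEq.const l 0
  | insert a s ha ih =>
    simp_rw [Finset.sum_insert ha]
    exact (h a).add ih

lemma AsympEq.limitLoss {p : ℕ} {v v' : ι → ℝ} {c c' b b' : ι → Fin p → ℝ}
    {A A' V V' I I' : ι → Matrix (Fin p) (Fin p) ℝ} (hv : AsympEq l v v')
    (hc : ∀ j, AsympEq l (c · j) (c' · j)) (hb : ∀ j, AsympEq l (b · j) (b' · j))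
    (hA : ∀ j k, AsympEq l (A · j k) (A' · j k)) (hV : ∀ j k, AsympEq l (V · j k) (V' · j k))
    (hI : ∀ j k, AsympEq l (I · j k) (I' · j k)) :
    AsympEq l (fun i => limitLoss (v i) (c i) (b i) (A i) (V i) (I i))
      fun i => limitLoss (v' i) (c' i) (b' i) (A' i) (V' i) (I' i) := by
  have h1 : AsympEq l (fun i => ∑ j, ((A i)ᵀ *ᵥ c i) j * b i j)
      fun i => ∑ j, ((A' i)ᵀ *ᵥ c' i) j * b' i j := by
    simp only [mulVec, dotProduct, transpose_apply]
    exact .sum _ fun j => (AsympEq.sum _ fun k => (hA k j).mul (hc k)).mul (hb j)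
  have h2 : ∀ j k, AsympEq l (fun i => ((A i)ᵀ * V i * A i) j k)
      fun i => ((A' i)ᵀ * V' i * A' i) j k := fun j k => by
    simp only [Matrix.mul_apply, transpose_apply]
    exact .sum _ fun m => (AsympEq.sum _ fun m' => (hA m' j).mul (hV m' m)).mul (hA m k)
  have h3 : AsympEq l (fun i => ∑ j, ∑ k, ((A i)ᵀ * V i * A i) j k * (I i j k + b i j * b i k))
      fun i => ∑ j, ∑ k, ((A' i)ᵀ * V' i * A' i) j k * (I' i j k + b' i j * b' i k) :=
    .sum _ fun j => .sum _ fun k => (h2 j k).mul ((hI j k).add ((hb j).mul (hb k)))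
  have h4 := ((hv.add ((AsympEq.const l (-2)).mul h1)).add h3).mul (AsympEq.const l 2⁻¹)
  simp only [LocalDeconv.limitLoss, div_eq_mul_inv, sub_eq_add_neg, ← neg_mul]
  exact h4

/-- Two families of square-integrable functions, asymptotically equal in `L²`. The index may contain
a direction along with the size of the domain: convergence along `atTop ×ˢ 𝓟 S` is uniform over
`S`. -/
structure L2Close {Ω : Type*} {mΩ : MeasurableSpace Ω} (P : Measure Ω) (l : Filter ι)
    (f f' : ι → Ω → ℝ) : Prop where
  memLp : ∀ᶠ i in l, MemLp (f i) 2 P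
  memLp' : ∀ᶠ i in l, MemLp (f' i) 2 P
  tendsto_sub : Tendsto (fun i => l2norm P fun ω => f i ω - f' i ω) l (𝓝 0)
  bounded : ∃ K, ∀ᶠ i in l, l2norm P (f' i) ≤ K

lemma L2Close.covariance {Ω : Type*} {mΩ : MeasurableSpace Ω} {P : Measure Ω}
    [IsProbabilityMeasure P] {f f' g g' : ι → Ω → ℝ} (h : L2Close P l f f')
    (h' : L2Close P l g g') :
    AsympEq l (fun i => cov[f i, g i; P]) fun i => cov[f' i, g' i; P] := by
  obtain ⟨f1, f2, f3, K, hK⟩ := h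
  obtain ⟨g1, g2, g3, K', hK'⟩ := h'
  refine ⟨?_, |K| * |K'|, ?_⟩
  · set e : ι → ℝ := fun i => max (l2norm P fun ω => f i ω - f' i ω)
      (l2norm P fun ω => g i ω - g' i ω) with he
    have het : Tendsto (fun i => e i * (2 * max K K' + e i)) l (𝓝 0) := by
      have h1 : Tendsto e l (𝓝 0) := by simpa using f3.max g3
      simpa using h1.mul (h1.const_add (2 * max K K'))
    refine squeeze_zero_norm' ?_ het
    filter_upwards [f1, f2, g1, g2, hK, hK'] with i a1 a2 a3 a4 a5 a6
    exact abs_covariance_sub_le a1 a3 a2 a4 (le_max_left _ _) (le_max_right _ _)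
      (a5.trans (le_max_left _ _)) (a6.trans (le_max_right _ _))
  · filter_upwards [f2, g2, hK, hK'] with i a1 a2 a3 a4
    exact (abs_covariance_le_l2norm a1 a2).trans (mul_le_mul (a3.trans (le_abs_self _))
      (a4.trans (le_abs_self _)) (l2norm_nonneg _ _) (abs_nonneg _))

lemma L2Close.comp_tendsto {Ω κ : Type*} {mΩ : MeasurableSpace Ω} {P : Measure Ω}
    {l' : Filter κ} {f f' : ι → Ω → ℝ} (h : L2Close P l f f') {u : κ → ι} (hu : Tendsto u l' l) :
    L2Close P l' (fun i => f (u i)) fun i => f' (u i) :=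
  ⟨hu.eventually h.1, hu.eventually h.2, h.3.comp hu, h.4.imp fun _ hK => hu.eventually hK⟩

end Asymptotics

section Limits

variable {σ κ C M : ℝ} {p : ℕ}

lemma l2Close_feature (hσ : 0 < σ) (j : Fin p) :
    L2Close gaussPair atTop (fun M ω => feature σ p j (wrappedLatent σ M ω))
      fun _ ω => hermiteFn (j + 1) ω.1 where
  memLp := (eventually_gt_atTop 0).mono fun _ hM => memLp_feature_wrappedLatent hM j
  memLp' := Eventually.of_forall fun _ => memLp_hermiteFn_fst _
  tendsto_sub := (tendsto_l2norm_hermiteFn_wrap hσ (j + 1)).congr'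
    ((eventually_gt_atTop 0).mono fun _ hM => (l2norm_feature_wrappedLatent_sub hM j).symm)
  bounded := ⟨_, Eventually.of_forall fun _ => le_rfl⟩

lemma l2Close_postMean (hσ : 0 < σ) (j : Fin p) :
    L2Close gaussPair atTop
      (fun M ω => postMean M (carrier σ M) (feature σ p) j (wrappedObs σ M ω))
      fun _ ω => condHermite σ (j + 1) (σ * ω.1 + ω.2) where
  memLp := (eventually_gt_atTop 0).mono fun _ hM => memLp_postMean_wrappedObs hσ hM j
  memLp' := Eventually.of_forall fun _ => memLp_condHermite _ _
  tendsto_sub := by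
    have h : Tendsto (fun M => wrapError σ M (j + 1) + 2 * wrapError (obsScale σ) M (j + 1)) atTop
        (𝓝 (0 + 2 * 0)) :=
      (tendsto_l2norm_hermiteFn_wrap hσ (j + 1)).add
        ((tendsto_l2norm_hermiteFn_wrap (obsScale_pos σ) (j + 1)).const_mul 2)
    rw [mul_zero, add_zero] at h
    exact squeeze_zero' (Eventually.of_forall fun _ => l2norm_nonneg _ _)
      ((eventually_gt_atTop 0).mono fun _ hM => l2norm_postMean_wrappedObs_sub_le hσ hM j) h
  bounded := ⟨_, Eventually.of_forall fun _ => le_rfl⟩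

/-- A direction of the ellipsoid, without its inessential additive constant. -/
noncomputable def centred (σ : ℝ) (τ : ℝ → ℝ) (μ : ℝ) : ℝ := τ μ - hermiteCoeff σ τ 0

lemma memLp_wrappedLatent (hσ : 0 < σ) (hM : 1 ≤ M) {τ : ℝ → ℝ}
    (hτ : MemLp τ 2 (gaussianReal 0 (σ ^ 2).toNNReal)) : MemLp τ 2 (carrier σ M) := by
  obtain ⟨c, hc, hle⟩ := exists_carrier_le hσ
  exact (hτ.smul_measure ENNReal.ofReal_ne_top).mono_measure (hle M hM)

lemma l2norm_centred_le (hσ : 0 < σ) (hκ : 1 < κ) (hC : 0 ≤ C) {τ : ℝ → ℝ}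
    (hτ : τ ∈ ellipsoid σ κ C) :
    l2norm (gaussianReal 0 1) (fun u => centred σ τ (σ * u)) ≤ C := by
  have h := integral_sq_sub_hermiteSum_le hσ hκ hτ 0
  have hκ0 : 0 < κ := by linarith
  simp only [centred, hermiteCoeff_eq_gaussCoeff hσ hτ.1, l2norm]
  refine Real.sqrt_le_iff.2 ⟨hC, ?_⟩
  simp only [hermiteSum, zero_add, Finset.sum_range_one, hermiteFn_zero, mul_one] at h
  exact h.trans (div_le_self (sq_nonneg _) (one_le_pow₀ hκ.le))

lemma memLp_centred {τ : ℝ → ℝ} (hτ : MemLp τ 2 (gaussianReal 0 (σ ^ 2).toNNReal)) :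
    MemLp (fun u => centred σ τ (σ * u)) 2 (gaussianReal 0 1) :=
  (memLp_comp_mul hτ).sub (memLp_const _)

lemma l2Close_centred (hσ : 0 < σ) (hκ : 1 < κ) (hC : 0 ≤ C) :
    L2Close gaussPair (atTop ×ˢ 𝓟 (ellipsoid σ κ C))
      (fun i ω => centred σ i.2 (wrappedLatent σ i.1 ω)) fun i ω => centred σ i.2 (σ * ω.1) where
  memLp := by
    refine eventually_prod_principal_iff.2 ((eventually_ge_atTop 1).mono fun M hM τ hτ => ?_)
    exact ((memLp_wrappedLatent hσ hM hτ.1).comp_measurePreserving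
      (measurePreserving_wrappedLatent hσ (by linarith))).sub (memLp_const _)
  memLp' := eventually_prod_principal_iff.2 (Eventually.of_forall fun M τ hτ =>
    (memLp_centred hτ.1).comp_measurePreserving measurePreserving_fst_gaussPair)
  tendsto_sub := by
    refine squeeze_zero_norm' (a := fun i => l2norm (gaussianReal 0 1)
      fun u => i.2 (wrap i.1 (σ * u)) - i.2 (σ * u)) ?_ ?_
    · refine eventually_prod_principal_iff.2 ((eventually_ge_atTop 1).mono fun M hM τ hτ => ?_)
      rw [Real.norm_eq_abs, abs_of_nonneg (l2norm_nonneg _ _)]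
      have hm : AEStronglyMeasurable (fun u => τ (wrap M (σ * u)) - τ (σ * u))
          (gaussianReal 0 1) := by
        obtain ⟨c, hc, h⟩ := exists_l2norm_wrap_le hσ
        exact ((h M hM τ hτ.1).1.sub (memLp_comp_mul hτ.1)).1
      have h1 := l2norm_comp measurePreserving_fst_gaussPair hm
      refine le_of_eq (Eq.trans ?_ h1)
      simp only [centred, wrappedLatent, sub_sub_sub_cancel_right]
    · refine Metric.tendsto_nhds.2 fun ε hε => ?_
      refine eventually_prod_principal_iff.2
        ((eventually_l2norm_wrap_sub_le hσ hκ hC (half_pos hε)).mono fun M hM τ hτ => ?_)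
      rw [dist_zero_right, Real.norm_eq_abs, abs_of_nonneg (l2norm_nonneg _ _)]
      exact (hM τ hτ).trans_lt (half_lt_self hε)
  bounded := ⟨C, eventually_prod_principal_iff.2 (Eventually.of_forall fun M τ hτ =>
    (l2norm_comp measurePreserving_fst_gaussPair (memLp_centred hτ.1).1).le.trans
      (l2norm_centred_le hσ hκ hC hτ))⟩

/-! Covariances in the unwrapped Gaussian model. -/

lemma integral_hermiteFn_succ (j : ℕ) : ∫ u, hermiteFn (j + 1) u ∂(gaussianReal 0 1) = 0 := by
  have := integral_hermiteFn_mul (j + 1) 0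
  simpa [hermiteFn_zero] using this

lemma covariance_hermiteFn (j k : ℕ) :
    cov[hermiteFn (j + 1), hermiteFn (k + 1); gaussianReal 0 1] = if j = k then 1 else 0 := by
  rw [covariance_eq_sub (memLp_hermiteFn _) (memLp_hermiteFn _), integral_hermiteFn_succ,
    zero_mul, sub_zero]
  simpa using integral_hermiteFn_mul (j + 1) (k + 1)

lemma covariance_hermiteFn_fst (j k : ℕ) :
    cov[fun ω : ℝ × ℝ => hermiteFn (j + 1) ω.1, fun ω => hermiteFn (k + 1) ω.1; gaussPair] =
      if j = k then 1 else 0 := by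
  rw [← covariance_comp measurePreserving_fst_gaussPair (memLp_hermiteFn _).1
    (memLp_hermiteFn _).1, covariance_hermiteFn]

lemma covariance_condHermite (σ : ℝ) (j k : ℕ) :
    cov[fun ω : ℝ × ℝ => condHermite σ (j + 1) (σ * ω.1 + ω.2),
      fun ω => condHermite σ (k + 1) (σ * ω.1 + ω.2); gaussPair] =
      if j = k then (σ / obsScale σ) ^ (2 * (j + 1)) else 0 := by
  simp only [condHermite]
  rw [covariance_const_mul_left, covariance_const_mul_right,
    ← covariance_comp (measurePreserving_obs σ) (memLp_hermiteFn _).1 (memLp_hermiteFn _).1,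
    covariance_hermiteFn]
  split_ifs with h
  · rw [h]; ring
  · simp

lemma gaussCoeff_sub_const {f : ℝ → ℝ} (hf : MemLp f 2 (gaussianReal 0 1)) (c : ℝ) (j : ℕ) :
    gaussCoeff (fun u => f u - c) (j + 1) = gaussCoeff f (j + 1) := by
  rw [gaussCoeff_sub hf (memLp_const c)]
  simp [gaussCoeff, integral_const_mul, integral_hermiteFn_succ]

variable {τ : ℝ → ℝ}

lemma gaussCoeff_centred (hτ : MemLp τ 2 (gaussianReal 0 (σ ^ 2).toNNReal)) (j : ℕ) :
    gaussCoeff (fun u => centred σ τ (σ * u)) (j + 1) = gaussCoeff (fun u => τ (σ * u)) (j + 1) :=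
  gaussCoeff_sub_const (memLp_comp_mul hτ) _ _

lemma memLp_centred_fst (hτ : MemLp τ 2 (gaussianReal 0 (σ ^ 2).toNNReal)) :
    MemLp (fun ω : ℝ × ℝ => centred σ τ (σ * ω.1)) 2 gaussPair :=
  (memLp_centred hτ).comp_measurePreserving measurePreserving_fst_gaussPair

lemma covariance_hermiteFn_centred (hτ : MemLp τ 2 (gaussianReal 0 (σ ^ 2).toNNReal)) (j : ℕ) :
    cov[fun ω : ℝ × ℝ => hermiteFn (j + 1) ω.1, fun ω => centred σ τ (σ * ω.1); gaussPair] =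
      gaussCoeff (fun u => τ (σ * u)) (j + 1) := by
  rw [← covariance_comp (f := hermiteFn (j + 1)) (g := fun u => centred σ τ (σ * u))
    measurePreserving_fst_gaussPair (memLp_hermiteFn _).1 (memLp_centred hτ).1,
    covariance_eq_sub (memLp_hermiteFn _) (memLp_centred hτ), integral_hermiteFn_succ, zero_mul,
    sub_zero, ← gaussCoeff_centred hτ, gaussCoeff]
  simp only [Pi.mul_apply, mul_comm]

lemma covariance_condHermite_centred (hτ : MemLp τ 2 (gaussianReal 0 (σ ^ 2).toNNReal)) (j : ℕ) :
    cov[fun ω : ℝ × ℝ => condHermite σ (j + 1) (σ * ω.1 + ω.2),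
      fun ω => centred σ τ (σ * ω.1); gaussPair] =
      (σ / obsScale σ) ^ (2 * (j + 1)) * gaussCoeff (fun u => τ (σ * u)) (j + 1) := by
  have h0 : ∫ ω : ℝ × ℝ, condHermite σ (j + 1) (σ * ω.1 + ω.2) ∂gaussPair = 0 := by
    have := integral_condHermite_mul σ (j + 1) (memLp_const (1 : ℝ))
    simpa [gaussCoeff, integral_hermiteFn_succ] using this
  rw [covariance_eq_sub (memLp_condHermite _ _) (memLp_centred_fst hτ), h0, zero_mul, sub_zero,
    ← gaussCoeff_centred hτ, ← integral_condHermite_mul σ (j + 1) (memLp_centred hτ)]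
  rfl

lemma hasSum_covariance_centred (hσ : 0 < σ)
    (hτ : MemLp τ 2 (gaussianReal 0 (σ ^ 2).toNNReal)) :
    HasSum (fun j => gaussCoeff (fun u => τ (σ * u)) (j + 1) ^ 2)
      cov[fun ω : ℝ × ℝ => centred σ τ (σ * ω.1), fun ω => centred σ τ (σ * ω.1); gaussPair] := by
  have h := hasSum_tail_sq (memLp_comp_mul hτ) 1
  convert h using 1
  have h0 : ∫ u, centred σ τ (σ * u) ∂(gaussianReal 0 1) = 0 := by
    simp only [centred, hermiteCoeff_eq_gaussCoeff hσ hτ]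
    rw [integral_sub ((memLp_comp_mul hτ).integrable one_le_two) (integrable_const _)]
    simp [gaussCoeff, hermiteFn_zero]
  rw [← covariance_comp (f := fun u => centred σ τ (σ * u)) (g := fun u => centred σ τ (σ * u))
    measurePreserving_fst_gaussPair (memLp_centred hτ).1 (memLp_centred hτ).1,
    covariance_eq_sub (memLp_centred hτ) (memLp_centred hτ), h0, zero_mul, sub_zero]
  simp only [centred, hermiteCoeff_eq_gaussCoeff hσ hτ, hermiteSum, Finset.sum_range_one,
    hermiteFn_zero, mul_one, Pi.mul_apply, sq]

end Limits

end

/-! ### The limit of the risk as the domain grows -/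

section

open Matrix

section RiskLimit

variable {σ κ C M : ℝ} {p : ℕ} {τ : ℝ → ℝ}

/-- The limit, as the domain grows, of the limiting rescaled risk: half of the squared bias
(the part of the direction that the model misses) plus half of the variance. -/
noncomputable def limitRisk (σ : ℝ) (p : ℕ) (τ : ℝ → ℝ) : ℝ :=
  (∑' j, gaussCoeff (fun u => τ (σ * u)) (j + p + 1) ^ 2 +
    ∑ j : Fin p, ((σ / obsScale σ) ^ (2 * ((j : ℕ) + 1)))⁻¹) / 2

/-- The information matrix of the unwrapped Gaussian model. -/
noncomputable def gaussInfo (σ : ℝ) (p : ℕ) : Matrix (Fin p) (Fin p) ℝ :=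
  Matrix.diagonal fun j => (σ / obsScale σ) ^ (2 * ((j : ℕ) + 1))

lemma gaussInfo_diag_pos (hσ : 0 < σ) (j : ℕ) : 0 < (σ / obsScale σ) ^ (2 * (j + 1)) :=
  pow_pos (div_pos hσ (obsScale_pos σ)) _

lemma inv_gaussInfo (hσ : 0 < σ) :
    (gaussInfo σ p)⁻¹ = Matrix.diagonal fun j : Fin p =>
      ((σ / obsScale σ) ^ (2 * ((j : ℕ) + 1)))⁻¹ := by
  refine Matrix.inv_eq_right_inv ?_
  rw [gaussInfo, Matrix.diagonal_mul_diagonal, ← Matrix.diagonal_one]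
  congr 1
  ext j
  exact mul_inv_cancel₀ (gaussInfo_diag_pos hσ j).ne'

lemma info_carrier_apply (hσ : 0 < σ) (hM : 0 < M) (j k : Fin p) :
    info M (carrier σ M) (feature σ p) j k =
      cov[fun ω => postMean M (carrier σ M) (feature σ p) j (wrappedObs σ M ω),
        fun ω => postMean M (carrier σ M) (feature σ p) k (wrappedObs σ M ω); gaussPair] := by
  have := isProbabilityMeasure_carrier hσ hM
  obtain ⟨B, hB0, hB⟩ := exists_abs_feature_le σ p M
  have hφ := fun j => (continuous_feature (σ := σ) (p := p) j).aemeasurable (μ := carrier σ M)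
  have hm := fun j => (continuous_postMean hM hφ (ae_abs_feature_le hB) j).aestronglyMeasurable
    (μ := obsLaw M (carrier σ M))
  exact covariance_comp (measurePreserving_wrappedObs hσ hM) (hm j) (hm k)

lemma asympEq_info (hσ : 0 < σ) (j k : Fin p) :
    AsympEq atTop (fun M => info M (carrier σ M) (feature σ p) j k) fun _ => gaussInfo σ p j k := by
  have h := (l2Close_postMean hσ j).covariance (l2Close_postMean hσ k)
  have e : gaussInfo σ p j k =
      if (j : ℕ) = k then (σ / obsScale σ) ^ (2 * ((j : ℕ) + 1)) else 0 := by
    simp [gaussInfo, Matrix.diagonal_apply, Fin.ext_iff]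
  simp only [covariance_condHermite] at h
  rw [e]
  exact ⟨h.1.congr' ((eventually_gt_atTop 0).mono fun M hM => by
    simp only [info_carrier_apply hσ hM]), h.2⟩

lemma tendsto_info (hσ : 0 < σ) :
    Tendsto (fun M => info M (carrier σ M) (feature σ p)) atTop (𝓝 (gaussInfo σ p)) := by
  refine tendsto_pi_nhds.2 fun j => tendsto_pi_nhds.2 fun k => ?_
  have := (asympEq_info (σ := σ) hσ j k).1.add_const (gaussInfo σ p j k)
  simpa using this

lemma tendsto_inv_info (hσ : 0 < σ) :
    Tendsto (fun M => (info M (carrier σ M) (feature σ p))⁻¹) atTop (𝓝 (gaussInfo σ p)⁻¹) := by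
  have hd : (gaussInfo σ p).det ≠ 0 := by
    rw [gaussInfo, Matrix.det_diagonal]
    exact (Finset.prod_pos fun (j : Fin p) _ => gaussInfo_diag_pos hσ j).ne'
  simp only [Matrix.inv_def, Ring.inverse_eq_inv']
  have h1 : Tendsto (fun M => (info M (carrier σ M) (feature σ p)).det) atTop
      (𝓝 (gaussInfo σ p).det) :=
    ((continuous_id.matrix_det).tendsto (gaussInfo σ p)).comp (tendsto_info hσ)
  have h2 : Tendsto (fun M => (info M (carrier σ M) (feature σ p)).adjugate) atTop
      (𝓝 (gaussInfo σ p).adjugate) :=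
    ((continuous_id.matrix_adjugate).tendsto (gaussInfo σ p)).comp (tendsto_info hσ)
  exact (h1.inv₀ hd).smul h2

/-- On a large domain, the information matrix is positive definite. -/
lemma eventually_info_posDef (hσ : 0 < σ) :
    ∀ᶠ M in atTop, ∃ l : ℝ, 0 < l ∧
      ∀ v, l * ‖v‖ ^ 2 ≤ v ⬝ᵥ info M (carrier σ M) (feature σ p) *ᵥ v := by
  set ρ := σ / obsScale σ with hρ
  have hρ0 : 0 < ρ := div_pos hσ (obsScale_pos σ)
  have hρ1 : ρ ≤ 1 := by
    rw [hρ, div_le_one (obsScale_pos σ)]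
    exact Real.le_sqrt_of_sq_le (by linarith)
  set d := ρ ^ (2 * p) with hd
  have hd0 : 0 < d := pow_pos hρ0 _
  set e := d / (2 * (p ^ 2 + 1)) with he
  have he0 : 0 < e := by positivity
  have hall : ∀ᶠ M in atTop, ∀ j k,
      |info M (carrier σ M) (feature σ p) j k - gaussInfo σ p j k| ≤ e := by
    refine eventually_all.2 fun j => eventually_all.2 fun k => ?_
    exact ((asympEq_info hσ j k).1.abs.eventually (ge_mem_nhds (by simpa using he0)))
  filter_upwards [hall] with M hM
  refine ⟨d / 2, half_pos hd0, fun v => ?_⟩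
  set I := info M (carrier σ M) (feature σ p) with hI
  have h1 : v ⬝ᵥ I *ᵥ v = v ⬝ᵥ gaussInfo σ p *ᵥ v + v ⬝ᵥ (I - gaussInfo σ p) *ᵥ v := by
    rw [Matrix.sub_mulVec, dotProduct_sub]; ring
  have h2 : d * ‖v‖ ^ 2 ≤ v ⬝ᵥ gaussInfo σ p *ᵥ v := by
    refine (mul_le_mul_of_nonneg_left (sq_norm_le_sum_sq v) hd0.le).trans ?_
    rw [Finset.mul_sum]
    simp only [dotProduct, gaussInfo, Matrix.mulVec_diagonal]
    refine Finset.sum_le_sum fun j _ => ?_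
    have : d ≤ ρ ^ (2 * ((j : ℕ) + 1)) :=
      pow_le_pow_of_le_one hρ0.le hρ1 (by have := j.2; omega)
    nlinarith [sq_nonneg (v j)]
  have h3 : |v ⬝ᵥ (I - gaussInfo σ p) *ᵥ v| ≤ d / 2 * ‖v‖ ^ 2 := by
    simp only [dotProduct, Matrix.mulVec, Finset.mul_sum]
    refine (Finset.abs_sum_le_sum_abs _ _).trans ?_
    calc _ ≤ ∑ _j : Fin p, ∑ _k : Fin p, e * ‖v‖ ^ 2 := by
          refine Finset.sum_le_sum fun j _ => (Finset.abs_sum_le_sum_abs _ _).trans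
            (Finset.sum_le_sum fun k _ => ?_)
          rw [abs_mul, abs_mul]
          have a1 : |v j| ≤ ‖v‖ := norm_le_pi_norm v j
          have a2 : |v k| ≤ ‖v‖ := norm_le_pi_norm v k
          calc _ ≤ ‖v‖ * (e * ‖v‖) :=
                mul_le_mul a1 (mul_le_mul (hM j k) a2 (abs_nonneg _) he0.le)
                  (by positivity) (norm_nonneg _)
            _ = _ := by ring
      _ = p ^ 2 * e * ‖v‖ ^ 2 := by simp; ring
      _ ≤ _ := by
          refine mul_le_mul_of_nonneg_right ?_ (sq_nonneg _)
          rw [he]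
          have : (0 : ℝ) < p ^ 2 + 1 := by positivity
          rw [mul_div_assoc', div_le_div_iff₀ (by positivity) two_pos]
          nlinarith
  rw [h1]
  have := (abs_le.1 h3).1
  linarith

lemma covariance_smooth_postMean (hσ : 0 < σ) (hM : 0 < M) {T : ℝ → ℝ}
    (hT : MemLp T 2 (carrier σ M)) (j : Fin p) :
    cov[smooth M (postMean M (carrier σ M) (feature σ p) j), T; carrier σ M] =
      cov[fun ω => postMean M (carrier σ M) (feature σ p) j (wrappedObs σ M ω),
        fun ω => T (wrappedLatent σ M ω); gaussPair] := by
  have := isProbabilityMeasure_carrier hσ hM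
  obtain ⟨B, hB0, hB⟩ := exists_abs_feature_le σ p M
  have hφ := fun j => (continuous_feature (σ := σ) (p := p) j).aemeasurable (μ := carrier σ M)
  set S := postMean M (carrier σ M) (feature σ p) j with hS
  have hSm : Measurable S := (continuous_postMean hM hφ (ae_abs_feature_le hB) j).measurable
  have hSb : ∀ x, |S x| ≤ B := abs_postMean_le hM (ae_abs_feature_le hB) j
  have hsm : MemLp (smooth M S) 2 (carrier σ M) :=
    memLp_of_abs_le (measurable_smooth hM hSm).aemeasurable
      (Eventually.of_forall (abs_smooth_le hM hSm hSb))
  have hpres := measurePreserving_wrappedLatent hσ hM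
  have hTc : MemLp (fun ω => T (wrappedLatent σ M ω)) 2 gaussPair :=
    hT.comp_measurePreserving hpres
  have hSc : MemLp (fun ω => S (wrappedObs σ M ω)) 2 gaussPair :=
    memLp_postMean_wrappedObs hσ hM j
  rw [covariance_eq_sub hsm hT, covariance_eq_sub hSc hTc]
  have h1 := integral_mul_smooth_carrier hσ hM (hT.integrable one_le_two) hSm hSb
  have h2 := integral_mul_smooth_carrier hσ hM (integrable_const (1 : ℝ)) hSm hSb
  have h3 : ∫ μ, T μ ∂(carrier σ M) = ∫ ω, T (wrappedLatent σ M ω) ∂gaussPair := by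
    have := integral_map hpres.aemeasurable (hpres.map_eq.symm ▸ hT.1)
    rwa [hpres.map_eq] at this
  simp only [one_mul] at h2
  simp only [Pi.mul_apply, mul_comm (smooth M S _)]
  rw [h1, h2, h3]
  simp only [wrappedObs, wrappedLatent, mul_comm (T _)]

lemma fixedRisk_eq_limitLoss (hσ : 0 < σ) (hM : 1 ≤ M)
    (hτ : MemLp τ 2 (gaussianReal 0 (σ ^ 2).toNNReal)) :
    fixedRisk M (carrier σ M) (feature σ p) (centred σ τ) = limitLoss
      cov[fun ω => centred σ τ (wrappedLatent σ M ω),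
        fun ω => centred σ τ (wrappedLatent σ M ω); gaussPair]
      (fun j => cov[fun ω => feature σ p j (wrappedLatent σ M ω),
        fun ω => centred σ τ (wrappedLatent σ M ω); gaussPair])
      (fun j => cov[fun ω => postMean M (carrier σ M) (feature σ p) j (wrappedObs σ M ω),
        fun ω => centred σ τ (wrappedLatent σ M ω); gaussPair])
      (info M (carrier σ M) (feature σ p))⁻¹
      (Matrix.of fun j k => cov[fun ω => feature σ p j (wrappedLatent σ M ω),
        fun ω => feature σ p k (wrappedLatent σ M ω); gaussPair])
      (info M (carrier σ M) (feature σ p)) := by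
  have hM0 : 0 < M := by linarith
  have := isProbabilityMeasure_carrier hσ hM0
  have hc : MemLp (centred σ τ) 2 (carrier σ M) :=
    (memLp_wrappedLatent hσ hM hτ).sub (memLp_const _)
  have hf := fun j => (continuous_feature (σ := σ) (p := p) j).aestronglyMeasurable
    (μ := carrier σ M)
  have hpres := measurePreserving_wrappedLatent hσ hM0
  rw [fixedRisk, ← covariance_self hc.1.aemeasurable]
  simp only [covariance_smooth_postMean hσ hM0 hc]
  rw [covariance_comp hpres hc.1 hc.1]
  simp only [covariance_comp hpres (hf _) hc.1, covariance_comp hpres (hf _) (hf _)]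

/-- In the unwrapped model everything is diagonal: the bias within the span of the features
disappears, since the one-step approximation is unbiased there, and the squares of the remaining
coefficients survive. -/
lemma limitRisk_eq_limitLoss (hσ : 0 < σ)
    (hτ : MemLp τ 2 (gaussianReal 0 (σ ^ 2).toNNReal)) :
    limitRisk σ p τ = limitLoss
      cov[fun ω => centred σ τ (σ * ω.1), fun ω => centred σ τ (σ * ω.1); gaussPair]
      (fun j => cov[fun ω => hermiteFn ((j : ℕ) + 1) ω.1,
        fun ω => centred σ τ (σ * ω.1); gaussPair])
      (fun j => cov[fun ω => condHermite σ ((j : ℕ) + 1) (σ * ω.1 + ω.2),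
        fun ω => centred σ τ (σ * ω.1); gaussPair])
      (gaussInfo σ p)⁻¹
      (Matrix.of fun j k => cov[fun ω : ℝ × ℝ => hermiteFn ((j : ℕ) + 1) ω.1,
        fun ω => hermiteFn ((k : ℕ) + 1) ω.1; gaussPair])
      (gaussInfo σ p) := by
  have hV : (Matrix.of fun j k : Fin p => cov[fun ω : ℝ × ℝ => hermiteFn ((j : ℕ) + 1) ω.1,
        fun ω => hermiteFn ((k : ℕ) + 1) ω.1; gaussPair]) = 1 := by
    ext j k
    simp only [covariance_hermiteFn_fst, Matrix.of_apply, Matrix.one_apply, Fin.ext_iff]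
  have hs := hasSum_covariance_centred hσ hτ
  rw [hV, inv_gaussInfo hσ, limitLoss, limitRisk]
  simp only [covariance_hermiteFn_centred hτ, covariance_condHermite_centred hτ]
  rw [← hs.tsum_eq, ← hs.summable.sum_add_tsum_nat_add p]
  set a := gaussCoeff fun u => τ (σ * u)
  simp only [Matrix.diagonal_transpose, Matrix.mul_one, Matrix.diagonal_mul_diagonal,
    Matrix.mulVec_diagonal, gaussInfo, Matrix.diagonal_apply, ite_mul, zero_mul,
    Finset.sum_ite_eq, Finset.mem_univ, if_true]
  rw [← Fin.sum_univ_eq_sum_range fun j => a (j + 1) ^ 2]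
  have h1 : ∀ j : Fin p, ((σ / obsScale σ) ^ (2 * ((j : ℕ) + 1)))⁻¹ * a (j + 1) *
      ((σ / obsScale σ) ^ (2 * ((j : ℕ) + 1)) * a (j + 1)) = a (j + 1) ^ 2 := fun j => by
    have := (gaussInfo_diag_pos hσ j).ne'
    field_simp
  have h2 : ∀ j : Fin p, ((σ / obsScale σ) ^ (2 * ((j : ℕ) + 1)))⁻¹ *
      ((σ / obsScale σ) ^ (2 * ((j : ℕ) + 1)))⁻¹ *
      ((σ / obsScale σ) ^ (2 * ((j : ℕ) + 1)) +
        (σ / obsScale σ) ^ (2 * ((j : ℕ) + 1)) * a (j + 1) *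
        ((σ / obsScale σ) ^ (2 * ((j : ℕ) + 1)) * a (j + 1))) =
      ((σ / obsScale σ) ^ (2 * ((j : ℕ) + 1)))⁻¹ + a (j + 1) ^ 2 := fun j => by
    have := (gaussInfo_diag_pos hσ j).ne'
    field_simp
  simp only [h1, h2, Finset.sum_add_distrib]
  ring

lemma asympEq_fixedRisk (hσ : 0 < σ) (hκ : 1 < κ) (hC : 0 ≤ C) :
    AsympEq (atTop ×ˢ 𝓟 (ellipsoid σ κ C))
      (fun i => fixedRisk i.1 (carrier σ i.1) (feature σ p) (centred σ i.2))
      fun i => limitRisk σ p i.2 := by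
  set l : Filter (ℝ × (ℝ → ℝ)) := atTop ×ˢ 𝓟 (ellipsoid σ κ C) with hl
  have hfst : Tendsto Prod.fst l (atTop : Filter ℝ) := tendsto_fst
  have hT := l2Close_centred hσ hκ hC
  have hF := fun j : Fin p => (l2Close_feature hσ j).comp_tendsto hfst
  have hS := fun j : Fin p => (l2Close_postMean hσ j).comp_tendsto hfst
  have hA : ∀ j k, AsympEq l
      (fun i => (info i.1 (carrier σ i.1) (feature σ p))⁻¹ j k) fun _ => (gaussInfo σ p)⁻¹ j k :=
    fun j k => .of_tendsto (((tendsto_pi_nhds.1 (tendsto_pi_nhds.1 (tendsto_inv_info hσ) j)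
      k)).comp hfst)
  have hI : ∀ j k, AsympEq l
      (fun i => info i.1 (carrier σ i.1) (feature σ p) j k) fun _ => gaussInfo σ p j k :=
    fun j k => .of_tendsto (((tendsto_pi_nhds.1 (tendsto_pi_nhds.1 (tendsto_info hσ) j)
      k)).comp hfst)
  have hV : ∀ j k : Fin p, AsympEq l
      (fun i => (Matrix.of fun j k => cov[fun ω => feature σ p j (wrappedLatent σ i.1 ω),
        fun ω => feature σ p k (wrappedLatent σ i.1 ω); gaussPair]) j k)
      fun _ => (Matrix.of fun j k : Fin p => cov[fun ω : ℝ × ℝ => hermiteFn ((j : ℕ) + 1) ω.1,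
        fun ω => hermiteFn ((k : ℕ) + 1) ω.1; gaussPair]) j k :=
    fun j k => (hF j).covariance (hF k)
  have key := AsympEq.limitLoss (hT.covariance hT) (fun j => (hF j).covariance hT)
    (fun j => (hS j).covariance hT) hA hV hI
  have hmem : ∀ᶠ i in l, 1 ≤ i.1 ∧ i.2 ∈ ellipsoid σ κ C :=
    eventually_prod_principal_iff.2 ((eventually_ge_atTop 1).mono fun M hM τ hτ => ⟨hM, hτ⟩)
  refine key.congr (hmem.mono fun i hi => ?_) (hmem.mono fun i hi => ?_)
  · exact (fixedRisk_eq_limitLoss hσ hi.1 hi.2.1).symm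
  · exact (limitRisk_eq_limitLoss hσ hi.2.1).symm

/-- As the domain grows, the limiting risk converges uniformly over the ellipsoid. -/
theorem eventually_abs_fixedRisk_sub_le (hσ : 0 < σ) (hκ : 1 < κ) (hC : 0 ≤ C) {ε : ℝ}
    (hε : 0 < ε) : ∀ᶠ M in atTop, ∀ τ ∈ ellipsoid σ κ C,
      |fixedRisk M (carrier σ M) (feature σ p) (centred σ τ) - limitRisk σ p τ| ≤ ε := by
  have h := (asympEq_fixedRisk (p := p) hσ hκ hC).1.abs.eventually
    (ge_mem_nhds (by simpa using hε))
  exact eventually_prod_principal_iff.1 h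

end RiskLimit

end

/-! ### Maximum likelihood estimators on a fixed domain -/

section MLE

variable {σ κ C L M : ℝ} {p : ℕ}

lemma carrier_eq_restrict_Ioo (σ M : ℝ) : carrier σ M =
    (volume.restrict (Set.Ioo (-M) M)).withDensity
      fun μ => ENNReal.ofReal (wrappedGaussian σ M μ) := by
  rw [carrier, domain, Measure.restrict_congr_set Ioo_ae_eq_Icc]

lemma ae_carrier_mem_Ioo (σ M : ℝ) : ∀ᵐ μ ∂(carrier σ M), μ ∈ Set.Ioo (-M) M := by
  rw [carrier_eq_restrict_Ioo]
  exact (withDensity_absolutelyContinuous _ _).ae_le (ae_restrict_mem measurableSet_Ioo)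

/-- The features and the constants are linearly independent on the domain: a polynomial that is
constant on an interval is constant, and the Hermite polynomials are orthonormal. -/
lemma not_lin_feature_ae_eq_const (hσ : 0 < σ) (hM : 0 < M) (v : Fin p → ℝ) (hv : v ≠ 0) (c : ℝ) :
    ¬ lin (feature σ p) v =ᵐ[carrier σ M] fun _ => c := by
  intro h
  have hac : volume.restrict (Set.Ioo (-M) M) ≪ carrier σ M := by
    rw [carrier_eq_restrict_Ioo]
    refine withDensity_absolutelyContinuous' ?_ ?_
    · exact (continuous_wrappedGaussian hσ hM).measurable.ennreal_ofReal.aemeasurable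
    · exact Eventually.of_forall fun μ =>
        (ENNReal.ofReal_pos.2 (wrappedGaussian_pos hσ hM μ)).ne'
  have hcont : Continuous (lin (feature σ p) v) :=
    continuous_finsetSum _ fun j _ => (continuous_feature j).const_mul _
  have heq := Measure.eqOn_open_of_ae_eq (hac.ae_eq h) isOpen_Ioo hcont.continuousOn
    continuousOn_const
  set Q : Polynomial ℝ := ∑ j : Fin p, Polynomial.C (v j) * hermitePoly (j + 1) - Polynomial.C c
    with hQ
  have hQe : ∀ u, Q.eval u = ∑ j : Fin p, v j * hermiteFn (j + 1) u - c := fun u => by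
    simp [hQ, Polynomial.eval_finsetSum, eval_hermitePoly]
  have hQ0 : Q = 0 := by
    refine Polynomial.eq_zero_of_infinite_isRoot Q ?_
    have hinf : ((fun μ => μ / σ) '' Set.Ioo (-M) M).Infinite :=
      (Set.Ioo_infinite (by linarith)).image fun μ _ μ' _ h =>
        (div_left_inj' hσ.ne').1 h
    refine hinf.mono ?_
    rintro _ ⟨μ, hμ, rfl⟩
    have h1 : lin (feature σ p) v μ = c := heq hμ
    change Q.eval (μ / σ) = 0
    rw [hQe, ← h1]
    exact sub_self _
  refine hv (funext fun k => ?_)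
  have h1 : ∀ u, ∑ j : Fin p, v j * hermiteFn (j + 1) u = c := fun u => by
    have := hQe u
    rw [hQ0, Polynomial.eval_zero] at this
    linarith
  have h2 : ∫ u, (∑ j : Fin p, v j * hermiteFn (j + 1) u) * hermiteFn (k + 1) u
      ∂(gaussianReal 0 1) = v k := by
    simp_rw [Finset.sum_mul, mul_assoc]
    have hi : ∀ j : Fin p, Integrable (fun u => v j * (hermiteFn (j + 1) u * hermiteFn (k + 1) u))
        (gaussianReal 0 1) := fun j =>
      ((memLp_hermiteFn _).integrable_mul (memLp_hermiteFn _)).const_mul _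
    rw [integral_finsetSum _ fun j _ => hi j]
    simp_rw [integral_const_mul, integral_hermiteFn_mul, Nat.add_right_cancel_iff, ← Fin.ext_iff]
    simp
  simp_rw [h1] at h2
  rw [integral_const_mul, integral_hermiteFn_succ, mul_zero] at h2
  exact h2.symm

lemma tilted_add_const (G : Measure ℝ) (f : ℝ → ℝ) (c : ℝ) :
    G.tilted (fun μ => f μ + c) = G.tilted f := by
  unfold Measure.tilted
  congr 1
  ext μ
  simp_rw [Real.exp_add]
  rw [integral_mul_const, mul_div_mul_right _ _ (Real.exp_pos c).ne']

lemma truth_eq_tilted_centred (σ M : ℝ) (n : ℕ) (τ : ℝ → ℝ) :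
    truth σ M n τ = (carrier σ M).tilted fun μ => centred σ τ μ / √n := by
  rw [truth, ← tilted_add_const _ _ (-(hermiteCoeff σ τ 0 / √n))]
  congr 1
  ext μ
  rw [centred]; ring

lemma model_eq_tilted_lin (σ M : ℝ) (η : Fin p → ℝ) :
    model σ M η = (carrier σ M).tilted (lin (feature σ p) η) := rfl

/-- On a bounded domain, the directions of the ellipsoid are uniformly bounded, up to constants. -/
lemma exists_abs_centred_le (hσ : 0 < σ) (hκ : 1 < κ) (C M : ℝ) :
    ∃ B₀ : ℝ, ∀ τ ∈ ellipsoid σ κ C, ∀ᵐ μ ∂(carrier σ M), |centred σ τ μ| ≤ B₀ := by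
  obtain ⟨B₀, hB₀⟩ := exists_abs_sub_gaussCoeff_le hκ C (M / σ)
  refine ⟨B₀, fun τ hτ => ?_⟩
  have h1 := hB₀ _ (memLp_comp_mul hτ.1) (ellipsoid_coeff_le hσ hτ)
  have h2 : ∀ᵐ μ ∂(gaussianReal 0 (σ ^ 2).toNNReal), |μ| ≤ M → |centred σ τ μ| ≤ B₀ := by
    rw [← map_mul_gaussian, (measurableEmbedding_mulLeft₀ hσ.ne').ae_map_iff]
    filter_upwards [h1] with u hu hle
    rw [abs_mul, abs_of_pos hσ] at hle
    rw [centred, hermiteCoeff_eq_gaussCoeff hσ hτ.1]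
    exact hu (by rw [le_div_iff₀ hσ]; linarith)
  filter_upwards [(carrier_absolutelyContinuous hσ M).ae_le h2, ae_carrier_mem σ M] with μ h3 h4
  exact h3 (abs_le.2 h4)

lemma aemeasurable_centred (hσ : 0 < σ) {τ : ℝ → ℝ}
    (hτ : MemLp τ 2 (gaussianReal 0 (σ ^ 2).toNNReal)) : AEMeasurable (centred σ τ) (carrier σ M) :=
  (hτ.1.aemeasurable.mono_ac (carrier_absolutelyContinuous hσ M)).sub_const _

/-! The likelihood and the log-likelihood ratio. -/

lemma likelihood_le_iff (hσ : 0 < σ) (hM : 0 < M) {n : ℕ} (hn : 0 < n) (x : Fin n → ℝ)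
    (η θ : Fin p → ℝ) :
    likelihood σ M x η ≤ likelihood σ M x θ ↔
      avg x (logRatio M (carrier σ M) (feature σ p) η) ≤
        avg x (logRatio M (carrier σ M) (feature σ p) θ) := by
  have := isProbabilityMeasure_carrier hσ hM
  obtain ⟨B, hB0, hB⟩ := exists_abs_feature_le σ p M
  have hφ := fun j => (continuous_feature (σ := σ) (p := p) j).aemeasurable (μ := carrier σ M)
  have hpos : ∀ (η : Fin p → ℝ) y, 0 < obsDensity M (model σ M η) y := fun η y => by
    have : IsProbabilityMeasure (model σ M η) :=
      isProbabilityMeasure_tilted_lin hφ (ae_abs_feature_le hB) η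
    exact obsDensity_pos hM y
  have hlog : ∀ η : Fin p → ℝ, Real.log (likelihood σ M x η) =
      n * avg x (logRatio M (carrier σ M) (feature σ p) η) +
        ∑ i, Real.log (obsDensity M (carrier σ M) (x i)) := fun η => by
    have hn' : (n : ℝ) ≠ 0 := by positivity
    rw [likelihood, Real.log_prod fun i _ => (hpos η (x i)).ne', avg, mul_div_cancel₀ _ hn',
      ← Finset.sum_add_distrib]
    refine Finset.sum_congr rfl fun i _ => ?_
    rw [logRatio, model_eq_tilted_lin]; ring
  have hl : ∀ η : Fin p → ℝ, 0 < likelihood σ M x η := fun η =>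
    Finset.prod_pos fun i _ => hpos η (x i)
  rw [← Real.log_le_log_iff (hl η) (hl θ), hlog, hlog, add_le_add_iff_right,
    mul_le_mul_iff_right₀ (by positivity)]

lemma logRatio_zero (hσ : 0 < σ) (hM : 0 < M) (x : ℝ) :
    logRatio M (carrier σ M) (feature σ p) 0 x = 0 := by
  have := isProbabilityMeasure_carrier hσ hM
  have e : lin (feature σ p) 0 = fun _ => (0 : ℝ) := by ext μ; simp [lin]
  rw [logRatio, e, tilted_const, sub_self]

lemma continuous_avg_logRatio (hσ : 0 < σ) (hM : 0 < M) {n : ℕ} (x : Fin n → ℝ) :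
    Continuous fun η => avg x (logRatio M (carrier σ M) (feature σ p) η) := by
  have := isProbabilityMeasure_carrier hσ hM
  obtain ⟨B, hB0, hB⟩ := exists_abs_feature_le σ p M
  have hBae := fun j => ae_abs_feature_le (σ := σ) hB j
  have hφ := fun j => (continuous_feature (σ := σ) (p := p) j).aemeasurable (μ := carrier σ M)
  have key : ∀ (H : Measure ℝ) [IsProbabilityMeasure H], H ≪ carrier σ M →
      Continuous fun η => Real.log (∫ μ, Real.exp (lin (feature σ p) η μ) ∂H) := by
    intro H _ hac
    have hφ' := fun j => (hφ j).mono_ac hac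
    have hB' := fun j => hac.ae_le (hBae j)
    have h1 := continuous_integral_exp_lin hφ' hB' hB0 (w := fun _ => 0) (b := 0)
      aemeasurable_const (Eventually.of_forall fun _ => by simp)
    simp only [sub_zero] at h1
    exact h1.log fun η => (integral_exp_pos (integrable_exp_of_abs_le (aemeasurable_lin hφ' η)
      (ae_abs_lin_le hB' η))).ne'
  unfold avg
  refine (continuous_finsetSum _ fun i _ => ?_).div_const _
  have e : ∀ η, logRatio M (carrier σ M) (feature σ p) η (x i) =
      Real.log (∫ μ, Real.exp (lin (feature σ p) η μ) ∂(posterior M (carrier σ M) (x i))) -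
      Real.log (∫ μ, Real.exp (lin (feature σ p) η μ) ∂(carrier σ M)) := fun η => by
    rw [logRatio, obsDensity_tilted hM (aemeasurable_lin hφ η) (ae_abs_lin_le hBae η)]; ring
  simp only [e]
  have := isProbabilityMeasure_posterior (G := carrier σ M) hM (x i)
  exact (key _ (posterior_absolutelyContinuous _ _ _)).sub
    (key _ (Measure.AbsolutelyContinuous.refl _))

lemma norm_le_of_mem_regular (hκ : 1 < κ) (hL : 0 ≤ L) {η : Fin p → ℝ} (h : η ∈ regular κ L p) :
    ‖η‖ ≤ L := by
  refine (pi_norm_le_iff_of_nonneg hL).2 fun j => ?_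
  have h1 : κ ^ (2 * ((j : ℕ) + 1)) * η j ^ 2 < L ^ 2 := by
    refine lt_of_le_of_lt ?_ h
    exact Finset.single_le_sum (f := fun j : Fin p => κ ^ (2 * ((j : ℕ) + 1)) * η j ^ 2)
      (fun i _ => by have : 0 < κ := by linarith
                     positivity) (Finset.mem_univ j)
  have h2 : 1 ≤ κ ^ (2 * ((j : ℕ) + 1)) := one_le_pow₀ hκ.le
  refine abs_le_of_sq_le_sq ?_ hL
  nlinarith [sq_nonneg (η j)]

lemma exists_closedBall_subset_regular (hκ : 1 < κ) (hL : 0 < L) :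
    ∃ δ₀ : ℝ, 0 < δ₀ ∧ ∀ η : Fin p → ℝ, ‖η‖ ≤ δ₀ → η ∈ regular κ L p := by
  have hκ0 : 0 < κ := by linarith
  set K := ∑ j : Fin p, κ ^ (2 * ((j : ℕ) + 1)) with hK
  have hK0 : 0 ≤ K := Finset.sum_nonneg fun j _ => by positivity
  refine ⟨L / (K + 1), by positivity, fun η hη => ?_⟩
  have h1 : ∑ j : Fin p, κ ^ (2 * ((j : ℕ) + 1)) * η j ^ 2 ≤ K * (L / (K + 1)) ^ 2 := by
    rw [hK, Finset.sum_mul]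
    refine Finset.sum_le_sum fun j _ => ?_
    have h2 : |η j| ≤ L / (K + 1) := (norm_le_pi_norm η j).trans hη
    rw [← sq_abs (η j)]
    gcongr
  refine lt_of_le_of_lt h1 ?_
  rw [div_pow, mul_div_assoc', div_lt_iff₀ (by positivity)]
  nlinarith [sq_pos_of_pos hL, mul_nonneg hK0 (sq_nonneg L), mul_nonneg (sq_nonneg K) (sq_nonneg L)]

/-- When the likelihood is small away from the origin, a maximum likelihood estimator is a
global maximizer of the likelihood close to the origin. -/
lemma IsMLE.maximizer (hσ : 0 < σ) (hM : 0 < M) {n : ℕ} (hn : 0 < n)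
    {est : (Fin n → ℝ) → (Fin p → ℝ)} (h : IsMLE σ κ L M est) {δ : ℝ} (hδ : 0 < δ)
    (hreg : ∀ η : Fin p → ℝ, ‖η‖ ≤ δ → η ∈ regular κ L p) {x : Fin n → ℝ}
    (hx : ∀ i, x i ∈ domain M)
    (hneg : ∀ η : Fin p → ℝ, δ ≤ ‖η‖ → avg x (logRatio M (carrier σ M) (feature σ p) η) < 0) :
    ‖est x‖ ≤ δ ∧ ∀ η, avg x (logRatio M (carrier σ M) (feature σ p) η) ≤
      avg x (logRatio M (carrier σ M) (feature σ p) (est x)) := by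
  set f : (Fin p → ℝ) → ℝ := fun η => avg x (logRatio M (carrier σ M) (feature σ p) η) with hf
  have hf0 : f 0 = 0 := by
    simp only [hf, avg, logRatio_zero hσ hM, Finset.sum_const_zero, zero_div]
  obtain ⟨η₀, hη₀, hmax⟩ := (isCompact_closedBall (0 : Fin p → ℝ) δ).exists_isMaxOn
    ⟨0, Metric.mem_closedBall_self hδ.le⟩ (continuous_avg_logRatio hσ hM x).continuousOn
  rw [mem_closedBall_zero_iff] at hη₀
  have h0 : 0 ≤ f η₀ := hf0 ▸ hmax (Metric.mem_closedBall_self hδ.le)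
  have hglob : ∀ η, f η ≤ f η₀ := fun η => by
    rcases le_total ‖η‖ δ with h1 | h1
    · exact hmax (mem_closedBall_zero_iff.2 h1)
    · exact (hneg η h1).le.trans h0
  have h1 : ∀ η, f η ≤ f (est x) := fun η =>
    (likelihood_le_iff hσ hM hn x _ _).1 (h.maximal x hx
      ⟨η₀, hreg _ hη₀, fun η => (likelihood_le_iff hσ hM hn x _ _).2 (hglob η)⟩ η)
  refine ⟨?_, h1⟩
  by_contra hlt
  have h2 := hneg _ (not_le.1 hlt).le
  have h3 := h1 0
  rw [hf0] at h3
  exact absurd h2 (not_lt.2 h3)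

/-- The risk of an estimator, as an integral of a real function. -/
lemma risk_eq_ofReal (hσ : 0 < σ) (hκ : 1 < κ) (hL : 0 ≤ L) (hM : 0 < M) {n : ℕ}
    {est : (Fin n → ℝ) → (Fin p → ℝ)} (h : IsMLE σ κ L M est) {τ : ℝ → ℝ}
    (hτ : τ ∈ ellipsoid σ κ C) :
    risk σ M est τ = ENNReal.ofReal (∫ x, n * tiltEntropy (carrier σ M)
      (fun μ => centred σ τ μ / √n) (lin (feature σ p) (est x))
      ∂(Measure.pi fun _ : Fin n => obsLaw M ((carrier σ M).tilted
        fun μ => centred σ τ μ / √n))) := by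
  have := isProbabilityMeasure_carrier hσ hM
  obtain ⟨B, hB0, hB⟩ := exists_abs_feature_le σ p M
  have hBae := fun j => ae_abs_feature_le (σ := σ) hB j
  have hφ := fun j => (continuous_feature (σ := σ) (p := p) j).aemeasurable (μ := carrier σ M)
  obtain ⟨B₀, hB₀⟩ := exists_abs_centred_le hσ hκ C M
  set a : ℝ → ℝ := fun μ => centred σ τ μ / √n with ha
  have ham : AEMeasurable a (carrier σ M) := (aemeasurable_centred hσ hτ.1).div_const _
  have hab : ∀ᵐ μ ∂(carrier σ M), |a μ| ≤ B₀ / √n := by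
    filter_upwards [hB₀ τ hτ] with μ h1
    rw [ha, abs_div, abs_of_nonneg (Real.sqrt_nonneg _)]
    gcongr
  have : IsProbabilityMeasure ((carrier σ M).tilted a) :=
    isProbabilityMeasure_tilted (integrable_exp_of_abs_le ham hab)
  have := isProbabilityMeasure_obsLaw (G := (carrier σ M).tilted a) hM
  have hbd := fun x : Fin n → ℝ => tiltEntropy_bounds ham hab (aemeasurable_lin hφ (est x))
    (ae_abs_lin_le hBae (est x))
  rw [risk, truth_eq_tilted_centred, ofReal_integral_eq_lintegral_ofReal]
  · refine lintegral_congr fun x => ?_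
    rw [model_eq_tilted_lin, klDiv_tilted_tilted ham hab (aemeasurable_lin hφ _)
      (ae_abs_lin_le hBae _), ENNReal.ofReal_mul (Nat.cast_nonneg n), ENNReal.ofReal_natCast]
    rfl
  · refine integrable_of_abs_le (b := n * (2 * (B₀ / √n + p * B * L))) ?_ ?_
    · exact (((continuous_tiltEntropy hφ hBae hB0 ham hab).measurable.comp
        h.measurable).const_mul _).aemeasurable
    · filter_upwards [ae_pi_forall_mem (ae_obsLaw_mem M ((carrier σ M).tilted a)) n] with x hx
      have h2 := norm_le_of_mem_regular hκ hL (h.mem_regular x hx)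
      have h3 := hbd x
      rw [abs_of_nonneg (mul_nonneg (Nat.cast_nonneg n) h3.1)]
      refine mul_le_mul_of_nonneg_left (h3.2.trans ?_) (Nat.cast_nonneg n)
      gcongr
  · exact Eventually.of_forall fun x => mul_nonneg (Nat.cast_nonneg n) (hbd x).1

/-- On a fixed large domain, the risk of maximum likelihood estimators converges uniformly over
the ellipsoid. -/
theorem eventually_risk_near (hσ : 0 < σ) (hκ : 1 < κ) (hL : 0 < L) (hM : 0 < M)
    (hpos : ∃ l : ℝ, 0 < l ∧
      ∀ v, l * ‖v‖ ^ 2 ≤ v ⬝ᵥ Matrix.mulVec (info M (carrier σ M) (feature σ p)) v)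
    {ε : ℝ} (hε : 0 < ε) :
    ∀ᶠ n : ℕ in atTop, ∀ est : (Fin n → ℝ) → (Fin p → ℝ), IsMLE σ κ L M est →
      ∀ τ ∈ ellipsoid σ κ C, ∃ r : ℝ, risk σ M est τ = ENNReal.ofReal r ∧
        |r - fixedRisk M (carrier σ M) (feature σ p) (centred σ τ)| ≤ ε := by
  have := isProbabilityMeasure_carrier hσ hM
  obtain ⟨B, hB0, hB⟩ := exists_abs_feature_le σ p M
  obtain ⟨B₀, hB₀⟩ := exists_abs_centred_le hσ hκ C M
  obtain ⟨l, hl, hlpos⟩ := hpos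
  obtain ⟨δ₀, hδ₀, hreg⟩ := exists_closedBall_subset_regular (p := p) hκ hL
  filter_upwards [eventually_abs_integral_tiltEntropy_sub_le hM continuous_feature hB0
    (ae_abs_feature_le hB) (ae_carrier_mem_Ioo σ M) (not_lin_feature_ae_eq_const hσ hM) hl hlpos
    hδ₀ L B₀ hε, eventually_gt_atTop 0] with n hn hn0 est hest τ hτ
  refine ⟨_, risk_eq_ofReal hσ hκ hL.le hM hest hτ, ?_⟩
  exact hn _ (aemeasurable_centred hσ hτ.1) (hB₀ τ hτ) est hest.measurable
    (fun x hx => norm_le_of_mem_regular hκ hL.le (hest.mem_regular x hx))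
    fun δ hδ hδδ₀ x hx hneg => hest.maximizer hσ hM hn0 hδ
      (fun η hη => hreg η (hη.trans hδδ₀)) hx hneg

end MLE

/-! ### The worst case and the choice of the degree -/

section WorstCase

variable {σ κ C L : ℝ} {p : ℕ} {τ : ℝ → ℝ}

lemma limitRisk_le (hσ : 0 < σ) (hκ : 1 < κ) (hτ : τ ∈ ellipsoid σ κ C) :
    limitRisk σ p τ ≤ (C ^ 2 / κ ^ (2 * (p + 1)) +
      ∑ j ∈ Finset.range p, ((σ / obsScale σ) ^ (2 * (j + 1)))⁻¹) / 2 := by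
  have h1 := (hasSum_tail_sq (memLp_comp_mul hτ.1) (p + 1)).tsum_eq
  have h2 := integral_sq_sub_hermiteSum_le hσ hκ hτ p
  rw [← h1] at h2
  rw [limitRisk, Fin.sum_univ_eq_sum_range fun j => ((σ / obsScale σ) ^ (2 * (j + 1)))⁻¹]
  have h3 : ∑' j, gaussCoeff (fun u => τ (σ * u)) (j + p + 1) ^ 2 ≤ C ^ 2 / κ ^ (2 * (p + 1)) := h2
  linarith

/-- The limit of the worst-case risks exists: the risks converge uniformly over the ellipsoid. -/
theorem tendsto_limsup_worstRisk (hσ : 0 < σ) (hκ : 1 < κ) (hC : 0 ≤ C) (hL : 0 < L)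
    {est : ℝ → (n : ℕ) → (Fin n → ℝ) → (Fin p → ℝ)}
    (hest : ∀ M : ℝ, 0 < M → ∀ n : ℕ, IsMLE σ κ L M (est M n)) :
    Tendsto (fun M : ℝ => limsup (fun n : ℕ => worstRisk σ κ C M (est M n)) atTop) atTop
      (𝓝 (⨆ τ ∈ ellipsoid σ κ C, ENNReal.ofReal (limitRisk σ p τ))) := by
  set ℓ := ⨆ τ ∈ ellipsoid σ κ C, ENNReal.ofReal (limitRisk σ p τ) with hℓ
  have hℓtop : ℓ ≠ ∞ := by
    refine ne_top_of_le_ne_top ENNReal.ofReal_ne_top (iSup₂_le fun τ hτ =>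
      ENNReal.ofReal_le_ofReal (limitRisk_le (p := p) hσ hκ hτ))
  refine (ENNReal.tendsto_nhds hℓtop).2 fun ε hε => ?_
  obtain ⟨e, he, heε⟩ : ∃ e : ℝ, 0 < e ∧ ENNReal.ofReal (2 * e) ≤ ε := by
    rcases eq_or_ne ε ∞ with h | h
    · exact ⟨1, one_pos, h ▸ le_top⟩
    · refine ⟨ε.toReal / 2, half_pos (ENNReal.toReal_pos hε.ne' h), ?_⟩
      rw [mul_div_cancel₀ _ two_ne_zero, ENNReal.ofReal_toReal h]
  have hclose : ∀ {a b : ℝ}, |a - b| ≤ 2 * e →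
      ENNReal.ofReal a ≤ ENNReal.ofReal b + ε := fun {a b} h => by
    refine (ENNReal.ofReal_le_ofReal (by linarith [(abs_le.1 h).2] : a ≤ b + 2 * e)).trans ?_
    exact ENNReal.ofReal_add_le.trans (add_le_add le_rfl heε)
  filter_upwards [eventually_abs_fixedRisk_sub_le (p := p) hσ hκ hC he,
    eventually_info_posDef (p := p) hσ, eventually_gt_atTop 0] with M hM1 hM2 hM
  have hn := eventually_risk_near (C := C) hσ hκ hL hM hM2 he
  have h : ∀ᶠ n : ℕ in atTop, ∀ τ ∈ ellipsoid σ κ C,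
      risk σ M (est M n) τ ≤ ENNReal.ofReal (limitRisk σ p τ) + ε ∧
      ENNReal.ofReal (limitRisk σ p τ) ≤ risk σ M (est M n) τ + ε := by
    filter_upwards [hn] with n hn τ hτ
    obtain ⟨r, hr, hr'⟩ := hn _ (hest M hM n) τ hτ
    have h1 := abs_sub_le r (fixedRisk M (carrier σ M) (feature σ p) (centred σ τ))
      (limitRisk σ p τ)
    have h2 : |r - limitRisk σ p τ| ≤ 2 * e := by linarith [hM1 τ hτ]
    rw [hr]
    exact ⟨hclose h2, hclose (abs_sub_comm r _ ▸ h2)⟩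
  constructor
  · refine le_limsup_of_frequently_le (Eventually.frequently ?_) (by isBoundedDefault)
    filter_upwards [h] with n hn
    rw [tsub_le_iff_right]
    refine iSup₂_le fun τ hτ => (hn τ hτ).2.trans ?_
    gcongr
    exact le_iSup₂ (f := fun τ (_ : τ ∈ ellipsoid σ κ C) => risk σ M (est M n) τ) τ hτ
  · refine limsup_le_of_le (by isBoundedDefault) ?_
    filter_upwards [h] with n hn
    refine iSup₂_le fun τ hτ => (hn τ hτ).1.trans ?_
    gcongr
    exact le_iSup₂ (f := fun τ (_ : τ ∈ ellipsoid σ κ C) =>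
      ENNReal.ofReal (limitRisk σ p τ)) τ hτ

end WorstCase

section Degree

variable {σ κ C : ℝ} {p : ℕ}

lemma rConst_eq (hσ : 0 < σ) : rConst σ = obsScale σ / σ := by
  rw [rConst, Real.sqrt_div (by positivity), Real.sqrt_sq hσ.le, obsScale]

lemma sq_mul_sq_rConst (hσ : 0 < σ) : σ ^ 2 * rConst σ ^ 2 = 1 + σ ^ 2 := by
  rw [rConst, Real.sq_sqrt (by positivity)]
  field_simp

lemma one_lt_rConst (hσ : 0 < σ) : 1 < rConst σ := by
  rw [rConst_eq hσ, lt_div_iff₀ hσ, one_mul]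
  exact Real.lt_sqrt_of_sq_lt (by linarith)

/-- The geometric sum of the variances, bounded by means of `σ² r² = 1 + σ²`. -/
lemma sum_rConst_le (hσ : 0 < σ) (p : ℕ) :
    ∑ j ∈ Finset.range p, rConst σ ^ (2 * (j + 1)) ≤
      rConst σ ^ 2 * (σ ^ 2 * rConst σ ^ (2 * p)) := by
  induction p with
  | zero => simp only [Finset.range_zero, Finset.sum_empty]
            exact mul_nonneg (sq_nonneg _)
              (mul_nonneg (sq_nonneg _) (pow_nonneg (Real.sqrt_nonneg _) _))
  | succ p ih =>
    rw [Finset.sum_range_succ]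
    refine (add_le_add_left ih _).trans (le_of_eq ?_)
    calc _ = rConst σ ^ (2 * p + 2) * (1 + σ ^ 2) := by ring
      _ = rConst σ ^ (2 * p + 2) * (σ ^ 2 * rConst σ ^ 2) := by rw [sq_mul_sq_rConst hσ]
      _ = _ := by ring

/-- The rounding in the choice of the degree of the model. -/
lemma polyDegree_bounds (hσ : 0 < σ) (hκ : 1 < κ) (hC : σ * (rConst σ * κ) ^ 2 < C) :
    (polyDegree σ κ C : ℝ) ≤ Real.log (C / σ) / Real.log (rConst σ * κ) ∧
      Real.log (C / σ) / Real.log (rConst σ * κ) ≤ polyDegree σ κ C + 1 := by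
  have hr := one_lt_rConst hσ
  have hb : 1 < rConst σ * κ := one_lt_mul_of_lt_of_le hr hκ.le
  have hl := Real.log_pos hb
  set D := Real.log (C / σ) / Real.log (rConst σ * κ) with hD
  have h2 : 2 < D := by
    rw [hD, lt_div_iff₀ hl]
    have h1 : Real.log ((rConst σ * κ) ^ 2) < Real.log (C / σ) :=
      Real.log_lt_log (by positivity) (by rw [lt_div_iff₀ hσ]; linarith)
    rw [Real.log_pow] at h1
    exact_mod_cast h1
  -- As `2 < D`, the maximum in the definition of the degree is attained by `⌈D⌉ - 1`.
  have h3 : 2 < ⌈D⌉₊ := Nat.lt_ceil.2 (by exact_mod_cast h2)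
  have hp : polyDegree σ κ C = ⌈D⌉₊ - 1 := by
    rw [polyDegree, ← hD]
    exact max_eq_right (by omega)
  obtain ⟨m, hm⟩ : ∃ m, ⌈D⌉₊ = m + 1 := ⟨⌈D⌉₊ - 1, by omega⟩
  rw [hp, hm, Nat.add_sub_cancel]
  refine ⟨(Nat.lt_ceil.1 (by omega : m < ⌈D⌉₊)).le, ?_⟩
  have := Nat.le_ceil D
  rw [hm] at this
  exact_mod_cast this

/-- With the chosen degree, the squared bias is at most `E` and the variance at most `r² E`, where
`E = σ^(2 log κ / (log r + log κ)) C^(2 log r / (log r + log κ))`: at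
`p + 1 = log (C / σ) / log (r κ)`, the upper bound for the former equals `E`. -/
lemma bias_add_variance_le (hσ : 0 < σ) (hκ : 1 < κ) (hC : 0 < C)
    (h1 : (p : ℝ) ≤ Real.log (C / σ) / Real.log (rConst σ * κ))
    (h2 : Real.log (C / σ) / Real.log (rConst σ * κ) ≤ p + 1) :
    C ^ 2 / κ ^ (2 * (p + 1)) + ∑ j ∈ Finset.range p, rConst σ ^ (2 * (j + 1)) ≤
      betaConst σ κ * C ^ (2 * Real.log (rConst σ) / (Real.log (rConst σ) + Real.log κ)) := by
  have hr := one_lt_rConst hσ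
  have hr0 : 0 < rConst σ := by linarith
  have hκ0 : 0 < κ := by linarith
  have hlr := Real.log_pos hr
  have hlκ := Real.log_pos hκ
  rw [Real.log_div hC.ne' hσ.ne', Real.log_mul hr0.ne' hκ0.ne'] at h1 h2
  set a := Real.log (rConst σ) with ha
  set b := Real.log κ with hb
  have hab : 0 < a + b := by linarith
  rw [le_div_iff₀ hab] at h1
  rw [div_le_iff₀ hab] at h2
  set E := Real.exp ((2 * b * Real.log σ + 2 * a * Real.log C) / (a + b)) with hE
  have hpow : ∀ {x : ℝ} (n : ℕ), 0 < x → x ^ n = Real.exp (n * Real.log x) := fun {x} n hx => by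
    rw [← Real.log_pow, Real.exp_log (by positivity)]
  have e1 : betaConst σ κ * C ^ (2 * a / (a + b)) = (1 + rConst σ ^ 2) * E := by
    rw [betaConst, mul_assoc, Real.rpow_def_of_pos hσ, Real.rpow_def_of_pos hC, ← Real.exp_add, hE]
    congr 2
    rw [← ha, ← hb]
    field_simp
  have e2 : C ^ 2 / κ ^ (2 * (p + 1)) ≤ E := by
    rw [hpow 2 hC, hpow _ hκ0, ← Real.exp_sub, hE, Real.exp_le_exp, le_div_iff₀ hab, ← hb]
    push_cast
    nlinarith
  have e3 : σ ^ 2 * rConst σ ^ (2 * p) ≤ E := by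
    rw [hpow 2 hσ, hpow _ hr0, ← Real.exp_add, hE, Real.exp_le_exp, le_div_iff₀ hab, ← ha]
    push_cast
    nlinarith
  have e4 := sum_rConst_le hσ p
  have e5 := mul_le_mul_of_nonneg_left e3 (sq_nonneg (rConst σ))
  rw [e1, add_mul, one_mul]
  linarith

end Degree

end LocalDeconv

theorem lemma4 (σ κ : ℝ) (hσ : 0 < σ) (hκ : 1 < κ) :
    ∃ C₀ : ℝ, 0 < C₀ ∧ ∀ C : ℝ, C₀ ≤ C → ∀ L : ℝ, C < L →
      ∀ est : ℝ → (n : ℕ) → (Fin n → ℝ) → (Fin (LocalDeconv.polyDegree σ κ C) → ℝ),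
        (∀ M : ℝ, 0 < M → ∀ n : ℕ, LocalDeconv.IsMLE σ κ L M (est M n)) →
        ∃ ℓ : ℝ≥0∞,
          Tendsto
            (fun M : ℝ =>
              limsup (fun n : ℕ => LocalDeconv.worstRisk σ κ C M (est M n)) atTop)
            atTop (𝓝 ℓ) ∧
          ℓ ≤ ENNReal.ofReal
            (LocalDeconv.betaConst σ κ *
              C ^ (2 * Real.log (LocalDeconv.rConst σ) /
                (Real.log (LocalDeconv.rConst σ) + Real.log κ))) := by
  have h0 : 0 ≤ σ * (LocalDeconv.rConst σ * κ) ^ 2 := by positivity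
  -- Above this constant the logarithmic quotient exceeds `2`, so the maximum in the definition of
  -- the degree plays no role.
  refine ⟨σ * (LocalDeconv.rConst σ * κ) ^ 2 + 1, by linarith, fun C hC L hL est hest =>
    ⟨_, LocalDeconv.tendsto_limsup_worstRisk (C := C) hσ hκ (by linarith) (by linarith) hest,
      iSup₂_le fun τ hτ => ENNReal.ofReal_le_ofReal ?_⟩⟩
  obtain ⟨h1, h2⟩ := LocalDeconv.polyDegree_bounds (C := C) hσ hκ (by linarith)
  have h3 := LocalDeconv.bias_add_variance_le hσ hκ (by linarith) h1 h2
  refine (LocalDeconv.limitRisk_le hσ hκ hτ).trans ?_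
  have h4 : ∀ j : ℕ, ((σ / LocalDeconv.obsScale σ) ^ (2 * (j + 1)))⁻¹ =
      LocalDeconv.rConst σ ^ (2 * (j + 1)) := fun j => by
    rw [LocalDeconv.rConst_eq hσ, ← inv_pow, inv_div]
  simp_rw [h4]
  have h5 : 0 ≤ C ^ 2 / κ ^ (2 * (LocalDeconv.polyDegree σ κ C + 1)) +
      ∑ j ∈ Finset.range (LocalDeconv.polyDegree σ κ C),
        LocalDeconv.rConst σ ^ (2 * (j + 1)) := by
    have : 0 < κ := by linarith
    have : 0 < LocalDeconv.rConst σ := by linarith [LocalDeconv.one_lt_rConst hσ]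
    positivity
  linarith
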